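/- All graphs are finite, simple and undirected; $n$ and $m$ denote the numbers of vertices and edges. A graph is *$P_4$-free* (a cograph) if no induced subgraph of it is isomorphic to the path $P_4$ on four vertices. A *cluster graph* is a graph in which every connected component is a clique. A set $S\subseteq V(G)$ is a *cluster vertex deletion set* of $G$ if $G-S$ is a cluster graph, and a *connected cluster vertex deletion set* if moreover the induced subgraph $G[S]$ is connected (the empty graph counts as connected). *Cluster-VD* (respectively *Connected Cluster-VD*) is the problem: given a graph $G$ and an integer $k$, decide whether $G$ has a (connected) cluster vertex deletion set $S$ with $|S|\le k$. In the weighted optimization version one is given a graph $G$ and integer vertex weights $w:V(G)\to\mathbb Z$, and has to find a (connected) cluster vertex deletion set $S$ whose weight $\sum_{v\in S}w(v)$ is minimum, together with this weight, or to report that there is no such set (which can happen only in the connected case). **Proposition.** Restricted to $P_4$-free input graphs, Cluster-VD and Connected Cluster-VD, as well as their weighted optimization versions, can be solved in linear time. That is, for each of these four problems there is an algorithm that solves every instance whose graph $G$ is $P_4$-free, given by adjacency lists in arbitrary order, in $O(n+m)$ steps (in at most $c\,(n+m+1)$ steps for a constant $c$, so that the empty graph is covered). The model of computation is a unit-cost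 random access machine with addition, subtraction, comparison and indirect addressing, whose words have $O(\log (n+m+M+2))$ bits, where $M=|k|$ for the decision problems and $M=\sum_{v}|w(v)|$ for the optimization problems. -/

import Mathlib

namespace ClusterVD

/-! ## Graphs -/

section Graphs

variable {V : Type*}

/-- A cluster graph: every connected component is a clique. -/
def IsClusterGraph (G : SimpleGraph V) : Prop :=
  ∀ C : G.ConnectedComponent, G.IsClique C.supp

/-- `S` is a cluster vertex deletion set of `G`: the graph `G - S` is a cluster graph. -/
def IsClusterVDSet (G : SimpleGraph V) (S : Set V) : Prop :=
  IsClusterGraph (G.induce Sᶜ)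

/-- `S` is a connected cluster vertex deletion set of `G`: in addition, `G[S]` is connected, i.e.
any two vertices of `S` are joined by a path inside `S`. (The empty set qualifies.) -/
def IsConnectedClusterVDSet (G : SimpleGraph V) (S : Set V) : Prop :=
  IsClusterVDSet G S ∧ (G.induce S).Preconnected

/-- `G` is `H`-free: no induced subgraph of `G` is isomorphic to `H`. -/
def IsFreeOf {W : Type*} (H : SimpleGraph W) (G : SimpleGraph V) : Prop :=
  ¬ H.IsIndContained G

end Graphs

/-! ## The machine model: a random access machine with unit cost and bounded words

A machine has integer registers and integer arrays, and is programmed by while-programs over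
integer expressions built with addition, subtraction and array access. A program is a finite
object, so it uses only finitely many registers and arrays. -/

/-- Contents of the registers (`reg i`) and of the arrays (`mem a j` is cell `j` of array `a`). -/
structure State where
  reg : ℕ → ℤ
  mem : ℕ → ℤ → ℤ

/-- Integer expressions. -/
inductive Exp where
  | const (z : ℤ)
  | reg (i : ℕ)
  | read (a : ℕ) (idx : Exp)
  | add (e₁ e₂ : Exp)
  | sub (e₁ e₂ : Exp)

/-- The value of an expression. -/
def Exp.eval (σ : State) : Exp → ℤ
  | .const z => z
  | .reg i => σ.reg i
  | .read a idx => σ.mem a (idx.eval σ)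
  | .add e₁ e₂ => e₁.eval σ + e₂.eval σ
  | .sub e₁ e₂ => e₁.eval σ - e₂.eval σ

/-- The cost of evaluating an expression: one unit for each of its nodes. -/
def Exp.cost : Exp → ℕ
  | .const _ => 1
  | .reg _ => 1
  | .read _ idx => idx.cost + 1
  | .add e₁ e₂ => e₁.cost + e₂.cost + 1
  | .sub e₁ e₂ => e₁.cost + e₂.cost + 1

/-- Tests. -/
inductive Guard where
  | le (e₁ e₂ : Exp)
  | eq (e₁ e₂ : Exp)
  | not (g : Guard)
  | and (g₁ g₂ : Guard)

/-- Truth of a test. -/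
def Guard.Holds (σ : State) : Guard → Prop
  | .le e₁ e₂ => e₁.eval σ ≤ e₂.eval σ
  | .eq e₁ e₂ => e₁.eval σ = e₂.eval σ
  | .not g => ¬ g.Holds σ
  | .and g₁ g₂ => g₁.Holds σ ∧ g₂.Holds σ

/-- The cost of evaluating a test: one unit for each of its nodes. -/
def Guard.cost : Guard → ℕ
  | .le e₁ e₂ => e₁.cost + e₂.cost + 1
  | .eq e₁ e₂ => e₁.cost + e₂.cost + 1
  | .not g => g.cost + 1
  | .and g₁ g₂ => g₁.cost + g₂.cost + 1

/-- Programs. -/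
inductive Prog where
  | skip
  | assign (i : ℕ) (e : Exp)
  | write (a : ℕ) (idx e : Exp)
  | seq (p q : Prog)
  | ite (g : Guard) (p q : Prog)
  | loop (g : Guard) (p : Prog)

/-- Set register `i` to `z`. -/
def State.setReg (σ : State) (i : ℕ) (z : ℤ) : State where
  reg := Function.update σ.reg i z
  mem := σ.mem

/-- Set cell `j` of array `a` to `z`. -/
def State.setMem (σ : State) (a : ℕ) (j z : ℤ) : State where
  reg := σ.reg
  mem := Function.update σ.mem a (Function.update (σ.mem a) j z)

/-- `Exec B p σ σ' t`: started in state `σ`, the program `p` halts in state `σ'` after exactly `t`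
time units, and every value that it stores and every address to which it stores is at most `B` in
absolute value (a program that violates this is stuck, it has no result). -/
inductive Exec (B : ℕ) : Prog → State → State → ℕ → Prop where
  | skip (σ : State) : Exec B .skip σ σ 1
  | assign (σ : State) (i : ℕ) (e : Exp) (he : |e.eval σ| ≤ (B : ℤ)) :
      Exec B (.assign i e) σ (σ.setReg i (e.eval σ)) (e.cost + 1)
  | write (σ : State) (a : ℕ) (idx e : Exp) (hi : |idx.eval σ| ≤ (B : ℤ))
      (he : |e.eval σ| ≤ (B : ℤ)) :
      Exec B (.write a idx e) σ (σ.setMem a (idx.eval σ) (e.eval σ)) (idx.cost + e.cost + 1)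
  | seq {p q : Prog} {σ₁ σ₂ σ₃ : State} {t₁ t₂ : ℕ} (hp : Exec B p σ₁ σ₂ t₁)
      (hq : Exec B q σ₂ σ₃ t₂) : Exec B (.seq p q) σ₁ σ₃ (t₁ + t₂)
  | ite_true {g : Guard} {p q : Prog} {σ σ' : State} {t : ℕ} (hg : g.Holds σ)
      (hp : Exec B p σ σ' t) : Exec B (.ite g p q) σ σ' (g.cost + t + 1)
  | ite_false {g : Guard} {p q : Prog} {σ σ' : State} {t : ℕ} (hg : ¬ g.Holds σ)
      (hq : Exec B q σ σ' t) : Exec B (.ite g p q) σ σ' (g.cost + t + 1)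
  | loop_done {g : Guard} {p : Prog} {σ : State} (hg : ¬ g.Holds σ) :
      Exec B (.loop g p) σ σ (g.cost + 1)
  | loop_step {g : Guard} {p : Prog} {σ₁ σ₂ σ₃ : State} {t₁ t₂ : ℕ} (hg : g.Holds σ₁)
      (hp : Exec B p σ₁ σ₂ t₁) (hl : Exec B (.loop g p) σ₂ σ₃ t₂) :
      Exec B (.loop g p) σ₁ σ₃ (g.cost + t₁ + t₂ + 1)

/-! ## Input format -/

/-- `adj` is a system of adjacency lists of the graph `G`, each in an arbitrary order. -/
def IsAdjLists {n : ℕ} (G : SimpleGraph (Fin n)) (adj : Fin n → List (Fin n)) : Prop :=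
  ∀ v, (adj v).Nodup ∧ ∀ u, u ∈ adj v ↔ G.Adj v u

/-- The adjacency lists in memory: register 0 holds the number `n` of vertices; array 1 holds the
lists of the vertices `0, …, n - 1` one after the other; for `i = 0, …, n`, cell `i` of array 0
holds the total length of the lists of the vertices below `i` (so the list of vertex `v` starts in
array 1 at this position). Everything else is `0`. -/
def graphInput {n : ℕ} (adj : Fin n → List (Fin n)) : State where
  reg := fun i => if i = 0 then (n : ℤ) else 0
  mem := fun a i =>
    if a = 0 then
      if i ≤ (n : ℤ) then
        ∑ v : Fin n, if ((v : ℕ) : ℤ) < i then ((adj v).length : ℤ) else 0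
      else 0
    else if a = 1 then
      if 0 ≤ i then ((List.ofFn adj).flatten.map (fun u => ((u : ℕ) : ℤ))).getD i.toNat 0 else 0
    else 0

/-- A graph and an integer `k`, the latter in register 1. -/
def decisionInput {n : ℕ} (adj : Fin n → List (Fin n)) (k : ℤ) : State :=
  (graphInput adj).setReg 1 k

/-- A graph and a vertex weighting; cell `v` of array 2 holds the weight of vertex `v`. -/
def weightedInput {n : ℕ} (adj : Fin n → List (Fin n)) (w : Fin n → ℤ) : State where
  reg := (graphInput adj).reg
  mem := fun a i =>
    if a = 2 then
      if h : 0 ≤ i ∧ i < (n : ℤ) then w ⟨i.toNat, by omega⟩ else 0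
    else (graphInput adj).mem a i

/-! ## Problems and linear time

A class of graphs is given by a predicate `𝒢`, and a vertex deletion problem by the predicate
`Feas`, where `Feas n G S` says that `S` is a feasible deletion set of `G`. Linear time means
`O(n + m)` steps for `n` vertices and `m` edges; the words of the machine have
`O(log (n + m + size of the numbers in the input))` bits. -/

/-- Is there a feasible set of size at most `k`? This decision problem can be solved in linear time
on the graph class `𝒢`. The answer is left in register 0 (`1` for yes and `0` for no). -/
def DecidableInLinearTime (𝒢 : ∀ n : ℕ, SimpleGraph (Fin n) → Prop)
    (Feas : ∀ n : ℕ, SimpleGraph (Fin n) → Set (Fin n) → Prop) : Prop :=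
  ∃ (p : Prog) (c d : ℕ), ∀ (n : ℕ) (G : SimpleGraph (Fin n)) (adj : Fin n → List (Fin n)) (k : ℤ),
    𝒢 n G → IsAdjLists G adj →
    ∃ (σ : State) (t : ℕ),
      Exec ((n + G.edgeSet.ncard + k.natAbs + 2) ^ d) p (decisionInput adj k) σ t ∧
      t ≤ c * (n + G.edgeSet.ncard + 1) ∧
      (σ.reg 0 = 0 ∨ σ.reg 0 = 1) ∧
      (σ.reg 0 = 1 ↔ ∃ S : Finset (Fin n), Feas n G (S : Set (Fin n)) ∧ (S.card : ℤ) ≤ k)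

/-- Find a feasible set of minimum weight, for given integer vertex weights. This optimization
problem can be solved in linear time on the graph class `𝒢`. Register 0 tells whether there is a
feasible set at all (`1` for yes and `0` for no). If so, array 3 holds the characteristic vector of
an optimal set `S` and register 1 its weight. -/
def MinimizableInLinearTime (𝒢 : ∀ n : ℕ, SimpleGraph (Fin n) → Prop)
    (Feas : ∀ n : ℕ, SimpleGraph (Fin n) → Set (Fin n) → Prop) : Prop :=
  ∃ (p : Prog) (c d : ℕ), ∀ (n : ℕ) (G : SimpleGraph (Fin n)) (adj : Fin n → List (Fin n))
    (w : Fin n → ℤ),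
    𝒢 n G → IsAdjLists G adj →
    ∃ (σ : State) (t : ℕ),
      Exec ((n + G.edgeSet.ncard + ∑ v, (w v).natAbs + 2) ^ d) p (weightedInput adj w) σ t ∧
      t ≤ c * (n + G.edgeSet.ncard + 1) ∧
      (((¬ ∃ T : Finset (Fin n), Feas n G (T : Set (Fin n))) ∧ σ.reg 0 = 0) ∨
        (σ.reg 0 = 1 ∧ ∃ S : Finset (Fin n),
          Feas n G (S : Set (Fin n)) ∧
          (∀ T : Finset (Fin n), Feas n G (T : Set (Fin n)) → ∑ v ∈ S, w v ≤ ∑ v ∈ T, w v) ∧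
          (∀ v : Fin n, σ.mem 3 ((v : ℕ) : ℤ) = if v ∈ S then 1 else 0) ∧
          σ.reg 1 = ∑ v ∈ S, w v))

end ClusterVD

namespace ClusterVD

/-! ## Total correctness with running times -/

/-- Started in `σ`, the program `p` halts within `T` steps in a state that satisfies `Q`. -/
def Runs (B : ℕ) (p : Prog) (σ : State) (T : ℕ) (Q : State → Prop) : Prop :=
  ∃ σ' t, Exec B p σ σ' t ∧ t ≤ T ∧ Q σ'

theorem Runs.mono {B : ℕ} {p : Prog} {σ : State} {T T' : ℕ} {Q Q' : State → Prop}
    (h : Runs B p σ T Q) (hT : T ≤ T') (hQ : ∀ σ', Q σ' → Q' σ') : Runs B p σ T' Q' := by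
  obtain ⟨σ', t, h1, h2, h3⟩ := h
  exact ⟨σ', t, h1, h2.trans hT, hQ _ h3⟩

theorem Runs.seq {B : ℕ} {p q : Prog} {σ : State} {T₁ T₂ : ℕ} {Q R : State → Prop}
    (h : Runs B p σ T₁ R) (h' : ∀ σ', R σ' → Runs B q σ' T₂ Q) :
    Runs B (.seq p q) σ (T₁ + T₂) Q := by
  obtain ⟨σ', t, h1, h2, h3⟩ := h
  obtain ⟨σ'', t', h1', h2', h3'⟩ := h' _ h3
  exact ⟨σ'', _, .seq h1 h1', by omega, h3'⟩

theorem Runs.ite {B : ℕ} {p q : Prog} {g : Guard} {σ : State} {T : ℕ} {Q : State → Prop}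
    (h : g.Holds σ → Runs B p σ T Q) (h' : ¬ g.Holds σ → Runs B q σ T Q) :
    Runs B (.ite g p q) σ (g.cost + T + 1) Q := by
  by_cases hg : g.Holds σ
  · obtain ⟨σ', t, h1, h2, h3⟩ := h hg
    exact ⟨σ', _, .ite_true hg h1, by omega, h3⟩
  · obtain ⟨σ', t, h1, h2, h3⟩ := h' hg
    exact ⟨σ', _, .ite_false hg h1, by omega, h3⟩

/-- The program assigns to register `i`. -/
def Prog.wr : Prog → ℕ → Bool
  | .skip, _ => false
  | .assign j _, i => i == j
  | .write _ _ _, _ => false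
  | .seq p q, i => p.wr i || q.wr i
  | .ite _ p q, i => p.wr i || q.wr i
  | .loop _ p, i => p.wr i

/-- The program writes to array `i`. -/
def Prog.wm : Prog → ℕ → Bool
  | .skip, _ => false
  | .assign _ _, _ => false
  | .write a _ _, i => i == a
  | .seq p q, i => p.wm i || q.wm i
  | .ite _ p q, i => p.wm i || q.wm i
  | .loop _ p, i => p.wm i

/-- The two states differ at most in the registers and arrays that `p` modifies. -/
def Agree (p : Prog) (σ σ' : State) : Prop :=
  (∀ i, p.wr i = false → σ'.reg i = σ.reg i) ∧ ∀ a, p.wm a = false → σ'.mem a = σ.mem a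

theorem Agree.refl (p : Prog) (σ : State) : Agree p σ σ := ⟨fun _ _ => rfl, fun _ _ => rfl⟩

theorem Agree.trans {p : Prog} {σ₁ σ₂ σ₃ : State} (h : Agree p σ₁ σ₂) (h' : Agree p σ₂ σ₃) :
    Agree p σ₁ σ₃ :=
  ⟨fun i hi => (h'.1 i hi).trans (h.1 i hi), fun a ha => (h'.2 a ha).trans (h.2 a ha)⟩

theorem Exec.agree {B : ℕ} {p : Prog} {σ σ' : State} {t : ℕ} (h : Exec B p σ σ' t) :
    Agree p σ σ' := by
  induction h with
  | skip => exact .refl _ _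
  | assign σ i e he =>
    refine ⟨fun j hj => ?_, fun _ _ => rfl⟩
    have : j ≠ i := by simpa [Prog.wr] using hj
    simp [State.setReg, this]
  | write σ a idx e hi he =>
    refine ⟨fun _ _ => rfl, fun j hj => ?_⟩
    have : j ≠ a := by simpa [Prog.wm] using hj
    simp [State.setMem, this]
  | seq _ _ h1 h2 =>
    refine ⟨fun i hi => ?_, fun i hi => ?_⟩
    · simp only [Prog.wr, Bool.or_eq_false_iff] at hi
      rw [h2.1 i hi.2, h1.1 i hi.1]
    · simp only [Prog.wm, Bool.or_eq_false_iff] at hi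
      rw [h2.2 i hi.2, h1.2 i hi.1]
  | ite_true hg _ h1 =>
    refine ⟨fun i hi => ?_, fun i hi => ?_⟩
    · simp only [Prog.wr, Bool.or_eq_false_iff] at hi
      exact h1.1 i hi.1
    · simp only [Prog.wm, Bool.or_eq_false_iff] at hi
      exact h1.2 i hi.1
  | ite_false hg _ h1 =>
    refine ⟨fun i hi => ?_, fun i hi => ?_⟩
    · simp only [Prog.wr, Bool.or_eq_false_iff] at hi
      exact h1.1 i hi.2
    · simp only [Prog.wm, Bool.or_eq_false_iff] at hi
      exact h1.2 i hi.2
  | loop_done hg => exact .refl _ _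
  | loop_step hg _ _ h1 h2 => exact ⟨fun i hi => (h2.1 i hi).trans (h1.1 i hi),
      fun i hi => (h2.2 i hi).trans (h1.2 i hi)⟩

theorem Runs.agree {B : ℕ} {p : Prog} {σ : State} {T : ℕ} {Q : State → Prop}
    (h : Runs B p σ T Q) : Runs B p σ T (fun σ' => Q σ' ∧ Agree p σ σ') := by
  obtain ⟨σ', t, h1, h2, h3⟩ := h
  exact ⟨σ', t, h1, h2, h3, h1.agree⟩

/-- Loops, with a potential that pays for the iterations. -/
theorem Runs.loop_potential {B : ℕ} {g : Guard} {p : Prog} {σ₀ : State} (I : State → Prop)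
    (Φ : State → ℕ) (h0 : I σ₀)
    (step : ∀ σ, Agree p σ₀ σ → I σ → g.Holds σ →
      ∃ T, Runs B p σ T (fun σ' => I σ' ∧ Φ σ' + T + g.cost + 1 ≤ Φ σ)) :
    Runs B (.loop g p) σ₀ (Φ σ₀ + g.cost + 1)
      (fun σ' => I σ' ∧ ¬ g.Holds σ' ∧ Agree p σ₀ σ') := by
  suffices H : ∀ k σ, Φ σ ≤ k → I σ → Agree p σ₀ σ →
      Runs B (.loop g p) σ (Φ σ + g.cost + 1)
        (fun σ' => I σ' ∧ ¬ g.Holds σ' ∧ Agree p σ₀ σ') from H _ _ le_rfl h0 (.refl _ _)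
  intro k
  induction k with
  | zero =>
    intro σ hk hI ha
    by_cases hg : g.Holds σ
    · obtain ⟨T, σ', t, _, _, _, h⟩ := step σ ha hI hg
      omega
    · exact ⟨σ, _, .loop_done hg, by omega, hI, hg, ha⟩
  | succ k ih =>
    intro σ hk hI ha
    by_cases hg : g.Holds σ
    · obtain ⟨T, σ', t, h1, h2, h3, h4⟩ := step σ ha hI hg
      obtain ⟨σ'', t', h1', h2', h3'⟩ := ih σ' (by omega) h3 (ha.trans h1.agree)
      exact ⟨σ'', _, .loop_step hg h1 h1', by omega, h3'⟩
    · exact ⟨σ, _, .loop_done hg, by omega, hI, hg, ha⟩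

/-- Loops in which each iteration takes at most `T` steps. -/
theorem Runs.loop {B : ℕ} {g : Guard} {p : Prog} {σ₀ : State} (T : ℕ) (I : State → Prop)
    (μ : State → ℕ) (h0 : I σ₀)
    (step : ∀ σ, Agree p σ₀ σ → I σ → g.Holds σ →
      Runs B p σ T (fun σ' => I σ' ∧ μ σ' < μ σ)) :
    Runs B (.loop g p) σ₀ (μ σ₀ * (T + g.cost + 1) + g.cost + 1)
      (fun σ' => I σ' ∧ ¬ g.Holds σ' ∧ Agree p σ₀ σ') := by
  refine Runs.loop_potential I (fun σ => μ σ * (T + g.cost + 1)) h0 fun σ ha hI hg =>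
    ⟨T, (step σ ha hI hg).mono le_rfl fun σ' h => ⟨h.1, ?_⟩⟩
  have := Nat.mul_le_mul_right (T + g.cost + 1) (Nat.succ_le_of_lt h.2)
  rw [Nat.succ_mul] at this
  omega

/-- Largest cost of an execution of a loop-free program. -/
def Prog.maxcost : Prog → ℕ
  | .skip => 1
  | .assign _ e => e.cost + 1
  | .write _ idx e => idx.cost + e.cost + 1
  | .seq p q => p.maxcost + q.maxcost
  | .ite g p q => g.cost + max p.maxcost q.maxcost + 1
  | .loop _ _ => 0

/-- Weakest preconditions of loop-free programs. -/
def wp (B : ℕ) : Prog → (State → Prop) → State → Prop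
  | .skip, Q, σ => Q σ
  | .assign i e, Q, σ => |e.eval σ| ≤ (B : ℤ) ∧ Q (σ.setReg i (e.eval σ))
  | .write a idx e, Q, σ => |idx.eval σ| ≤ (B : ℤ) ∧ |e.eval σ| ≤ (B : ℤ) ∧
      Q (σ.setMem a (idx.eval σ) (e.eval σ))
  | .seq p q, Q, σ => wp B p (wp B q Q) σ
  | .ite g p q, Q, σ => (g.Holds σ → wp B p Q σ) ∧ (¬ g.Holds σ → wp B q Q σ)
  | .loop _ _, _, _ => False

theorem Runs.of_wp {B : ℕ} {p : Prog} {Q : State → Prop} {σ : State} (h : wp B p Q σ) :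
    Runs B p σ p.maxcost Q := by
  induction p generalizing Q σ with
  | skip => exact ⟨σ, _, .skip _, le_rfl, h⟩
  | assign i e => exact ⟨_, _, .assign _ _ _ h.1, le_rfl, h.2⟩
  | write a idx e => exact ⟨_, _, .write _ _ _ _ h.1 h.2.1, le_rfl, h.2.2⟩
  | seq p q hp hq => exact Runs.seq (hp h) fun σ' h' => hq h'
  | ite g p q hp hq =>
    exact Runs.ite (fun hg => (hp (h.1 hg)).mono (le_max_left _ _) fun _ h => h)
      (fun hg => (hq (h.2 hg)).mono (le_max_right _ _) fun _ h => h)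
  | loop g p => exact h.elim

theorem Runs.of_wp_le {B : ℕ} {p : Prog} {Q : State → Prop} {σ : State} {T : ℕ}
    (h : wp B p Q σ) (hT : p.maxcost ≤ T) : Runs B p σ T Q :=
  (Runs.of_wp h).mono hT fun _ h => h

/-! Notation for programs. -/

notation:max "ℛ" i:max => Exp.reg i
notation:max "𝒞" z:max => Exp.const z
notation:max a:max "⟪" e "⟫" => Exp.read a e
infixl:65 " +ₑ " => Exp.add
infixl:65 " -ₑ " => Exp.sub
infix:50 " ≤ₑ " => Guard.le
infix:50 " =ₑ " => Guard.eq
infix:45 " ≔ " => Prog.assign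
infixr:40 " ;; " => Prog.seq

/-! ## Cotrees stored by parent pointers -/

/-- A symmetric irreflexive relation without induced paths on four vertices. -/
structure IsCograph (A : ℤ → ℤ → Prop) : Prop where
  symm : ∀ {a b}, A a b → A b a
  irrefl : ∀ a, ¬ A a a
  p4 : ∀ {a b c d}, A a b → A b c → A c d → ¬ A a c → ¬ A a d → ¬ A b d → False

/-- A cotree with node set `N` and set of leaves `X`, given by parent pointers `par` and node types
`typ` (`0` for unions, `1` for joins, `2` for leaves); `L t` is the set of leaves below `t`. Types
alternate except perhaps between `e` and its parent, and inner nodes other than `e'` have at least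
two children. -/
structure Cotree (A : ℤ → ℤ → Prop) (X N : Finset ℤ) (root : ℤ) (par typ : ℤ → ℤ)
    (L : ℤ → Finset ℤ) (e e' : ℤ) : Prop where
  X_sub : X ⊆ N
  root_mem : root ∈ N
  root_not : root ∉ X
  neg : (-1) ∉ N
  par_root : par root = -1
  par_neg : par (-1) = -1
  par_mem : ∀ v ∈ N, v ≠ root → par v ∈ N ∧ par v ∉ X
  leaf : ∀ v ∈ X, L v = {v} ∧ typ v = 2
  typ_int : ∀ t ∈ N, t ∉ X → typ t = 0 ∨ typ t = 1
  typ_root : typ root = 0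
  mem_L : ∀ t ∈ N, t ∉ X → ∀ y, y ∈ L t ↔ ∃ c ∈ N, par c = t ∧ y ∈ L c
  ne : ∀ t ∈ N, (L t).Nonempty
  disj : ∀ c ∈ N, ∀ d ∈ N, c ≠ d → par c = par d → ∀ y, y ∈ L c → y ∉ L d
  adj : ∀ c ∈ N, ∀ d ∈ N, c ≠ d → par c = par d → ∀ a ∈ L c, ∀ b ∈ L d,
    (A a b ↔ typ (par c) = 1)
  L_root : L root = X
  alt : ∀ c ∈ N, c ∉ X → c ≠ root → c ≠ e → typ c ≠ typ (par c)
  two : ∀ t ∈ N, t ∉ X → t ≠ e' → ∃ c ∈ N, ∃ d ∈ N, c ≠ d ∧ par c = t ∧ par d = t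
  rank : ∃ rk : ℤ → ℚ, ∀ c ∈ N, c ≠ root → rk c < rk (par c)

/-- The children of `t`. -/
def chs (N : Finset ℤ) (par : ℤ → ℤ) (t : ℤ) : Finset ℤ := N.filter (fun c => par c = t)

@[simp] theorem mem_chs {N : Finset ℤ} {par : ℤ → ℤ} {t c : ℤ} :
    c ∈ chs N par t ↔ c ∈ N ∧ par c = t := Finset.mem_filter

/-- `cnt t` and `sum t` are the number of children of the inner node `t` and their sum. -/
def Counts (X N : Finset ℤ) (par cnt sum : ℤ → ℤ) : Prop :=
  ∀ t ∈ N, t ∉ X → cnt t = (chs N par t).card ∧ sum t = ∑ c ∈ chs N par t, c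

/-- `t` is `s` or an ancestor of `s`. -/
def Anc (N : Finset ℤ) (par : ℤ → ℤ) : ℤ → ℤ → Prop :=
  Relation.ReflTransGen (fun c t => c ∈ N ∧ t ∈ N ∧ par c = t)

theorem Anc.eq_or {N : Finset ℤ} {par : ℤ → ℤ} {s t : ℤ} (h : Anc N par s t) :
    t = s ∨ ∃ c ∈ N, par c = t ∧ t ∈ N ∧ Anc N par s c := by
  rcases Relation.ReflTransGen.cases_tail h with h | ⟨c, h1, h2, h3, h4⟩
  · exact .inl h
  · exact .inr ⟨c, h2, h4, h3, h1⟩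

theorem Anc.step {N : Finset ℤ} {par : ℤ → ℤ} {s c : ℤ} (h : Anc N par s c) (hc : c ∈ N)
    (hp : par c ∈ N) : Anc N par s (par c) :=
  Relation.ReflTransGen.tail h ⟨hc, hp, rfl⟩

namespace Cotree

variable {A : ℤ → ℤ → Prop} {X N : Finset ℤ} {root : ℤ} {par typ : ℤ → ℤ} {L : ℤ → Finset ℤ}
  {e e' : ℤ}

theorem induct (T : Cotree A X N root par typ L e e') (P : ℤ → Prop)
    (h : ∀ t ∈ N, (∀ c ∈ N, par c = t → P c) → P t) : ∀ t ∈ N, P t := by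
  obtain ⟨rk, hrk⟩ := T.rank
  have key : ∀ k : ℕ, ∀ t ∈ N, (N.filter (fun c => rk c < rk t)).card ≤ k → P t := by
    intro k
    induction k with
    | zero =>
      intro t ht hk
      refine h t ht fun c hc hp => ?_
      have hcr : c ≠ root := by
        rintro rfl
        exact T.neg (by rw [← T.par_root, hp]; exact ht)
      have : c ∈ N.filter (fun c => rk c < rk t) := by
        simp [hc, ← hp, hrk c hc hcr]
      exact absurd (Finset.card_pos.2 ⟨_, this⟩) (by omega)
    | succ k ih =>
      intro t ht hk
      refine h t ht fun c hc hp => ih c hc ?_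
      have hcr : c ≠ root := by
        rintro rfl
        exact T.neg (by rw [← T.par_root, hp]; exact ht)
      have hlt := hrk c hc hcr
      rw [hp] at hlt
      have : (N.filter (fun d => rk d < rk c)) ⊂ N.filter (fun d => rk d < rk t) := by
        rw [Finset.ssubset_iff_of_subset]
        · exact ⟨c, by simp [hc, hlt], by simp⟩
        · intro d
          simp only [Finset.mem_filter]
          exact fun hd => ⟨hd.1, hd.2.trans hlt⟩
      have := Finset.card_lt_card this
      omega
  exact fun t ht => key _ t ht le_rfl

theorem ne_root_of_par (T : Cotree A X N root par typ L e e') {c t : ℤ} (ht : t ∈ N)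
    (hp : par c = t) : c ≠ root := by
  rintro rfl
  exact T.neg (by rw [← T.par_root, hp]; exact ht)

theorem not_leaf_of_par (T : Cotree A X N root par typ L e e') {c t : ℤ} (hc : c ∈ N) (ht : t ∈ N)
    (hp : par c = t) : t ∉ X := hp ▸ (T.par_mem c hc (T.ne_root_of_par ht hp)).2

theorem sub_of_par (T : Cotree A X N root par typ L e e') {c t : ℤ} (hc : c ∈ N) (ht : t ∈ N)
    (hp : par c = t) : L c ⊆ L t := fun y hy =>
  (T.mem_L t ht (T.not_leaf_of_par hc ht hp) y).2 ⟨c, hc, hp, hy⟩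

theorem anc_sub (T : Cotree A X N root par typ L e e') {s t : ℤ} (h : Anc N par s t) :
    L s ⊆ L t := by
  induction h with
  | refl => exact subset_rfl
  | tail _ h ih => exact ih.trans (T.sub_of_par h.1 h.2.1 h.2.2)

theorem anc_mem {s t : ℤ} (h : Anc N par s t) (hs : s ∈ N) : t ∈ N := by
  rcases h.eq_or with rfl | ⟨c, _, _, ht, _⟩ <;> assumption

theorem not_anc_of_par (T : Cotree A X N root par typ L e e') {s t : ℤ} (hs : s ∈ N)
    (hp : par t = s) (h : Anc N par s t) : False := by
  obtain ⟨rk, hrk⟩ := T.rank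
  have : rk s ≤ rk t := by
    clear hp
    induction h with
    | refl => exact le_rfl
    | tail _ h ih =>
      have := hrk _ h.1 (T.ne_root_of_par h.2.1 h.2.2)
      rw [h.2.2] at this
      exact ih.trans this.le
  have ht := anc_mem h hs
  have := hrk t ht (T.ne_root_of_par hs hp)
  rw [hp] at this
  linarith

theorem anc_root (T : Cotree A X N root par typ L e e') {s : ℤ} (hs : s ∈ N) :
    Anc N par s root := by
  obtain ⟨rk, hrk⟩ := T.rank
  have key : ∀ k : ℕ, ∀ t ∈ N, (N.filter (fun c => rk t < rk c)).card ≤ k → Anc N par t root := by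
    intro k
    induction k with
    | zero =>
      intro t ht hk
      by_cases h : t = root
      · exact h ▸ .refl
      · have h1 := T.par_mem t ht h
        have : par t ∈ N.filter (fun c => rk t < rk c) := by simp [h1.1, hrk t ht h]
        exact absurd (Finset.card_pos.2 ⟨_, this⟩) (by omega)
    | succ k ih =>
      intro t ht hk
      by_cases h : t = root
      · exact h ▸ .refl
      · have h1 := T.par_mem t ht h
        have hlt := hrk t ht h
        refine .head ⟨ht, h1.1, rfl⟩ (ih _ h1.1 ?_)
        have : (N.filter (fun d => rk (par t) < rk d)) ⊂ N.filter (fun d => rk t < rk d) := by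
          rw [Finset.ssubset_iff_of_subset]
          · exact ⟨par t, by simp [h1.1, hlt], by simp⟩
          · intro d
            simp only [Finset.mem_filter]
            exact fun hd => ⟨hd.1, hlt.trans hd.2⟩
        have := Finset.card_lt_card this
        omega
  exact key _ s hs le_rfl

theorem L_sub (T : Cotree A X N root par typ L e e') {t : ℤ} (ht : t ∈ N) : L t ⊆ X :=
  T.L_root ▸ T.anc_sub (T.anc_root ht)

/-- An inner node that contains neighbours and non-neighbours of `x` contains such a pair from
different children. -/
theorem exists_crossing (T : Cotree A X N root par typ L e (-1)) {x t : ℤ} (ht : t ∈ N)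
    (htX : t ∉ X) (h1 : ∃ a ∈ L t, A x a) (h2 : ∃ b ∈ L t, ¬ A x b) :
    ∃ a ∈ L t, ∃ b ∈ L t, A x a ∧ ¬ A x b ∧ (A a b ↔ typ t = 1) := by
  obtain ⟨a, ha, hxa⟩ := h1
  obtain ⟨b, hb, hxb⟩ := h2
  obtain ⟨c, hc, hct, hac⟩ := (T.mem_L t ht htX a).1 ha
  obtain ⟨d, hd, hdt, hbd⟩ := (T.mem_L t ht htX b).1 hb
  by_cases hcd : c = d
  · subst hcd
    obtain ⟨s, hs, hst, hsc⟩ : ∃ s ∈ N, par s = t ∧ s ≠ c := by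
      obtain ⟨c1, h1, c2, h2, h3, h4, h5⟩ := T.two t ht htX (fun h => T.neg (h ▸ ht))
      by_cases h : c1 = c
      · exact ⟨c2, h2, h5, fun h' => h3 (h.trans h'.symm)⟩
      · exact ⟨c1, h1, h4, h⟩
    obtain ⟨z, hz⟩ := T.ne s hs
    have hzt : z ∈ L t := (T.mem_L t ht htX z).2 ⟨s, hs, hst, hz⟩
    by_cases hxz : A x z
    · exact ⟨z, hzt, b, hb, hxz, hxb, by
        rw [T.adj s hs c hc hsc (hst.trans hct.symm) z hz b hbd, hst]⟩
    · exact ⟨a, ha, z, hzt, hxa, hxz, by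
        rw [T.adj c hc s hs hsc.symm (hct.trans hst.symm) a hac z hz, hct]⟩
  · exact ⟨a, ha, b, hb, hxa, hxb, by
      rw [T.adj c hc d hd hcd (hct.trans hdt.symm) a hac b hbd, hct]⟩

/-- `t` contains neighbours and non-neighbours of `x`. -/
def Mixed (A : ℤ → ℤ → Prop) (L : ℤ → Finset ℤ) (x t : ℤ) : Prop :=
  (∃ a ∈ L t, A x a) ∧ ∃ b ∈ L t, ¬ A x b

/-- All leaves below `t` are neighbours of `x`. -/
def Full (A : ℤ → ℤ → Prop) (L : ℤ → Finset ℤ) (x t : ℤ) : Prop := ∀ a ∈ L t, A x a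

theorem Mixed.not_full {x t : ℤ} (h : Mixed A L x t) : ¬ Full A L x t := by
  obtain ⟨_, b, hb, h⟩ := h
  exact fun h' => h (h' b hb)

theorem Mixed.not_leaf (T : Cotree A X N root par typ L e e') {x t : ℤ} (h : Mixed A L x t) :
    t ∉ X := by
  intro ht
  obtain ⟨⟨a, ha, h1⟩, b, hb, h2⟩ := h
  rw [(T.leaf t ht).1, Finset.mem_singleton] at ha hb
  exact h2 (hb ▸ ha ▸ h1)

theorem Mixed.mono {x s t : ℤ} (h : Mixed A L x s) (hst : L s ⊆ L t) : Mixed A L x t := by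
  obtain ⟨⟨a, ha, h1⟩, b, hb, h2⟩ := h
  exact ⟨⟨a, hst ha, h1⟩, b, hst hb, h2⟩

/-- The siblings of a node that `x` splits are not split. -/
theorem Mixed.sibling (T : Cotree A X N root par typ L (-1) (-1)) (hA : IsCograph A) {x c d t : ℤ}
    (h : Mixed A L x c) (hc : c ∈ N) (hd : d ∈ N) (hcd : c ≠ d) (ht : t ∈ N) (hct : par c = t)
    (hdt : par d = t) : ∀ y ∈ L d, (A x y ↔ typ t = 1) := by
  intro y hy
  have hcX := h.not_leaf T
  have htX := T.not_leaf_of_par hc ht hct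
  have halt := T.alt c hc hcX (T.ne_root_of_par ht hct) (fun h => T.neg (h ▸ hc))
  obtain ⟨a, ha, b, hb, hxa, hxb, hab⟩ := T.exists_crossing hc hcX h.1 h.2
  have hay := T.adj c hc d hd hcd (hct.trans hdt.symm) a ha y hy
  have hby := T.adj c hc d hd hcd (hct.trans hdt.symm) b hb y hy
  rw [hct] at halt hay hby
  rcases T.typ_int t ht htX with h0 | h1
  · have hc1 : typ c = 1 := by
      rcases T.typ_int c hc hcX with h | h
      · exact absurd (h.trans h0.symm) halt
      · exact h
    have hay' : ¬ A a y := by rw [hay, h0]; decide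
    have hby' : ¬ A b y := by rw [hby, h0]; decide
    refine ⟨fun hxy => ?_, fun h => by rw [h0] at h; exact absurd h (by decide)⟩
    exact (hA.p4 (hA.symm hxy) hxa (hab.2 hc1) (fun h => hay' (hA.symm h))
      (fun h => hby' (hA.symm h)) hxb).elim
  · have hc0 : ¬ typ c = 1 := fun h => halt (h.trans h1.symm)
    refine ⟨fun _ => h1, fun _ => ?_⟩
    by_contra hxy
    exact hA.p4 hxa (hay.2 h1) (hA.symm (hby.2 h1)) hxy hxb (fun h => hc0 (hab.1 h))

theorem exists_lowest (T : Cotree A X N root par typ L e e') {x : ℤ} :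
    ∀ t ∈ N, Mixed A L x t →
      ∃ u ∈ N, Mixed A L x u ∧ ∀ c ∈ N, par c = u → ¬ Mixed A L x c := by
  refine T.induct _ fun t ht ih hm => ?_
  by_cases h : ∃ c ∈ N, par c = t ∧ Mixed A L x c
  · obtain ⟨c, hc, hp, hcm⟩ := h
    exact ih c hc hp hcm
  · push Not at h
    exact ⟨t, ht, hm, h⟩

/-- All split nodes are ancestors of a lowest one. -/
theorem anc_of_mixed (T : Cotree A X N root par typ L (-1) (-1)) (hA : IsCograph A) {x u : ℤ}
    (hu : u ∈ N) (hum : Mixed A L x u) (hlow : ∀ c ∈ N, par c = u → ¬ Mixed A L x c) {t : ℤ}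
    (ht : t ∈ N) (htm : Mixed A L x t) : Anc N par u t := by
  suffices H : ∀ r ∈ N, Anc N par u r → Anc N par t r → Anc N par u t from
    H root T.root_mem (T.anc_root hu) (T.anc_root ht)
  refine T.induct _ fun r hr ih hur htr => ?_
  rcases htr.eq_or with rfl | ⟨d, hd, hdr, _, htd⟩
  · exact hur
  rcases hur.eq_or with rfl | ⟨c, hc, hcr, _, huc⟩
  · exact absurd (htm.mono (T.anc_sub htd)) (hlow d hd hdr)
  by_cases hcd : c = d
  · subst hcd
    exact ih c hc hcr huc htd
  · exfalso
    have hs := (hum.mono (T.anc_sub huc)).sibling T hA hc hd hcd hr hcr hdr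
    obtain ⟨⟨a, ha, h1⟩, b, hb, h2⟩ := htm.mono (T.anc_sub htd)
    exact h2 ((hs b hb).2 ((hs a ha).1 h1))

/-- Outside a lowest split node `u`, the vertex `x` has the same neighbours as the leaves of `u`. -/
theorem module_of_lowest (T : Cotree A X N root par typ L (-1) (-1)) (hA : IsCograph A) {x u : ℤ}
    (hu : u ∈ N) (hum : Mixed A L x u) {a y : ℤ} (ha : a ∈ L u) (hy : y ∈ X) (hyu : y ∉ L u) :
    A x y ↔ A a y := by
  suffices H : ∀ r ∈ N, Anc N par u r → y ∈ L r → (A x y ↔ A a y) from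
    H root T.root_mem (T.anc_root hu) (T.L_root ▸ hy)
  refine T.induct _ fun r hr ih hur hyr => ?_
  rcases hur.eq_or with rfl | ⟨c, hc, hcr, _, huc⟩
  · exact absurd hyr hyu
  by_cases hyc : y ∈ L c
  · exact ih c hc hcr huc hyc
  · obtain ⟨d, hd, hdr, hyd⟩ := (T.mem_L r hr (T.not_leaf_of_par hc hr hcr) y).1 hyr
    have hcd : c ≠ d := by rintro rfl; exact hyc hyd
    rw [(hum.mono (T.anc_sub huc)).sibling T hA hc hd hcd hr hcr hdr y hyd,
      T.adj c hc d hd hcd (hcr.trans hdr.symm) a (T.anc_sub huc ha) y hyd, hcr]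

/-- Children of a lowest split node are full or empty. -/
theorem full_or_empty {x c : ℤ} (h : ¬ Mixed A L x c) : Full A L x c ∨ ∀ a ∈ L c, ¬ A x a := by
  by_contra hh
  simp only [Full, not_or, not_forall, not_not] at hh
  obtain ⟨⟨b, hb, h1⟩, a, ha, h2⟩ := hh
  exact h ⟨⟨a, ha, h2⟩, b, hb, h1⟩

theorem adj_of_lowest (T : Cotree A X N root par typ L e e') {x u a b : ℤ} (hu : u ∈ N)
    (hum : Mixed A L x u) (hlow : ∀ c ∈ N, par c = u → ¬ Mixed A L x c) (ha : a ∈ L u)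
    (hb : b ∈ L u) (hxa : A x a) (hxb : ¬ A x b) : A a b ↔ typ u = 1 := by
  have huX := hum.not_leaf T
  obtain ⟨c, hc, hcu, hac⟩ := (T.mem_L u hu huX a).1 ha
  obtain ⟨d, hd, hdu, hbd⟩ := (T.mem_L u hu huX b).1 hb
  have hcd : c ≠ d := by
    rintro rfl
    exact hlow c hc hcu ⟨⟨a, hac, hxa⟩, b, hbd, hxb⟩
  rw [T.adj c hc d hd hcd (hcu.trans hdu.symm) a hac b hbd, hcu]

/-- A split node that has a full child. -/
def Touched (A : ℤ → ℤ → Prop) (N : Finset ℤ) (par : ℤ → ℤ) (L : ℤ → Finset ℤ) (x t : ℤ) : Prop :=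
  t ∈ N ∧ Mixed A L x t ∧ ∃ c ∈ N, par c = t ∧ Full A L x c

theorem touched_of_lowest (T : Cotree A X N root par typ L e e') {x u : ℤ} (hu : u ∈ N)
    (hum : Mixed A L x u) (hlow : ∀ c ∈ N, par c = u → ¬ Mixed A L x c) :
    Touched A N par L x u := by
  obtain ⟨⟨a, ha, h1⟩, _⟩ := id hum
  obtain ⟨c, hc, hcu, hac⟩ := (T.mem_L u hu (hum.not_leaf T) a).1 ha
  refine ⟨hu, hum, c, hc, hcu, ?_⟩
  rcases full_or_empty (hlow c hc hcu) with h | h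
  · exact h
  · exact absurd h1 (h a hac)

/-- The lowest split node is the only touched node that is neither the parent nor the grandparent
of a touched node. -/
theorem lowest_iff (T : Cotree A X N root par typ L (-1) (-1)) (hA : IsCograph A) {x u : ℤ}
    (hu : u ∈ N) (hum : Mixed A L x u) (hlow : ∀ c ∈ N, par c = u → ¬ Mixed A L x c) (t : ℤ) :
    t = u ↔ Touched A N par L x t ∧
      ∀ s, Touched A N par L x s → t ≠ par s ∧ t ≠ par (par s) := by
  have hneg : ∀ t ∈ N, t ≠ -1 := fun t ht h => T.neg (h ▸ ht)
  constructor
  · rintro rfl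
    refine ⟨T.touched_of_lowest hu hum hlow, fun s hs => ?_⟩
    have hanc := T.anc_of_mixed hA hu hum hlow hs.1 hs.2.1
    have h1 : t ≠ par s := fun h => T.not_anc_of_par hu h.symm hanc
    refine ⟨h1, fun h => ?_⟩
    by_cases hsr : s = root
    · rw [hsr, T.par_root, T.par_neg] at h
      exact hneg t hu h
    · have hps := T.par_mem s hs.1 hsr
      exact T.not_anc_of_par hu h.symm (hanc.step hs.1 hps.1)
  · rintro ⟨⟨ht, htm, f, hf, hft, hff⟩, hbad⟩
    by_contra hne
    have hanc := T.anc_of_mixed hA hu hum hlow ht htm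
    rcases hanc.eq_or with h | ⟨c, hc, hct, _, huc⟩
    · exact hne h
    have hcm := hum.mono (T.anc_sub huc)
    have hcf : c ≠ f := by rintro rfl; exact hcm.not_full hff
    -- the full child shows that `t` is a join
    have ht1 : typ t = 1 := by
      obtain ⟨y, hy⟩ := T.ne f hf
      exact (hcm.sibling T hA hc hf hcf ht hct hft y hy).1 (hff y hy)
    rcases huc.eq_or with h | ⟨d, hd, hdc, _, hud⟩
    · subst h
      exact (hbad c (T.touched_of_lowest hu hum hlow)).1 hct.symm
    have hdm := hum.mono (T.anc_sub hud)
    have htouch : Touched A N par L x d := by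
      rcases hud.eq_or with h | ⟨g, hg, hgd, _, hug⟩
      · subst h
        exact T.touched_of_lowest hu hum hlow
      · have hdX := hdm.not_leaf T
        have hcX := hcm.not_leaf T
        have hd1 : typ d = 1 := by
          have h1 := T.alt d hd hdX (T.ne_root_of_par hc hdc) (hneg d hd)
          have h2 := T.alt c hc hcX (T.ne_root_of_par ht hct) (hneg c hc)
          rw [hdc] at h1
          rw [hct, ht1] at h2
          rcases T.typ_int d hd hdX with h | h
          · rcases T.typ_int c hc hcX with h' | h'
            · exact absurd (h.trans h'.symm) h1
            · exact absurd h' h2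
          · exact h
        obtain ⟨s, hs, hsd, hsg⟩ : ∃ s ∈ N, par s = d ∧ s ≠ g := by
          obtain ⟨c1, h1, c2, h2, h3, h4, h5⟩ := T.two d hd hdX (hneg d hd)
          by_cases h : c1 = g
          · exact ⟨c2, h2, h5, fun h' => h3 (h.trans h'.symm)⟩
          · exact ⟨c1, h1, h4, h⟩
        refine ⟨hd, hdm, s, hs, hsd, fun y hy => ?_⟩
        exact ((hum.mono (T.anc_sub hug)).sibling T hA hg hs hsg.symm hd hgd hsd y hy).2 hd1
    exact (hbad d htouch).2 (by rw [hdc, hct])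

end Cotree

open Function (update)

theorem chs_new {N : Finset ℤ} {par : ℤ → ℤ} {z h : ℤ} (hz : z ∉ N) (t : ℤ) :
    chs (insert z N) (update par z h) t = if t = h then insert z (chs N par h) else chs N par t := by
  ext c
  split_ifs <;> simp only [mem_chs, Finset.mem_insert, Function.update_apply] <;> grind

theorem chs_move {N : Finset ℤ} {par : ℤ → ℤ} {v b : ℤ} (hv : v ∈ N) (t : ℤ) :
    chs N (update par v b) t = if t = b then insert v (chs N par b) else (chs N par t).erase v := by
  ext c
  split_ifs <;> simp only [mem_chs, Finset.mem_insert, Finset.mem_erase, Function.update_apply] <;>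
    grind

namespace Counts

variable {X N : Finset ℤ} {par cnt sum : ℤ → ℤ}

theorem insertAbove (h : Counts X N par cnt sum) {c z : ℤ} (hc : c ∈ N) (hz : z ∉ N)
    (hpN : par c ∈ N) (hzp : ∀ v ∈ N, par v ≠ z) :
    Counts X (insert z N) (update (update par z (par c)) c z) (update cnt z 1)
      (update (update sum z c) (par c) (sum (par c) + z - c)) := by
  have hcz : c ≠ z := by rintro rfl; exact hz hc
  have hpz : par c ≠ z := by intro h; exact hz (h ▸ hpN)
  intro t ht htX
  rw [chs_move (Finset.mem_insert_of_mem hc), chs_new hz, chs_new hz]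
  by_cases h1 : t = z
  · subst h1
    have : chs N par t = ∅ := by
      ext d
      simpa using hzp d
    simp [hpz.symm, this]
  · have htN : t ∈ N := by simpa [h1] using ht
    by_cases h2 : t = par c
    · subst h2
      have hcm : c ∈ chs N par (par c) := by simp [hc]
      have hzm : z ∉ chs N par (par c) := by simp [hz]
      have e1 : (insert z (chs N par (par c))).erase c = insert z ((chs N par (par c)).erase c) := by
        rw [Finset.erase_insert_of_ne hcz.symm]
      have hzm' : z ∉ (chs N par (par c)).erase c := by simp [hz]
      simp only [h1, if_false, if_true, e1, Finset.card_insert_of_notMem hzm',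
        Finset.sum_insert hzm', Function.update_self, Function.update_of_ne h1]
      have := h _ htN htX
      have h3 := Finset.card_erase_add_one hcm
      have h4 := Finset.sum_erase_add _ (fun x => x) hcm
      constructor
      · rw [this.1, ← h3]
      · rw [this.2, ← h4]; ring
    · have hcm : c ∉ chs N par t := by simp [hc, Ne.symm h2]
      simp only [h1, h2, if_false, Finset.erase_eq_of_notMem hcm, ne_eq, not_false_eq_true,
        Function.update_of_ne]
      exact h t htN htX

theorem move (h : Counts X N par cnt sum) {v w : ℤ} (hv : v ∈ N) (hvw : par v ≠ w) :
    Counts X N (update par v w) (update (update cnt w (cnt w + 1)) (par v) (cnt (par v) - 1))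
      (update (update sum w (sum w + v)) (par v) (sum (par v) - v)) := by
  intro t ht htX
  rw [chs_move hv]
  by_cases h1 : t = w
  · subst h1
    have hm : v ∉ chs N par t := by simp [hvw]
    have := h t ht htX
    simp only [if_true, Finset.card_insert_of_notMem hm, Finset.sum_insert hm,
      Function.update_of_ne hvw.symm, Function.update_self, this.1, this.2]
    exact ⟨by push_cast; ring, by ring⟩
  · by_cases h2 : t = par v
    · subst h2
      have hm : v ∈ chs N par (par v) := by simp [hv]
      have := h _ ht htX
      have h3 := Finset.card_erase_add_one hm
      have h4 := Finset.sum_erase_add _ (fun x => x) hm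
      simp only [h1, if_false, Function.update_self, this.1, this.2]
      exact ⟨by rw [← h3]; push_cast; ring, by rw [← h4]; ring⟩
    · have hm : v ∉ chs N par t := by simp [hv, Ne.symm h2]
      simp only [h1, h2, if_false, Finset.erase_eq_of_notMem hm, ne_eq, not_false_eq_true,
        Function.update_of_ne]
      exact h t ht htX

theorem addLeaf (h : Counts X N par cnt sum) {x g : ℤ} (hx : x ∉ N) (hg : g ∈ N) :
    Counts (insert x X) (insert x N) (update par x g) (update cnt g (cnt g + 1))
      (update sum g (sum g + x)) := by
  intro t ht htX
  have htx : t ≠ x := by rintro rfl; simp at htX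
  have htN : t ∈ N := by simpa [htx] using ht
  have htX' : t ∉ X := fun h => htX (Finset.mem_insert_of_mem h)
  rw [chs_new hx]
  have := h t htN htX'
  by_cases h1 : t = g
  · subst h1
    have hm : x ∉ chs N par t := by simp [hx]
    simp only [if_true, Finset.card_insert_of_notMem hm, Finset.sum_insert hm,
      Function.update_self, this.1, this.2]
    exact ⟨by push_cast; ring, by ring⟩
  · simpa [h1] using this

end Counts

namespace Cotree

variable {A : ℤ → ℤ → Prop} {X N : Finset ℤ} {root : ℤ} {par typ : ℤ → ℤ} {L : ℤ → Finset ℤ}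
  {e e' : ℤ}

/-- Insert a new node `z` between `c` and its parent. -/
theorem insertAbove (T : Cotree A X N root par typ L e (-1)) {c z ty e₂ : ℤ} (hc : c ∈ N)
    (hcr : c ≠ root) (hz : z ∉ N) (hz1 : z ≠ -1) (hty : ty = 0 ∨ ty = 1)
    (h1 : z ≠ e₂ → ty ≠ typ (par c)) (h2 : c ∉ X → c ≠ e₂ → typ c ≠ ty)
    (h3 : ∀ v ∈ N, v ≠ e₂ → v ≠ c → v ≠ e) :
    Cotree A X (insert z N) root (update (update par z (par c)) c z) (update typ z ty)
      (update L z (L c)) e₂ z := by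
  have hcz : c ≠ z := by rintro rfl; exact hz hc
  have hzX : z ∉ X := fun h => hz (T.X_sub h)
  have hzr : z ≠ root := by rintro rfl; exact hz T.root_mem
  obtain ⟨hpN, hpX⟩ := T.par_mem c hc hcr
  have hpz : par c ≠ z := fun h => hz (h ▸ hpN)
  have hne : ∀ v ∈ N, v ≠ z := by rintro v hv rfl; exact hz hv
  have hparz : ∀ v ∈ N, par v ≠ z := by
    intro v hv h
    by_cases hvr : v = root
    · rw [hvr, T.par_root] at h; exact hz1 h.symm
    · exact hz (h ▸ (T.par_mem v hv hvr).1)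
  have hpc : par c ≠ c := fun h => T.not_anc_of_par hc h .refl
  have hX := fun v hv => hne v (T.X_sub hv)
  have hneg : c ≠ -1 := by rintro rfl; exact T.neg hc
  constructor
  · exact T.X_sub.trans (Finset.subset_insert _ _)
  · exact Finset.mem_insert_of_mem T.root_mem
  · exact T.root_not
  · simp [T.neg, hz1.symm]
  · simp [hcr.symm, hzr.symm, T.par_root]
  · simp [hneg.symm, hz1.symm, T.par_neg]
  · intro v hv hvr
    have := T.par_mem v
    simp only [Function.update_apply, Finset.mem_insert] at *
    grind
  · intro v hv
    have := T.leaf v hv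
    simpa [hX v hv] using this
  · intro t ht htX
    have := T.typ_int t
    simp only [Function.update_apply, Finset.mem_insert] at *
    grind
  · simp [hzr.symm, T.typ_root]
  · intro t ht htX y
    have := T.mem_L t
    simp only [Function.update_apply, Finset.mem_insert] at *
    grind
  · intro t ht
    have := T.ne t
    have := T.ne c hc
    simp only [Function.update_apply, Finset.mem_insert] at *
    grind
  · intro v hv d hd hvd hp y
    have := T.disj v
    have := T.disj c hc
    simp only [Function.update_apply, Finset.mem_insert] at *
    grind
  · intro v hv d hd hvd hp a ha b hb
    have := T.adj v
    have := T.adj c hc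
    simp only [Function.update_apply, Finset.mem_insert] at *
    grind
  · simp [hzr.symm, T.L_root]
  · intro v hv hvX hvr hve
    have := T.alt v
    have := h3 v
    simp only [Function.update_apply, Finset.mem_insert] at *
    grind
  · intro t ht htX htz
    have htN : t ∈ N := by simpa [htz] using ht
    obtain ⟨c1, hc1, d1, hd1, hh1, hh2, hh3⟩ := T.two t htN htX (fun h => T.neg (h ▸ htN))
    simp only [Function.update_apply, Finset.mem_insert] at *
    by_cases c1 = c <;> by_cases d1 = c <;> grind
  · obtain ⟨rk, hrk⟩ := T.rank
    refine ⟨update rk z ((rk c + rk (par c)) / 2), fun v hv hvr => ?_⟩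
    have := hrk c hc hcr
    have hv' := hrk v
    by_cases hvz : v = z
    · subst hvz
      simp only [Function.update_self, Function.update_of_ne hcz.symm, Function.update_of_ne hpz]
      linarith
    · have hvN : v ∈ N := by simpa [hvz] using hv
      by_cases hvc : v = c
      · subst hvc
        simp only [Function.update_self, Function.update_of_ne hvz]
        linarith
      · simp only [Function.update_of_ne hvz, Function.update_of_ne hvc,
          Function.update_of_ne (hparz v hvN)]
        exact hv' hvN hvr

/-- Move a child `v` of `u` to the parent `w` of `u`, which has the same type. -/
theorem moveUp (T : Cotree A X N root par typ L e e') {u v w : ℤ} (hu : u ∈ N) (hv : v ∈ N)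
    (hw : w ∈ N) (hvu : par v = u) (huw : par u = w) (htyp : typ w = typ u)
    (h1 : ∃ c ∈ N, ∃ d ∈ N, c ≠ d ∧ c ≠ v ∧ d ≠ v ∧ par c = u ∧ par d = u)
    (h2 : ∀ t ∈ N, t ≠ w → t ≠ e') :
    Cotree A X N root (update par v w) typ (update L u (L u \ L v)) e (-1) := by
  have hur : u ≠ root := T.ne_root_of_par hw huw
  have hvr : v ≠ root := T.ne_root_of_par hu hvu
  have huX := T.not_leaf_of_par hv hu hvu
  have hwX := T.not_leaf_of_par hu hw huw
  have hwu : w ≠ u := fun h => T.not_anc_of_par hu (huw.trans h) .refl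
  have hvu' : v ≠ u := fun h => T.not_anc_of_par hu (h ▸ hvu) .refl
  have hvw' : v ≠ w := by
    intro h
    exact T.not_anc_of_par (t := u) hv (by rw [huw, h])
      (hvu ▸ Anc.step (.refl) hv (by rw [hvu]; exact hu))
  have hvneg : v ≠ -1 := by rintro rfl; exact T.neg hv
  have hsv := T.sub_of_par hv hu hvu
  have hsu := T.sub_of_par hu hw huw
  constructor
  · exact T.X_sub
  · exact T.root_mem
  · exact T.root_not
  · exact T.neg
  · simp [hvr.symm, T.par_root]
  · simp [hvneg.symm, T.par_neg]
  · intro d hd hdr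
    have := T.par_mem d
    simp only [Function.update_apply] at *
    grind
  · intro d hd
    have : d ≠ u := by rintro rfl; exact huX hd
    simpa [this] using T.leaf d hd
  · exact T.typ_int
  · exact T.typ_root
  · intro t ht htX y
    have := T.mem_L t ht htX y
    have := T.disj v hv
    have := @hsv y
    have := @hsu y
    simp only [Function.update_apply] at *
    grind
  · intro t ht
    obtain ⟨c, hc, d, hd, hcd, hcv, hdv, hcu, hdu⟩ := h1
    obtain ⟨y, hy⟩ := T.ne c hc
    have := T.disj v hv c hc hcv.symm (hvu.trans hcu.symm)
    have := T.sub_of_par hc hu hcu hy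
    have := T.ne t ht
    by_cases htu : t = u
    · subst htu
      rw [Function.update_self]
      exact ⟨y, by grind⟩
    · rwa [Function.update_of_ne htu]
  · intro c hc d hd hcd hp y
    have := T.disj c hc d hd hcd
    have := T.disj u hu c hc
    have := T.disj u hu d hd
    have := @hsv y
    simp only [Function.update_apply] at *
    grind
  · intro c hc d hd hcd hp a ha b hb
    have := T.adj c hc d hd hcd
    have := T.adj u hu c hc
    have := T.adj u hu d hd
    have := T.adj c hc u hu
    have := T.adj d hd u hu
    have := T.mem_L u hu huX a
    have := T.mem_L u hu huX b
    have := T.adj v hv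
    have := fun c hc => T.adj c hc v hv
    have := @hsv a
    have := @hsv b
    simp only [Function.update_apply] at *
    grind
  · simp [hur.symm, T.L_root]
  · intro c hc hcX hcr hce
    have := T.alt c hc hcX hcr hce
    simp only [Function.update_apply] at *
    grind
  · intro t ht htX _
    by_cases htu : t = u
    · obtain ⟨c, hc, d, hd, hcd, hcv, hdv, hcu, hdu⟩ := h1
      exact ⟨c, hc, d, hd, hcd, by simp [hcv, hcu, htu], by simp [hdv, hdu, htu]⟩
    · by_cases htw : t = w
      · exact ⟨u, hu, v, hv, hvu'.symm, by simp [hvu'.symm, huw, htw], by simp [htw]⟩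
      · obtain ⟨c, hc, d, hd, hcd, hct, hdt⟩ := T.two t ht htX (h2 t ht htw)
        exact ⟨c, hc, d, hd, hcd, by simp only [Function.update_apply]; grind,
          by simp only [Function.update_apply]; grind⟩
  · obtain ⟨rk, hrk⟩ := T.rank
    refine ⟨rk, fun d hd hdr => ?_⟩
    have h3 := hrk d hd hdr
    have h4 := hrk u hu hur
    by_cases hdv : d = v
    · subst hdv
      rw [Function.update_self]
      rw [hvu] at h3
      rw [huw] at h4
      linarith
    · rwa [Function.update_of_ne hdv]

/-- Move a child `v` of `u` to another child `w` of `u`, which has the same type. -/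
theorem moveDown (T : Cotree A X N root par typ L e e') {u v w : ℤ} (hu : u ∈ N) (hv : v ∈ N)
    (hw : w ∈ N) (hvu : par v = u) (hwu : par w = u) (hvw : v ≠ w) (hwX : w ∉ X)
    (htyp : typ w = typ u)
    (h1 : ∃ c ∈ N, c ≠ w ∧ c ≠ v ∧ par c = u)
    (h2 : ∀ t ∈ N, t ≠ w → t ≠ e') :
    Cotree A X N root (update par v w) typ (update L w (L w ∪ L v)) e (-1) := by
  have hwr : w ≠ root := T.ne_root_of_par hu hwu
  have hvr : v ≠ root := T.ne_root_of_par hu hvu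
  have huX := T.not_leaf_of_par hv hu hvu
  have hwu' : w ≠ u := fun h => T.not_anc_of_par hu (h ▸ hwu) .refl
  have hvu' : v ≠ u := fun h => T.not_anc_of_par hu (h ▸ hvu) .refl
  have hvneg : v ≠ -1 := by rintro rfl; exact T.neg hv
  have hsv := T.sub_of_par hv hu hvu
  have hsw := T.sub_of_par hw hu hwu
  constructor
  · exact T.X_sub
  · exact T.root_mem
  · exact T.root_not
  · exact T.neg
  · simp [hvr.symm, T.par_root]
  · simp [hvneg.symm, T.par_neg]
  · intro d hd hdr
    have := T.par_mem d
    simp only [Function.update_apply] at *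
    grind
  · intro d hd
    have : d ≠ w := by rintro rfl; exact hwX hd
    simpa [this] using T.leaf d hd
  · exact T.typ_int
  · exact T.typ_root
  · intro t ht htX y
    have := T.mem_L t ht htX y
    have := @hsv y
    have := @hsw y
    simp only [Function.update_apply] at *
    grind
  · intro t ht
    have := T.ne t ht
    by_cases htw : t = w
    · subst htw
      rw [Function.update_self]
      exact this.mono Finset.subset_union_left
    · rwa [Function.update_of_ne htw]
  · intro c hc d hd hcd hp y
    have := T.disj c hc d hd hcd
    have := T.disj v hv c hc
    have := T.disj v hv d hd
    have := T.disj w hw c hc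
    have := T.disj w hw d hd
    have := T.mem_L w hw hwX y
    simp only [Function.update_apply] at *
    grind
  · intro c hc d hd hcd hp a ha b hb
    have := T.adj c hc d hd hcd
    have := T.adj v hv c hc
    have := T.adj v hv d hd
    have := T.adj c hc v hv
    have := T.adj d hd v hv
    have := T.adj v hv w hw hvw
    have := T.adj w hw v hv hvw.symm
    have := T.mem_L w hw hwX a
    have := T.mem_L w hw hwX b
    simp only [Function.update_apply] at *
    grind
  · simp [hwr.symm, T.L_root]
  · intro c hc hcX hcr hce
    have := T.alt c hc hcX hcr hce
    simp only [Function.update_apply] at *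
    grind
  · intro t ht htX _
    by_cases htu : t = u
    · obtain ⟨c, hc, hcw, hcv, hcu⟩ := h1
      exact ⟨c, hc, w, hw, hcw, by simp [hcv, hcu, htu], by simp [hvw.symm, hwu, htu]⟩
    · by_cases htw : t = w
      · obtain ⟨y, hy⟩ := T.ne w hw
        obtain ⟨c, hc, hcw, _⟩ := (T.mem_L w hw hwX y).1 hy
        have hcv : c ≠ v := by rintro rfl; exact hwu' (hcw.symm.trans hvu)
        exact ⟨c, hc, v, hv, hcv, by simp [hcv, hcw, htw], by simp [htw]⟩
      · obtain ⟨c, hc, d, hd, hcd, hct, hdt⟩ := T.two t ht htX (h2 t ht htw)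
        exact ⟨c, hc, d, hd, hcd, by simp only [Function.update_apply]; grind,
          by simp only [Function.update_apply]; grind⟩
  · obtain ⟨rk, hrk⟩ := T.rank
    refine ⟨update rk w ((max (rk v) (rk w) + rk u) / 2), fun d hd hdr => ?_⟩
    have h1 := hrk d hd hdr
    have h2 := hrk v hv hvr
    have h3 := hrk w hw hwr
    rw [hvu] at h2
    rw [hwu] at h3
    have h4 : max (rk v) (rk w) < rk u := max_lt h2 h3
    have h5 := le_max_left (rk v) (rk w)
    have h6 := le_max_right (rk v) (rk w)
    by_cases hdv : d = v
    · subst hdv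
      rw [Function.update_self, Function.update_self, Function.update_of_ne hvw]
      linarith
    · rw [Function.update_of_ne hdv]
      by_cases hdw : d = w
      · subst hdw
        rw [Function.update_self, hwu, Function.update_of_ne hwu'.symm]
        linarith
      · rw [Function.update_of_ne hdw]
        by_cases hpd : par d = w
        · rw [hpd, Function.update_self]
          rw [hpd] at h1
          linarith
        · rwa [Function.update_of_ne hpd]

open Classical in
/-- Add a new leaf `x` below `g`. -/
theorem addLeaf (T : Cotree A X N root par typ L (-1) e') (hA : IsCograph A) {x g : ℤ} (hg : g ∈ N)
    (hgX : g ∉ X) (hx : x ∉ N) (hx1 : x ≠ -1) (htx : typ x = 2)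
    (h1 : ∀ a ∈ L g, ∀ y ∈ X, y ∉ L g → (A x y ↔ A a y))
    (h2 : ∀ y ∈ L g, (A x y ↔ typ g = 1)) (h3 : ∀ t ∈ N, t ≠ g → t ≠ e') :
    ∃ L', Cotree A (insert x X) (insert x N) root (update par x g) typ L' (-1) (-1) := by
  refine ⟨fun t => if t = x then {x} else if Anc N par g t then insert x (L t) else L t, ?_⟩
  have hxr : x ≠ root := by rintro rfl; exact hx T.root_mem
  have hNx : ∀ v ∈ N, v ≠ x := by rintro v hv rfl; exact hx hv
  have hXx : ∀ v ∈ X, v ≠ x := fun v hv => hNx v (T.X_sub hv)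
  have hparx : ∀ v ∈ N, par v ≠ x := by
    intro v hv h
    by_cases hvr : v = root
    · rw [hvr, T.par_root] at h; exact hx1 h.symm
    · exact hx (h ▸ (T.par_mem v hv hvr).1)
  have hLx : ∀ v ∈ N, x ∉ L v := fun v hv h => hXx x (T.L_sub hv h) rfl
  have hanc : ∀ c ∈ N, Anc N par g c → par c ≠ g := fun c hc h h' => T.not_anc_of_par hg h' h
  have hancX : ∀ c ∈ N, Anc N par g c → c ∉ X := by
    intro c hc h
    rcases h.eq_or with rfl | ⟨d, hd, hdc, _, _⟩
    · exact hgX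
    · exact T.not_leaf_of_par hd hc hdc
  have hanc2 : ∀ c ∈ N, ∀ d ∈ N, c ≠ d → par c = par d → Anc N par g c → ¬ Anc N par g d := by
    intro c hc d hd hcd hp h h'
    obtain ⟨y, hy⟩ := T.ne g hg
    exact T.disj c hc d hd hcd hp y (T.anc_sub h hy) (T.anc_sub h' hy)
  have hancp : ∀ c ∈ N, c ≠ root → Anc N par g c → Anc N par g (par c) := fun c hc hcr h =>
    h.step hc (T.par_mem c hc hcr).1
  -- adjacency between `x` and the leaves of a sibling of an ancestor of `g`
  have hadj : ∀ c ∈ N, ∀ d ∈ N, c ≠ d → par c = par d → Anc N par g c → ∀ b ∈ L d,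
      (A x b ↔ typ (par c) = 1) := by
    intro c hc d hd hcd hp h b hb
    obtain ⟨a, ha⟩ := T.ne g hg
    have hac := T.anc_sub h ha
    have hbg : b ∉ L g := fun h' => T.disj c hc d hd hcd hp b (T.anc_sub h h') hb
    rw [h1 a ha b (T.L_sub hd hb) hbg, T.adj c hc d hd hcd hp a hac b hb]
  have hsymm : ∀ a b, A a b ↔ A b a := fun a b => ⟨hA.symm, hA.symm⟩
  have hsubg : ∀ c ∈ N, par c = g → L c ⊆ L g := fun c hc h => T.sub_of_par hc hg h
  constructor
  · exact Finset.insert_subset_insert _ T.X_sub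
  · exact Finset.mem_insert_of_mem T.root_mem
  · simp [hxr.symm, T.root_not]
  · simp [hx1.symm, T.neg]
  · simp [hxr.symm, T.par_root]
  · simp [hx1.symm, T.par_neg]
  · intro v hv hvr
    have := T.par_mem v
    simp only [Function.update_apply, Finset.mem_insert] at *
    grind
  · intro v hv
    by_cases hvx : v = x
    · simp [hvx, htx]
    · have hvX : v ∈ X := by simpa [hvx] using hv
      have : ¬ Anc N par g v := fun h => hancX v (T.X_sub hvX) h hvX
      simpa [hvx, this] using T.leaf v hvX
  · intro t ht htX
    have := T.typ_int t
    grind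
  · exact T.typ_root
  · intro t ht htX y
    have htx : t ≠ x := by rintro rfl; simp at htX
    have htN : t ∈ N := by simpa [htx] using ht
    have htX' : t ∉ X := fun h => htX (Finset.mem_insert_of_mem h)
    have hm := T.mem_L t htN htX' y
    by_cases hyx : y = x
    · subst hyx
      have e1 : (y ∈ if t = y then {y} else if Anc N par g t then insert y (L t) else L t) ↔
          Anc N par g t := by
        have := hLx t htN
        split_ifs <;> simp_all
      simp only [e1]
      constructor
      · intro h
        rcases h.eq_or with h | ⟨c, hc, hct, _, hgc⟩
        · exact ⟨y, by simp, by simp [h], by simp⟩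
        · exact ⟨c, by simp [hc], by simp [hNx c hc, hct], by simp [hNx c hc, hgc]⟩
      · rintro ⟨c, hc, hct, hcy⟩
        by_cases hcx : c = y
        · rw [hcx, Function.update_self] at hct
          exact hct ▸ .refl
        · have hcN : c ∈ N := by simpa [hcx] using hc
          rw [Function.update_of_ne hcx] at hct
          have : Anc N par g c := by
            by_contra h
            simp [hcx, h, hLx c hcN] at hcy
          exact hct ▸ this.step hcN (hct ▸ htN)
    · have e1 : ∀ t, t ≠ x → ((y ∈ if t = x then {x} else if Anc N par g t then insert x (L t)
          else L t) ↔ y ∈ L t) := by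
        intro t ht
        simp only [ht, if_false]
        split_ifs <;> simp [hyx]
      rw [e1 t htx, hm]
      constructor
      · rintro ⟨c, hc, hct, hcy⟩
        exact ⟨c, by simp [hc], by simp [hNx c hc, hct], (e1 c (hNx c hc)).2 hcy⟩
      · rintro ⟨c, hc, hct, hcy⟩
        by_cases hcx : c = x
        · simp [hcx, hyx] at hcy
        · exact ⟨c, by simpa [hcx] using hc, by simpa [hcx] using hct, (e1 c hcx).1 hcy⟩
  · intro t ht
    by_cases htx : t = x
    · simp [htx]
    · have := T.ne t (by simpa [htx] using ht)
      simp only [htx, if_false]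
      split_ifs
      · simp
      · exact this
  · intro c hc d hd hcd hp y hyc hyd
    have e1 : ∀ t a, t ≠ x → (a ∈ if t = x then {x} else if Anc N par g t then insert x (L t)
          else L t) → a ∈ L t ∨ (a = x ∧ Anc N par g t) := by
      intro t a ht ha
      split_ifs at ha <;> simp_all
      tauto
    by_cases hcx : c = x
    · subst hcx
      have hdN : d ∈ N := by simpa [hcd.symm] using hd
      rw [Function.update_self, Function.update_of_ne hcd.symm] at hp
      simp only [if_true, Finset.mem_singleton] at hyc
      subst hyc
      rcases e1 d y hcd.symm hyd with h | ⟨_, h⟩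
      · exact hLx d hdN h
      · exact hanc d hdN h hp.symm
    · have hcN : c ∈ N := by simpa [hcx] using hc
      rw [Function.update_of_ne hcx] at hp
      by_cases hdx : d = x
      · subst hdx
        rw [Function.update_self] at hp
        simp only [if_true, Finset.mem_singleton] at hyd
        subst hyd
        rcases e1 c y hcx hyc with h | ⟨_, h⟩
        · exact hLx c hcN h
        · exact hanc c hcN h hp
      · have hdN : d ∈ N := by simpa [hdx] using hd
        rw [Function.update_of_ne hdx] at hp
        rcases e1 c y hcx hyc with h | ⟨h, h'⟩
        · rcases e1 d y hdx hyd with h1 | ⟨h1, _⟩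
          · exact T.disj c hcN d hdN hcd hp y h h1
          · exact hLx c hcN (h1 ▸ h)
        · rcases e1 d y hdx hyd with h1 | ⟨_, h1⟩
          · exact hLx d hdN (h ▸ h1)
          · exact hanc2 c hcN d hdN hcd hp h' h1
  · intro c hc d hd hcd hp a ha b hb
    have e1 : ∀ t a, t ≠ x → (a ∈ if t = x then {x} else if Anc N par g t then insert x (L t)
          else L t) → a ∈ L t ∨ (a = x ∧ Anc N par g t) := by
      intro t a ht ha
      split_ifs at ha <;> simp_all
      tauto
    by_cases hcx : c = x
    · subst hcx
      have hdN : d ∈ N := by simpa [hcd.symm] using hd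
      rw [Function.update_self, Function.update_of_ne hcd.symm] at hp
      simp only [if_true, Finset.mem_singleton] at ha
      subst ha
      rw [Function.update_self]
      rcases e1 d b hcd.symm hb with h | ⟨_, h⟩
      · exact h2 b (hsubg d hdN hp.symm h)
      · exact absurd hp.symm (hanc d hdN h)
    · have hcN : c ∈ N := by simpa [hcx] using hc
      rw [Function.update_of_ne hcx] at hp ⊢
      by_cases hdx : d = x
      · subst hdx
        rw [Function.update_self] at hp
        simp only [if_true, Finset.mem_singleton] at hb
        subst hb
        rcases e1 c a hcx ha with h | ⟨_, h⟩
        · rw [hsymm, hp]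
          exact h2 a (hsubg c hcN hp h)
        · exact absurd hp (hanc c hcN h)
      · have hdN : d ∈ N := by simpa [hdx] using hd
        rw [Function.update_of_ne hdx] at hp
        rcases e1 c a hcx ha with h | ⟨rfl, h⟩
        · rcases e1 d b hdx hb with h' | ⟨rfl, h'⟩
          · exact T.adj c hcN d hdN hcd hp a h b h'
          · rw [hsymm, hp]
            exact hadj d hdN c hcN hcd.symm hp.symm h' a h
        · rcases e1 d b hdx hb with h' | ⟨rfl, h'⟩
          · exact hadj c hcN d hdN hcd hp h b h'
          · exact absurd h' (hanc2 c hcN d hdN hcd hp h)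
  · have := T.anc_root hg
    simp [hxr.symm, this, T.L_root]
  · intro c hc hcX hcr hce
    have hcx : c ≠ x := by rintro rfl; simp at hcX
    rw [Function.update_of_ne hcx]
    exact T.alt c (by simpa [hcx] using hc) (fun h => hcX (Finset.mem_insert_of_mem h)) hcr hce
  · intro t ht htX _
    have htx : t ≠ x := by rintro rfl; simp at htX
    have htN : t ∈ N := by simpa [htx] using ht
    have htX' : t ∉ X := fun h => htX (Finset.mem_insert_of_mem h)
    by_cases htg : t = g
    · obtain ⟨y, hy⟩ := T.ne g hg
      obtain ⟨c, hc, hcg, _⟩ := (T.mem_L g hg hgX y).1 hy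
      exact ⟨c, by simp [hc], x, by simp, hNx c hc, by simp [hNx c hc, hcg, htg], by simp [htg]⟩
    · obtain ⟨c, hc, d, hd, hcd, hct, hdt⟩ := T.two t htN htX' (h3 t htN htg)
      exact ⟨c, by simp [hc], d, by simp [hd], hcd, by simp [hNx c hc, hct],
        by simp [hNx d hd, hdt]⟩
  · obtain ⟨rk, hrk⟩ := T.rank
    refine ⟨update rk x (rk g - 1), fun v hv hvr => ?_⟩
    by_cases hvx : v = x
    · subst hvx
      rw [Function.update_self, Function.update_self, Function.update_of_ne (hNx g hg)]
      linarith
    · have hvN : v ∈ N := by simpa [hvx] using hv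
      rw [Function.update_of_ne hvx, Function.update_of_ne hvx,
        Function.update_of_ne (hparx v hvN)]
      exact hrk v hvN hvr

end Cotree

open Function (update update_self update_of_ne)

/-! ## Queues -/

/-- The first `k` cells of `q` enumerate the set `S`. -/
structure IsEnum (q : ℤ → ℤ) (k : ℤ) (S : Finset ℤ) : Prop where
  nonneg : 0 ≤ k
  mem : ∀ i, 0 ≤ i → i < k → q i ∈ S
  surj : ∀ s ∈ S, ∃ i, 0 ≤ i ∧ i < k ∧ q i = s
  inj : ∀ i j, 0 ≤ i → i < j → j < k → q i ≠ q j

namespace IsEnum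

variable {q q' : ℤ → ℤ} {k h : ℤ} {S P : Finset ℤ}

theorem zero (q : ℤ → ℤ) : IsEnum q 0 ∅ :=
  ⟨le_rfl, fun _ _ _ => by omega, by simp, fun _ _ _ _ _ => by omega⟩

theorem succ (hS : IsEnum q k S) (h : q k ∉ S) : IsEnum q (k + 1) (insert (q k) S) := by
  refine ⟨by have := hS.nonneg; omega, fun i h0 h1 => ?_, fun s hs => ?_, fun i j h0 h1 h2 => ?_⟩
  · by_cases hik : i = k
    · simp [hik]
    · exact Finset.mem_insert_of_mem (hS.mem i h0 (by omega))
  · rcases Finset.mem_insert.1 hs with rfl | hs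
    · exact ⟨k, hS.nonneg, by omega, rfl⟩
    · obtain ⟨i, h0, h1, h2⟩ := hS.surj s hs
      exact ⟨i, h0, by omega, h2⟩
  · by_cases hjk : j = k
    · subst hjk
      intro h'
      exact h (h' ▸ hS.mem i h0 h1)
    · exact hS.inj i j h0 h1 (by omega)

theorem congr (hS : IsEnum q k S) (h : ∀ i, 0 ≤ i → i < k → q' i = q i) : IsEnum q' k S := by
  refine ⟨hS.nonneg, fun i h0 h1 => ?_, fun s hs => ?_, fun i j h0 h1 h2 => ?_⟩
  · rw [h i h0 h1]; exact hS.mem i h0 h1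
  · obtain ⟨i, h0, h1, h2⟩ := hS.surj s hs
    exact ⟨i, h0, h1, by rw [h i h0 h1, h2]⟩
  · rw [h i h0 (by omega), h j (by omega) h2]; exact hS.inj i j h0 h1 h2

theorem push (hS : IsEnum q k S) {s : ℤ} (h : s ∉ S) :
    IsEnum (update q k s) (k + 1) (insert s S) := by
  have h1 : IsEnum (update q k s) k S := hS.congr fun i _ h1 => Function.update_of_ne (by omega) _ _
  simpa using h1.succ (by simpa using h)

theorem card (hS : IsEnum q k S) : (S.card : ℤ) = k := by
  have : S = (Finset.Ico 0 k).image q := by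
    ext s
    simp only [Finset.mem_image, Finset.mem_Ico]
    constructor
    · intro h
      obtain ⟨i, h0, h1, h2⟩ := hS.surj s h
      exact ⟨i, ⟨h0, h1⟩, h2⟩
    · rintro ⟨i, ⟨h0, h1⟩, rfl⟩
      exact hS.mem i h0 h1
  rw [this, Finset.card_image_of_injOn]
  · have := hS.nonneg
    simp [this]
  · intro i hi j hj hij
    simp only [Finset.coe_Ico, Set.mem_Ico] at hi hj
    rcases lt_trichotomy i j with h | h | h
    · exact absurd hij (hS.inj i j hi.1 h hj.2)
    · exact h
    · exact absurd hij.symm (hS.inj j i hj.1 h hi.2)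

theorem notMem_of_prefix (hS : IsEnum q k S) (hP : IsEnum q h P) (hk : h < k) : q h ∉ P := by
  intro hm
  obtain ⟨i, h0, h1, h2⟩ := hP.surj _ hm
  exact hS.inj i h h0 h1 hk h2

theorem eq_of_eq (hS : IsEnum q k S) (hP : IsEnum q k P) : P = S := by
  ext s
  constructor
  · intro hs
    obtain ⟨i, h0, h1, rfl⟩ := hP.surj s hs
    exact hS.mem i h0 h1
  · intro hs
    obtain ⟨i, h0, h1, rfl⟩ := hS.surj s hs
    exact hP.mem i h0 h1

end IsEnum

theorem card_le_of_bound {S : Finset ℤ} {M : ℤ} (hM : 0 ≤ M) (h : ∀ t ∈ S, 0 ≤ t ∧ t < M) :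
    (S.card : ℤ) ≤ M := by
  have : S ⊆ Finset.Ico 0 M := fun t ht => by simpa using h t ht
  have := Finset.card_le_card this
  simp at this
  omega

theorem sum_le_of_bound {S : Finset ℤ} {M : ℤ} (hM : 0 ≤ M) (h : ∀ t ∈ S, 0 ≤ t ∧ t < M) :
    0 ≤ ∑ t ∈ S, t ∧ ∑ t ∈ S, t ≤ M * M := by
  refine ⟨Finset.sum_nonneg fun t ht => (h t ht).1, ?_⟩
  have h1 := Finset.sum_le_card_nsmul S (fun t => t) M fun t ht => (h t ht).2.le
  have h2 := card_le_of_bound hM h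
  rw [nsmul_eq_mul] at h1
  exact h1.trans (mul_le_mul_of_nonneg_right h2 hM)

/-! ## The sweep: nodes all of whose leaves lie in a given set -/

section Sweep

variable {A : ℤ → ℤ → Prop} {X N S₀ : Finset ℤ} {root : ℤ} {par typ cnt sum : ℤ → ℤ}
  {L : ℤ → Finset ℤ}

/-- The nodes all of whose leaves lie in `S₀`. -/
def fullNodes (N : Finset ℤ) (L : ℤ → Finset ℤ) (S₀ : Finset ℤ) : Finset ℤ :=
  N.filter (fun t => L t ⊆ S₀)

@[simp] theorem mem_fullNodes {t : ℤ} : t ∈ fullNodes N L S₀ ↔ t ∈ N ∧ L t ⊆ S₀ :=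
  Finset.mem_filter

theorem two_le_chs (T : Cotree A X N root par typ L (-1) (-1)) {t : ℤ} (ht : t ∈ N) (htX : t ∉ X) :
    2 ≤ (chs N par t).card := by
  obtain ⟨c, hc, d, hd, hcd, h1, h2⟩ := T.two t ht htX (fun h => T.neg (h ▸ ht))
  exact Finset.one_lt_card.2 ⟨c, by simp [hc, h1], d, by simp [hd, h2], hcd⟩

theorem card_fullNodes_le (T : Cotree A X N root par typ L (-1) (-1)) :
    (fullNodes N L S₀).card ≤ 2 * S₀.card := by
  set F := fullNodes N L S₀ with hF
  have h1 : F.filter (· ∈ X) ⊆ S₀ := by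
    intro t ht
    simp only [hF, Finset.mem_filter, mem_fullNodes] at ht
    have := (T.leaf t ht.2).1
    exact ht.1.2 (by simp [this])
  have h2 : ∑ t ∈ F.filter (· ∉ X), (chs N par t).card ≤ F.card := by
    rw [← Finset.card_biUnion]
    · refine Finset.card_le_card fun c hc => ?_
      simp only [hF, Finset.mem_biUnion, Finset.mem_filter, mem_fullNodes, mem_chs] at hc ⊢
      obtain ⟨t, ⟨⟨ht, hts⟩, _⟩, hc, hct⟩ := hc
      exact ⟨hc, (T.sub_of_par hc ht hct).trans hts⟩
    · intro s _ t _ hst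
      refine Finset.disjoint_left.2 fun c hc hd => hst ?_
      simp only [mem_chs] at hc hd
      exact hc.2.symm.trans hd.2
  have h3 : (F.filter (· ∉ X)).card * 2 ≤ ∑ t ∈ F.filter (· ∉ X), (chs N par t).card := by
    rw [← smul_eq_mul]
    refine Finset.card_nsmul_le_sum _ _ _ fun t ht => ?_
    simp only [hF, Finset.mem_filter, mem_fullNodes] at ht
    exact two_le_chs T ht.1.1 ht.2
  have h4 := Finset.card_filter_add_card_filter_not (s := F) (· ∈ X)
  have h5 := Finset.card_le_card h1
  omega

/-- The state of the sweep: the nodes `q 0, …, q (k - 1)` have been found and the first `h` of them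
have been counted at their parents. -/
structure SweepInv (X N S₀ : Finset ℤ) (par cnt : ℤ → ℤ) (L : ℤ → Finset ℤ) (q : ℤ → ℤ) (h k : ℤ)
    (fc fs : ℤ → ℤ) (P S : Finset ℤ) : Prop where
  hk : h ≤ k
  enumP : IsEnum q h P
  enumS : IsEnum q k S
  sub : S ⊆ fullNodes N L S₀
  base : S₀ ⊆ S
  count : ∀ t, t ≠ -1 → fc t = (chs P par t).card ∧ fs t = ∑ c ∈ chs P par t, c
  neg : fc (-1) = 0 ∧ fs (-1) = 0
  inner : ∀ t ∈ N, t ∉ X → (t ∈ S ↔ fc t = cnt t)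
  order : ∀ i, 0 ≤ i → i < k → q i ∉ X → ∀ c ∈ chs N par (q i), ∃ j, 0 ≤ j ∧ j < i ∧ q j = c

namespace SweepInv

variable {q fc fs : ℤ → ℤ} {h k : ℤ} {P S : Finset ℤ}

theorem init (T : Cotree A X N root par typ L (-1) (-1)) (C : Counts X N par cnt sum)
    (hq : IsEnum q k S₀) (hS : S₀ ⊆ X) (hfc : ∀ t, fc t = 0) (hfs : ∀ t, fs t = 0) :
    SweepInv X N S₀ par cnt L q 0 k fc fs ∅ S₀ where
  hk := hq.nonneg
  enumP := .zero q
  enumS := hq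
  sub := fun t ht => by
    rw [mem_fullNodes, (T.leaf t (hS ht)).1]
    exact ⟨T.X_sub (hS ht), by simpa using ht⟩
  base := subset_rfl
  count := fun t _ => by simp [chs, hfc, hfs]
  neg := ⟨hfc _, hfs _⟩
  inner := fun t ht htX => by
    have h1 := two_le_chs T ht htX
    rw [(C t ht htX).1, hfc]
    constructor
    · exact fun h => absurd (hS h) htX
    · intro h; omega
  order := fun i h0 h1 h2 => absurd (hS (hq.mem i h0 h1)) h2

theorem P_sub (I : SweepInv X N S₀ par cnt L q h k fc fs P S) : P ⊆ S := by
  intro s hs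
  obtain ⟨i, h0, h1, rfl⟩ := I.enumP.surj s hs
  exact I.enumS.mem i h0 (by have := I.hk; omega)

theorem S_sub (I : SweepInv X N S₀ par cnt L q h k fc fs P S) : S ⊆ N :=
  I.sub.trans (Finset.filter_subset _ _)

theorem step_root (T : Cotree A X N root par typ L (-1) (-1))
    (I : SweepInv X N S₀ par cnt L q h k fc fs P S) (hh : h < k) (hv : q h = root) :
    SweepInv X N S₀ par cnt L q (h + 1) k fc fs (insert (q h) P) S := by
  refine ⟨by omega, I.enumP.succ (I.enumS.notMem_of_prefix I.enumP hh), I.enumS, I.sub, I.base,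
    fun t ht => ?_, I.neg, I.inner, I.order⟩
  have : chs (insert (q h) P) par t = chs P par t := by
    ext c
    simp only [mem_chs, Finset.mem_insert]
    constructor
    · rintro ⟨rfl | hc, h⟩
      · rw [hv, T.par_root] at h
        exact absurd h.symm ht
      · exact ⟨hc, h⟩
    · exact fun h => ⟨.inr h.1, h.2⟩
  rw [this]
  exact I.count t ht

theorem chs_insert {v t : ℤ} : chs (insert v P) par t =
    if t = par v then insert v (chs P par t) else chs P par t := by
  ext c
  split_ifs with ht <;> simp only [mem_chs, Finset.mem_insert] <;> grind

/-- One step of the sweep, except that the parent has not yet been added to the queue. -/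
theorem step_aux (T : Cotree A X N root par typ L (-1) (-1)) (C : Counts X N par cnt sum)
    (I : SweepInv X N S₀ par cnt L q h k fc fs P S) (hh : h < k) {f : ℤ} (hv : q h ≠ root)
    (hf : par (q h) = f) :
    f ∈ N ∧ f ∉ X ∧ f ∉ S ∧ fc f + 1 = (chs (insert (q h) P) par f).card ∧
      fs f + q h = ∑ c ∈ chs (insert (q h) P) par f, c ∧
      (fc f + 1 = cnt f → chs N par f ⊆ insert (q h) P) := by
  have hvS := I.enumS.mem h I.enumP.nonneg hh
  have hvN := I.S_sub hvS
  have hvP := I.enumS.notMem_of_prefix I.enumP hh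
  have hfN := T.par_mem _ hvN hv
  rw [hf] at hfN
  have hf1 : f ≠ -1 := fun h => T.neg (h ▸ hfN.1)
  have hvc : q h ∉ chs P par f := by simp [hvP]
  have e1 := I.count f hf1
  have e2 : chs (insert (q h) P) par f = insert (q h) (chs P par f) := by
    rw [chs_insert, if_pos hf.symm]
  have hPN : insert (q h) P ⊆ N := Finset.insert_subset hvN (I.P_sub.trans I.S_sub)
  have hsub : chs (insert (q h) P) par f ⊆ chs N par f := Finset.filter_subset_filter _ hPN
  have hcard : fc f + 1 = (chs (insert (q h) P) par f).card := by
    rw [e2, Finset.card_insert_of_notMem hvc, e1.1]; push_cast; rfl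
  have hle := Finset.card_le_card hsub
  refine ⟨hfN.1, hfN.2, fun hfS => ?_, hcard, ?_, fun hc => ?_⟩
  · have := (I.inner f hfN.1 hfN.2).1 hfS
    rw [(C f hfN.1 hfN.2).1] at this
    omega
  · rw [e2, Finset.sum_insert hvc, e1.2]; ring
  · rw [(C f hfN.1 hfN.2).1, hcard] at hc
    have := Finset.eq_of_subset_of_card_le hsub (by omega)
    rw [← this]
    exact Finset.filter_subset _ _

theorem step_push (T : Cotree A X N root par typ L (-1) (-1)) (C : Counts X N par cnt sum)
    (I : SweepInv X N S₀ par cnt L q h k fc fs P S) (hh : h < k) {f : ℤ} (hv : q h ≠ root)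
    (hf : par (q h) = f) (hc : fc f + 1 = cnt f) :
    SweepInv X N S₀ par cnt L (update q k f) (h + 1) (k + 1) (update fc f (fc f + 1))
      (update fs f (fs f + q h)) (insert (q h) P) (insert f S) := by
  obtain ⟨hfN, hfX, hfS, h1, h2, h3⟩ := I.step_aux T C hh hv hf
  have hf1 : f ≠ -1 := fun h => T.neg (h ▸ hfN)
  have hsub := h3 hc
  have hPS : insert (q h) P ⊆ S :=
    Finset.insert_subset (I.enumS.mem h I.enumP.nonneg hh) I.P_sub
  refine ⟨by omega, ?_, I.enumS.push hfS, ?_, I.base.trans (Finset.subset_insert _ _), ?_, ?_, ?_,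
    ?_⟩
  · exact (I.enumP.succ (I.enumS.notMem_of_prefix I.enumP hh)).congr fun i _ hi =>
      Function.update_of_ne (by omega) _ _
  · refine Finset.insert_subset ?_ I.sub
    rw [mem_fullNodes]
    refine ⟨hfN, fun y hy => ?_⟩
    obtain ⟨c, hc, hcf, hy⟩ := (T.mem_L f hfN hfX y).1 hy
    have := I.sub (hPS (hsub (by simp [hc, hcf] : c ∈ chs N par f)))
    exact (mem_fullNodes.1 this).2 hy
  · intro t ht
    by_cases htf : t = f
    · subst htf; simp only [Function.update_self]; exact ⟨h1, h2⟩
    · rw [Function.update_of_ne htf, Function.update_of_ne htf, chs_insert, if_neg (hf ▸ htf)]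
      exact I.count t ht
  · rw [Function.update_of_ne hf1.symm, Function.update_of_ne hf1.symm]; exact I.neg
  · intro t ht htX
    by_cases htf : t = f
    · subst htf; simp [hc]
    · rw [Function.update_of_ne htf, Finset.mem_insert, ← I.inner t ht htX]
      simp [htf]
  · intro i h0 hi hiX c hc
    by_cases hik : i = k
    · subst hik
      rw [Function.update_self] at hc
      have := hPS (hsub hc)
      obtain ⟨j, hj0, hj1, hj⟩ := I.enumS.surj c this
      exact ⟨j, hj0, hj1, by rw [Function.update_of_ne (by omega), hj]⟩
    · rw [Function.update_of_ne hik] at hc hiX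
      obtain ⟨j, hj0, hj1, hj⟩ := I.order i h0 (by omega) hiX c hc
      exact ⟨j, hj0, hj1, by rw [Function.update_of_ne (by omega), hj]⟩

theorem step_skip (T : Cotree A X N root par typ L (-1) (-1)) (C : Counts X N par cnt sum)
    (I : SweepInv X N S₀ par cnt L q h k fc fs P S) (hh : h < k) {f : ℤ} (hv : q h ≠ root)
    (hf : par (q h) = f) (hc : fc f + 1 ≠ cnt f) :
    SweepInv X N S₀ par cnt L q (h + 1) k (update fc f (fc f + 1))
      (update fs f (fs f + q h)) (insert (q h) P) S := by
  obtain ⟨hfN, hfX, hfS, h1, h2, h3⟩ := I.step_aux T C hh hv hf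
  have hf1 : f ≠ -1 := fun h => T.neg (h ▸ hfN)
  refine ⟨by omega, I.enumP.succ (I.enumS.notMem_of_prefix I.enumP hh), I.enumS, I.sub, I.base,
    ?_, ?_, ?_, I.order⟩
  · intro t ht
    by_cases htf : t = f
    · subst htf; simp only [Function.update_self]; exact ⟨h1, h2⟩
    · rw [Function.update_of_ne htf, Function.update_of_ne htf, chs_insert, if_neg (hf ▸ htf)]
      exact I.count t ht
  · rw [Function.update_of_ne hf1.symm, Function.update_of_ne hf1.symm]; exact I.neg
  · intro t ht htX
    by_cases htf : t = f
    · subst htf; simp [hc, hfS]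
    · rw [Function.update_of_ne htf, ← I.inner t ht htX]

/-- When the queue is exhausted, all full nodes have been found. -/
theorem done (T : Cotree A X N root par typ L (-1) (-1)) (C : Counts X N par cnt sum)
    (I : SweepInv X N S₀ par cnt L q k k fc fs P S) : P = fullNodes N L S₀ ∧ S = P := by
  have hPS : P = S := I.enumS.eq_of_eq I.enumP
  refine ⟨?_, hPS.symm⟩
  rw [hPS]
  refine subset_antisymm I.sub fun t ht => ?_
  rw [mem_fullNodes] at ht
  refine (T.induct (fun t => L t ⊆ S₀ → t ∈ S) (fun t ht ih hts => ?_)) t ht.1 ht.2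
  by_cases htX : t ∈ X
  · rw [(T.leaf t htX).1] at hts
    exact I.base (hts (by simp))
  · rw [I.inner t ht htX, (C t ht htX).1, (I.count t (fun h => T.neg (h ▸ ht))).1]
    congr 2
    ext c
    simp only [mem_chs]
    constructor
    · exact fun h => ⟨I.S_sub (hPS ▸ h.1), h.2⟩
    · exact fun h => ⟨hPS ▸ ih c h.1 h.2 ((T.sub_of_par h.1 ht h.2).trans hts), h.2⟩

end SweepInv

/-- The body of the sweep. -/
def sweepBody : Prog :=
  6 ≔ 10⟪ℛ 4⟫ ;;
  .ite (ℛ 6 =ₑ (ℛ 0 +ₑ 𝒞 2)) .skip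
    (7 ≔ 4⟪ℛ 6⟫ ;;
     .write 8 (ℛ 7) (8⟪ℛ 7⟫ +ₑ 𝒞 1) ;;
     .write 9 (ℛ 7) (9⟪ℛ 7⟫ +ₑ ℛ 6) ;;
     .ite (8⟪ℛ 7⟫ =ₑ 5⟪ℛ 7⟫) (.write 10 (ℛ 5) (ℛ 7) ;; 5 ≔ ℛ 5 +ₑ 𝒞 1) .skip) ;;
  4 ≔ ℛ 4 +ₑ 𝒞 1

/-- Starting with a queue of leaves, find all nodes all of whose leaves are in the queue. -/
def sweep : Prog := 4 ≔ 𝒞 0 ;; .loop ((ℛ 4 +ₑ 𝒞 1) ≤ₑ ℛ 5) sweepBody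

theorem sweep_runs {B : ℕ} {σ : State} {M : ℤ}
    (T : Cotree A X N root (σ.mem 4) typ L (-1) (-1))
    (C : Counts X N (σ.mem 4) (σ.mem 5) sum) (hroot : σ.reg 0 + 2 = root)
    (hM : ∀ t ∈ N, 0 ≤ t ∧ t < M) (hB : M * M + M + 5 ≤ B)
    (hq : IsEnum (σ.mem 10) (σ.reg 5) S₀) (hS : S₀ ⊆ X)
    (hfc : ∀ t, σ.mem 8 t = 0) (hfs : ∀ t, σ.mem 9 t = 0) :
    Runs B sweep σ (100 * S₀.card + 100) (fun σ' =>
      SweepInv X N S₀ (σ.mem 4) (σ.mem 5) L (σ'.mem 10) (σ'.reg 5) (σ'.reg 5) (σ'.mem 8) (σ'.mem 9)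
        (fullNodes N L S₀) (fullNodes N L S₀)) := by
  have hM0 : 0 ≤ M := by have := hM root T.root_mem; omega
  have hMM : 0 ≤ M * M := mul_nonneg hM0 hM0
  refine ((Runs.of_wp (Q := fun σ' => σ' = σ.setReg 4 0) ?_).seq (T₂ := 100 * S₀.card + 50)
    ?_).mono (by simp only [Prog.maxcost, Exp.cost]; omega) (fun _ h => h)
  · simp [wp, Exp.eval]
  rintro σ₁ rfl
  have hcard := card_fullNodes_le (S₀ := S₀) T
  refine (Runs.loop 43
    (fun σ' => ∃ P S, SweepInv X N S₀ (σ.mem 4) (σ.mem 5) L (σ'.mem 10) (σ'.reg 4) (σ'.reg 5)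
      (σ'.mem 8) (σ'.mem 9) P S)
    (fun σ' => (2 * S₀.card - σ'.reg 4).toNat) ?_ ?_).mono ?_ ?_
  · exact ⟨∅, S₀, by simpa [State.setReg] using SweepInv.init T C hq hS hfc hfs⟩
  · rintro σ₂ hag ⟨P, S, I⟩ hg
    have hh : σ₂.reg 4 < σ₂.reg 5 := by
      simp only [Guard.Holds, Exp.eval] at hg; omega
    have h4 : σ₂.mem 4 = σ.mem 4 := hag.2 4 rfl
    have h5 : σ₂.mem 5 = σ.mem 5 := hag.2 5 rfl
    have h0 : σ₂.reg 0 = σ.reg 0 := hag.1 0 rfl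
    have hcS := I.enumS.card
    have hcS' := Finset.card_le_card I.sub
    have hSM := card_le_of_bound hM0 (fun t ht => hM t (I.S_sub ht))
    have hh0 := I.enumP.nonneg
    have hvS := I.enumS.mem _ hh0 hh
    have hvN := I.S_sub hvS
    have hvM := hM _ hvN
    refine Runs.of_wp_le ?_ (by decide)
    simp only [sweepBody, wp, Exp.eval, Guard.Holds, State.setReg, State.setMem, update_self, update_of_ne, ne_eq,
      Nat.reduceEqDiff, not_false_eq_true, abs_le, h4, h5, h0, hroot]
    refine ⟨by omega, fun hv => ?_, fun hv => ?_⟩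
    · refine ⟨by omega, ⟨_, _, I.step_root T hh hv⟩, by omega⟩
    · obtain ⟨hfN, hfX, hfS, h1, h2, h3⟩ := I.step_aux T C hh hv rfl
      have hfM := hM _ hfN
      have hPN : ∀ t ∈ chs (insert (σ₂.mem 10 (σ₂.reg 4)) P) (σ.mem 4)
          (σ.mem 4 (σ₂.mem 10 (σ₂.reg 4))), 0 ≤ t ∧ t < M := by
        intro t ht
        refine hM t ?_
        rcases Finset.mem_insert.1 (mem_chs.1 ht).1 with h | h
        · exact h ▸ hvN
        · exact I.S_sub (I.P_sub h)
      have hb1 := card_le_of_bound hM0 hPN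
      have hb2 := sum_le_of_bound hM0 hPN
      rw [← h1] at hb1
      rw [← h2] at hb2
      have hfc0 : 0 ≤ σ₂.mem 8 (σ.mem 4 (σ₂.mem 10 (σ₂.reg 4))) + 1 := by rw [h1]; positivity
      refine ⟨by omega, by omega, by omega, by omega, by omega, fun hc => ?_, fun hc => ?_⟩
      · exact ⟨by omega, by omega, by omega, by omega, ⟨_, _, I.step_push T C hh hv rfl hc⟩,
          by omega⟩
      · exact ⟨by omega, ⟨_, _, I.step_skip T C hh hv rfl hc⟩, by omega⟩
  · simp only [State.setReg, Exp.cost, Guard.cost, Function.update_self]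
    omega
  · rintro σ' ⟨⟨P, S, I⟩, hg, -⟩
    have : σ'.reg 4 = σ'.reg 5 := by
      have := I.hk
      simp only [Guard.Holds, Exp.eval] at hg; omega
    rw [this] at I
    obtain ⟨h1, h2⟩ := I.done T C
    subst h2
    rw [h1] at I
    exact I

end Sweep

open Function (update update_self update_of_ne)

/-- The state stores a cotree: parents, numbers of children, sums of children and types in the
arrays 4 to 7, and the first unused node in register 2. -/
structure Stores (A : ℤ → ℤ → Prop) (X N : Finset ℤ) (root : ℤ) (σ : State) (L : ℤ → Finset ℤ)
    (e e' : ℤ) : Prop where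
  tree : Cotree A X N root (σ.mem 4) (σ.mem 7) L e e'
  counts : Counts X N (σ.mem 4) (σ.mem 5) (σ.mem 6)
  bd : ∀ t ∈ N, 0 ≤ t ∧ t < σ.reg 2
  root_nonneg : 0 ≤ root
  lf : ∀ v, 0 ≤ v → v < root → σ.mem 7 v = 2
  inner : ∀ t ∈ N, t ∉ X → root ≤ t

theorem Stores.of_eq {A : ℤ → ℤ → Prop} {X N : Finset ℤ} {root : ℤ} {σ σ' : State}
    {L : ℤ → Finset ℤ} {e e' : ℤ} (T : Stores A X N root σ L e e') (h4 : σ'.mem 4 = σ.mem 4)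
    (h5 : σ'.mem 5 = σ.mem 5) (h6 : σ'.mem 6 = σ.mem 6) (h7 : σ'.mem 7 = σ.mem 7)
    (h2 : σ'.reg 2 = σ.reg 2) : Stores A X N root σ' L e e' := by
  obtain ⟨t1, t2, t3, t4, t5, t6⟩ := T
  exact ⟨by rwa [h4, h7], by rwa [h4, h5, h6], by rwa [h2], t4, by rwa [h7], t6⟩

/-- Insert a new node (returned in register 13) of the type in register 16 between the node in
register 12 and its parent. -/
def insertAboveP : Prog :=
  13 ≔ ℛ 2 ;; 2 ≔ ℛ 2 +ₑ 𝒞 1 ;; 18 ≔ 4⟪ℛ 12⟫ ;; .write 4 (ℛ 13) (ℛ 18) ;; .write 5 (ℛ 13) (𝒞 1) ;;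
  .write 6 (ℛ 13) (ℛ 12) ;; .write 7 (ℛ 13) (ℛ 16) ;;
  .write 6 (ℛ 18) (6⟪ℛ 18⟫ +ₑ ℛ 13 -ₑ ℛ 12) ;; .write 4 (ℛ 12) (ℛ 13)

/-- Move the node in register 6 from the node in register 8 to the node in register 13. -/
def moveP : Prog :=
  .write 4 (ℛ 6) (ℛ 13) ;; .write 5 (ℛ 13) (5⟪ℛ 13⟫ +ₑ 𝒞 1) ;; .write 5 (ℛ 8) (5⟪ℛ 8⟫ -ₑ 𝒞 1) ;;
  .write 6 (ℛ 13) (6⟪ℛ 13⟫ +ₑ ℛ 6) ;; .write 6 (ℛ 8) (6⟪ℛ 8⟫ -ₑ ℛ 6)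

/-- Add the leaf in register 3 below the node in register 12. -/
def addLeafP : Prog :=
  .write 4 (ℛ 3) (ℛ 12) ;; .write 5 (ℛ 12) (5⟪ℛ 12⟫ +ₑ 𝒞 1) ;; .write 6 (ℛ 12) (6⟪ℛ 12⟫ +ₑ ℛ 3)

section

variable {A : ℤ → ℤ → Prop} {X N : Finset ℤ} {root : ℤ} {L : ℤ → Finset ℤ} {e e' : ℤ} {B : ℕ}
  {σ : State} {M : ℤ}

theorem chs_bound {X N : Finset ℤ} {par cnt sum : ℤ → ℤ} {M t : ℤ} (C : Counts X N par cnt sum)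
    (hM0 : 0 ≤ M) (hM : ∀ t ∈ N, 0 ≤ t ∧ t < M) (ht : t ∈ N) (htX : t ∉ X) :
    (0 ≤ cnt t ∧ cnt t ≤ M) ∧ 0 ≤ sum t ∧ sum t ≤ M * M := by
  rw [(C t ht htX).1, (C t ht htX).2]
  have h : ∀ c ∈ chs N par t, 0 ≤ c ∧ c < M := fun c hc => hM c (mem_chs.1 hc).1
  exact ⟨⟨by positivity, card_le_of_bound hM0 h⟩, sum_le_of_bound hM0 h⟩

theorem insertAbove_runs (T : Stores A X N root σ L e (-1)) {c ty e₂ : ℤ} (hrc : σ.reg 12 = c)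
    (hrt : σ.reg 16 = ty) (hc : c ∈ N) (hcr : c ≠ root) (hty : ty = 0 ∨ ty = 1)
    (h1 : σ.reg 2 ≠ e₂ → ty ≠ σ.mem 7 (σ.mem 4 c)) (h2 : c ∉ X → c ≠ e₂ → σ.mem 7 c ≠ ty)
    (h3 : ∀ v ∈ N, v ≠ e₂ → v ≠ c → v ≠ e) (hM : σ.reg 2 + 1 ≤ M) (hB : M * M + M + 5 ≤ B) :
    Runs B insertAboveP σ 50 (fun σ' =>
      (σ'.reg 13 = σ.reg 2 ∧ σ'.reg 2 = σ.reg 2 + 1 ∧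
      Stores A X (insert (σ.reg 2) N) root σ' (update L (σ.reg 2) (L c)) e₂ (σ.reg 2) ∧
      σ'.mem 4 = update (update (σ.mem 4) (σ.reg 2) (σ.mem 4 c)) c (σ.reg 2) ∧
      σ'.mem 7 = update (σ.mem 7) (σ.reg 2) ty) ∧ Agree insertAboveP σ σ') := by
  refine Runs.agree (Runs.of_wp_le ?_ (by decide))
  have hz : σ.reg 2 ∉ N := fun h => by have := (T.bd _ h).2; omega
  have hroot := T.bd root T.tree.root_mem
  have hz1 : σ.reg 2 ≠ -1 := by omega
  have hM0 : 0 ≤ M := by omega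
  have hMM : 0 ≤ M * M := mul_nonneg hM0 hM0
  have hp := T.tree.par_mem c hc hcr
  have hpz : σ.mem 4 c ≠ σ.reg 2 := fun h => hz (h ▸ hp.1)
  have hparz : ∀ v ∈ N, σ.mem 4 v ≠ σ.reg 2 := by
    intro v hv h
    by_cases hvr : v = root
    · rw [hvr, T.tree.par_root] at h; exact hz1 h.symm
    · exact hz (h ▸ (T.tree.par_mem v hv hvr).1)
  have T' := T.tree.insertAbove hc hcr hz hz1 hty h1 h2 h3
  have C' := T.counts.insertAbove hc hz hp.1 hparz
  have hbd : ∀ t ∈ insert (σ.reg 2) N, 0 ≤ t ∧ t < M := by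
    intro t ht
    rcases Finset.mem_insert.1 ht with rfl | ht
    · omega
    · have := T.bd t ht; omega
  have hpb := hbd _ (Finset.mem_insert_of_mem hp.1)
  have hcb := hbd _ (Finset.mem_insert_of_mem hc)
  have hsb := (chs_bound C' hM0 hbd (Finset.mem_insert_of_mem hp.1) hp.2).2
  rw [Function.update_self] at hsb
  simp only [insertAboveP, wp, Exp.eval, Guard.Holds, State.setReg, State.setMem, update_self, update_of_ne, ne_eq,
      Nat.reduceEqDiff, not_false_eq_true, abs_le, hrc, hrt, hpz]
  refine ⟨by omega, by omega, by omega, by omega, by omega, by omega, by omega, by omega, by omega,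
    by omega, by omega, by omega, by omega, by omega, by omega, trivial, trivial, ?_, trivial, trivial⟩
  refine ⟨T', C', fun t ht => ?_, T.root_nonneg, fun v hv hvr => ?_, fun t ht htX => ?_⟩
  · have := hbd t ht
    simp only [Function.update_self, Function.update_of_ne, ne_eq, Nat.reduceEqDiff,
      not_false_eq_true]
    rcases Finset.mem_insert.1 ht with rfl | ht
    · omega
    · have := T.bd t ht; omega
  · simp only [Function.update_self, Function.update_of_ne, ne_eq, Nat.reduceEqDiff,
      not_false_eq_true]
    rw [Function.update_of_ne (by omega)]
    exact T.lf v hv hvr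
  · rcases Finset.mem_insert.1 ht with rfl | ht
    · omega
    · exact T.inner t ht htX

theorem move_runs (T : Stores A X N root σ L e e') {u v w : ℤ} {L' : ℤ → Finset ℤ}
    (hu : σ.reg 8 = u) (hv : σ.reg 6 = v) (hw : σ.reg 13 = w) (huN : u ∈ N) (huX : u ∉ X)
    (hvN : v ∈ N) (hwN : w ∈ N) (hwX : w ∉ X) (hvu : σ.mem 4 v = u) (huw : u ≠ w)
    (T' : Cotree A X N root (update (σ.mem 4) v w) (σ.mem 7) L' e (-1))
    (hM : σ.reg 2 ≤ M) (hB : M * M + M + 5 ≤ B) :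
    Runs B moveP σ 50 (fun σ' => (Stores A X N root σ' L' e (-1) ∧
      σ'.mem 4 = update (σ.mem 4) v w) ∧ Agree moveP σ σ') := by
  refine Runs.agree (Runs.of_wp_le ?_ (by decide))
  have hroot := T.bd root T.tree.root_mem
  have hM0 : 0 ≤ M := by have := T.root_nonneg; omega
  have hMM : 0 ≤ M * M := mul_nonneg hM0 hM0
  have hbd : ∀ t ∈ N, 0 ≤ t ∧ t < M := by
    intro t ht
    have := T.bd t ht; omega
  have C' := T.counts.move hvN (by rwa [hvu])
  have hub := hbd u huN
  have hvb := hbd v hvN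
  have hwb := hbd w hwN
  have hs1 := chs_bound C' hM0 hbd huN huX
  have hs2 := chs_bound C' hM0 hbd hwN hwX
  rw [hvu] at C' hs1 hs2
  rw [Function.update_self, Function.update_self] at hs1
  rw [Function.update_of_ne huw.symm, Function.update_self, Function.update_of_ne huw.symm,
    Function.update_self] at hs2
  simp only [moveP, wp, Exp.eval, Guard.Holds, State.setReg, State.setMem, update_self, update_of_ne, ne_eq,
      Nat.reduceEqDiff, not_false_eq_true, abs_le, hu, hv, hw, huw]
  refine ⟨by omega, by omega, by omega, by omega, by omega, by omega, by omega, by omega, by omega,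
    by omega, ⟨T', C', T.bd, T.root_nonneg, T.lf, T.inner⟩, trivial⟩

theorem addLeaf_runs (T : Stores A X N root σ L e e') {x g : ℤ} {L' : ℤ → Finset ℤ}
    (hg : σ.reg 12 = g) (hx : σ.reg 3 = x) (hgN : g ∈ N) (hgX : g ∉ X) (hxN : x ∉ N)
    (T' : Cotree A (insert x X) (insert x N) root (update (σ.mem 4) x g) (σ.mem 7) L' (-1) (-1))
    (hx0 : 0 ≤ x) (hxr : x < root)
    (hM : σ.reg 2 ≤ M) (hB : M * M + M + 5 ≤ B) :
    Runs B addLeafP σ 50 (fun σ' => Stores A (insert x X) (insert x N) root σ' L' (-1) (-1) ∧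
      Agree addLeafP σ σ') := by
  refine Runs.agree (Runs.of_wp_le ?_ (by decide))
  have hroot := T.bd root T.tree.root_mem
  have hM0 : 0 ≤ M := by omega
  have hMM : 0 ≤ M * M := mul_nonneg hM0 hM0
  have hbd : ∀ t ∈ insert x N, 0 ≤ t ∧ t < σ.reg 2 := by
    intro t ht
    rcases Finset.mem_insert.1 ht with rfl | ht
    · omega
    · exact T.bd t ht
  have C' := T.counts.addLeaf hxN hgN
  have hgb := hbd g (Finset.mem_insert_of_mem hgN)
  have hgX' : g ∉ insert x X := by
    rw [Finset.mem_insert]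
    rintro (rfl | h)
    · exact hxN hgN
    · exact hgX h
  have hs1 := chs_bound C' hM0 (fun t ht => ⟨(hbd t ht).1, by have := (hbd t ht).2; omega⟩)
    (Finset.mem_insert_of_mem hgN) hgX'
  rw [Function.update_self, Function.update_self] at hs1
  simp only [addLeafP, wp, Exp.eval, Guard.Holds, State.setReg, State.setMem, update_self, update_of_ne, ne_eq,
      Nat.reduceEqDiff, not_false_eq_true, abs_le, hg, hx]
  refine ⟨by omega, by omega, by omega, by omega, by omega, by omega,
    ⟨T', C', hbd, T.root_nonneg, T.lf, fun t ht htX => ?_⟩⟩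
  rw [Finset.mem_insert, not_or] at htX
  exact T.inner t (by simpa [htX.1] using ht) htX.2

end

open Function (update update_self update_of_ne)

/-- Run `p` with register 4 ranging over the positions of the queue. -/
def qloop (p : Prog) : Prog :=
  4 ≔ 𝒞 0 ;; .loop ((ℛ 4 +ₑ 𝒞 1) ≤ₑ ℛ 5) (p ;; 4 ≔ ℛ 4 +ₑ 𝒞 1)

theorem qloop_runs {B : ℕ} {σ : State} {p : Prog} {S : Finset ℤ} (T : ℕ)
    (I : Finset ℤ → State → Prop) (hq : IsEnum (σ.mem 10) (σ.reg 5) S)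
    (h10 : p.wm 10 = false) (h5 : p.wr 5 = false) (h4 : p.wr 4 = false)
    (hI : ∀ P σ' z, I P σ' → I P (σ'.setReg 4 z)) (h0 : I ∅ σ) (hB : S.card + 1 ≤ B)
    (step : ∀ P σ' v, Agree (qloop p) σ σ' → IsEnum (σ.mem 10) (σ'.reg 4) P → P ⊆ S → v ∈ S →
      v ∉ P → σ'.mem 10 (σ'.reg 4) = v → I P σ' → Runs B p σ' T (I (insert v P))) :
    Runs B (qloop p) σ (S.card * (T + 20) + 20)
      (fun σ' => I S σ' ∧ Agree (qloop p) σ σ') := by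
  refine Runs.agree ?_
  refine ((Runs.of_wp (Q := fun σ' => σ' = σ.setReg 4 0) ?_).seq
    (T₂ := S.card * (T + 20) + 10) ?_).mono (by simp only [Prog.maxcost, Exp.cost]; omega)
    (fun _ h => h)
  · simp [wp, Exp.eval]
  rintro σ₁ rfl
  have hcard := hq.card
  refine (Runs.loop (T + 4)
    (fun σ' => ∃ P ⊆ S, IsEnum (σ.mem 10) (σ'.reg 4) P ∧ σ'.reg 4 ≤ σ.reg 5 ∧ I P σ')
    (fun σ' => (σ.reg 5 - σ'.reg 4).toNat) ?_ ?_).mono ?_ ?_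
  · refine ⟨∅, by simp, by simpa [State.setReg] using IsEnum.zero _, ?_, hI _ _ _ h0⟩
    simpa [State.setReg] using hq.nonneg
  · rintro σ₂ hag ⟨P, hPS, hP, hle, hIP⟩ hg
    have e5 : σ₂.reg 5 = σ.reg 5 := by
      rw [hag.1 5 (by simp [Prog.wr, h5])]; simp [State.setReg]
    have e10 : σ₂.mem 10 = σ.mem 10 := by
      rw [hag.2 10 (by simp [Prog.wm, h10])]; simp [State.setReg]
    have hlt : σ₂.reg 4 < σ.reg 5 := by
      simp only [Guard.Holds, Exp.eval] at hg; omega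
    have hag' : Agree (qloop p) σ σ₂ := by
      refine ⟨fun i hi => ?_, fun a ha => ?_⟩
      · simp only [qloop, Prog.wr, Bool.or_eq_false_iff, beq_eq_false_iff_ne] at hi
        rw [hag.1 i (by simp [Prog.wr, hi.1, hi.2.1])]
        simp [State.setReg, hi.1]
      · simp only [qloop, Prog.wm, Bool.or_eq_false_iff] at ha
        rw [hag.2 a (by simp [Prog.wm, ha.2.1])]
        simp [State.setReg]
    have hv := hq.mem _ hP.nonneg hlt
    have hvP := hq.notMem_of_prefix hP hlt
    refine ((step P σ₂ _ hag' hP hPS hv hvP (by rw [e10]) hIP).agree.seq (T₂ := 4)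
      fun σ₃ h3 => ?_)
    have e4 : σ₃.reg 4 = σ₂.reg 4 := h3.2.1 4 h4
    refine Runs.of_wp_le ?_ (by decide)
    simp only [wp, Exp.eval]
    have hn := hP.nonneg
    refine ⟨by rw [abs_le]; omega, ⟨_, Finset.insert_subset hv hPS, ?_, ?_, hI _ _ _ h3.1⟩, ?_⟩
    · simpa [State.setReg, e4] using hP.succ hvP
    · simp [State.setReg, e4]; omega
    · simp [State.setReg, e4]; omega
  · have : (σ.setReg 4 0).reg 4 = 0 := by simp [State.setReg]
    rw [this]
    have e : (σ.reg 5 - 0).toNat = S.card := by omega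
    rw [e]
    simp only [Guard.cost, Exp.cost]
    nlinarith
  · rintro σ' ⟨⟨P, hPS, hP, hle, hIP⟩, hg, hag⟩
    have e5 : σ'.reg 5 = σ.reg 5 := by
      rw [hag.1 5 (by simp [Prog.wr, h5])]; simp [State.setReg]
    have : σ'.reg 4 = σ.reg 5 := by
      simp only [Guard.Holds, Exp.eval] at hg; omega
    rw [this] at hP
    rwa [hq.eq_of_eq hP] at hIP

/-- Mark the parents and grandparents of the touched nodes. -/
def badBody : Prog :=
  6 ≔ 10⟪ℛ 4⟫ ;; 7 ≔ 4⟪ℛ 6⟫ ;;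
  .ite (.not (8⟪ℛ 7⟫ =ₑ 5⟪ℛ 7⟫))
    (.write 11 (4⟪ℛ 7⟫) (ℛ 3 +ₑ 𝒞 1) ;; .write 11 (4⟪4⟪ℛ 7⟫⟫) (ℛ 3 +ₑ 𝒞 1)) .skip

/-- Find the touched node that is not marked, and a full child of it. -/
def findBody : Prog :=
  6 ≔ 10⟪ℛ 4⟫ ;; 7 ≔ 4⟪ℛ 6⟫ ;;
  .ite (.and (.not (8⟪ℛ 7⟫ =ₑ 5⟪ℛ 7⟫)) (.not (11⟪ℛ 7⟫ =ₑ (ℛ 3 +ₑ 𝒞 1)))) (8 ≔ ℛ 7 ;; 19 ≔ ℛ 6) .skip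

/-- Reset the counters of the sweep. -/
def resetBody : Prog :=
  6 ≔ 10⟪ℛ 4⟫ ;; .write 8 (4⟪ℛ 6⟫) (𝒞 0) ;; .write 9 (4⟪ℛ 6⟫) (𝒞 0)

/-- Move the queued children of one node to another one. -/
def regroupBody : Prog := 6 ≔ 10⟪ℛ 4⟫ ;; .ite (4⟪ℛ 6⟫ =ₑ ℛ 8) moveP .skip

section

variable {A : ℤ → ℤ → Prop} {X N : Finset ℤ} {root : ℤ} {L : ℤ → Finset ℤ} {B : ℕ}
  {σ : State} {M x : ℤ}

open Cotree

theorem Stores.par_ge (T : Stores A X N root σ L (-1) (-1)) {t : ℤ} (ht : t ∈ N ∨ t = -1) :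
    (σ.mem 4 t ∈ N ∨ σ.mem 4 t = -1) ∧ -1 ≤ σ.mem 4 t ∧ σ.mem 4 t < σ.reg 2 := by
  have h : σ.mem 4 t ∈ N ∨ σ.mem 4 t = -1 := by
    rcases ht with ht | rfl
    · by_cases htr : t = root
      · right; rw [htr, T.tree.par_root]
      · exact .inl (T.tree.par_mem t ht htr).1
    · exact .inr T.tree.par_neg
  refine ⟨h, ?_⟩
  have h0 := T.bd _ T.tree.root_mem
  rcases h with h | h
  · have := T.bd _ h; omega
  · omega

theorem badLoop_runs (T : Stores A X N root σ L (-1) (-1)) {F : Finset ℤ}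
    (hq : IsEnum (σ.mem 10) (σ.reg 5) F) (hF : F ⊆ N) (hx : σ.reg 3 = x) (hx0 : 0 ≤ x)
    (hxr : x < root) (hbad : ∀ t, σ.mem 11 t ≤ x) (hM : σ.reg 2 ≤ M) (hB : M * M + M + 5 ≤ B) :
    Runs B (qloop badBody) σ (F.card * 80 + 20) (fun σ' =>
      ((∀ t, σ'.mem 11 t ≤ x + 1) ∧ ∀ t, σ'.mem 11 t = x + 1 ↔ ∃ v ∈ F,
        σ.mem 8 (σ.mem 4 v) ≠ σ.mem 5 (σ.mem 4 v) ∧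
        (t = σ.mem 4 (σ.mem 4 v) ∨ t = σ.mem 4 (σ.mem 4 (σ.mem 4 v)))) ∧
      Agree (qloop badBody) σ σ') := by
  have hroot := T.bd root T.tree.root_mem
  have hM0 : 0 ≤ M := by omega
  have hMM : 0 ≤ M * M := mul_nonneg hM0 hM0
  have hFM := card_le_of_bound hM0 (S := F) (fun t ht => by have := T.bd t (hF ht); omega)
  refine (qloop_runs (p := badBody) 55 (fun P σ' => (∀ t, σ'.mem 11 t ≤ x + 1) ∧
      ∀ t, σ'.mem 11 t = x + 1 ↔ ∃ v ∈ P, σ.mem 8 (σ.mem 4 v) ≠ σ.mem 5 (σ.mem 4 v) ∧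
        (t = σ.mem 4 (σ.mem 4 v) ∨ t = σ.mem 4 (σ.mem 4 (σ.mem 4 v))))
    hq rfl rfl rfl (fun P σ' z h => h) ?_ (by omega) ?_).mono (by omega) (fun _ h => h)
  · refine ⟨fun t => by have := hbad t; omega, fun t => ?_⟩
    have := hbad t
    simp; omega
  · rintro P σ₁ v hag hP hPF hv hvP hqv ⟨I1, I2⟩
    have e4 : σ₁.mem 4 = σ.mem 4 := hag.2 4 rfl
    have e5 : σ₁.mem 5 = σ.mem 5 := hag.2 5 rfl
    have e8 : σ₁.mem 8 = σ.mem 8 := hag.2 8 rfl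
    have e3 : σ₁.reg 3 = x := (hag.1 3 rfl).trans hx
    have hvb := T.bd v (hF hv)
    obtain ⟨p1, p1', p1''⟩ := T.par_ge (.inl (hF hv))
    obtain ⟨p2, p2', p2''⟩ := T.par_ge p1
    obtain ⟨p3, p3', p3''⟩ := T.par_ge p2
    refine Runs.of_wp_le ?_ (by decide)
    simp only [badBody, wp, Exp.eval, Guard.Holds, State.setReg, State.setMem, update_self, update_of_ne, ne_eq,
      Nat.reduceEqDiff, not_false_eq_true, abs_le, e4, e5, e8, e3, hqv]
    refine ⟨by omega, by omega, fun hc => ⟨by omega, by omega, by omega, by omega, ?_, ?_⟩,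
      fun hc => ⟨I1, fun t => ?_⟩⟩
    · intro t
      rw [Function.update_apply, Function.update_apply]
      have := I1 t
      split_ifs <;> omega
    · intro t
      rw [Function.update_apply, Function.update_apply]
      have := I2 t
      split_ifs with h1 h2
      · simp only [true_iff]
        exact ⟨v, by simp, hc, .inr h1⟩
      · simp only [true_iff]
        exact ⟨v, by simp, hc, .inl h2⟩
      · rw [this]
        constructor
        · rintro ⟨w, hw, hh⟩
          exact ⟨w, by simp [hw], hh⟩
        · rintro ⟨w, hw, hh⟩
          rcases Finset.mem_insert.1 hw with rfl | hw
          · exact absurd hh.2 (by simp [h1, h2])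
          · exact ⟨w, hw, hh⟩
    · rw [I2 t]
      constructor
      · rintro ⟨w, hw, hh⟩
        exact ⟨w, by simp [hw], hh⟩
      · rintro ⟨w, hw, hh⟩
        rcases Finset.mem_insert.1 hw with rfl | hw
        · exact absurd hh.1 hc
        · exact ⟨w, hw, hh⟩

theorem findLoop_runs (T : Stores A X N root σ L (-1) (-1)) {F : Finset ℤ} {u : ℤ}
    (hq : IsEnum (σ.mem 10) (σ.reg 5) F) (hF : F ⊆ N) (hx : σ.reg 3 = x)
    (hu : ∀ v ∈ F, σ.mem 4 v = u ↔ σ.mem 8 (σ.mem 4 v) ≠ σ.mem 5 (σ.mem 4 v) ∧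
      σ.mem 11 (σ.mem 4 v) ≠ x + 1)
    (hM : σ.reg 2 ≤ M) (hB : M * M + M + 5 ≤ B) :
    Runs B (qloop findBody) σ (F.card * 80 + 20) (fun σ' =>
      ((∃ v ∈ F, σ.mem 4 v = u) → σ'.reg 8 = u ∧ σ'.reg 19 ∈ F ∧ σ.mem 4 (σ'.reg 19) = u) ∧
      Agree (qloop findBody) σ σ') := by
  have hroot := T.bd root T.tree.root_mem
  have hM0 : 0 ≤ M := by omega
  have hMM : 0 ≤ M * M := mul_nonneg hM0 hM0
  have hFM := card_le_of_bound hM0 (S := F) (fun t ht => by have := T.bd t (hF ht); omega)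
  refine (qloop_runs (p := findBody) 55 (fun P σ' => (∃ v ∈ P, σ.mem 4 v = u) →
      σ'.reg 8 = u ∧ σ'.reg 19 ∈ F ∧ σ.mem 4 (σ'.reg 19) = u)
    hq rfl rfl rfl ?_ (by simp) (by omega) ?_).mono (by omega) (fun _ h => h)
  · intro P σ' z h
    simpa [State.setReg] using h
  · rintro P σ₁ v hag hP hPF hv hvP hqv I
    have e4 : σ₁.mem 4 = σ.mem 4 := hag.2 4 rfl
    have e5 : σ₁.mem 5 = σ.mem 5 := hag.2 5 rfl
    have e8 : σ₁.mem 8 = σ.mem 8 := hag.2 8 rfl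
    have e11 : σ₁.mem 11 = σ.mem 11 := hag.2 11 rfl
    have e3 : σ₁.reg 3 = x := (hag.1 3 rfl).trans hx
    have hvb := T.bd v (hF hv)
    obtain ⟨p1, p1', p1''⟩ := T.par_ge (.inl (hF hv))
    refine Runs.of_wp_le ?_ (by decide)
    simp only [findBody, wp, Exp.eval, Guard.Holds, State.setReg, State.setMem, update_self, update_of_ne, ne_eq,
      Nat.reduceEqDiff, not_false_eq_true, abs_le, e4, e5, e8, e11, e3, hqv]
    refine ⟨by omega, by omega, fun hc => ⟨by omega, by omega, ?_⟩, fun hc => ?_⟩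
    · have := (hu v hv).2 hc
      exact fun _ => ⟨this, hv, this⟩
    · rintro ⟨w, hw, hwu⟩
      rcases Finset.mem_insert.1 hw with rfl | hw
      · exact absurd ((hu w hv).1 hwu) hc
      · exact I ⟨w, hw, hwu⟩

theorem resetLoop_runs (T : Stores A X N root σ L (-1) (-1)) {F : Finset ℤ}
    (hq : IsEnum (σ.mem 10) (σ.reg 5) F) (hF : F ⊆ N)
    (h8 : ∀ t, (∀ v ∈ F, σ.mem 4 v ≠ t) → σ.mem 8 t = 0 ∧ σ.mem 9 t = 0)
    (hM : σ.reg 2 ≤ M) (hB : M * M + M + 5 ≤ B) :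
    Runs B (qloop resetBody) σ (F.card * 80 + 20) (fun σ' =>
      (∀ t, σ'.mem 8 t = 0 ∧ σ'.mem 9 t = 0) ∧ Agree (qloop resetBody) σ σ') := by
  have hroot := T.bd root T.tree.root_mem
  have hM0 : 0 ≤ M := by have := T.root_nonneg; omega
  have hMM : 0 ≤ M * M := mul_nonneg hM0 hM0
  have hFM := card_le_of_bound hM0 (S := F) (fun t ht => by have := T.bd t (hF ht); omega)
  refine (qloop_runs (p := resetBody) 55 (fun P σ' => ∀ t,
      (∀ v ∈ F, v ∉ P → σ.mem 4 v ≠ t) → σ'.mem 8 t = 0 ∧ σ'.mem 9 t = 0)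
    hq rfl rfl rfl (fun _ _ _ h => h) (by simpa using h8) (by omega) ?_).mono (by omega)
    (fun _ h => ⟨fun t => h.1 t (by tauto), h.2⟩)
  · rintro P σ₁ v hag hP hPF hv hvP hqv I
    have e4 : σ₁.mem 4 = σ.mem 4 := hag.2 4 rfl
    have hvb := T.bd v (hF hv)
    obtain ⟨p1, p1', p1''⟩ := T.par_ge (.inl (hF hv))
    refine Runs.of_wp_le ?_ (by decide)
    simp only [resetBody, wp, Exp.eval, Guard.Holds, State.setReg, State.setMem, update_self, update_of_ne, ne_eq,
      Nat.reduceEqDiff, not_false_eq_true, abs_le, e4, hqv]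
    refine ⟨by omega, by omega, by omega, by omega, by omega, fun t ht => ?_⟩
    by_cases htv : t = σ.mem 4 v
    · simp [htv]
    · rw [Function.update_of_ne htv, Function.update_of_ne htv]
      refine I t fun w hw hwP h => ?_
      by_cases hwv : w = v
      · exact htv (hwv ▸ h.symm)
      · exact ht w hw (by simp [hwP, hwv]) h

/-- Regrouping below a join. -/
theorem regroupUp_runs {u w : ℤ} {F : Finset ℤ} (T : Stores A X N root σ L u w)
    (hq : IsEnum (σ.mem 10) (σ.reg 5) F) (hF : F ⊆ N) (hru : σ.reg 8 = u) (hrw : σ.reg 13 = w)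
    (hu : u ∈ N) (hw : w ∈ N) (huw : σ.mem 4 u = w) (htyp : σ.mem 7 w = σ.mem 7 u)
    (hwF : w ∉ F) (hfull : ∀ v ∈ F, σ.mem 4 v = u → Full A L x v)
    (hemp : ∀ v ∈ N, v ∉ F → σ.mem 4 v = u → ∀ y ∈ L v, ¬ A x y)
    (h1 : ∃ v ∈ F, σ.mem 4 v = u)
    (h2 : ∃ c ∈ N, ∃ d ∈ N, c ≠ d ∧ c ∉ F ∧ d ∉ F ∧ σ.mem 4 c = u ∧ σ.mem 4 d = u)
    (hM : σ.reg 2 ≤ M) (hB : M * M + M + 5 ≤ B) :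
    Runs B (qloop regroupBody) σ (F.card * 90 + 20) (fun σ' =>
      (∃ L', Stores A X N root σ' L' u (-1) ∧ σ'.mem 4 u = w ∧
        ∀ y, y ∈ L' u ↔ y ∈ L u ∧ ¬ A x y) ∧ Agree (qloop regroupBody) σ σ') := by
  have hroot := T.bd root T.tree.root_mem
  have hM0 : 0 ≤ M := by have := T.root_nonneg; omega
  have hMM : 0 ≤ M * M := mul_nonneg hM0 hM0
  have hFM := card_le_of_bound hM0 (S := F) (fun t ht => by have := T.bd t (hF ht); omega)
  obtain ⟨c, hc, d, hd, hcd, hcF, hdF, hcu, hdu⟩ := h2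
  have huX := T.tree.not_leaf_of_par hc hu hcu
  have hwX := T.tree.not_leaf_of_par hu hw huw
  have hne : u ≠ w := fun h => T.tree.not_anc_of_par hu (huw.trans h.symm) .refl
  refine (qloop_runs (p := regroupBody) 65 (fun P σ' => ∃ L', Stores A X N root σ' L' u w ∧
      (∀ v ∈ P, σ'.mem 4 v ≠ u) ∧
      (∀ v, σ'.mem 4 v = σ.mem 4 v ∨ v ∈ F ∧ σ.mem 4 v = u ∧ σ'.mem 4 v = w) ∧
      (∀ v ∈ N, v ≠ u → L' v = L v) ∧ L' u ⊆ L u ∧ ∀ y ∈ L u, ¬ A x y → y ∈ L' u)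
    hq rfl rfl rfl ?_ ?_ (by omega) ?_).mono (by omega) ?_
  · rintro P σ' z ⟨L', S, h⟩
    exact ⟨L', S.of_eq rfl rfl rfl rfl (by simp [State.setReg]), h⟩
  · exact ⟨L, T, by simp, fun v => .inl rfl, fun _ _ _ => rfl, subset_rfl, fun y hy _ => hy⟩
  · rintro P σ₁ v hag hP hPF hv hvP hqv ⟨L', S, I1, I2, I3, I4, I5⟩
    have e8 : σ₁.reg 8 = u := (hag.1 8 rfl).trans hru
    have e13 : σ₁.reg 13 = w := (hag.1 13 rfl).trans hrw
    have e2 : σ₁.reg 2 = σ.reg 2 := hag.1 2 rfl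
    have e7 : σ₁.mem 7 = σ.mem 7 := hag.2 7 rfl
    have hvb := T.bd v (hF hv)
    refine ((Runs.of_wp (Q := fun σ' => σ' = σ₁.setReg 6 v) ?_).seq (T₂ := 60) ?_).mono
      (by decide) (fun _ h => h)
    · simp only [wp, Exp.eval, hqv, abs_le]
      exact ⟨by omega, trivial⟩
    rintro σ₂ rfl
    have S2 : Stores A X N root (σ₁.setReg 6 v) L' u w :=
      S.of_eq rfl rfl rfl rfl (by simp [State.setReg])
    refine (Runs.ite (T := 50) (fun hg => ?_) (fun hg => ?_)).mono (by decide) (fun _ h => h)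
    · have hvu : σ₁.mem 4 v = u := by simpa [Guard.Holds, Exp.eval, State.setReg, e8] using hg
      have hvu0 : σ.mem 4 v = u := by
        rcases I2 v with h | h
        · rw [← h, hvu]
        · exact h.2.1
      have hcu' : σ₁.mem 4 c = u := by
        rcases I2 c with h | h
        · rw [h, hcu]
        · exact absurd h.1 hcF
      have hdu' : σ₁.mem 4 d = u := by
        rcases I2 d with h | h
        · rw [h, hdu]
        · exact absurd h.1 hdF
      have huw' : σ₁.mem 4 u = w := by
        rcases I2 u with h | h
        · rw [h, huw]
        · exact h.2.2
      have T2 := S.tree.moveUp hu (hF hv) hw hvu huw' (by rw [e7, htyp])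
        ⟨c, hc, d, hd, hcd, fun h => hcF (h ▸ hv), fun h => hdF (h ▸ hv), hcu', hdu'⟩
        (fun t _ h => h)
      refine (move_runs S2 (M := M) (by simp [State.setReg, e8]) (by simp [State.setReg])
        (by simp [State.setReg, e13]) hu huX (hF hv) hw hwX hvu hne T2
        (by simp [State.setReg, e2, hM]) hB).mono le_rfl ?_
      rintro σ₃ ⟨⟨S3, h4⟩, -⟩
      have h4' : σ₃.mem 4 = update (σ₁.mem 4) v w := h4
      have S3' : Stores A X N root σ₃ (update L' u (L' u \ L' v)) u w := by
        obtain ⟨t1, t2, t3, t4, t5, t6⟩ := S3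
        refine ⟨?_, t2, t3, t4, t5, t6⟩
        exact { t1 with two := fun t ht htX _ => t1.two t ht htX (fun h => t1.neg (h ▸ ht)) }
      have hvu' : v ≠ u := fun h => T.tree.not_anc_of_par hu (h ▸ hvu0) .refl
      refine ⟨_, S3', fun s hs => ?_, fun s => ?_, fun s hs hsu => ?_, ?_, fun y hy hxy => ?_⟩
      · rw [h4']
        by_cases hsv : s = v
        · rw [hsv, Function.update_self]; exact hne.symm
        · rw [Function.update_of_ne hsv]
          exact I1 s (by simpa [hsv] using hs)
      · rw [h4']
        by_cases hsv : s = v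
        · right; rw [hsv, Function.update_self]; exact ⟨hv, hvu0, rfl⟩
        · rw [Function.update_of_ne hsv]; exact I2 s
      · rw [Function.update_of_ne hsu]; exact I3 s hs hsu
      · rw [Function.update_self]
        exact Finset.sdiff_subset.trans I4
      · rw [Function.update_self, Finset.mem_sdiff]
        refine ⟨I5 y hy hxy, fun h => hxy ?_⟩
        rw [I3 v (hF hv) hvu'] at h
        exact hfull v hv hvu0 y h
    · have hvu : σ₁.mem 4 v ≠ u := by simpa [Guard.Holds, Exp.eval, State.setReg, e8] using hg
      refine Runs.of_wp_le ?_ (by decide)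
      refine ⟨L', S2, fun s hs => ?_, I2, I3, I4, I5⟩
      rcases Finset.mem_insert.1 hs with rfl | hs
      · exact hvu
      · exact I1 s hs
  · rintro σ' ⟨⟨L', S, I1, I2, I3, I4, I5⟩, hag⟩
    refine ⟨⟨L', ?_, ?_, fun y => ⟨fun hy => ⟨I4 hy, ?_⟩, fun hy => I5 y hy.1 hy.2⟩⟩, hag⟩
    · obtain ⟨v, hv, hvu⟩ := h1
      have hvw : σ'.mem 4 v = w := by
        rcases I2 v with h | h
        · exact absurd (h.trans hvu) (I1 v hv)
        · exact h.2.2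
      have huw' : σ'.mem 4 u = w := by
        rcases I2 u with h | h
        · rw [h, huw]
        · exact h.2.2
      obtain ⟨t1, t2, t3, t4, t5, t6⟩ := S
      refine ⟨?_, t2, t3, t4, t5, t6⟩
      refine { t1 with two := fun t ht htX _ => ?_ }
      by_cases htw : t = w
      · subst htw
        refine ⟨v, hF hv, u, hu, fun h => ?_, hvw, huw'⟩
        exact T.tree.not_anc_of_par hu (h ▸ hvu) .refl
      · exact t1.two t ht htX htw
    · rcases I2 u with h | h
      · rw [h, huw]
      · exact h.2.2
    · obtain ⟨v, hv, hvu, hyv⟩ := (S.tree.mem_L u hu huX y).1 hy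
      have hvF : v ∉ F := fun h => I1 v h hvu
      have hvu0 : σ.mem 4 v = u := by
        rcases I2 v with h | h
        · rw [← h, hvu]
        · exact absurd h.1 hvF
      have hvu' : v ≠ u := fun h => T.tree.not_anc_of_par hu (h ▸ hvu0) .refl
      rw [I3 v hv hvu'] at hyv
      exact hemp v hv hvF hvu0 y hyv

/-- Regrouping below a union. -/
theorem regroupDown_runs {u w : ℤ} {F : Finset ℤ} (T : Stores A X N root σ L w w)
    (hq : IsEnum (σ.mem 10) (σ.reg 5) F) (hF : F ⊆ N) (hru : σ.reg 8 = u) (hrw : σ.reg 13 = w)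
    (hu : u ∈ N) (hw : w ∈ N) (hwX : w ∉ X) (hwu : σ.mem 4 w = u) (htyp : σ.mem 7 w = σ.mem 7 u)
    (hwF : w ∉ F) (hfull : ∀ v ∈ F, σ.mem 4 v = u → Full A L x v) (hwfull : Full A L x w)
    (hemp : ∀ v ∈ N, v ≠ w → v ∉ F → σ.mem 4 v = u → ∀ y ∈ L v, ¬ A x y)
    (h1 : ∃ v ∈ F, σ.mem 4 v = u) (h2 : ∃ c ∈ N, c ≠ w ∧ c ∉ F ∧ σ.mem 4 c = u)
    (hM : σ.reg 2 ≤ M) (hB : M * M + M + 5 ≤ B) :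
    Runs B (qloop regroupBody) σ (F.card * 90 + 20) (fun σ' =>
      (∃ L', Stores A X N root σ' L' w (-1) ∧ σ'.mem 4 w = u ∧
        ∀ y, y ∈ L' w ↔ y ∈ L u ∧ A x y) ∧ Agree (qloop regroupBody) σ σ') := by
  have hroot := T.bd root T.tree.root_mem
  have hM0 : 0 ≤ M := by have := T.root_nonneg; omega
  have hMM : 0 ≤ M * M := mul_nonneg hM0 hM0
  have hFM := card_le_of_bound hM0 (S := F) (fun t ht => by have := T.bd t (hF ht); omega)
  obtain ⟨c, hc, hcw, hcF, hcu⟩ := h2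
  have huX := T.tree.not_leaf_of_par hc hu hcu
  have hne : u ≠ w := fun h => T.tree.not_anc_of_par hu (h ▸ hwu) .refl
  refine (qloop_runs (p := regroupBody) 65 (fun P σ' => ∃ L', Stores A X N root σ' L' w w ∧
      (∀ v ∈ P, σ'.mem 4 v ≠ u) ∧
      (∀ v, σ'.mem 4 v = σ.mem 4 v ∨ v ∈ F ∧ σ.mem 4 v = u ∧ σ'.mem 4 v = w) ∧
      (∀ v ∈ N, v ≠ w → L' v = L v) ∧ ∀ y ∈ L' w, y ∈ L u ∧ A x y)
    hq rfl rfl rfl ?_ ?_ (by omega) ?_).mono (by omega) ?_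
  · rintro P σ' z ⟨L', S, h⟩
    exact ⟨L', S.of_eq rfl rfl rfl rfl (by simp [State.setReg]), h⟩
  · exact ⟨L, T, by simp, fun v => .inl rfl, fun _ _ _ => rfl,
      fun y hy => ⟨T.tree.sub_of_par hw hu hwu hy, hwfull y hy⟩⟩
  · rintro P σ₁ v hag hP hPF hv hvP hqv ⟨L', S, I1, I2, I3, I4⟩
    have e8 : σ₁.reg 8 = u := (hag.1 8 rfl).trans hru
    have e13 : σ₁.reg 13 = w := (hag.1 13 rfl).trans hrw
    have e2 : σ₁.reg 2 = σ.reg 2 := hag.1 2 rfl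
    have e7 : σ₁.mem 7 = σ.mem 7 := hag.2 7 rfl
    have hvb := T.bd v (hF hv)
    have hwu' : σ₁.mem 4 w = u := by
      rcases I2 w with h | h
      · rw [h, hwu]
      · exact absurd h.1 hwF
    refine ((Runs.of_wp (Q := fun σ' => σ' = σ₁.setReg 6 v) ?_).seq (T₂ := 60) ?_).mono
      (by decide) (fun _ h => h)
    · simp only [wp, Exp.eval, hqv, abs_le]
      exact ⟨by omega, trivial⟩
    rintro σ₂ rfl
    have S2 : Stores A X N root (σ₁.setReg 6 v) L' w w :=
      S.of_eq rfl rfl rfl rfl (by simp [State.setReg])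
    refine (Runs.ite (T := 50) (fun hg => ?_) (fun hg => ?_)).mono (by decide) (fun _ h => h)
    · have hvu : σ₁.mem 4 v = u := by simpa [Guard.Holds, Exp.eval, State.setReg, e8] using hg
      have hvu0 : σ.mem 4 v = u := by
        rcases I2 v with h | h
        · rw [← h, hvu]
        · exact h.2.1
      have hcu' : σ₁.mem 4 c = u := by
        rcases I2 c with h | h
        · rw [h, hcu]
        · exact absurd h.1 hcF
      have hvw : v ≠ w := fun h => hwF (h ▸ hv)
      have T2 := S.tree.moveDown hu (hF hv) hw hvu hwu' hvw hwX (by rw [e7, htyp])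
        ⟨c, hc, hcw, fun h => hcF (h ▸ hv), hcu'⟩ (fun t _ h => h)
      refine (move_runs S2 (M := M) (by simp [State.setReg, e8]) (by simp [State.setReg])
        (by simp [State.setReg, e13]) hu huX (hF hv) hw hwX hvu hne T2
        (by simp [State.setReg, e2, hM]) hB).mono le_rfl ?_
      rintro σ₃ ⟨⟨S3, h4⟩, -⟩
      have h4' : σ₃.mem 4 = update (σ₁.mem 4) v w := h4
      have S3' : Stores A X N root σ₃ (update L' w (L' w ∪ L' v)) w w := by
        obtain ⟨t1, t2, t3, t4, t5, t6⟩ := S3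
        refine ⟨?_, t2, t3, t4, t5, t6⟩
        exact { t1 with two := fun t ht htX _ => t1.two t ht htX (fun h => t1.neg (h ▸ ht)) }
      refine ⟨_, S3', fun s hs => ?_, fun s => ?_, fun s hs hsw => ?_, fun y hy => ?_⟩
      · rw [h4']
        by_cases hsv : s = v
        · rw [hsv, Function.update_self]; exact hne.symm
        · rw [Function.update_of_ne hsv]
          exact I1 s (by simpa [hsv] using hs)
      · rw [h4']
        by_cases hsv : s = v
        · right; rw [hsv, Function.update_self]; exact ⟨hv, hvu0, rfl⟩
        · rw [Function.update_of_ne hsv]; exact I2 s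
      · rw [Function.update_of_ne hsw]; exact I3 s hs hsw
      · rw [Function.update_self, Finset.mem_union] at hy
        rcases hy with hy | hy
        · exact I4 y hy
        · rw [I3 v (hF hv) hvw] at hy
          exact ⟨T.tree.sub_of_par (hF hv) hu hvu0 hy, hfull v hv hvu0 y hy⟩
    · have hvu : σ₁.mem 4 v ≠ u := by simpa [Guard.Holds, Exp.eval, State.setReg, e8] using hg
      refine Runs.of_wp_le ?_ (by decide)
      refine ⟨L', S2, fun s hs => ?_, I2, I3, I4⟩
      rcases Finset.mem_insert.1 hs with rfl | hs
      · exact hvu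
      · exact I1 s hs
  · rintro σ' ⟨⟨L', S, I1, I2, I3, I4⟩, hag⟩
    have hwu' : σ'.mem 4 w = u := by
      rcases I2 w with h | h
      · rw [h, hwu]
      · exact absurd h.1 hwF
    refine ⟨⟨L', ?_, hwu', fun y => ⟨I4 y, fun ⟨hy, hxy⟩ => ?_⟩⟩, hag⟩
    · obtain ⟨v, hv, hvu⟩ := h1
      have hvw : σ'.mem 4 v = w := by
        rcases I2 v with h | h
        · exact absurd (h.trans hvu) (I1 v hv)
        · exact h.2.2
      obtain ⟨t1, t2, t3, t4, t5, t6⟩ := S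
      refine ⟨?_, t2, t3, t4, t5, t6⟩
      refine { t1 with two := fun t ht htX _ => ?_ }
      by_cases htw : t = w
      · -- an old child of `w` and the moved node `v`
        subst htw
        obtain ⟨y, hy⟩ := T.tree.ne t hw
        obtain ⟨s, hs, hst, _⟩ := (T.tree.mem_L t hw hwX y).1 hy
        refine ⟨v, hF hv, s, hs, fun h => ?_, hvw, ?_⟩
        · exact hne (hvu.symm.trans ((congrArg _ h).trans hst))
        · rcases I2 s with h | h
          · rw [h, hst]
          · exact h.2.2
      · exact t1.two t ht htX htw
    · rw [← I3 u hu hne] at hy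
      obtain ⟨v, hv, hvu, hyv⟩ := (S.tree.mem_L u hu huX y).1 hy
      by_cases hvw : v = w
      · rwa [← hvw]
      have hvF : v ∉ F := fun h => I1 v h hvu
      have hvu0 : σ.mem 4 v = u := by
        rcases I2 v with h | h
        · rw [← h, hvu]
        · exact absurd h.1 hvF
      rw [I3 v hv hvw] at hyv
      exact absurd hxy (hemp v hv hvw hvF hvu0 y hyv)

end

open Function (update update_self update_of_ne)

/-- Given a lowest split node (register 8), produce a node (register 12) whose leaves are its
neighbours, if it is a union, or its non-neighbours, if it is a join. -/
def regroupP : Prog :=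
  .ite (ℛ 9 =ₑ 𝒞 0)
    (.ite (ℛ 10 =ₑ 𝒞 1) (12 ≔ ℛ 19)
      ((12 ≔ ℛ 19 ;; 16 ≔ 𝒞 0) ;; insertAboveP ;; qloop regroupBody ;; 12 ≔ ℛ 13))
    (.ite (5⟪ℛ 8⟫ =ₑ (ℛ 10 +ₑ 𝒞 1)) (12 ≔ 6⟪ℛ 8⟫ -ₑ ℛ 11)
      ((12 ≔ ℛ 8 ;; 16 ≔ 𝒞 1) ;; insertAboveP ;; qloop regroupBody ;; 12 ≔ ℛ 8))

/-- Make sure that the node in register 12 has the type opposite to that in register 9. -/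
def splitP : Prog :=
  .ite (7⟪ℛ 12⟫ =ₑ (𝒞 1 -ₑ ℛ 9)) .skip (16 ≔ 𝒞 1 -ₑ ℛ 9 ;; insertAboveP ;; 12 ≔ ℛ 13)

section

variable {A : ℤ → ℤ → Prop} {X N : Finset ℤ} {root : ℤ} {L : ℤ → Finset ℤ} {B : ℕ}
  {σ : State} {M x : ℤ}

open Cotree

theorem regroup_runs {u a τ : ℤ} {F : Finset ℤ} (T : Stores A X N root σ L (-1) (-1))
    (hF : ∀ t, t ∈ F ↔ t ∈ N ∧ Full A L x t) (hq : IsEnum (σ.mem 10) (σ.reg 5) F)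
    (hu : u ∈ N) (hum : Mixed A L x u) (hlow : ∀ c ∈ N, par c = u → ¬ Mixed A L x c)
    (hpar : par = σ.mem 4)
    (hru : σ.reg 8 = u) (hra : σ.reg 19 = a) (ha : a ∈ F) (hau : σ.mem 4 a = u)
    (hτ : σ.reg 9 = τ) (htyp : σ.mem 7 u = τ) (hk : σ.reg 10 = (chs F (σ.mem 4) u).card)
    (hs : σ.reg 11 = ∑ c ∈ chs F (σ.mem 4) u, c) (hx0 : 0 ≤ x) (hxr : x < root) (hxN : x ∉ N)
    (hM : σ.reg 2 + 1 ≤ M) (hB : M * M + M + 5 ≤ B) :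
    Runs B regroupP σ (F.card * 90 + 150) (fun σ' =>
      (∃ N' L' e c, σ'.reg 12 = c ∧ Stores A X N' root σ' L' e (-1) ∧ x ∉ N' ∧ c ∈ N' ∧ c ≠ root ∧
        σ'.mem 7 (σ'.mem 4 c) = τ ∧ (e = -1 ∨ e = c ∧ σ'.mem 7 c = τ) ∧
        (∀ y, y ∈ L' c ↔ y ∈ L u ∧ (A x y ↔ τ = 0)) ∧ σ'.reg 2 ≤ σ.reg 2 + 1) ∧
      Agree regroupP σ σ') := by
  subst hpar
  refine Runs.agree ?_
  have hroot := T.bd root T.tree.root_mem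
  have hM0 : 0 ≤ M := by omega
  have hMM : 0 ≤ M * M := mul_nonneg hM0 hM0
  have hFN : F ⊆ N := fun t ht => ((hF t).1 ht).1
  have huX := hum.not_leaf T.tree
  have hneg : ∀ t ∈ N, t ≠ -1 := fun t ht h => T.tree.neg (h ▸ ht)
  have hz : σ.reg 2 ∉ N := fun h => by have := (T.bd _ h).2; omega
  have hne : ∀ t ∈ N, t ≠ σ.reg 2 := by rintro t ht rfl; exact hz ht
  have hzF : σ.reg 2 ∉ F := fun h => hz (hFN h)
  have hzX : σ.reg 2 ∉ X := fun h => hz (T.tree.X_sub h)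
  have hxz : x ≠ σ.reg 2 := by omega
  have har : a ≠ root := T.tree.ne_root_of_par hu hau
  have haN := hFN ha
  have hab := T.bd a haN
  have hub := T.bd u hu
  have hau' : u ≠ a := fun h => T.tree.not_anc_of_par hu (h ▸ hau) .refl
  have hempty : ∀ v ∈ N, v ∉ F → σ.mem 4 v = u → ∀ y ∈ L v, ¬ A x y := by
    intro v hv hvF hvu
    rcases full_or_empty (hlow v hv hvu) with h | h
    · exact absurd ((hF v).2 ⟨hv, h⟩) hvF
    · exact h
  -- the children of `u`
  have hsub : chs F (σ.mem 4) u ⊆ chs N (σ.mem 4) u := Finset.filter_subset_filter _ hFN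
  have hbne : (chs N (σ.mem 4) u \ chs F (σ.mem 4) u).Nonempty := by
    obtain ⟨_, b, hb, hxb⟩ := id hum
    obtain ⟨c, hc, hcu, hbc⟩ := (T.tree.mem_L u hu huX b).1 hb
    refine ⟨c, ?_⟩
    simp only [Finset.mem_sdiff, mem_chs, hc, hcu, and_true, true_and]
    exact fun h => hxb (((hF c).1 h).2 b hbc)
  have hcardB : ((chs N (σ.mem 4) u \ chs F (σ.mem 4) u).card : ℤ) = σ.mem 5 u - σ.reg 10 := by
    have := Finset.card_sdiff_add_card_eq_card hsub
    rw [hk, (T.counts u hu huX).1]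
    omega
  have hmemB : ∀ c, c ∈ chs N (σ.mem 4) u \ chs F (σ.mem 4) u ↔ c ∈ N ∧ σ.mem 4 c = u ∧ c ∉ F := by
    intro c
    simp only [Finset.mem_sdiff, mem_chs]
    tauto
  refine (Runs.ite (T := F.card * 90 + 140) (fun hg => ?_) (fun hg => ?_)).mono
    (by simp only [Guard.cost, Exp.cost]; omega) (fun _ h => h)
  · have hτ0 : τ = 0 := by simpa [Guard.Holds, Exp.eval, hτ] using hg
    subst hτ0
    refine (Runs.ite (T := F.card * 90 + 130) (fun hg => ?_) (fun hg => ?_)).mono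
      (by simp only [Guard.cost, Exp.cost]; omega) (fun _ h => h)
    · have hk1 : σ.reg 10 = 1 := by simpa [Guard.Holds, Exp.eval] using hg
      refine Runs.of_wp_le ?_ (by simp only [Prog.maxcost, Exp.cost]; omega)
      simp only [wp, Exp.eval, Guard.Holds, State.setReg, State.setMem, update_self, update_of_ne, ne_eq,
      Nat.reduceEqDiff, not_false_eq_true, abs_le, hra]
      refine ⟨by omega, N, L, -1, a, rfl, T.of_eq rfl rfl rfl rfl (by simp), hxN, haN, har,
        by rw [hau, htyp], .inl rfl, fun y => ⟨fun hy => ⟨T.tree.sub_of_par haN hu hau hy, ?_⟩,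
          fun hy => ?_⟩, by omega⟩
      · simpa using ((hF a).1 ha).2 y hy
      · obtain ⟨v, hv, hvu, hyv⟩ := (T.tree.mem_L u hu huX y).1 hy.1
        have hvF : v ∈ F := by
          by_contra h
          exact hempty v hv h hvu y hyv (hy.2.2 trivial)
        have hc1 : (chs F (σ.mem 4) u).card = 1 := by rw [hk] at hk1; exact_mod_cast hk1
        have := Finset.card_le_one.1 hc1.le v (by simp [hvF, hvu]) a (by simp [ha, hau])
        rwa [← this]
    · have hk1 : σ.reg 10 ≠ 1 := by simpa [Guard.Holds, Exp.eval] using hg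
      have hk2 : 1 < (chs F (σ.mem 4) u).card := by
        have : 0 < (chs F (σ.mem 4) u).card := Finset.card_pos.2 ⟨a, by simp [ha, hau]⟩
        omega
      refine ((Runs.of_wp (Q := fun σ' => σ' = (σ.setReg 12 a).setReg 16 0) ?_).seq
        (T₂ := F.card * 90 + 100) ?_).mono (by simp only [Prog.maxcost, Exp.cost]; omega)
        (fun _ h => h)
      · simp only [wp, Exp.eval, Guard.Holds, State.setReg, State.setMem, update_self, update_of_ne, ne_eq,
      Nat.reduceEqDiff, not_false_eq_true, abs_le, hra]
        exact ⟨by omega, by omega, trivial⟩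
      rintro σ₁ rfl
      have T1 : Stores A X N root ((σ.setReg 12 a).setReg 16 0) L (-1) (-1) :=
        T.of_eq rfl rfl rfl rfl (by simp [State.setReg])
      refine ((insertAbove_runs (M := M) (e₂ := σ.reg 2) (c := a) (ty := 0) T1 (by simp [State.setReg]) (by simp [State.setReg]) haN har
        (.inl rfl) (by simp [State.setReg]) ?_ (fun v hv _ _ => hneg v hv)
        (by simpa [State.setReg] using hM) hB).seq (T₂ := F.card * 90 + 40) ?_).mono (by omega)
        (fun _ h => h)
      · intro haX _
        have := T.tree.alt a haN haX har (hneg a haN)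
        rwa [hau, htyp] at this
      rintro σ₂ ⟨⟨h13, h2, T2, h4, h7⟩, hag⟩
      simp only [State.setReg, Function.update_of_ne, ne_eq, Nat.reduceEqDiff, not_false_eq_true]
        at h13 h2 T2 h4 h7
      rw [hau] at h4
      have e10 : σ₂.mem 10 = σ.mem 10 := hag.2 10 rfl
      have e5 : σ₂.reg 5 = σ.reg 5 := (hag.1 5 rfl).trans (by simp [State.setReg])
      have e8 : σ₂.reg 8 = u := (hag.1 8 rfl).trans (by simp [State.setReg, hru])
      have e4 : ∀ v, v ≠ a → v ≠ σ.reg 2 → σ₂.mem 4 v = σ.mem 4 v := by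
        intro v h1 h2
        rw [h4, Function.update_of_ne h1, Function.update_of_ne h2]
      have e4a : σ₂.mem 4 a = σ.reg 2 := by rw [h4, Function.update_self]
      have hLF : ∀ v, v ≠ σ.reg 2 → update L (σ.reg 2) (L a) v = L v := fun v hv =>
        Function.update_of_ne hv _ _
      refine ((regroupDown_runs (F := F) (u := u) (w := σ.reg 2) (M := M) (x := x) T2
        (by rw [e10, e5]; exact hq) (hFN.trans (Finset.subset_insert _ _)) e8 h13
        (Finset.mem_insert_of_mem hu) (Finset.mem_insert_self _ _) hzX ?_ ?_ hzF ?_ ?_ ?_ ?_ ?_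
        (by omega) hB).seq (T₂ := 10) ?_).mono (by omega) (fun _ h => h)
      · rw [h4, Function.update_of_ne (hne a haN).symm, Function.update_self]
      · rw [h7, Function.update_self, Function.update_of_ne (hne u hu), htyp]
      · intro v hv _
        rw [Full, hLF v (fun h => hzF (h ▸ hv))]
        exact ((hF v).1 hv).2
      · rw [Full, Function.update_self]
        exact ((hF a).1 ha).2
      · intro v hv hvw hvF hvu y
        have hva : v ≠ a := fun h => hvF (h ▸ ha)
        rw [hLF v hvw]
        rw [e4 v hva hvw] at hvu
        exact hempty v (by simpa [hvw] using hv) hvF hvu y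
      · obtain ⟨v, hv, hva⟩ := Finset.exists_mem_ne hk2 a
        rw [mem_chs] at hv
        exact ⟨v, hv.1, by rw [e4 v hva (hne v (hFN hv.1)), hv.2]⟩
      · obtain ⟨c, hc⟩ := hbne
        obtain ⟨hc, hcu, hcF⟩ := (hmemB c).1 hc
        exact ⟨c, Finset.mem_insert_of_mem hc, hne c hc, hcF,
          by rw [e4 c (fun h => hcF (h ▸ ha)) (hne c hc), hcu]⟩
      rintro σ₃ ⟨⟨L', T3, h4', hL'⟩, hag3⟩
      have e13 : σ₃.reg 13 = σ.reg 2 := (hag3.1 13 rfl).trans h13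
      have e7 : σ₃.mem 7 = σ₂.mem 7 := hag3.2 7 rfl
      have e2 : σ₃.reg 2 = σ₂.reg 2 := hag3.1 2 rfl
      have htw : σ₃.mem 7 (σ.reg 2) = 0 := by rw [e7, h7, Function.update_self]
      refine Runs.of_wp_le ?_ (by decide)
      simp only [wp, Exp.eval, Guard.Holds, State.setReg, State.setMem, update_self, update_of_ne, ne_eq,
      Nat.reduceEqDiff, not_false_eq_true, abs_le, e13]
      refine ⟨by omega, _, L', σ.reg 2, σ.reg 2, rfl, T3.of_eq rfl rfl rfl rfl (by simp), ?_,
        Finset.mem_insert_self _ _, (hne _ T.tree.root_mem).symm, ?_, .inr ⟨rfl, htw⟩,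
        fun y => ?_, by omega⟩
      · simp [hxz, hxN]
      · rw [h4', e7, h7, Function.update_of_ne (hne u hu), htyp]
      · rw [hL' y, hLF u (hne u hu)]; simp
  · have hτ0 : τ ≠ 0 := by simpa [Guard.Holds, Exp.eval, hτ] using hg
    have hτ1 : τ = 1 := by
      rcases T.tree.typ_int u hu huX with h | h
      · exact absurd (htyp.symm.trans h) hτ0
      · exact htyp.symm.trans h
    subst hτ1
    have hur : u ≠ root := by
      rintro rfl
      rw [T.tree.typ_root] at htyp
      omega
    refine (Runs.ite (T := F.card * 90 + 130) (fun hg => ?_) (fun hg => ?_)).mono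
      (by simp only [Guard.cost, Exp.cost]; omega) (fun _ h => h)
    · have hc1 : σ.mem 5 u = σ.reg 10 + 1 := by simpa [Guard.Holds, Exp.eval, hru] using hg
      obtain ⟨b, hb⟩ := Finset.card_eq_one.1
        (by omega : (chs N (σ.mem 4) u \ chs F (σ.mem 4) u).card = 1)
      have hsum : σ.mem 6 u - σ.reg 11 = b := by
        have := Finset.sum_sdiff (f := fun x : ℤ => x) hsub
        rw [hb, Finset.sum_singleton] at this
        rw [(T.counts u hu huX).2, hs]
        omega
      obtain ⟨hbN, hbu, hbF⟩ := (hmemB b).1 (by rw [hb]; simp)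
      have hbb := T.bd b hbN
      refine Runs.of_wp_le ?_ (by simp only [Prog.maxcost, Exp.cost]; omega)
      simp only [wp, Exp.eval, Guard.Holds, State.setReg, State.setMem, update_self, update_of_ne, ne_eq,
      Nat.reduceEqDiff, not_false_eq_true, abs_le, hru, hsum]
      refine ⟨by omega, N, L, -1, b, rfl, T.of_eq rfl rfl rfl rfl (by simp), hxN, hbN,
        T.tree.ne_root_of_par hu hbu,
        by rw [hbu, htyp], .inl rfl, fun y => ⟨fun hy => ⟨T.tree.sub_of_par hbN hu hbu hy, ?_⟩,
          fun hy => ?_⟩, by omega⟩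
      · simpa using hempty b hbN hbF hbu y hy
      · obtain ⟨v, hv, hvu, hyv⟩ := (T.tree.mem_L u hu huX y).1 hy.1
        have hvF : v ∉ F := by
          intro h
          have := hy.2.1 (((hF v).1 h).2 y hyv)
          omega
        have := (hmemB v).2 ⟨hv, hvu, hvF⟩
        rw [hb, Finset.mem_singleton] at this
        rwa [← this]
    · have hc1 : σ.mem 5 u ≠ σ.reg 10 + 1 := by simpa [Guard.Holds, Exp.eval, hru] using hg
      have hc2 : 1 < (chs N (σ.mem 4) u \ chs F (σ.mem 4) u).card := by
        have := Finset.card_pos.2 hbne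
        omega
      obtain ⟨b, hb, d, hd, hbd⟩ := Finset.one_lt_card.1 hc2
      obtain ⟨hbN, hbu, hbF⟩ := (hmemB b).1 hb
      obtain ⟨hdN, hdu, hdF⟩ := (hmemB d).1 hd
      refine ((Runs.of_wp (Q := fun σ' => σ' = (σ.setReg 12 u).setReg 16 1) ?_).seq
        (T₂ := F.card * 90 + 100) ?_).mono (by simp only [Prog.maxcost, Exp.cost]; omega)
        (fun _ h => h)
      · simp only [wp, Exp.eval, Guard.Holds, State.setReg, State.setMem, update_self, update_of_ne, ne_eq,
      Nat.reduceEqDiff, not_false_eq_true, abs_le, hru]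
        exact ⟨by omega, by omega, trivial⟩
      rintro σ₁ rfl
      have T1 : Stores A X N root ((σ.setReg 12 u).setReg 16 1) L (-1) (-1) :=
        T.of_eq rfl rfl rfl rfl (by simp [State.setReg])
      refine ((insertAbove_runs (M := M) (e₂ := u) (c := u) (ty := 1) T1 (by simp [State.setReg]) (by simp [State.setReg]) hu hur
        (.inr rfl) ?_ (fun _ h => absurd rfl h) (fun v hv _ _ => hneg v hv)
        (by simpa [State.setReg] using hM) hB).seq (T₂ := F.card * 90 + 40) ?_).mono (by omega)
        (fun _ h => h)
      · intro _
        have := T.tree.alt u hu huX hur (hneg u hu)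
        rwa [htyp] at this
      rintro σ₂ ⟨⟨h13, h2, T2, h4, h7⟩, hag⟩
      simp only [State.setReg, Function.update_of_ne, ne_eq, Nat.reduceEqDiff, not_false_eq_true]
        at h13 h2 T2 h4 h7
      have e10 : σ₂.mem 10 = σ.mem 10 := hag.2 10 rfl
      have e5 : σ₂.reg 5 = σ.reg 5 := (hag.1 5 rfl).trans (by simp [State.setReg])
      have e8 : σ₂.reg 8 = u := (hag.1 8 rfl).trans (by simp [State.setReg, hru])
      have e4 : ∀ v, v ≠ u → v ≠ σ.reg 2 → σ₂.mem 4 v = σ.mem 4 v := by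
        intro v h1 h2
        rw [h4, Function.update_of_ne h1, Function.update_of_ne h2]
      have e4u : σ₂.mem 4 u = σ.reg 2 := by rw [h4, Function.update_self]
      have hLF : ∀ v, v ≠ σ.reg 2 → update L (σ.reg 2) (L u) v = L v := fun v hv =>
        Function.update_of_ne hv _ _
      have hvu' : ∀ v, σ.mem 4 v = u → v ≠ u := fun v hv h =>
        T.tree.not_anc_of_par hu (h ▸ hv) .refl
      have hp : ∀ v ∈ N, σ₂.mem 4 v = u → σ.mem 4 v = u := by
        intro v hv h
        by_cases hvu : v = u
        · rw [hvu, e4u] at h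
          exact absurd h.symm (hne u hu)
        · rwa [e4 v hvu (hne v hv)] at h
      refine ((regroupUp_runs (F := F) (u := u) (w := σ.reg 2) (M := M) (x := x) T2
        (by rw [e10, e5]; exact hq) (hFN.trans (Finset.subset_insert _ _)) e8 h13
        (Finset.mem_insert_of_mem hu) (Finset.mem_insert_self _ _) e4u ?_ hzF ?_ ?_ ?_ ?_
        (by omega) hB).seq (T₂ := 10) ?_).mono (by omega) (fun _ h => h)
      · rw [h7, Function.update_self, Function.update_of_ne (hne u hu), htyp]
      · intro v hv _
        rw [Full, hLF v (fun h => hzF (h ▸ hv))]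
        exact ((hF v).1 hv).2
      · intro v hv hvF hvu y
        by_cases hvw : v = σ.reg 2
        · exfalso
          rw [hvw, h4, Function.update_of_ne (hne u hu).symm, Function.update_self] at hvu
          exact T.tree.not_anc_of_par hu hvu .refl
        · rw [hLF v hvw]
          have hvN : v ∈ N := by simpa [hvw] using hv
          exact hempty v hvN hvF (hp v hvN hvu) y
      · exact ⟨a, ha, by rw [e4 a hau'.symm (hne a haN), hau]⟩
      · exact ⟨b, Finset.mem_insert_of_mem hbN, d, Finset.mem_insert_of_mem hdN, hbd, hbF, hdF,
          by rw [e4 b (hvu' b hbu) (hne b hbN), hbu], by rw [e4 d (hvu' d hdu) (hne d hdN), hdu]⟩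
      rintro σ₃ ⟨⟨L', T3, h4', hL'⟩, hag3⟩
      have e8' : σ₃.reg 8 = u := (hag3.1 8 rfl).trans e8
      have e7 : σ₃.mem 7 = σ₂.mem 7 := hag3.2 7 rfl
      have e2 : σ₃.reg 2 = σ₂.reg 2 := hag3.1 2 rfl
      have htu : σ₃.mem 7 u = 1 := by rw [e7, h7, Function.update_of_ne (hne u hu), htyp]
      refine Runs.of_wp_le ?_ (by decide)
      simp only [wp, Exp.eval, Guard.Holds, State.setReg, State.setMem, update_self, update_of_ne, ne_eq,
      Nat.reduceEqDiff, not_false_eq_true, abs_le, e8']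
      refine ⟨by omega, _, L', u, u, rfl, T3.of_eq rfl rfl rfl rfl (by simp), ?_,
        Finset.mem_insert_of_mem hu, hur, ?_, .inr ⟨rfl, htu⟩,
        fun y => ?_, by omega⟩
      · simp [hxz, hxN]
      · rw [h4', e7, h7, Function.update_self]
      · rw [hL' y, hLF u (hne u hu)]; simp

theorem split_runs {c τ e : ℤ} (T : Stores A X N root σ L e (-1)) (hc : σ.reg 12 = c) (hcN : c ∈ N)
    (hcr : c ≠ root) (h9 : σ.reg 9 = τ) (hτ : τ = 0 ∨ τ = 1) (hp : σ.mem 7 (σ.mem 4 c) = τ)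
    (he : e = -1 ∨ e = c ∧ σ.mem 7 c = τ) (hM : σ.reg 2 + 1 ≤ M) (hB : M * M + M + 5 ≤ B) :
    Runs B splitP σ 100 (fun σ' =>
      (∃ N' L' e' g, σ'.reg 12 = g ∧ Stores A X N' root σ' L' (-1) e' ∧ g ∈ N' ∧ g ∉ X ∧
        σ'.mem 7 g = 1 - τ ∧ L' g = L c ∧ (∀ t ∈ N', t ≠ g → t ≠ e') ∧
        (∀ t ∈ N', t ∈ N ∨ t = σ.reg 2) ∧ σ'.reg 2 ≤ σ.reg 2 + 1) ∧ Agree splitP σ σ') := by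
  refine Runs.agree ?_
  have hroot := T.bd root T.tree.root_mem
  have hM0 : 0 ≤ M := by have := T.root_nonneg; omega
  have hMM : 0 ≤ M * M := mul_nonneg hM0 hM0
  have hneg : ∀ t ∈ N, t ≠ -1 := fun t ht h => T.tree.neg (h ▸ ht)
  refine (Runs.ite (T := 90) (fun hg => ?_) (fun hg => ?_)).mono
    (by simp only [Guard.cost, Exp.cost]; omega) (fun _ h => h)
  · have hct : σ.mem 7 c = 1 - τ := by simpa [Guard.Holds, Exp.eval, hc, h9] using hg
    have he1 : e = -1 := by
      rcases he with h | ⟨_, h⟩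
      · exact h
      · omega
    subst he1
    refine Runs.of_wp_le ?_ (by decide)
    refine ⟨N, L, -1, c, hc, T, hcN, fun h => ?_, hct, rfl, fun t ht _ => hneg t ht,
      fun t ht => .inl ht, by omega⟩
    have := (T.tree.leaf c h).2
    omega
  · have hct : σ.mem 7 c ≠ 1 - τ := by simpa [Guard.Holds, Exp.eval, hc, h9] using hg
    refine ((Runs.of_wp (Q := fun σ' => σ' = σ.setReg 16 (1 - τ)) ?_).seq
      (T₂ := 80) ?_).mono (by decide) (fun _ h => h)
    · simp only [wp, Exp.eval, Guard.Holds, State.setReg, State.setMem, update_self, update_of_ne, ne_eq,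
      Nat.reduceEqDiff, not_false_eq_true, abs_le, h9]
      exact ⟨by omega, trivial⟩
    rintro σ₁ rfl
    have hpN := (T.tree.par_mem c hcN hcr).1
    have T1 : Stores A X N root (σ.setReg 16 (1 - τ)) L e (-1) :=
      T.of_eq rfl rfl rfl rfl (by simp [State.setReg])
    refine ((insertAbove_runs (M := M) (e₂ := -1) (c := c) (ty := 1 - τ) T1 (by simpa [State.setReg] using hc) (by simp [State.setReg]) hcN hcr
      (by omega) (fun _ h => ?_) (fun _ _ => hct) (fun v hv _ hvc h => ?_)
      (by simpa [State.setReg] using hM) hB).seq (T₂ := 20) ?_).mono (by omega)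
      (fun _ h => h)
    · have h' : 1 - τ = τ := h.trans hp
      omega
    · rcases he with he | he
      · exact hneg v hv (h.trans he)
      · exact hvc (h.trans he.1)
    rintro σ₂ ⟨⟨h13, h2, T2, h4, h7⟩, hag⟩
    simp only [State.setReg, Function.update_of_ne, ne_eq, Nat.reduceEqDiff, not_false_eq_true]
      at h13 h2 T2 h4 h7
    refine Runs.of_wp_le ?_ (by decide)
    simp only [wp, Exp.eval, Guard.Holds, State.setReg, State.setMem, update_self, update_of_ne, ne_eq,
      Nat.reduceEqDiff, not_false_eq_true, abs_le, h13]
    refine ⟨by omega, _, _, _, σ.reg 2, rfl, T2.of_eq rfl rfl rfl rfl (by simp),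
      Finset.mem_insert_self _ _, fun h => ?_, by rw [h7, Function.update_self],
      by rw [Function.update_self], fun t ht h => h, fun t ht => ?_, by omega⟩
    · have := (T.bd _ (T.tree.X_sub h)).2
      omega
    · rcases Finset.mem_insert.1 ht with h | h
      · exact .inr h
      · exact .inl h

end

open Function (update update_self update_of_ne)

/-- The arrays `off` and `nb` store the adjacency lists of a graph on `0, …, n - 1`. -/
structure Lists (A : ℤ → ℤ → Prop) (n : ℤ) (off nb : ℤ → ℤ) : Prop where
  nonneg : ∀ x, 0 ≤ x → x < n → 0 ≤ off x
  mono : ∀ x, 0 ≤ x → x < n → off x ≤ off (x + 1)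
  range : ∀ x y, A x y → (0 ≤ x ∧ x < n) ∧ 0 ≤ y ∧ y < n
  mem : ∀ x, 0 ≤ x → x < n → ∀ y, A x y ↔ ∃ i, off x ≤ i ∧ i < off (x + 1) ∧ nb i = y
  inj : ∀ x, 0 ≤ x → x < n → ∀ i j, off x ≤ i → i < off (x + 1) → off x ≤ j → j < off (x + 1) →
    nb i = nb j → i = j

/-- Collect the neighbours of the vertex in register 3 that are smaller than it. -/
def gather : Prog :=
  (5 ≔ 𝒞 0 ;; 14 ≔ 0⟪ℛ 3⟫ ;; 15 ≔ 0⟪ℛ 3 +ₑ 𝒞 1⟫) ;;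
  .loop ((ℛ 14 +ₑ 𝒞 1) ≤ₑ ℛ 15)
    (6 ≔ 1⟪ℛ 14⟫ ;;
      .ite ((ℛ 6 +ₑ 𝒞 1) ≤ₑ ℛ 3) (.write 10 (ℛ 5) (ℛ 6) ;; 5 ≔ ℛ 5 +ₑ 𝒞 1) .skip ;;
      14 ≔ ℛ 14 +ₑ 𝒞 1)

/-- Insert the vertex in register 3 into the cotree. -/
def insertP : Prog :=
  gather ;;
  .ite (ℛ 5 =ₑ 𝒞 0) (12 ≔ ℛ 0 +ₑ 𝒞 2)
    (sweep ;; qloop badBody ;; qloop findBody ;;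
      (9 ≔ 7⟪ℛ 8⟫ ;; 10 ≔ 8⟪ℛ 8⟫ ;; 11 ≔ 9⟪ℛ 8⟫) ;; qloop resetBody ;; regroupP ;; splitP) ;;
  addLeafP

section

variable {A : ℤ → ℤ → Prop} {X N : Finset ℤ} {root : ℤ} {L : ℤ → Finset ℤ} {B : ℕ}
  {σ : State} {M x n : ℤ}

open Cotree

theorem gather_runs (G : Lists A n (σ.mem 0) (σ.mem 1)) (hx : σ.reg 3 = x) (hx0 : 0 ≤ x)
    (hxn : x < n) (hB : n + 2 ≤ B) (hoff : σ.mem 0 (x + 1) ≤ B) :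
    Runs B gather σ ((σ.mem 0 (x + 1) - σ.mem 0 x).toNat * 40 + 40) (fun σ' =>
      (∃ S, IsEnum (σ'.mem 10) (σ'.reg 5) S ∧ (∀ y, y ∈ S ↔ y < x ∧ A x y) ∧
        (S.card : ℤ) ≤ σ.mem 0 (x + 1) - σ.mem 0 x) ∧ Agree gather σ σ') := by
  refine Runs.agree ?_
  have g1 := G.nonneg x hx0 hxn
  have g2 := G.mono x hx0 hxn
  set d := (σ.mem 0 (x + 1) - σ.mem 0 x).toNat with hd
  refine ((Runs.of_wp (Q := fun σ' => σ' = ((σ.setReg 5 0).setReg 14 (σ.mem 0 x)).setReg 15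
    (σ.mem 0 (x + 1))) ?_).seq (T₂ := d * 40 + 15) ?_).mono
    (by simp only [Prog.maxcost, Exp.cost]; omega) (fun _ h => h)
  · simp only [wp, Exp.eval, Guard.Holds, State.setReg, State.setMem, update_self, update_of_ne, ne_eq,
      Nat.reduceEqDiff, not_false_eq_true, abs_le, hx]
    refine ⟨by omega, by omega, by omega, trivial⟩
  rintro σ₁ rfl
  refine (Runs.loop 30 (fun σ' => (σ.mem 0 x ≤ σ'.reg 14 ∧ σ'.reg 14 ≤ σ.mem 0 (x + 1)) ∧
      ∃ S, IsEnum (σ'.mem 10) (σ'.reg 5) S ∧ (S.card : ℤ) ≤ σ'.reg 14 - σ.mem 0 x ∧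
        ∀ y, y ∈ S ↔ y < x ∧ ∃ i, σ.mem 0 x ≤ i ∧ i < σ'.reg 14 ∧ σ.mem 1 i = y)
    (fun σ' => (σ.mem 0 (x + 1) - σ'.reg 14).toNat) ?_ ?_).mono ?_ ?_
  · simp only [wp, Exp.eval, Guard.Holds, State.setReg, State.setMem, update_self, update_of_ne, ne_eq,
      Nat.reduceEqDiff, not_false_eq_true, abs_le]
    refine ⟨⟨le_rfl, g2⟩, ∅, .zero _, by simp, fun y => ?_⟩
    simp only [Finset.notMem_empty, false_iff, not_and, not_exists]
    intros; omega
  · rintro σ₂ hag ⟨⟨i1, i2⟩, S, hS, hSc, hSm⟩ hg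
    have e15 : σ₂.reg 15 = σ.mem 0 (x + 1) := (hag.1 15 rfl).trans (by simp [State.setReg])
    have e3 : σ₂.reg 3 = x := (hag.1 3 rfl).trans (by simp [State.setReg, hx])
    have e1 : σ₂.mem 1 = σ.mem 1 := hag.2 1 rfl
    simp only [Guard.Holds, Exp.eval, e15] at hg
    have hA := (G.mem x hx0 hxn (σ.mem 1 (σ₂.reg 14))).2 ⟨_, i1, by omega, rfl⟩
    have hr := (G.range _ _ hA).2
    have hSn : (S.card : ℤ) ≤ n := by
      refine card_le_of_bound (by omega) fun y hy => ?_
      obtain ⟨_, i, h1, h2, rfl⟩ := (hSm y).1 hy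
      exact (G.range _ _ ((G.mem x hx0 hxn _).2 ⟨i, h1, by omega, rfl⟩)).2
    have hk := hS.card
    refine Runs.of_wp_le ?_ (by decide)
    simp only [wp, Exp.eval, Guard.Holds, State.setReg, State.setMem, update_self, update_of_ne, ne_eq,
      Nat.reduceEqDiff, not_false_eq_true, abs_le, e1, e3]
    have hnew : σ.mem 1 (σ₂.reg 14) ∉ S := by
      intro h
      obtain ⟨_, i, h1, h2, h3⟩ := (hSm _).1 h
      have := G.inj x hx0 hxn i _ h1 (by omega) i1 (by omega) h3
      omega
    refine ⟨by omega, fun hlt => ⟨by omega, by omega, by omega, by omega,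
      ⟨⟨by omega, by omega⟩, _, hS.push hnew, ?_, fun y => ?_⟩, by omega⟩,
      fun hlt => ⟨by omega, ⟨⟨by omega, by omega⟩, _, hS, by omega, fun y => ?_⟩, by omega⟩⟩
    · rw [Finset.card_insert_of_notMem hnew]; push_cast; omega
    · rw [Finset.mem_insert, hSm]
      constructor
      · rintro (rfl | ⟨h, i, h1, h2, h3⟩)
        · exact ⟨by omega, _, i1, by omega, rfl⟩
        · exact ⟨h, i, h1, by omega, h3⟩
      · rintro ⟨h, i, h1, h2, h3⟩
        by_cases hi : i = σ₂.reg 14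
        · exact .inl (by rw [← h3, hi])
        · exact .inr ⟨h, i, h1, by omega, h3⟩
    · rw [hSm]
      constructor
      · rintro ⟨h, i, h1, h2, h3⟩
        exact ⟨h, i, h1, by omega, h3⟩
      · rintro ⟨h, i, h1, h2, h3⟩
        refine ⟨h, i, h1, ?_, h3⟩
        have : i ≠ σ₂.reg 14 := by
          rintro rfl
          omega
        omega
  · have : (((σ.setReg 5 0).setReg 14 (σ.mem 0 x)).setReg 15 (σ.mem 0 (x + 1))).reg 14
        = σ.mem 0 x := by simp [State.setReg]
    rw [this, ← hd]
    simp only [Guard.cost, Exp.cost]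
    omega
  · rintro σ' ⟨⟨⟨i1, i2⟩, S, hS, hSc, hSm⟩, hg, hag⟩
    have e15 : σ'.reg 15 = σ.mem 0 (x + 1) := (hag.1 15 rfl).trans (by simp [State.setReg])
    simp only [Guard.Holds, Exp.eval, e15] at hg
    have e14 : σ'.reg 14 = σ.mem 0 (x + 1) := by omega
    rw [e14] at hSc hSm
    refine ⟨S, hS, fun y => ?_, hSc⟩
    rw [hSm, G.mem x hx0 hxn]

theorem chs_full_ne {F : Finset ℤ} {fc fs q : ℤ → ℤ} {k : ℤ} {par cnt typ : ℤ → ℤ}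
    (T : Cotree A X N root par typ L (-1) (-1)) {S₀ : Finset ℤ}
    (hF : ∀ t, t ∈ F ↔ t ∈ N ∧ Full A L x t) (hr : root ∉ F)
    (I : SweepInv X N S₀ par cnt L q k k fc fs F F) {v : ℤ} (hv : v ∈ F) :
    fc (par v) ≠ cnt (par v) ↔ Touched A N par L x (par v) := by
  have hvN := ((hF v).1 hv).1
  have hp := T.par_mem v hvN (fun h => hr (h ▸ hv))
  rw [ne_eq, ← I.inner _ hp.1 hp.2, hF]
  obtain ⟨a, ha⟩ := T.ne v hvN
  have hfull := ((hF v).1 hv).2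
  have hap := T.sub_of_par hvN hp.1 rfl ha
  constructor
  · intro h
    have : ¬ Full A L x (par v) := fun h' => h ⟨hp.1, h'⟩
    simp only [Full, not_forall] at this
    obtain ⟨b, hb, hxb⟩ := this
    exact ⟨hp.1, ⟨⟨a, hap, hfull a ha⟩, b, hb, hxb⟩, v, hvN, rfl, hfull⟩
  · rintro ⟨_, h, _⟩ h'
    exact h.not_full h'.2

set_option maxHeartbeats 1000000 in
theorem insert_runs (T : Stores A X N root σ L (-1) (-1)) (hA : IsCograph A)
    (G : Lists A n (σ.mem 0) (σ.mem 1)) (h0 : σ.reg 0 = n) (hroot : n + 2 = root)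
    (hX : ∀ y, y ∈ X ↔ (0 ≤ y ∧ y < x) ∨ y = n ∨ y = n + 1) (hx : σ.reg 3 = x) (hx0 : 0 ≤ x)
    (hxn : x < n) (hfc : ∀ t, σ.mem 8 t = 0 ∧ σ.mem 9 t = 0) (hbad : ∀ t, σ.mem 11 t ≤ x)
    (hM : σ.reg 2 + 2 ≤ M) (hB : M * M + M + 5 ≤ B) (hoff : σ.mem 0 (x + 1) ≤ B) :
    Runs B insertP σ ((σ.mem 0 (x + 1) - σ.mem 0 x).toNat * 1000 + 1000) (fun σ' =>
      ((∃ N' L', Stores A (insert x X) N' root σ' L' (-1) (-1)) ∧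
        (∀ t, σ'.mem 8 t = 0 ∧ σ'.mem 9 t = 0) ∧ (∀ t, σ'.mem 11 t ≤ x + 1) ∧
        σ'.reg 2 ≤ σ.reg 2 + 2) ∧ Agree insertP σ σ') := by
  refine Runs.agree ?_
  have hrt := T.bd root T.tree.root_mem
  have hM0 : 0 ≤ M := by omega
  have hMM : 0 ≤ M * M := mul_nonneg hM0 hM0
  have hxX : x ∉ X := by rw [hX]; omega
  have hxN : x ∉ N := fun h => by have := T.inner x h hxX; omega
  have htx : σ.mem 7 x = 2 := T.lf x hx0 (by omega)
  set d := (σ.mem 0 (x + 1) - σ.mem 0 x).toNat with hd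
  have g2 := G.mono x hx0 hxn
  refine ((gather_runs G hx hx0 hxn (by omega) hoff).seq (T₂ := d * 950 + 950) ?_).mono (by omega)
    (fun _ h => h)
  rintro σ₁ ⟨⟨S, hS, hSm, hSc⟩, hag⟩
  have T1 : Stores A X N root σ₁ L (-1) (-1) := T.of_eq (hag.2 4 rfl) (hag.2 5 rfl) (hag.2 6 rfl)
    (hag.2 7 rfl) (hag.1 2 rfl)
  have q0 : σ₁.reg 0 = n := (hag.1 0 rfl).trans h0
  have q3 : σ₁.reg 3 = x := (hag.1 3 rfl).trans hx
  have q2 : σ₁.reg 2 = σ.reg 2 := hag.1 2 rfl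
  have q8 : σ₁.mem 8 = σ.mem 8 := hag.2 8 rfl
  have q9 : σ₁.mem 9 = σ.mem 9 := hag.2 9 rfl
  have q11 : σ₁.mem 11 = σ.mem 11 := hag.2 11 rfl
  rw [← q8, ← q9] at hfc
  rw [← q11] at hbad
  rw [← q2] at hM ⊢
  clear q8 q9 q11 hag T hrt htx
  have hrt := T1.bd root T1.tree.root_mem
  have hS0 : ∀ y, y ∈ S ↔ y ∈ X ∧ A x y := by
    intro y
    rw [hSm, hX]
    constructor
    · intro h
      have := G.range _ _ h.2
      exact ⟨by omega, h.2⟩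
    · intro h
      have := G.range _ _ h.2
      exact ⟨by omega, h.2⟩
  refine Runs.seq (T₁ := d * 950 + 850) (T₂ := 50) (R := fun σ₂ => (∃ N' L' g e',
      Stores A X N' root σ₂ L' (-1) e' ∧ x ∉ N' ∧ σ₂.reg 12 = g ∧ g ∈ N' ∧ g ∉ X ∧
      (∀ a ∈ L' g, ∀ y ∈ X, y ∉ L' g → (A x y ↔ A a y)) ∧
      (∀ y ∈ L' g, (A x y ↔ σ₂.mem 7 g = 1)) ∧ ∀ t ∈ N', t ≠ g → t ≠ e') ∧ σ₂.reg 3 = x ∧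
      (∀ t, σ₂.mem 8 t = 0 ∧ σ₂.mem 9 t = 0) ∧ (∀ t, σ₂.mem 11 t ≤ x + 1) ∧
      σ₂.reg 2 ≤ σ₁.reg 2 + 2) ?_ ?_ |>.mono (by omega) (fun _ h => h)
  swap
  · rintro σ₂ ⟨⟨N', L', g, e', T2, hxN', h12, hg, hgX, m1, m2, m3⟩, h3, hfc', hbad', hu⟩
    obtain ⟨L'', T3⟩ := T2.tree.addLeaf hA hg hgX hxN' (by omega) (T2.lf x hx0 (by omega)) m1 m2 m3
    refine (addLeaf_runs (M := M) T2 h12 h3 hg hgX hxN' T3 hx0 (by omega) (by omega) hB).mono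
      le_rfl ?_
    rintro σ₃ ⟨T4, hag⟩
    have r8 : σ₃.mem 8 = σ₂.mem 8 := hag.2 8 rfl
    have r9 : σ₃.mem 9 = σ₂.mem 9 := hag.2 9 rfl
    have r11 : σ₃.mem 11 = σ₂.mem 11 := hag.2 11 rfl
    have r2 : σ₃.reg 2 = σ₂.reg 2 := hag.1 2 rfl
    rw [r8, r9, r11, r2]
    exact ⟨⟨_, _, T4⟩, hfc', hbad', hu⟩
  refine (Runs.ite (T := d * 950 + 800) (fun hg => ?_) (fun hg => ?_)).mono
    (by simp only [Guard.cost, Exp.cost]; omega) (fun _ h => h)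
  · have hS00 : S = ∅ := by
      have := hS.card
      simp only [Guard.Holds, Exp.eval] at hg
      rw [hg] at this
      exact Finset.card_eq_zero.1 (by exact_mod_cast this)
    refine Runs.of_wp_le ?_ (by simp only [Prog.maxcost, Exp.cost]; omega)
    simp only [wp, Exp.eval, Guard.Holds, State.setReg, State.setMem, update_self, update_of_ne, ne_eq,
      Nat.reduceEqDiff, not_false_eq_true, abs_le, q0, q3]
    refine ⟨by omega, ⟨N, L, root, -1, T1.of_eq rfl rfl rfl rfl (by simp), hxN, hroot,
      T1.tree.root_mem, T1.tree.root_not, fun a ha y hy hyr => ?_, fun y hy => ?_, fun t ht _ h =>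
      T1.tree.neg (h ▸ ht)⟩, trivial, hfc, fun t => by have := hbad t; omega, by omega⟩
    · rw [T1.tree.L_root] at hyr
      exact absurd hy hyr
    · rw [T1.tree.typ_root]
      simp only [zero_ne_one, iff_false]
      intro h
      rw [T1.tree.L_root] at hy
      have := (hS0 y).2 ⟨hy, h⟩
      simp [hS00] at this
  · have hSne : S.Nonempty := by
      rw [Finset.nonempty_iff_ne_empty]
      rintro rfl
      have := hS.card
      simp only [Guard.Holds, Exp.eval] at hg
      exact hg (by simpa using this.symm)
    obtain ⟨a₀, ha₀⟩ := hSne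
    have hSX : S ⊆ X := fun y hy => ((hS0 y).1 hy).1
    have hrm : Mixed A L x root := by
      rw [Mixed, T1.tree.L_root]
      refine ⟨⟨a₀, (hS0 a₀).1 ha₀⟩, n, (hX n).2 (by simp), fun h => ?_⟩
      have := G.range _ _ h
      omega
    obtain ⟨u, hu, hum, hlow⟩ := T1.tree.exists_lowest root T1.tree.root_mem hrm
    have hSd : S.card ≤ d := by omega
    have hbdM : ∀ t ∈ N, 0 ≤ t ∧ t < M := fun t ht => by have := T1.bd t ht; omega
    have hFc := (card_fullNodes_le (S₀ := S) T1.tree).trans (Nat.mul_le_mul_left 2 hSd)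
    set F := fullNodes N L S with hFdef
    have hF : ∀ t, t ∈ F ↔ t ∈ N ∧ Full A L x t := by
      intro t
      rw [hFdef, mem_fullNodes]
      refine and_congr_right fun ht => ⟨fun h a ha => ((hS0 a).1 (h ha)).2, fun h a ha => ?_⟩
      exact (hS0 a).2 ⟨T1.tree.L_sub ht ha, h a ha⟩
    have hrF : root ∉ F := fun h => hrm.not_full ((hF root).1 h).2
    have hFN : F ⊆ N := fun t ht => ((hF t).1 ht).1
    -- the sweep
    refine ((sweep_runs T1.tree T1.counts (by omega) hbdM hB hS hSX (fun t => (hfc t).1)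
      (fun t => (hfc t).2)).agree.seq (T₂ := d * 850 + 700) ?_).mono (by omega) (fun _ h => h)
    rintro σ₂ ⟨I, hag2⟩
    rw [← hFdef] at I
    have T2 : Stores A X N root σ₂ L (-1) (-1) := T1.of_eq (hag2.2 4 rfl) (hag2.2 5 rfl)
      (hag2.2 6 rfl) (hag2.2 7 rfl) (hag2.1 2 rfl)
    have b4 : σ₂.mem 4 = σ₁.mem 4 := hag2.2 4 rfl
    have b5 : σ₂.mem 5 = σ₁.mem 5 := hag2.2 5 rfl
    have b11 : σ₂.mem 11 = σ₁.mem 11 := hag2.2 11 rfl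
    have b3 : σ₂.reg 3 = x := (hag2.1 3 rfl).trans q3
    have b2 : σ₂.reg 2 = σ₁.reg 2 := hag2.1 2 rfl
    rw [← b4, ← b5] at I
    rw [← b2] at hM ⊢
    rw [← b11] at hbad
    have htouch : ∀ v ∈ F, σ₂.mem 8 (σ₂.mem 4 v) ≠ σ₂.mem 5 (σ₂.mem 4 v) ↔
        Touched A N (σ₂.mem 4) L x (σ₂.mem 4 v) := fun v hv => chs_full_ne T2.tree hF hrF I hv
    have hlow' : ∀ c ∈ N, σ₂.mem 4 c = u → ¬ Mixed A L x c := by rwa [b4]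
    clear hlow hfc T1 hag2 b4 b5 b11 hrt
    have hrt := T2.bd root T2.tree.root_mem
    -- marking
    refine ((badLoop_runs T2 I.enumS hFN b3 hx0 (by omega) hbad (by omega) hB).seq
      (T₂ := d * 690 + 650) ?_).mono (by omega) (fun _ h => h)
    rintro σ₃ ⟨⟨hb1, hb2⟩, hag3⟩
    have T3 : Stores A X N root σ₃ L (-1) (-1) := T2.of_eq (hag3.2 4 rfl) (hag3.2 5 rfl)
      (hag3.2 6 rfl) (hag3.2 7 rfl) (hag3.1 2 rfl)
    have c4 : σ₃.mem 4 = σ₂.mem 4 := hag3.2 4 rfl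
    have c5 : σ₃.mem 5 = σ₂.mem 5 := hag3.2 5 rfl
    have c8 : σ₃.mem 8 = σ₂.mem 8 := hag3.2 8 rfl
    have c9 : σ₃.mem 9 = σ₂.mem 9 := hag3.2 9 rfl
    have c10 : σ₃.mem 10 = σ₂.mem 10 := hag3.2 10 rfl
    have c3 : σ₃.reg 3 = x := (hag3.1 3 rfl).trans b3
    have c2 : σ₃.reg 2 = σ₂.reg 2 := hag3.1 2 rfl
    have cr5 : σ₃.reg 5 = σ₂.reg 5 := hag3.1 5 rfl
    have hufind : ∀ v ∈ F, σ₃.mem 4 v = u ↔ σ₃.mem 8 (σ₃.mem 4 v) ≠ σ₃.mem 5 (σ₃.mem 4 v) ∧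
        σ₃.mem 11 (σ₃.mem 4 v) ≠ x + 1 := by
      intro v hv
      rw [c4, c5, c8, T2.tree.lowest_iff hA hu hum hlow', htouch v hv, ne_eq, hb2]
      refine and_congr_right fun _ => ?_
      simp only [not_exists, not_and, not_or]
      constructor
      · intro h w hw hw'
        exact h _ ((htouch w hw).1 hw')
      · rintro h s ⟨hs, hsm, c, hc, rfl, hcf⟩
        have hcF := (hF c).2 ⟨hc, hcf⟩
        exact h c hcF ((htouch c hcF).2 ⟨hs, hsm, c, hc, rfl, hcf⟩)
    obtain ⟨a₁, ha₁, ha₁u, ha₁f⟩ := (T3.tree.touched_of_lowest hu hum (by rwa [c4])).2.2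
    refine ((findLoop_runs T3 (by rw [c10, cr5]; exact I.enumS) hFN c3 hufind (by omega) hB).seq
      (T₂ := d * 530 + 600) ?_).mono (by omega) (fun _ h => h)
    rintro σ₄ ⟨hfind, hag4⟩
    obtain ⟨f8, f19, f19'⟩ := hfind ⟨a₁, (hF _).2 ⟨ha₁, ha₁f⟩, ha₁u⟩
    have T4 : Stores A X N root σ₄ L (-1) (-1) := T3.of_eq (hag4.2 4 rfl) (hag4.2 5 rfl)
      (hag4.2 6 rfl) (hag4.2 7 rfl) (hag4.1 2 rfl)
    have d4 : σ₄.mem 4 = σ₂.mem 4 := (hag4.2 4 rfl).trans c4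
    have d5 : σ₄.mem 5 = σ₂.mem 5 := (hag4.2 5 rfl).trans c5
    have d8 : σ₄.mem 8 = σ₂.mem 8 := (hag4.2 8 rfl).trans c8
    have d9 : σ₄.mem 9 = σ₂.mem 9 := (hag4.2 9 rfl).trans c9
    have d10 : σ₄.mem 10 = σ₂.mem 10 := (hag4.2 10 rfl).trans c10
    have d11 : σ₄.mem 11 = σ₃.mem 11 := hag4.2 11 rfl
    have d3 : σ₄.reg 3 = x := (hag4.1 3 rfl).trans c3
    have d2 : σ₄.reg 2 = σ₂.reg 2 := (hag4.1 2 rfl).trans c2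
    have dr5 : σ₄.reg 5 = σ₂.reg 5 := (hag4.1 5 rfl).trans cr5
    have huX := hum.not_leaf T2.tree
    have hub := T2.bd u hu
    have hu1 : u ≠ -1 := by omega
    have htyp := T4.tree.typ_int u hu huX
    have hcount := I.count u hu1
    rw [c4] at f19'
    set τ := σ₄.mem 7 u with hτ
    have hsum : 0 ≤ σ₂.mem 9 u ∧ σ₂.mem 9 u ≤ M * M := by
      rw [hcount.2]
      refine sum_le_of_bound hM0 fun t ht => hbdM t ?_
      exact hFN (mem_chs.1 ht).1
    have hcnt : 0 ≤ σ₂.mem 8 u ∧ σ₂.mem 8 u ≤ M := by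
      rw [hcount.1]
      refine ⟨by positivity, card_le_of_bound hM0 fun t ht => hbdM t ?_⟩
      exact hFN (mem_chs.1 ht).1
    refine ((Runs.of_wp (Q := fun σ' => σ' = ((σ₄.setReg 9 τ).setReg 10 (σ₂.mem 8 u)).setReg 11
      (σ₂.mem 9 u)) ?_).seq (T₂ := d * 530 + 550) ?_).mono
      (by simp only [Prog.maxcost, Exp.cost]; omega) (fun _ h => h)
    · simp only [wp, Exp.eval, Guard.Holds, State.setReg, State.setMem, update_self, update_of_ne, ne_eq,
      Nat.reduceEqDiff, not_false_eq_true, abs_le, f8, d8, d9]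
      exact ⟨by omega, by omega, by omega, rfl⟩
    rintro σ₅ rfl
    have T5 : Stores A X N root (((σ₄.setReg 9 τ).setReg 10 (σ₂.mem 8 u)).setReg 11
      (σ₂.mem 9 u)) L (-1) (-1) := T4.of_eq rfl rfl rfl rfl (by simp [State.setReg])
    refine ((resetLoop_runs (M := M) (F := F) T5 ?_ hFN ?_ ?_ hB).seq
      (T₂ := d * 370 + 500) ?_).mono (by omega) (fun _ h => h)
    · simp only [State.setReg, ne_eq, Nat.reduceEqDiff, not_false_eq_true, Function.update_of_ne,
        d10, dr5]
      exact I.enumS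
    · simp only [State.setReg, d4, d8, d9]
      intro t ht
      by_cases ht1 : t = -1
      · rw [ht1]; exact I.neg
      · have : chs F (σ₂.mem 4) t = ∅ := by
          ext c
          simp only [mem_chs, Finset.notMem_empty, iff_false, not_and]
          exact fun hc => ht c hc
        have h := I.count t ht1
        rw [this] at h
        simpa using h
    · simp [State.setReg, d2]; omega
    rintro σ₆ ⟨hfc6, hag6⟩
    have T6 : Stores A X N root σ₆ L (-1) (-1) := T5.of_eq (hag6.2 4 rfl) (hag6.2 5 rfl)
      (hag6.2 6 rfl) (hag6.2 7 rfl) (hag6.1 2 rfl)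
    have e4 : σ₆.mem 4 = σ₂.mem 4 := (hag6.2 4 rfl).trans d4
    have e7 : σ₆.mem 7 u = τ := by rw [hag6.2 7 rfl, hτ]; rfl
    have e10 : σ₆.mem 10 = σ₂.mem 10 := (hag6.2 10 rfl).trans d10
    have e11 : σ₆.mem 11 = σ₃.mem 11 := (hag6.2 11 rfl).trans d11
    have er3 : σ₆.reg 3 = x := (hag6.1 3 rfl).trans (by simp [State.setReg, d3])
    have er2 : σ₆.reg 2 = σ₂.reg 2 := (hag6.1 2 rfl).trans (by simp [State.setReg, d2])
    have er5 : σ₆.reg 5 = σ₂.reg 5 := (hag6.1 5 rfl).trans (by simp [State.setReg, dr5])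
    have er8 : σ₆.reg 8 = u := (hag6.1 8 rfl).trans (by simp [State.setReg, f8])
    have er19 : σ₆.reg 19 = σ₄.reg 19 := (hag6.1 19 rfl).trans (by simp [State.setReg])
    have er9 : σ₆.reg 9 = τ := (hag6.1 9 rfl).trans (by simp [State.setReg])
    have er10 : σ₆.reg 10 = σ₂.mem 8 u := (hag6.1 10 rfl).trans (by simp [State.setReg])
    have er11 : σ₆.reg 11 = σ₂.mem 9 u := (hag6.1 11 rfl).trans (by simp [State.setReg])
    refine ((regroup_runs (M := M) (a := σ₄.reg 19) (x := x) T6 hF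
      (by rw [e10, er5]; exact I.enumS) hu hum (par := σ₆.mem 4) (by rwa [e4]) rfl er8 er19 f19
      (by rw [e4]; exact f19') er9 e7 (by rw [er10, e4]; exact hcount.1)
      (by rw [er11, e4]; exact hcount.2) hx0 (by omega) hxN (by omega) hB).seq
      (T₂ := 200) ?_).mono (by omega) (fun _ h => h)
    rintro σ₇ ⟨⟨N₁, L₁, e, c, h12, T7, hxN₁, hc, hcr, hpc, he, hLc, h2⟩, hag7⟩
    have g9 : σ₇.reg 9 = τ := (hag7.1 9 rfl).trans er9
    refine (split_runs (M := M) T7 h12 hc hcr g9 htyp hpc he (by omega) hB).mono (by omega) ?_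
    rintro σ₈ ⟨⟨N₂, L₂, e₂, g, h12', T8, hg2, hgX, htg, hLg, hne, hN₂, h2'⟩, hag8⟩
    have i3 : σ₈.reg 3 = x := (hag8.1 3 rfl).trans ((hag7.1 3 rfl).trans er3)
    have i8 : σ₈.mem 8 = σ₆.mem 8 := (hag8.2 8 rfl).trans (hag7.2 8 rfl)
    have i9 : σ₈.mem 9 = σ₆.mem 9 := (hag8.2 9 rfl).trans (hag7.2 9 rfl)
    have i11 : σ₈.mem 11 = σ₃.mem 11 := (hag8.2 11 rfl).trans ((hag7.2 11 rfl).trans e11)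
    have hr7 := T7.bd root T7.tree.root_mem
    refine ⟨⟨N₂, L₂, g, e₂, T8, fun h => ?_, h12', hg2, hgX, ?_, ?_, hne⟩, i3, by rwa [i8, i9],
      by rwa [i11], by omega⟩
    · rcases hN₂ x h with h | h
      · exact hxN₁ h
      · omega
    · intro a ha y hy hyg
      rw [hLg, hLc] at ha hyg
      by_cases hyu : y ∈ L u
      · have h1 : A x y ↔ ¬ τ = 0 := by tauto
        rcases htyp with h | h
        · have h2 := T2.tree.adj_of_lowest hu hum hlow' ha.1 hyu (ha.2.2 h) (by tauto)
          have : τ = σ₂.mem 7 u := by rw [hτ, hag4.2 7 rfl, hag3.2 7 rfl]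
          rw [h2, h1, ← this]
          omega
        · have h2 := T2.tree.adj_of_lowest hu hum hlow' hyu ha.1 (h1.2 (by omega))
            (fun h' => by have := ha.2.1 h'; omega)
          have : τ = σ₂.mem 7 u := by rw [hτ, hag4.2 7 rfl, hag3.2 7 rfl]
          have h3 : A a y ↔ A y a := ⟨hA.symm, hA.symm⟩
          rw [h3, h2, h1, ← this]
          omega
      · exact T2.tree.module_of_lowest hA hu hum ha.1 hy hyu
    · intro y hy
      rw [hLg, hLc] at hy
      rw [hy.2, htg]
      omega

end

open Function (update update_self update_of_ne)

/-- The cotree of two isolated phantom vertices. -/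
def initP : Prog :=
  (6 ≔ 𝒞 0 ;; .loop (ℛ 6 ≤ₑ (ℛ 0 +ₑ 𝒞 1)) (.write 7 (ℛ 6) (𝒞 2) ;; 6 ≔ ℛ 6 +ₑ 𝒞 1)) ;;
  .write 4 (𝒞 (-1)) (𝒞 (-1)) ;; .write 4 (ℛ 0 +ₑ 𝒞 2) (𝒞 (-1)) ;; .write 4 (ℛ 0) (ℛ 0 +ₑ 𝒞 2) ;;
  .write 4 (ℛ 0 +ₑ 𝒞 1) (ℛ 0 +ₑ 𝒞 2) ;; .write 5 (ℛ 0 +ₑ 𝒞 2) (𝒞 2) ;;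
  .write 6 (ℛ 0 +ₑ 𝒞 2) (ℛ 0 +ₑ ℛ 0 +ₑ 𝒞 1) ;; .write 7 (ℛ 0 +ₑ 𝒞 2) (𝒞 0) ;;
  2 ≔ ℛ 0 +ₑ 𝒞 3 ;; 3 ≔ 𝒞 0

/-- Compute the cotree of the input graph, extended by two isolated vertices. -/
def buildP : Prog :=
  initP ;; .loop ((ℛ 3 +ₑ 𝒞 1) ≤ₑ ℛ 0) (insertP ;; 3 ≔ ℛ 3 +ₑ 𝒞 1)

theorem Cotree.phantoms {A : ℤ → ℤ → Prop} {n : ℤ} {par typ : ℤ → ℤ} (hn : 0 ≤ n)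
    (hA : ∀ x y, A x y → (0 ≤ x ∧ x < n) ∧ 0 ≤ y ∧ y < n) (h0 : par n = n + 2)
    (h1 : par (n + 1) = n + 2) (h2 : par (n + 2) = -1) (h3 : par (-1) = -1) (t0 : typ n = 2)
    (t1 : typ (n + 1) = 2) (t2 : typ (n + 2) = 0) :
    Cotree A {n, n + 1} {n, n + 1, n + 2} (n + 2) par typ
      (fun t => if t = n + 2 then {n, n + 1} else {t}) (-1) (-1) where
  X_sub := by intro y; simp; tauto
  root_mem := by simp
  root_not := by simp
  neg := by simp; omega
  par_root := h2
  par_neg := h3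
  par_mem := by
    intro v hv hvr
    have : v = n ∨ v = n + 1 := by simp at hv; tauto
    rcases this with rfl | rfl <;> simp [h0, h1]
  leaf := by
    intro v hv
    have : v = n ∨ v = n + 1 := by simpa using hv
    rcases this with rfl | rfl <;> simp [t0, t1]
  typ_int := by
    intro t ht htX
    have : t = n + 2 := by simp at ht htX; omega
    rw [this]; exact .inl t2
  typ_root := t2
  mem_L := by
    intro t ht htX y
    have : t = n + 2 := by simp at ht htX; omega
    subst this
    simp only [if_true, Finset.mem_insert, Finset.mem_singleton]
    constructor
    · rintro (rfl | rfl)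
      · exact ⟨y, by simp, h0, by simp⟩
      · exact ⟨n + 1, by simp, h1, by simp⟩
    · rintro ⟨c, rfl | rfl | rfl, hc, h⟩
      · simp at h; exact .inl h
      · simp at h; exact .inr h
      · omega
  ne := by
    intro t _
    split_ifs <;> simp
  disj := by
    rintro c hc d hd hcd hp y h1' h2'
    have hc' : c ≠ n + 2 := by
      rintro rfl
      have : d = n ∨ d = n + 1 := by simp at hd; omega
      rcases this with rfl | rfl <;> omega
    have hd' : d ≠ n + 2 := by
      rintro rfl
      have : c = n ∨ c = n + 1 := by simp at hc; omega
      rcases this with rfl | rfl <;> omega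
    simp only [hc', hd', if_false, Finset.mem_singleton] at h1' h2'
    exact hcd (h1'.symm.trans h2')
  adj := by
    rintro c hc d hd hcd hp a ha b hb
    have hc' : c ≠ n + 2 := by
      rintro rfl
      have : d = n ∨ d = n + 1 := by simp at hd; omega
      rcases this with rfl | rfl <;> omega
    have hd' : d ≠ n + 2 := by
      rintro rfl
      have : c = n ∨ c = n + 1 := by simp at hc; omega
      rcases this with rfl | rfl <;> omega
    simp only [hc', hd', if_false, Finset.mem_singleton] at ha hb
    subst ha hb
    have hcn : a = n ∨ a = n + 1 := by simp at hc; omega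
    have hpa : par a = n + 2 := by rcases hcn with rfl | rfl <;> assumption
    rw [hpa, t2]
    simp only [zero_ne_one, iff_false]
    intro h
    have := hA _ _ h
    omega
  L_root := by simp
  alt := by
    intro c hc hcX hcr
    simp at hc hcX
    omega
  two := by
    intro t ht htX _
    have : t = n + 2 := by simp at ht htX; omega
    subst this
    exact ⟨n, by simp, n + 1, by simp, by simp, h0, h1⟩
  rank := by
    refine ⟨fun t => if t = n + 2 then 1 else 0, fun c hc hcr => ?_⟩
    have : c = n ∨ c = n + 1 := by simp at hc; tauto
    rcases this with rfl | rfl <;> simp [h0, h1]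

section

variable {A : ℤ → ℤ → Prop} {B : ℕ} {σ : State} {M n : ℤ}

theorem init_runs (hn : 0 ≤ n) (h0 : σ.reg 0 = n)
    (hA : ∀ x y, A x y → (0 ≤ x ∧ x < n) ∧ 0 ≤ y ∧ y < n)
    (hB : 2 * n + 10 ≤ B) :
    Runs B initP σ (n.toNat * 20 + 200) (fun σ' =>
      (∃ N L, Stores A {n, n + 1} N (n + 2) σ' L (-1) (-1)) ∧ σ'.reg 2 = n + 3 ∧ σ'.reg 3 = 0 ∧
      Agree initP σ σ') := by
  refine Runs.mono (Q := fun σ' => ((∃ N L, Stores A {n, n + 1} N (n + 2) σ' L (-1) (-1)) ∧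
    σ'.reg 2 = n + 3 ∧ σ'.reg 3 = 0) ∧ Agree initP σ σ') (Runs.agree ?_) le_rfl (fun _ h => by tauto)
  refine Runs.seq (T₁ := n.toNat * 20 + 100) (T₂ := 80) (R := fun σ₁ =>
    (∀ v, 0 ≤ v → v < n + 2 → σ₁.mem 7 v = 2) ∧ σ₁.reg 0 = n) ?_ ?_ |>.mono (by omega) (fun _ h => h)
  · refine ((Runs.of_wp (Q := fun σ' => σ' = σ.setReg 6 0) ?_).seq
      (T₂ := n.toNat * 20 + 80) ?_).mono (by simp only [Prog.maxcost, Exp.cost]; omega)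
      (fun _ h => h)
    · simp [wp, Exp.eval]
    rintro σ₁ rfl
    refine (Runs.loop 13 (fun σ' => 0 ≤ σ'.reg 6 ∧ ∀ v, 0 ≤ v → v < σ'.reg 6 → σ'.mem 7 v = 2)
      (fun σ' => (n + 2 - σ'.reg 6).toNat) ?_ ?_).mono ?_ ?_
    · simp only [wp, Exp.eval, Guard.Holds, State.setReg, State.setMem, update_self, update_of_ne, ne_eq,
      Nat.reduceEqDiff, not_false_eq_true, abs_le]
      refine ⟨le_rfl, fun v _ _ => by omega⟩
    · rintro σ₂ hag ⟨i1, i2⟩ hg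
      have e0 : σ₂.reg 0 = n := (hag.1 0 rfl).trans (by simpa [State.setReg] using h0)
      simp only [Guard.Holds, Exp.eval, e0] at hg
      refine Runs.of_wp_le ?_ (by decide)
      simp only [wp, Exp.eval, Guard.Holds, State.setReg, State.setMem, update_self, update_of_ne, ne_eq,
      Nat.reduceEqDiff, not_false_eq_true, abs_le]
      refine ⟨by omega, by omega, by omega, ⟨by omega, fun v h1 h2 => ?_⟩, by omega⟩
      rw [Function.update_apply]
      split_ifs with h
      · rfl
      · exact i2 v h1 (by omega)
    · simp only [State.setReg, Function.update_self, Guard.cost, Exp.cost]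
      omega
    · rintro σ' ⟨⟨i1, i2⟩, hg, hag⟩
      have e0 : σ'.reg 0 = n := (hag.1 0 rfl).trans (by simpa [State.setReg] using h0)
      simp only [Guard.Holds, Exp.eval, e0] at hg
      exact ⟨fun v h1 h2 => i2 v h1 (by omega), e0⟩
  rintro σ₁ ⟨htyp, e0⟩
  refine Runs.of_wp_le ?_ (by decide)
  simp only [wp, Exp.eval, Guard.Holds, State.setReg, State.setMem, update_self, update_of_ne, ne_eq,
      Nat.reduceEqDiff, not_false_eq_true, abs_le, e0]
  refine ⟨by omega, by omega, by omega, by omega, by omega, by omega, by omega, by omega, by omega,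
    by omega, by omega, by omega, by omega, by omega, by omega, by omega,
    ⟨{n, n + 1, n + 2}, fun t => if t = n + 2 then {n, n + 1} else {t}, ?_⟩, trivial, trivial⟩
  refine ⟨Cotree.phantoms hn hA ?_ ?_ ?_ ?_ ?_ ?_ ?_, ?_, ?_, by omega, ?_, ?_⟩
  · simp only [wp, Exp.eval, Guard.Holds, State.setReg, State.setMem, update_self, update_of_ne, ne_eq,
      Nat.reduceEqDiff, not_false_eq_true, abs_le]
    rw [Function.update_of_ne (by omega), Function.update_self]
  · simp only [wp, Exp.eval, Guard.Holds, State.setReg, State.setMem, update_self, update_of_ne, ne_eq,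
      Nat.reduceEqDiff, not_false_eq_true, abs_le]
  · simp only [wp, Exp.eval, Guard.Holds, State.setReg, State.setMem, update_self, update_of_ne, ne_eq,
      Nat.reduceEqDiff, not_false_eq_true, abs_le]
    rw [Function.update_of_ne (by omega), Function.update_of_ne (by omega), Function.update_self]
  · simp only [wp, Exp.eval, Guard.Holds, State.setReg, State.setMem, update_self, update_of_ne, ne_eq,
      Nat.reduceEqDiff, not_false_eq_true, abs_le]
    rw [Function.update_of_ne (by omega), Function.update_of_ne (by omega),
      Function.update_of_ne (by omega), Function.update_self]
  · simp only [wp, Exp.eval, Guard.Holds, State.setReg, State.setMem, update_self, update_of_ne, ne_eq,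
      Nat.reduceEqDiff, not_false_eq_true, abs_le]
    rw [Function.update_of_ne (by omega)]; exact htyp _ (by omega) (by omega)
  · simp only [wp, Exp.eval, Guard.Holds, State.setReg, State.setMem, update_self, update_of_ne, ne_eq,
      Nat.reduceEqDiff, not_false_eq_true, abs_le]
    rw [Function.update_of_ne (by omega)]; exact htyp _ (by omega) (by omega)
  · simp only [wp, Exp.eval, Guard.Holds, State.setReg, State.setMem, update_self, update_of_ne, ne_eq,
      Nat.reduceEqDiff, not_false_eq_true, abs_le]
  · intro t ht htX
    have : t = n + 2 := by simp at ht htX; omega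
    subst this
    have : chs {n, n + 1, n + 2} (update (update (update (update (σ₁.mem 4) (-1) (-1)) (n + 2) (-1)) n
        (n + 2)) (n + 1) (n + 2)) (n + 2) = {n, n + 1} := by
      ext c
      simp only [mem_chs, Finset.mem_insert, Finset.mem_singleton, Function.update_apply]
      split_ifs <;> omega
    simp only [State.setReg, State.setMem, Function.update_self, Function.update_of_ne, ne_eq,
      Nat.reduceEqDiff, not_false_eq_true, this]
    rw [Finset.card_pair (by omega), Finset.sum_pair (by omega)]
    exact ⟨rfl, by ring⟩
  · intro t ht
    simp only [wp, Exp.eval, Guard.Holds, State.setReg, State.setMem, update_self, update_of_ne, ne_eq,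
      Nat.reduceEqDiff, not_false_eq_true, abs_le]
    simp at ht
    omega
  · intro v h1 h2
    simp only [wp, Exp.eval, Guard.Holds, State.setReg, State.setMem, update_self, update_of_ne, ne_eq,
      Nat.reduceEqDiff, not_false_eq_true, abs_le]
    rw [Function.update_of_ne (by omega)]; exact htyp _ (by omega) (by omega)
  · intro t ht htX
    simp at ht htX
    omega

theorem build_runs (hn : 0 ≤ n) (h0 : σ.reg 0 = n) (hA : IsCograph A)
    (G : Lists A n (σ.mem 0) (σ.mem 1)) (hfc : ∀ t, σ.mem 8 t = 0 ∧ σ.mem 9 t = 0)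
    (hbad : ∀ t, σ.mem 11 t ≤ 0) (hM : 3 * n + 5 ≤ M) (hB : M * M + M + 5 ≤ B)
    (hoff : ∀ x, 0 ≤ x → x < n → σ.mem 0 (x + 1) ≤ σ.mem 0 n) (hoff' : σ.mem 0 n ≤ B) :
    Runs B buildP σ ((σ.mem 0 n - σ.mem 0 0).toNat * 1000 + n.toNat * 1100 + 300) (fun σ' =>
      ((∃ X N L, Stores A X N (n + 2) σ' L (-1) (-1) ∧ ∀ y, y ∈ X ↔ 0 ≤ y ∧ y < n + 2) ∧
        (∀ t, σ'.mem 8 t = 0 ∧ σ'.mem 9 t = 0) ∧ σ'.reg 2 ≤ M) ∧ Agree buildP σ σ') := by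
  refine Runs.agree ?_
  have hMM : 0 ≤ M * M := mul_nonneg (by omega) (by omega)
  refine ((init_runs hn h0 G.range (by omega)).seq
    (T₂ := (σ.mem 0 n - σ.mem 0 0).toNat * 1000 + n.toNat * 1050 + 20) ?_).mono (by omega)
    (fun _ h => h)
  rintro σ₁ ⟨⟨N, L, T⟩, h2, h3, hag⟩
  have a0 : σ₁.mem 0 = σ.mem 0 := hag.2 0 rfl
  have a1 : σ₁.mem 1 = σ.mem 1 := hag.2 1 rfl
  have a8 : σ₁.mem 8 = σ.mem 8 := hag.2 8 rfl
  have a9 : σ₁.mem 9 = σ.mem 9 := hag.2 9 rfl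
  have a11 : σ₁.mem 11 = σ.mem 11 := hag.2 11 rfl
  have ar : σ₁.reg 0 = n := (hag.1 0 rfl).trans h0
  refine (Runs.loop_potential (fun σ' => (0 ≤ σ'.reg 3 ∧ σ'.reg 3 ≤ n) ∧
      (∃ X N L, Stores A X N (n + 2) σ' L (-1) (-1) ∧
        ∀ y, y ∈ X ↔ (0 ≤ y ∧ y < σ'.reg 3) ∨ y = n ∨ y = n + 1) ∧
      (∀ t, σ'.mem 8 t = 0 ∧ σ'.mem 9 t = 0) ∧ (∀ t, σ'.mem 11 t ≤ σ'.reg 3) ∧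
      σ'.reg 2 ≤ 2 * σ'.reg 3 + n + 3)
    (fun σ' => (σ.mem 0 n - σ.mem 0 (σ'.reg 3)).toNat * 1000 + (n - σ'.reg 3).toNat * 1020)
    ?_ ?_).mono ?_ ?_
  · rw [h3, a8, a9, a11, h2]
    refine ⟨⟨le_rfl, hn⟩, ⟨_, N, L, T, fun y => ?_⟩, hfc, hbad, by omega⟩
    simp only [Finset.mem_insert, Finset.mem_singleton]
    omega
  · rintro σ₂ hag2 ⟨⟨i1, i2⟩, ⟨X, N, L, T, hX⟩, i4, i5, i6⟩ hg
    have b0 : σ₂.mem 0 = σ.mem 0 := (hag2.2 0 rfl).trans a0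
    have b1 : σ₂.mem 1 = σ.mem 1 := (hag2.2 1 rfl).trans a1
    have br : σ₂.reg 0 = n := (hag2.1 0 rfl).trans ar
    simp only [Guard.Holds, Exp.eval, br] at hg
    have hm1 := hoff (σ₂.reg 3) i1 (by omega)
    have hm2 := G.mono (σ₂.reg 3) i1 (by omega)
    refine ⟨_, ((insert_runs (M := M) T hA (by rwa [b0, b1]) br rfl hX rfl i1 (by omega) i4 i5
      (by omega) hB (by rw [b0]; exact hm1.trans hoff')).seq (T₂ := 4) ?_).mono le_rfl
      (fun _ h => h)⟩
    rintro σ₃ ⟨⟨⟨N', L', T'⟩, j1, j2, j3⟩, hag3⟩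
    have e3 : σ₃.reg 3 = σ₂.reg 3 := hag3.1 3 rfl
    refine Runs.of_wp_le ?_ (by decide)
    simp only [wp, Exp.eval, Guard.Holds, State.setReg, State.setMem, update_self, update_of_ne, ne_eq,
      Nat.reduceEqDiff, not_false_eq_true, abs_le, e3, b0, Guard.cost, Exp.cost]
    refine ⟨by omega, ⟨by omega, ⟨_, N', L', T'.of_eq rfl rfl rfl rfl (by simp), fun y => ?_⟩, j1,
      j2, by omega⟩, by omega⟩
    rw [Finset.mem_insert, hX]
    omega
  · rw [h3]
    simp only [Guard.cost, Exp.cost]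
    omega
  · rintro σ' ⟨⟨⟨i1, i2⟩, ⟨X, N, L, T, hX⟩, i4, i5, i6⟩, hg, hag2⟩
    have br : σ'.reg 0 = n := (hag2.1 0 rfl).trans ar
    simp only [Guard.Holds, Exp.eval, br] at hg
    refine ⟨⟨X, N, L, T, fun y => ?_⟩, i4, by omega⟩
    rw [hX]
    omega

end

open Function (update)

/-! ## Dynamic programming on the cotree -/

/-- Any two elements of `K` are adjacent. -/
def Clique (A : ℤ → ℤ → Prop) (K : Finset ℤ) : Prop := ∀ a ∈ K, ∀ b ∈ K, a ≠ b → A a b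

/-- `K` induces a disjoint union of cliques. -/
def Cluster (A : ℤ → ℤ → Prop) (K : Finset ℤ) : Prop :=
  ∀ a ∈ K, ∀ b ∈ K, ∀ c ∈ K, A a b → A b c → a ≠ c → A a c

theorem Clique.cluster {A : ℤ → ℤ → Prop} {K : Finset ℤ} (h : Clique A K) : Cluster A K :=
  fun a ha _ _ c hc _ _ hac => h a ha c hc hac

theorem Clique.mono {A : ℤ → ℤ → Prop} {K K' : Finset ℤ} (h : Clique A K) (hK : K' ⊆ K) :
    Clique A K' := fun a ha b hb => h a (hK ha) b (hK hb)

theorem Cluster.mono {A : ℤ → ℤ → Prop} {K K' : Finset ℤ} (h : Cluster A K) (hK : K' ⊆ K) :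
    Cluster A K' := fun a ha b hb c hc => h a (hK ha) b (hK hb) c (hK hc)

theorem clique_empty (A : ℤ → ℤ → Prop) : Clique A ∅ := fun a ha => by simp at ha

/-- The tables of the dynamic program: maximum weight `mc` of a clique, maximum weight `r` of a
cluster graph, total weight `tw`, and numbers of inner children (`nb`) and of children that are
joins but not cliques (`nc`). -/
structure Tables (X N : Finset ℤ) (par typ w mc mr r best tw nb nc : ℤ → ℤ) : Prop where
  leaf : ∀ v ∈ X, mc v = max (w v) 0 ∧ r v = max (w v) 0 ∧ tw v = w v
  tw_eq : ∀ t ∈ N, t ∉ X → tw t = ∑ c ∈ chs N par t, tw c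
  nb_eq : ∀ t ∈ N, t ∉ X → nb t = ((chs N par t).filter (· ∉ X)).card
  nc_eq : ∀ t ∈ N, t ∉ X → nc t = ((chs N par t).filter (fun c => typ c = 1 ∧ nb c ≠ 0)).card
  union : ∀ t ∈ N, typ t = 0 → r t = ∑ c ∈ chs N par t, r c
  union_mc : ∀ t ∈ N, typ t = 0 → (∀ c ∈ chs N par t, mc c ≤ mc t) ∧ best t ∈ chs N par t ∧
    mc (best t) = mc t
  join : ∀ t ∈ N, typ t = 1 → mc t = ∑ c ∈ chs N par t, mc c
  join_r : ∀ t ∈ N, typ t = 1 → (∀ c ∈ chs N par t, r c ≤ mr t) ∧ best t ∈ chs N par t ∧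
    r (best t) = mr t ∧ r t = max (mc t) (mr t)

section

variable {A : ℤ → ℤ → Prop} {X N : Finset ℤ} {root : ℤ} {par typ : ℤ → ℤ} {L : ℤ → Finset ℤ}
  {w mc mr r best tw nb nc : ℤ → ℤ}

namespace Cotree

theorem leaf_of_typ (T : Cotree A X N root par typ L (-1) (-1)) {t : ℤ} (ht : t ∈ N) :
    (t ∈ X ∧ typ t = 2 ∧ L t = {t}) ∨ (t ∉ X ∧ typ t = 0) ∨ (t ∉ X ∧ typ t = 1) := by
  by_cases h : t ∈ X
  · exact .inl ⟨h, (T.leaf t h).2, (T.leaf t h).1⟩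
  · rcases T.typ_int t ht h with h' | h' <;> tauto

/-- The leaves below `t` are partitioned by the children of `t`. -/
theorem sum_chs (T : Cotree A X N root par typ L (-1) (-1)) {t : ℤ} (ht : t ∈ N) (htX : t ∉ X)
    {K : Finset ℤ} (hK : K ⊆ L t) (f : ℤ → ℤ) :
    ∑ y ∈ K, f y = ∑ c ∈ chs N par t, ∑ y ∈ K ∩ L c, f y := by
  rw [← Finset.sum_biUnion]
  · congr 1
    ext y
    simp only [Finset.mem_biUnion, Finset.mem_inter, mem_chs]
    constructor
    · intro hy
      obtain ⟨c, hc, hct, hyc⟩ := (T.mem_L t ht htX y).1 (hK hy)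
      exact ⟨c, ⟨hc, hct⟩, hy, hyc⟩
    · rintro ⟨c, _, hy, _⟩
      exact hy
  · intro c hc d hd hcd
    simp only [Finset.mem_coe, mem_chs] at hc hd
    refine Finset.disjoint_left.2 fun y hy hy' => ?_
    simp only [Finset.mem_inter] at hy hy'
    exact T.disj c hc.1 d hd.1 hcd (hc.2.trans hd.2.symm) y hy.2 hy'.2

theorem sum_L (T : Cotree A X N root par typ L (-1) (-1)) {t : ℤ} (ht : t ∈ N) (htX : t ∉ X)
    (f : ℤ → ℤ) : ∑ y ∈ L t, f y = ∑ c ∈ chs N par t, ∑ y ∈ L c, f y := by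
  rw [T.sum_chs ht htX subset_rfl]
  refine Finset.sum_congr rfl fun c hc => ?_
  rw [mem_chs] at hc
  rw [Finset.inter_eq_right.2 (T.sub_of_par hc.1 ht hc.2)]

/-- A clique below a union lies below a child of it. -/
theorem clique_union (T : Cotree A X N root par typ L (-1) (-1)) {t : ℤ} (ht : t ∈ N)
    (htyp : typ t = 0) (htX : t ∉ X) {K : Finset ℤ} (hK : K ⊆ L t) (hc : Clique A K)
    (hne : K.Nonempty) : ∃ c ∈ chs N par t, K ⊆ L c := by
  obtain ⟨a, ha⟩ := hne
  obtain ⟨c, hcN, hct, hac⟩ := (T.mem_L t ht htX a).1 (hK ha)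
  refine ⟨c, mem_chs.2 ⟨hcN, hct⟩, fun b hb => ?_⟩
  obtain ⟨d, hd, hdt, hbd⟩ := (T.mem_L t ht htX b).1 (hK hb)
  by_cases hcd : c = d
  · rwa [hcd]
  have hab : a ≠ b := by
    rintro rfl
    exact T.disj c hcN d hd hcd (hct.trans hdt.symm) a hac hbd
  have := (T.adj c hcN d hd hcd (hct.trans hdt.symm) a hac b hbd).1 (hc a ha b hb hab)
  rw [hct] at this
  omega

/-- A cluster graph below a join is a clique unless it lies below a child. -/
theorem cluster_join (T : Cotree A X N root par typ L (-1) (-1)) (hA : IsCograph A) {t : ℤ}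
    (ht : t ∈ N) (htyp : typ t = 1) (htX : t ∉ X) {K : Finset ℤ} (hK : K ⊆ L t)
    (hc : Cluster A K) : Clique A K ∨ ∃ c ∈ chs N par t, K ⊆ L c := by
  by_cases h : ∃ c ∈ chs N par t, K ⊆ L c
  · exact .inr h
  push Not at h
  left
  intro a ha b hb hab
  obtain ⟨c, hcN, hct, hac⟩ := (T.mem_L t ht htX a).1 (hK ha)
  obtain ⟨d, hd, hdt, hbd⟩ := (T.mem_L t ht htX b).1 (hK hb)
  have key : ∀ {c d a b}, c ∈ N → d ∈ N → par c = t → par d = t → a ∈ L c → b ∈ L d → c ≠ d →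
      A a b := by
    intro c d a b hc hd hct hdt ha hb hcd
    rw [T.adj c hc d hd hcd (hct.trans hdt.symm) a ha b hb, hct, htyp]
  by_cases hcd : c = d
  · subst hcd
    obtain ⟨z, hz, hzc⟩ := Finset.not_subset.1 (h c (mem_chs.2 ⟨hcN, hct⟩))
    obtain ⟨e, he, het, hze⟩ := (T.mem_L t ht htX z).1 (hK hz)
    have hce : c ≠ e := by rintro rfl; exact hzc hze
    exact hc a ha z hz b hb (key hcN he hct het hac hze hce)
      (key he hcN het hct hze hbd hce.symm) hab
  · exact key hcN hd hct hdt hac hbd hcd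

theorem clique_join (T : Cotree A X N root par typ L (-1) (-1)) {t : ℤ}
    (ht : t ∈ N) (htyp : typ t = 1) (htX : t ∉ X) {K : Finset ℤ} (hK : K ⊆ L t)
    (hc : ∀ c ∈ chs N par t, Clique A (K ∩ L c)) : Clique A K := by
  intro a ha b hb hab
  obtain ⟨c, hcN, hct, hac⟩ := (T.mem_L t ht htX a).1 (hK ha)
  obtain ⟨d, hd, hdt, hbd⟩ := (T.mem_L t ht htX b).1 (hK hb)
  by_cases hcd : c = d
  · subst hcd
    exact hc c (mem_chs.2 ⟨hcN, hct⟩) a (by simp [ha, hac]) b (by simp [hb, hbd]) hab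
  · rw [T.adj c hcN d hd hcd (hct.trans hdt.symm) a hac b hbd, hct, htyp]

theorem cluster_union (T : Cotree A X N root par typ L (-1) (-1)) {t : ℤ}
    (ht : t ∈ N) (htyp : typ t = 0) (htX : t ∉ X) {K : Finset ℤ} (hK : K ⊆ L t)
    (hc : ∀ c ∈ chs N par t, Cluster A (K ∩ L c)) : Cluster A K := by
  have key : ∀ {a b c}, c ∈ N → par c = t → a ∈ L c → b ∈ K → A a b → b ∈ L c := by
    intro a b c hcN hct hac hb hab
    obtain ⟨d, hd, hdt, hbd⟩ := (T.mem_L t ht htX b).1 (hK hb)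
    by_cases hcd : c = d
    · rwa [hcd]
    · rw [T.adj c hcN d hd hcd (hct.trans hdt.symm) a hac b hbd, hct] at hab
      omega
  intro a ha b hb e he hab hbe hae
  obtain ⟨c, hcN, hct, hac⟩ := (T.mem_L t ht htX a).1 (hK ha)
  have hbc := key hcN hct hac hb hab
  have hec := key hcN hct hbc he hbe
  exact hc c (mem_chs.2 ⟨hcN, hct⟩) a (by simp [ha, hac]) b (by simp [hb, hbc]) e
    (by simp [he, hec]) hab hbe hae

theorem typ_not_leaf (T : Cotree A X N root par typ L (-1) (-1)) {t : ℤ} (htyp : typ t ≠ 2) :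
    t ∉ X := fun h => htyp (T.leaf t h).2

end Cotree

namespace Tables

open Cotree

theorem nonneg (D : Tables X N par typ w mc mr r best tw nb nc)
    (T : Cotree A X N root par typ L (-1) (-1)) : ∀ t ∈ N, 0 ≤ mc t ∧ 0 ≤ r t := by
  refine T.induct _ fun t ht ih => ?_
  rcases T.leaf_of_typ ht with ⟨h, _⟩ | ⟨h, htyp⟩ | ⟨h, htyp⟩
  · obtain ⟨h1, h2, _⟩ := D.leaf t h
    rw [h1, h2]
    simp
  · obtain ⟨_, h2, h3⟩ := D.union_mc t ht htyp
    rw [← h3, D.union t ht htyp]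
    rw [mem_chs] at h2
    refine ⟨(ih _ h2.1 h2.2).1, Finset.sum_nonneg fun c hc => ?_⟩
    rw [mem_chs] at hc
    exact (ih c hc.1 hc.2).2
  · have h1 : 0 ≤ mc t := by
      rw [D.join t ht htyp]
      refine Finset.sum_nonneg fun c hc => ?_
      rw [mem_chs] at hc
      exact (ih c hc.1 hc.2).1
    obtain ⟨_, _, _, h4⟩ := D.join_r t ht htyp
    rw [h4]
    exact ⟨h1, h1.trans (le_max_left _ _)⟩

theorem tw_sum (D : Tables X N par typ w mc mr r best tw nb nc)
    (T : Cotree A X N root par typ L (-1) (-1)) : ∀ t ∈ N, tw t = ∑ y ∈ L t, w y := by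
  refine T.induct _ fun t ht ih => ?_
  by_cases h : t ∈ X
  · rw [(D.leaf t h).2.2, (T.leaf t h).1, Finset.sum_singleton]
  · rw [D.tw_eq t ht h, T.sum_L ht h]
    refine Finset.sum_congr rfl fun c hc => ?_
    rw [mem_chs] at hc
    exact ih c hc.1 hc.2

theorem clique_le (D : Tables X N par typ w mc mr r best tw nb nc)
    (T : Cotree A X N root par typ L (-1) (-1)) : ∀ t ∈ N, ∀ K ⊆ L t, Clique A K →
      ∑ y ∈ K, w y ≤ mc t := by
  refine T.induct _ fun t ht ih K hK hc => ?_
  rcases T.leaf_of_typ ht with ⟨h, _, hL⟩ | ⟨h, htyp⟩ | ⟨h, htyp⟩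
  · rw [(D.leaf t h).1]
    rw [hL, Finset.subset_singleton_iff] at hK
    rcases hK with rfl | rfl <;> simp
  · rcases K.eq_empty_or_nonempty with rfl | hne
    · simpa using (D.nonneg T t ht).1
    · obtain ⟨c, hct, hKc⟩ := T.clique_union ht htyp h hK hc hne
      have := (D.union_mc t ht htyp).1 c hct
      rw [mem_chs] at hct
      exact (ih c hct.1 hct.2 K hKc hc).trans this
  · rw [D.join t ht htyp, T.sum_chs ht h hK]
    refine Finset.sum_le_sum fun c hct => ?_
    rw [mem_chs] at hct
    exact ih c hct.1 hct.2 _ Finset.inter_subset_right (hc.mono Finset.inter_subset_left)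

theorem cluster_le (D : Tables X N par typ w mc mr r best tw nb nc)
    (T : Cotree A X N root par typ L (-1) (-1)) (hA : IsCograph A) : ∀ t ∈ N, ∀ K ⊆ L t,
      Cluster A K → ∑ y ∈ K, w y ≤ r t := by
  refine T.induct _ fun t ht ih K hK hc => ?_
  rcases T.leaf_of_typ ht with ⟨h, _, hL⟩ | ⟨h, htyp⟩ | ⟨h, htyp⟩
  · rw [(D.leaf t h).2.1]
    rw [hL, Finset.subset_singleton_iff] at hK
    rcases hK with rfl | rfl <;> simp
  · rw [D.union t ht htyp, T.sum_chs ht h hK]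
    refine Finset.sum_le_sum fun c hct => ?_
    rw [mem_chs] at hct
    exact ih c hct.1 hct.2 _ Finset.inter_subset_right (hc.mono Finset.inter_subset_left)
  · obtain ⟨h1, _, _, h4⟩ := D.join_r t ht htyp
    rw [h4]
    rcases T.cluster_join hA ht htyp h hK hc with hc' | ⟨c, hct, hKc⟩
    · exact (D.clique_le T t ht K hK hc').trans (le_max_left _ _)
    · have := h1 c hct
      rw [mem_chs] at hct
      exact ((ih c hct.1 hct.2 K hKc hc).trans this).trans (le_max_right _ _)

end Tables

/-! ## Tracing back -/

/-- The mode that a node inherits from its parent: `1` if an optimal cluster graph is to be kept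
below it, `2` for an optimal clique, `3` for everything, `4` for nothing, `5` for the vertices of
positive weight. -/
def inherit (typ mc mr best mode : ℤ → ℤ) (p v : ℤ) : ℤ :=
  if typ p = 0 then if mode p = 2 ∧ best p ≠ v then 4 else mode p
  else if mode p = 1 then if mr p ≤ mc p then 2 else if best p = v then 1 else 4
  else mode p

/-- The modes of the nodes, where `ov` contains the modes that are not inherited. -/
structure Modes (N : Finset ℤ) (root : ℤ) (par typ mc mr best ov mode : ℤ → ℤ) : Prop where
  ov_of : ∀ v ∈ N, ov v ≠ 0 → mode v = ov v
  inh : ∀ v ∈ N, v ≠ root → ov v = 0 → mode v = inherit typ mc mr best mode (par v) v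

/-- The vertices that are kept. -/
def kept (w mode : ℤ → ℤ) (S : Finset ℤ) : Finset ℤ :=
  S.filter (fun y => mode y = 3 ∨ (mode y ≠ 4 ∧ 0 < w y))

theorem kept_inter {w mode : ℤ → ℤ} {S S' : Finset ℤ} (h : S' ⊆ S) :
    kept w mode S ∩ S' = kept w mode S' := by
  ext y
  simp only [kept, Finset.mem_inter, Finset.mem_filter]
  constructor
  · tauto
  · intro hy
    exact ⟨⟨h hy.1, hy.2⟩, hy.1⟩

theorem kept_sub {w mode : ℤ → ℤ} {S : Finset ℤ} : kept w mode S ⊆ S := Finset.filter_subset _ _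

/-- What the mode of `t` promises about the kept vertices below `t`. -/
structure Selects (A : ℤ → ℤ → Prop) (L : ℤ → Finset ℤ) (w mc r mode : ℤ → ℤ) (t : ℤ) : Prop where
  one : mode t = 1 → Cluster A (kept w mode (L t)) ∧ ∑ y ∈ kept w mode (L t), w y = r t
  two : mode t = 2 → Clique A (kept w mode (L t)) ∧ ∑ y ∈ kept w mode (L t), w y = mc t
  three : mode t = 3 → kept w mode (L t) = L t
  four : mode t = 4 → kept w mode (L t) = ∅
  five : mode t = 5 → kept w mode (L t) = (L t).filter (fun y => 0 < w y)

/-- No modes are prescribed strictly below `t`. -/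
def Free (N : Finset ℤ) (par ov : ℤ → ℤ) (t : ℤ) : Prop :=
  ∀ c ∈ N, Anc N par c t → c ≠ t → ov c = 0

namespace Cotree

theorem kept_sum (T : Cotree A X N root par typ L (-1) (-1)) {t : ℤ} (ht : t ∈ N) (htX : t ∉ X)
    (mode : ℤ → ℤ) (f : ℤ → ℤ) :
    ∑ y ∈ kept w mode (L t), f y = ∑ c ∈ chs N par t, ∑ y ∈ kept w mode (L c), f y := by
  rw [T.sum_chs ht htX kept_sub]
  refine Finset.sum_congr rfl fun c hc => ?_
  rw [mem_chs] at hc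
  rw [kept_inter (T.sub_of_par hc.1 ht hc.2)]

theorem mem_kept (T : Cotree A X N root par typ L (-1) (-1)) {t : ℤ} (ht : t ∈ N) (htX : t ∉ X)
    {mode : ℤ → ℤ} {y : ℤ} :
    y ∈ kept w mode (L t) ↔ ∃ c ∈ chs N par t, y ∈ kept w mode (L c) := by
  simp only [kept, Finset.mem_filter, T.mem_L t ht htX, mem_chs]
  constructor
  · rintro ⟨⟨c, h1, h2, h3⟩, h4⟩
    exact ⟨c, ⟨h1, h2⟩, h3, h4⟩
  · rintro ⟨c, ⟨h1, h2⟩, h3, h4⟩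
    exact ⟨⟨c, h1, h2, h3⟩, h4⟩

end Cotree

theorem Modes.selects {ov mode : ℤ → ℤ} (Mo : Modes N root par typ mc mr best ov mode)
    (D : Tables X N par typ w mc mr r best tw nb nc)
    (T : Cotree A X N root par typ L (-1) (-1)) :
    ∀ t ∈ N, Free N par ov t → Selects A L w mc r mode t := by
  refine T.induct _ fun t ht ih hfree => ?_
  by_cases htX : t ∈ X
  · have hL := (T.leaf t htX).1
    have hD := D.leaf t htX
    have hk : kept w mode (L t) = if mode t = 3 ∨ (mode t ≠ 4 ∧ 0 < w t) then {t} else ∅ := by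
      rw [hL, kept, Finset.filter_singleton]
    have hcl : Clique A (kept w mode (L t)) := by
      intro a ha b hb hab
      have ha := kept_sub ha
      have hb := kept_sub hb
      rw [hL, Finset.mem_singleton] at ha hb
      exact absurd (ha.trans hb.symm) hab
    have hsum : mode t ≠ 3 → mode t ≠ 4 → ∑ y ∈ kept w mode (L t), w y = max (w t) 0 := by
      intro h3 h4
      rw [hk]
      split_ifs with h
      · rw [Finset.sum_singleton, max_eq_left]
        rcases h with h | h
        · exact absurd h h3
        · omega
      · rw [Finset.sum_empty, max_eq_right]
        push Not at h
        exact h.2 h4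
    refine ⟨fun h => ⟨hcl.cluster, ?_⟩, fun h => ⟨hcl, ?_⟩, fun h => ?_, fun h => ?_, fun h => ?_⟩
    · rw [hsum (by omega) (by omega), hD.2.1]
    · rw [hsum (by omega) (by omega), hD.1]
    · rw [hk, hL, if_pos (.inl h)]
    · rw [hk, if_neg (by omega)]
    · rw [hk, hL, Finset.filter_singleton]
      simp [h]
  have hch : ∀ c ∈ chs N par t, Selects A L w mc r mode c ∧
      mode c = inherit typ mc mr best mode t c := by
    intro c hc
    rw [mem_chs] at hc
    have hct : Anc N par c t := .single ⟨hc.1, ht, hc.2⟩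
    have hne : c ≠ t := fun h => T.not_anc_of_par ht (h ▸ hc.2) .refl
    refine ⟨ih c hc.1 hc.2 fun d hd hdc hdc' => hfree d hd (hdc.trans hct) ?_, ?_⟩
    · rintro rfl
      exact T.not_anc_of_par ht hc.2 hdc
    · rw [Mo.inh c hc.1 (T.ne_root_of_par ht hc.2) (hfree c hc.1 hct hne), hc.2]
  have hkc : ∀ c ∈ chs N par t, kept w mode (L t) ∩ L c = kept w mode (L c) := fun c hc =>
    kept_inter (T.sub_of_par (mem_chs.1 hc).1 ht (mem_chs.1 hc).2)
  have hall : ∀ (m : ℤ), (∀ c ∈ chs N par t, mode c = m) →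
      (m = 3 → kept w mode (L t) = L t) ∧ (m = 4 → kept w mode (L t) = ∅) ∧
      (m = 5 → kept w mode (L t) = (L t).filter (fun y => 0 < w y)) := by
    intro m hm
    refine ⟨?_, ?_, ?_⟩
    · rintro rfl
      ext y
      rw [T.mem_kept ht htX, T.mem_L t ht htX]
      constructor
      · rintro ⟨c, hc, hy⟩
        rw [(hch c hc).1.three (hm c hc)] at hy
        rw [mem_chs] at hc
        exact ⟨c, hc.1, hc.2, hy⟩
      · rintro ⟨c, h1, h2, hy⟩
        have hc := mem_chs.2 ⟨h1, h2⟩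
        exact ⟨c, hc, by rwa [(hch c hc).1.three (hm c hc)]⟩
    · rintro rfl
      ext y
      rw [T.mem_kept ht htX]
      simp only [Finset.notMem_empty, iff_false]
      rintro ⟨c, hc, hy⟩
      rw [(hch c hc).1.four (hm c hc)] at hy
      simp at hy
    · rintro rfl
      ext y
      rw [T.mem_kept ht htX, Finset.mem_filter, T.mem_L t ht htX]
      constructor
      · rintro ⟨c, hc, hy⟩
        rw [(hch c hc).1.five (hm c hc), Finset.mem_filter] at hy
        rw [mem_chs] at hc
        exact ⟨⟨c, hc.1, hc.2, hy.1⟩, hy.2⟩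
      · rintro ⟨⟨c, h1, h2, hy⟩, hw⟩
        have hc := mem_chs.2 ⟨h1, h2⟩
        exact ⟨c, hc, by rw [(hch c hc).1.five (hm c hc), Finset.mem_filter]; exact ⟨hy, hw⟩⟩
  -- only one child is kept
  have hone : ∀ b ∈ chs N par t, (∀ c ∈ chs N par t, c ≠ b → mode c = 4) →
      kept w mode (L t) = kept w mode (L b) := by
    intro b hb h
    ext y
    rw [T.mem_kept ht htX]
    constructor
    · rintro ⟨c, hc, hy⟩
      by_cases hcb : c = b
      · rwa [← hcb]
      · rw [(hch c hc).1.four (h c hc hcb)] at hy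
        simp at hy
    · exact fun hy => ⟨b, hb, hy⟩
  rcases T.typ_int t ht htX with htyp | htyp
  · have hm : mode t ≠ 2 → ∀ c ∈ chs N par t, mode c = mode t := by
      intro h c hc
      rw [(hch c hc).2, inherit, if_pos htyp, if_neg (by tauto)]
    refine ⟨fun h => ?_, fun h => ?_, fun h => (hall _ (hm (by omega))).1 h,
      fun h => (hall _ (hm (by omega))).2.1 h, fun h => (hall _ (hm (by omega))).2.2 h⟩
    · refine ⟨T.cluster_union ht htyp htX kept_sub fun c hc => ?_, ?_⟩
      · rw [hkc c hc]
        exact ((hch c hc).1.one (by rw [hm (by omega) c hc, h])).1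
      · rw [T.kept_sum ht htX, D.union t ht htyp]
        exact Finset.sum_congr rfl fun c hc => ((hch c hc).1.one (by rw [hm (by omega) c hc, h])).2
    · obtain ⟨_, hb, hbm⟩ := D.union_mc t ht htyp
      rw [hone _ hb, ← hbm]
      · refine (hch _ hb).1.two ?_
        rw [(hch _ hb).2, inherit, if_pos htyp, if_neg (by tauto), h]
      · intro c hc hcb
        rw [(hch _ hc).2, inherit, if_pos htyp, if_pos ⟨h, hcb.symm⟩]
  · have h01 : typ t ≠ 0 := by omega
    have hm : mode t ≠ 1 → ∀ c ∈ chs N par t, mode c = mode t := by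
      intro h c hc
      rw [(hch c hc).2, inherit, if_neg h01, if_neg h]
    have hcl : (∀ c ∈ chs N par t, mode c = 2) →
        Clique A (kept w mode (L t)) ∧ ∑ y ∈ kept w mode (L t), w y = mc t := by
      intro h
      refine ⟨T.clique_join ht htyp htX kept_sub fun c hc => ?_, ?_⟩
      · rw [hkc c hc]
        exact ((hch c hc).1.two (h c hc)).1
      · rw [T.kept_sum ht htX, D.join t ht htyp]
        exact Finset.sum_congr rfl fun c hc => ((hch c hc).1.two (h c hc)).2
    refine ⟨fun h => ?_, fun h => hcl fun c hc => by rw [hm (by omega) c hc, h],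
      fun h => (hall _ (hm (by omega))).1 h,
      fun h => (hall _ (hm (by omega))).2.1 h, fun h => (hall _ (hm (by omega))).2.2 h⟩
    obtain ⟨_, hb, hbm, hr⟩ := D.join_r t ht htyp
    by_cases hle : mr t ≤ mc t
    · obtain ⟨h1, h2⟩ := hcl fun c hc => by
        rw [(hch _ hc).2, inherit, if_neg h01, if_pos h, if_pos hle]
      exact ⟨h1.cluster, by rw [h2, hr, max_eq_left hle]⟩
    · rw [hone _ hb, hr, max_eq_right (by omega), ← hbm]
      · refine (hch _ hb).1.one ?_
        rw [(hch _ hb).2, inherit, if_neg h01, if_pos h, if_neg hle, if_pos rfl]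
      · intro c hc hcb
        rw [(hch _ hc).2, inherit, if_neg h01, if_pos h, if_neg hle, if_neg hcb.symm]

end

open Function (update)

/-- Finish the table entries of the node in register 6. -/
def finishP : Prog :=
  .ite (7⟪ℛ 6⟫ =ₑ 𝒞 2)
    (.ite (2⟪ℛ 6⟫ ≤ₑ 𝒞 0) (.write 12 (ℛ 6) (𝒞 0) ;; .write 14 (ℛ 6) (𝒞 0))
      (.write 12 (ℛ 6) (2⟪ℛ 6⟫) ;; .write 14 (ℛ 6) (2⟪ℛ 6⟫)) ;;
      .write 16 (ℛ 6) (2⟪ℛ 6⟫))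
    (.ite (7⟪ℛ 6⟫ =ₑ 𝒞 0) (.write 14 (ℛ 6) (13⟪ℛ 6⟫))
      (.ite (13⟪ℛ 6⟫ ≤ₑ 12⟪ℛ 6⟫) (.write 14 (ℛ 6) (12⟪ℛ 6⟫)) (.write 14 (ℛ 6) (13⟪ℛ 6⟫))))

/-- Count the node in register 6 at its parent in register 7. -/
def countP : Prog :=
  .write 16 (ℛ 7) (16⟪ℛ 7⟫ +ₑ 16⟪ℛ 6⟫) ;;
  .ite (7⟪ℛ 6⟫ =ₑ 𝒞 2) .skip
    (.write 19 (ℛ 7) (19⟪ℛ 7⟫ +ₑ 𝒞 1) ;;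
      .ite (.and (7⟪ℛ 6⟫ =ₑ 𝒞 1) (.not (19⟪ℛ 6⟫ =ₑ 𝒞 0)))
        (.write 20 (ℛ 7) (20⟪ℛ 7⟫ +ₑ 𝒞 1)) .skip)

/-- Report the maxima of the node in register 6 to its parent in register 7. -/
def reportP : Prog :=
  .ite (7⟪ℛ 7⟫ =ₑ 𝒞 0)
    (.write 13 (ℛ 7) (13⟪ℛ 7⟫ +ₑ 14⟪ℛ 6⟫) ;;
      .ite (12⟪ℛ 7⟫ ≤ₑ 12⟪ℛ 6⟫) (.write 12 (ℛ 7) (12⟪ℛ 6⟫) ;; .write 15 (ℛ 7) (ℛ 6)) .skip)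
    (.write 12 (ℛ 7) (12⟪ℛ 7⟫ +ₑ 12⟪ℛ 6⟫) ;;
      .ite (13⟪ℛ 7⟫ ≤ₑ 14⟪ℛ 6⟫) (.write 13 (ℛ 7) (14⟪ℛ 6⟫) ;; .write 15 (ℛ 7) (ℛ 6)) .skip)

def upBody : Prog :=
  (6 ≔ 10⟪ℛ 4⟫ ;; 7 ≔ 4⟪ℛ 6⟫) ;; finishP ;; .ite (ℛ 6 =ₑ (ℛ 0 +ₑ 𝒞 2)) .skip (countP ;; reportP)

/-- The tables in the memory of the machine. -/
structure Table where
  (mc mr r best tw nb nc : ℤ → ℤ)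

def State.table (σ : State) : Table :=
  ⟨σ.mem 12, σ.mem 13, σ.mem 14, σ.mem 15, σ.mem 16, σ.mem 19, σ.mem 20⟩

/-- `b` is the last of the maximisers of `f` in `C`, and `m` is the maximum. -/
def IsMax (f : ℤ → ℤ) (C : Finset ℤ) (m b : ℤ) : Prop :=
  (∀ c ∈ C, f c ≤ m) ∧ (C = ∅ → m = 0) ∧ (C.Nonempty → b ∈ C ∧ f b = m)

theorem IsMax.insert_new {f : ℤ → ℤ} {C : Finset ℤ} {m b v : ℤ} (h : IsMax f C m b)
    (hv : m ≤ f v) : IsMax f (insert v C) (f v) v := by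
  refine ⟨fun c hc => ?_, fun h' => by simp at h', fun _ => ⟨by simp, rfl⟩⟩
  rcases Finset.mem_insert.1 hc with rfl | hc
  · exact le_rfl
  · exact (h.1 c hc).trans hv

theorem IsMax.insert_old {f : ℤ → ℤ} {C : Finset ℤ} {m b v : ℤ} (h : IsMax f C m b)
    (hv : f v < m) (h0 : 0 ≤ f v) : IsMax f (insert v C) m b := by
  refine ⟨fun c hc => ?_, fun h' => by simp at h', fun _ => ?_⟩
  · rcases Finset.mem_insert.1 hc with rfl | hc
    · exact hv.le
    · exact h.1 c hc
  · have hne : C.Nonempty := by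
      rw [Finset.nonempty_iff_ne_empty]
      intro h'
      have := h.2.1 h'
      omega
    exact ⟨Finset.mem_insert_of_mem (h.2.2 hne).1, (h.2.2 hne).2⟩

theorem IsMax.congr {f g : ℤ → ℤ} {C : Finset ℤ} {m b : ℤ} (h : IsMax f C m b)
    (hg : ∀ c ∈ C, g c = f c) : IsMax g C m b := by
  refine ⟨fun c hc => by rw [hg c hc]; exact h.1 c hc, h.2.1, fun hne => ?_⟩
  obtain ⟨h1, h2⟩ := h.2.2 hne
  exact ⟨h1, by rw [hg b h1, h2]⟩

/-- The entries of `t` account for the children in `C`. -/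
structure Acc (X : Finset ℤ) (typ : ℤ → ℤ) (D : Table) (C : Finset ℤ) (t : ℤ) : Prop where
  tw : D.tw t = ∑ c ∈ C, D.tw c
  nb : D.nb t = (C.filter (· ∉ X)).card
  nc : D.nc t = (C.filter (fun c => typ c = 1 ∧ D.nb c ≠ 0)).card
  union : typ t = 0 → D.mr t = ∑ c ∈ C, D.r c ∧ IsMax D.mc C (D.mc t) (D.best t)
  join : typ t = 1 → D.mc t = ∑ c ∈ C, D.mc c ∧ IsMax D.r C (D.mr t) (D.best t)

/-- The entries of `v` are final. -/
structure Finished (X : Finset ℤ) (typ w : ℤ → ℤ) (D : Table) (v : ℤ) : Prop where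
  leaf : v ∈ X → D.mc v = max (w v) 0 ∧ D.r v = max (w v) 0 ∧ D.tw v = w v
  union : typ v = 0 → D.r v = D.mr v
  join : typ v = 1 → D.r v = max (D.mc v) (D.mr v)

theorem Acc.congr {X : Finset ℤ} {typ : ℤ → ℤ} {D D' : Table} {C : Finset ℤ} {t : ℤ}
    (h : Acc X typ D C t) (h1 : D'.tw t = D.tw t) (h2 : D'.nb t = D.nb t) (h3 : D'.nc t = D.nc t)
    (h4 : D'.mc t = D.mc t) (h5 : D'.mr t = D.mr t) (h6 : D'.best t = D.best t)
    (hC : ∀ c ∈ C, D'.tw c = D.tw c ∧ D'.nb c = D.nb c ∧ D'.mc c = D.mc c ∧ D'.r c = D.r c) :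
    Acc X typ D' C t where
  tw := by
    rw [h1, h.tw]
    exact Finset.sum_congr rfl fun c hc => ((hC c hc).1).symm
  nb := by rw [h2, h.nb]
  nc := by
    rw [h3, h.nc]
    congr 2
    refine Finset.filter_congr fun c hc => ?_
    rw [(hC c hc).2.1]
  union := fun ht => by
    obtain ⟨a, b⟩ := h.union ht
    rw [h4, h5, h6, a]
    exact ⟨Finset.sum_congr rfl fun c hc => ((hC c hc).2.2.2).symm,
      b.congr fun c hc => (hC c hc).2.2.1⟩
  join := fun ht => by
    obtain ⟨a, b⟩ := h.join ht
    rw [h4, h5, h6, a]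
    exact ⟨Finset.sum_congr rfl fun c hc => ((hC c hc).2.2.1).symm,
      b.congr fun c hc => (hC c hc).2.2.2⟩

theorem Finished.congr {X : Finset ℤ} {typ w : ℤ → ℤ} {D D' : Table} {v : ℤ}
    (h : Finished X typ w D v) (h1 : D'.mc v = D.mc v) (h2 : D'.mr v = D.mr v)
    (h3 : D'.r v = D.r v) (h4 : D'.tw v = D.tw v) : Finished X typ w D' v where
  leaf := by rw [h1, h3, h4]; exact h.leaf
  union := by rw [h2, h3]; exact h.union
  join := by rw [h1, h2, h3]; exact h.join

/-- Total absolute weight. -/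
def absSum (w : ℤ → ℤ) (S : Finset ℤ) : ℤ := ∑ y ∈ S, |w y|

theorem absSum_mono {w : ℤ → ℤ} {S S' : Finset ℤ} (h : S ⊆ S') : absSum w S ≤ absSum w S' :=
  Finset.sum_le_sum_of_subset_of_nonneg h fun _ _ _ => abs_nonneg _

theorem absSum_nonneg {w : ℤ → ℤ} {S : Finset ℤ} : 0 ≤ absSum w S :=
  Finset.sum_nonneg fun _ _ => abs_nonneg _

/-- The entries of `v` are bounded by the weights below `v`. -/
structure Bounded (w : ℤ → ℤ) (L : ℤ → Finset ℤ) (D : Table) (v : ℤ) : Prop where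
  tw : |D.tw v| ≤ absSum w (L v)
  mc : 0 ≤ D.mc v ∧ D.mc v ≤ absSum w (L v)
  r : 0 ≤ D.r v ∧ D.r v ≤ absSum w (L v)

section

variable {A : ℤ → ℤ → Prop} {X N : Finset ℤ} {root : ℤ} {par typ w : ℤ → ℤ} {L : ℤ → Finset ℤ}

open Cotree

theorem IsMax.bound {f : ℤ → ℤ} {C : Finset ℤ} {m b M : ℤ} (h : IsMax f C m b) (hM : 0 ≤ M)
    (hC : ∀ c ∈ C, 0 ≤ f c ∧ f c ≤ M) : 0 ≤ m ∧ m ≤ M := by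
  rcases C.eq_empty_or_nonempty with hC' | hC'
  · rw [h.2.1 hC']
    exact ⟨le_rfl, hM⟩
  · obtain ⟨h1, h2⟩ := h.2.2 hC'
    rw [← h2]
    exact hC b h1

theorem absSum_chs (T : Cotree A X N root par typ L (-1) (-1)) {t : ℤ} (ht : t ∈ N) (htX : t ∉ X)
    {C : Finset ℤ} (hC : C ⊆ chs N par t) : ∑ c ∈ C, absSum w (L c) ≤ absSum w (L t) := by
  rw [absSum, T.sum_L ht htX]
  exact Finset.sum_le_sum_of_subset_of_nonneg hC fun _ _ _ => absSum_nonneg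

theorem Acc.bound (T : Cotree A X N root par typ L (-1) (-1)) {t : ℤ} (ht : t ∈ N) (htX : t ∉ X)
    {D : Table} {C : Finset ℤ} (h : Acc X typ D C t) (hC : C ⊆ chs N par t)
    (hb : ∀ c ∈ C, Bounded w L D c) :
    |D.tw t| ≤ absSum w (L t) ∧ (0 ≤ D.mc t ∧ D.mc t ≤ absSum w (L t)) ∧
      (0 ≤ D.mr t ∧ D.mr t ≤ absSum w (L t)) := by
  have hS := absSum_chs (w := w) T ht htX hC
  have hLc : ∀ c ∈ C, absSum w (L c) ≤ absSum w (L t) := fun c hc =>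
    absSum_mono (T.sub_of_par (mem_chs.1 (hC hc)).1 ht (mem_chs.1 (hC hc)).2)
  have hs : ∀ f : ℤ → ℤ, (∀ c ∈ C, 0 ≤ f c ∧ f c ≤ absSum w (L c)) →
      0 ≤ ∑ c ∈ C, f c ∧ ∑ c ∈ C, f c ≤ absSum w (L t) := fun f hf =>
    ⟨Finset.sum_nonneg fun c hc => (hf c hc).1,
      (Finset.sum_le_sum fun c hc => (hf c hc).2).trans hS⟩
  refine ⟨?_, ?_⟩
  · rw [h.tw]
    exact (Finset.abs_sum_le_sum_abs _ _).trans
      ((Finset.sum_le_sum fun c hc => (hb c hc).tw).trans hS)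
  · rcases T.typ_int t ht htX with h0 | h1
    · obtain ⟨a, b⟩ := h.union h0
      rw [a]
      exact ⟨b.bound absSum_nonneg fun c hc => ⟨(hb c hc).mc.1, (hb c hc).mc.2.trans (hLc c hc)⟩,
        hs _ fun c hc => (hb c hc).r⟩
    · obtain ⟨a, b⟩ := h.join h1
      rw [a]
      exact ⟨hs _ fun c hc => (hb c hc).mc,
        b.bound absSum_nonneg fun c hc => ⟨(hb c hc).r.1, (hb c hc).r.2.trans (hLc c hc)⟩⟩

/-- The state of the computation of the tables when the nodes in `P` have been processed. -/
structure UpInv (X N : Finset ℤ) (par typ w : ℤ → ℤ) (L : ℤ → Finset ℤ) (D : Table)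
    (P : Finset ℤ) : Prop where
  fin : ∀ v ∈ P, Finished X typ w D v
  acc : ∀ t ∈ N, t ∉ X → Acc X typ D (chs P par t) t
  bdd : ∀ v ∈ P, Bounded w L D v

theorem UpInv.tables (T : Cotree A X N root par typ L (-1) (-1)) {D : Table}
    (I : UpInv X N par typ w L D N) :
    Tables X N par typ w D.mc D.mr D.r D.best D.tw D.nb D.nc := by
  have hne : ∀ t ∈ N, t ∉ X → (chs N par t).Nonempty := by
    intro t ht htX
    have := two_le_chs T ht htX
    exact Finset.card_pos.1 (by omega)
  have hX : ∀ t ∈ N, typ t ≠ 2 → t ∉ X := fun t _ h h' => h (T.leaf t h').2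
  refine ⟨fun v hv => (I.fin v (T.X_sub hv)).leaf hv, fun t ht htX => (I.acc t ht htX).tw,
    fun t ht htX => (I.acc t ht htX).nb, fun t ht htX => (I.acc t ht htX).nc, fun t ht h => ?_,
    fun t ht h => ?_, fun t ht h => ?_, fun t ht h => ?_⟩
  · rw [(I.fin t ht).union h, ((I.acc t ht (hX t ht (by omega))).union h).1]
  · obtain ⟨_, a, _, b⟩ := (I.acc t ht (hX t ht (by omega))).union h
    exact ⟨a, b (hne t ht (hX t ht (by omega)))⟩
  · exact ((I.acc t ht (hX t ht (by omega))).join h).1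
  · obtain ⟨_, a, _, b⟩ := (I.acc t ht (hX t ht (by omega))).join h
    obtain ⟨c, d⟩ := b (hne t ht (hX t ht (by omega)))
    exact ⟨a, c, d, (I.fin t ht).join h⟩

/-- Adding a child to the accounts of a node. -/
theorem Acc.grow {D D' : Table} {C : Finset ℤ} {t v : ℤ} (h : Acc X typ D C t)
    (hv : v ∉ C) (hC : ∀ c ∈ insert v C, D'.tw c = D.tw c ∧ D'.nb c = D.nb c ∧ D'.mc c = D.mc c ∧
      D'.r c = D.r c) (h1 : D'.tw t = D.tw t + D.tw v)
    (h2 : D'.nb t = if v ∈ X then D.nb t else D.nb t + 1)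
    (h3 : D'.nc t = if typ v = 1 ∧ D.nb v ≠ 0 then D.nc t + 1 else D.nc t)
    (h4 : typ t = 0 → D'.mr t = D.mr t + D.r v ∧
      if D.mc t ≤ D.mc v then D'.mc t = D.mc v ∧ D'.best t = v else
        D'.mc t = D.mc t ∧ D'.best t = D.best t)
    (h5 : typ t = 1 → D'.mc t = D.mc t + D.mc v ∧
      if D.mr t ≤ D.r v then D'.mr t = D.r v ∧ D'.best t = v else
        D'.mr t = D.mr t ∧ D'.best t = D.best t)
    (hmc : 0 ≤ D.mc v) (hr : 0 ≤ D.r v) :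
    Acc X typ D' (insert v C) t := by
  have hsum : ∀ f f' : ℤ → ℤ, (∀ c ∈ insert v C, f' c = f c) →
      ∑ c ∈ insert v C, f' c = ∑ c ∈ C, f c + f v := by
    intro f f' hf
    rw [Finset.sum_congr rfl hf, Finset.sum_insert hv, add_comm]
  refine ⟨?_, ?_, ?_, fun ht => ?_, fun ht => ?_⟩
  · rw [hsum _ _ fun c hc => (hC c hc).1, h1, h.tw]
  · rw [h2, h.nb, Finset.filter_insert]
    split_ifs with hvX hvX
    · rfl
    · rw [Finset.card_insert_of_notMem (by simp [hv])]
      push_cast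
      rfl
  · have : (insert v C).filter (fun c => typ c = 1 ∧ D'.nb c ≠ 0) =
        (insert v C).filter (fun c => typ c = 1 ∧ D.nb c ≠ 0) :=
      Finset.filter_congr fun c hc => by rw [(hC c hc).2.1]
    rw [this, h3, h.nc, Finset.filter_insert]
    split_ifs with hvX
    · rw [Finset.card_insert_of_notMem (by simp [hv])]
      push_cast
      rfl
    · rfl
  · obtain ⟨a, b⟩ := h.union ht
    obtain ⟨a', b'⟩ := h4 ht
    rw [hsum _ _ fun c hc => (hC c hc).2.2.2, a', a]
    refine ⟨rfl, ?_⟩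
    split_ifs at b' with hle
    · rw [b'.1, b'.2]
      exact (b.insert_new hle).congr fun c hc => (hC c hc).2.2.1
    · rw [b'.1, b'.2]
      exact (b.insert_old (by omega) hmc).congr fun c hc => (hC c hc).2.2.1
  · obtain ⟨a, b⟩ := h.join ht
    obtain ⟨a', b'⟩ := h5 ht
    rw [hsum _ _ fun c hc => (hC c hc).2.2.1, a', a]
    refine ⟨rfl, ?_⟩
    split_ifs at b' with hle
    · rw [b'.1, b'.2]
      exact (b.insert_new hle).congr fun c hc => (hC c hc).2.2.2
    · rw [b'.1, b'.2]
      exact (b.insert_old (by omega) hr).congr fun c hc => (hC c hc).2.2.2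

/-- `D'` arises from `D` by finishing the entries of `v`. -/
structure Finish (X : Finset ℤ) (typ w : ℤ → ℤ) (D D' : Table) (v : ℤ) : Prop where
  done : Finished X typ w D' v
  r : ∀ t, t ≠ v → D'.r t = D.r t
  mc : ∀ t, t ≠ v → D'.mc t = D.mc t
  tw : ∀ t, t ≠ v → D'.tw t = D.tw t
  inner : v ∉ X → D'.mc = D.mc ∧ D'.tw = D.tw
  same : D'.mr = D.mr ∧ D'.best = D.best ∧ D'.nb = D.nb ∧ D'.nc = D.nc

/-- `D'` arises from `D` by adding the entries of `v` to those of `p`. -/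
structure Add (X : Finset ℤ) (typ : ℤ → ℤ) (D D' : Table) (v p : ℤ) : Prop where
  r : D'.r = D.r
  other : ∀ t, t ≠ p → D'.mc t = D.mc t ∧ D'.mr t = D.mr t ∧ D'.best t = D.best t ∧
    D'.tw t = D.tw t ∧ D'.nb t = D.nb t ∧ D'.nc t = D.nc t
  tw : D'.tw p = D.tw p + D.tw v
  nb : D'.nb p = if v ∈ X then D.nb p else D.nb p + 1
  nc : D'.nc p = if typ v = 1 ∧ D.nb v ≠ 0 then D.nc p + 1 else D.nc p
  union : typ p = 0 → D'.mr p = D.mr p + D.r v ∧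
      if D.mc p ≤ D.mc v then D'.mc p = D.mc v ∧ D'.best p = v else
        D'.mc p = D.mc p ∧ D'.best p = D.best p
  join : typ p = 1 → D'.mc p = D.mc p + D.mc v ∧
      if D.mr p ≤ D.r v then D'.mr p = D.r v ∧ D'.best p = v else
        D'.mr p = D.mr p ∧ D'.best p = D.best p

theorem UpInv.finish (T : Cotree A X N root par typ L (-1) (-1)) {D D' : Table} {P : Finset ℤ}
    {v : ℤ} (I : UpInv X N par typ w L D P) (hP : P ⊆ N) (hv : v ∈ N) (hvP : v ∉ P)
    (F : Finish X typ w D D' v) (hcl : v ∉ X → chs N par v ⊆ P) :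
    (∀ u ∈ insert v P, Finished X typ w D' u) ∧ (∀ t ∈ N, t ∉ X → Acc X typ D' (chs P par t) t) ∧
      (∀ u ∈ insert v P, Bounded w L D' u) := by
  have hne : ∀ u ∈ P, u ≠ v := by rintro u hu rfl; exact hvP hu
  have hacc : ∀ t ∈ N, t ∉ X → Acc X typ D' (chs P par t) t := by
    intro t ht htX
    have h1 : D'.mc t = D.mc t := by
      by_cases h : t = v
      · rw [(F.inner (h ▸ htX)).1]
      · exact F.mc t h
    have h2 : D'.tw t = D.tw t := by
      by_cases h : t = v
      · rw [(F.inner (h ▸ htX)).2]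
      · exact F.tw t h
    refine (I.acc t ht htX).congr h2 (by rw [F.same.2.2.1]) (by rw [F.same.2.2.2]) h1
      (by rw [F.same.1]) (by rw [F.same.2.1]) fun c hc => ?_
    have := hne c (mem_chs.1 hc).1
    exact ⟨F.tw c this, by rw [F.same.2.2.1], F.mc c this, F.r c this⟩
  have hbd : ∀ u ∈ P, Bounded w L D' u := by
    intro u hu
    have h := I.bdd u hu
    have := hne u hu
    exact ⟨by rw [F.tw u this]; exact h.tw, by rw [F.mc u this]; exact h.mc, by rw [F.r u this]; exact h.r⟩
  refine ⟨fun u hu => ?_, hacc, fun u hu => ?_⟩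
  · rcases Finset.mem_insert.1 hu with rfl | hu
    · exact F.done
    · have := hne u hu
      exact (I.fin u hu).congr (F.mc u this) (by rw [F.same.1]) (F.r u this) (F.tw u this)
  · rcases Finset.mem_insert.1 hu with rfl | hu
    · by_cases huX : u ∈ X
      · obtain ⟨h1, h2, h3⟩ := F.done.leaf huX
        have hs : absSum w (L u) = |w u| := by rw [absSum, (T.leaf u huX).1, Finset.sum_singleton]
        have hmax : 0 ≤ max (w u) 0 ∧ max (w u) 0 ≤ |w u| :=
          ⟨le_max_right _ _, max_le (le_abs_self _) (abs_nonneg _)⟩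
        exact ⟨by rw [h3, hs], by rw [h1, hs]; exact hmax, by rw [h2, hs]; exact hmax⟩
      · obtain ⟨a, b, c⟩ := (hacc u hv huX).bound (w := w) T hv huX
          (Finset.filter_subset_filter _ hP) fun c hc => hbd c (mem_chs.1 hc).1
        refine ⟨a, b, ?_⟩
        rcases T.typ_int u hv huX with h | h
        · rw [F.done.union h]; exact c
        · rw [F.done.join h]
          exact ⟨b.1.trans (le_max_left _ _), max_le b.2 c.2⟩
    · exact hbd u hu

theorem UpInv.add (T : Cotree A X N root par typ L (-1) (-1)) {D D' : Table} {P : Finset ℤ}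
    {v p : ℤ} (h1 : ∀ u ∈ insert v P, Finished X typ w D u)
    (h2 : ∀ t ∈ N, t ∉ X → Acc X typ D (chs P par t) t)
    (h3 : ∀ u ∈ insert v P, Bounded w L D u) (hvP : v ∉ P) (hp : par v = p)
    (hpP : p ∉ insert v P) (F : Add X typ D D' v p) :
    UpInv X N par typ w L D' (insert v P) := by
  have hne : ∀ u ∈ insert v P, u ≠ p := by rintro u hu rfl; exact hpP hu
  refine ⟨fun u hu => ?_, fun t ht htX => ?_, fun u hu => ?_⟩
  · have := F.other u (hne u hu)
    exact (h1 u hu).congr this.1 this.2.1 (by rw [F.r]) this.2.2.2.1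
  · have hC : ∀ c ∈ insert v P, D'.tw c = D.tw c ∧ D'.nb c = D.nb c ∧ D'.mc c = D.mc c ∧
      D'.r c = D.r c := by
      intro c hc
      have := F.other c (hne c hc)
      exact ⟨this.2.2.2.1, this.2.2.2.2.1, this.1, by rw [F.r]⟩
    by_cases htp : t = p
    · have hch : chs (insert v P) par t = insert v (chs P par t) := by
        ext c
        simp only [mem_chs, Finset.mem_insert]
        grind
      rw [hch]
      subst htp
      have hb := h3 v (by simp)
      refine (h2 t ht htX).grow (by simp [hvP]) (fun c hc => hC c ?_) F.tw F.nb F.nc F.union F.join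
        hb.mc.1 hb.r.1
      rcases Finset.mem_insert.1 hc with rfl | hc
      · simp
      · exact Finset.mem_insert_of_mem (mem_chs.1 hc).1
    · have hch : chs (insert v P) par t = chs P par t := by
        ext c
        simp only [mem_chs, Finset.mem_insert]
        grind
      rw [hch]
      have := F.other t htp
      exact (h2 t ht htX).congr this.2.2.2.1 this.2.2.2.2.1 this.2.2.2.2.2 this.1 this.2.1
        this.2.2.1 fun c hc => hC c (Finset.mem_insert_of_mem (mem_chs.1 hc).1)
  · have h := h3 u hu
    have := F.other u (hne u hu)
    exact ⟨by rw [this.2.2.2.1]; exact h.tw, by rw [this.1]; exact h.mc, by rw [F.r]; exact h.r⟩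

end

open Function (update update_self update_of_ne)

section

variable {A : ℤ → ℤ → Prop} {X N : Finset ℤ} {root : ℤ} {L : ℤ → Finset ℤ} {B : ℕ} {σ : State}
  {n v p W M : ℤ}

open Cotree

theorem finish_runs (h6 : σ.reg 6 = v) (hX : v ∈ X ↔ σ.mem 7 v = 2) (hv : 0 ≤ v ∧ v ≤ B)
    (htyp : σ.mem 7 v = 0 ∨ σ.mem 7 v = 1 ∨ σ.mem 7 v = 2) (hw : v ∈ X → |σ.mem 2 v| ≤ B)
    (hm : v ∉ X → (0 ≤ σ.mem 12 v ∧ σ.mem 12 v ≤ B) ∧ 0 ≤ σ.mem 13 v ∧ σ.mem 13 v ≤ B) :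
    Runs B finishP σ 50 (fun σ' => Finish X (σ.mem 7) (σ.mem 2) σ.table σ'.table v ∧
      Agree finishP σ σ') := by
  refine Runs.agree (Runs.of_wp_le ?_ (by decide))
  rw [abs_le] at hw
  simp only [wp, Exp.eval, Guard.Holds, State.setReg, State.setMem, update_self, update_of_ne, ne_eq,
      Nat.reduceEqDiff, not_false_eq_true, abs_le, finishP, h6]
  refine ⟨fun h2 => ⟨fun hle => ?_, fun hle => ?_⟩, fun h2 => ⟨fun h0 => ?_, fun h0 =>
    ⟨fun hle => ?_, fun hle => ?_⟩⟩⟩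
  · have hvX := hX.2 h2
    have := hw hvX
    refine ⟨by omega, by omega, by omega, by omega, by omega, by omega, ⟨fun _ => ?_, fun h => ?_,
      fun h => ?_⟩, fun t ht => ?_, fun t ht => ?_, fun t ht => ?_, fun h => absurd hvX h, ?_⟩ <;>
    simp only [State.table, Function.update_self, ne_eq, Nat.reduceEqDiff, not_false_eq_true,
      Function.update_of_ne, and_self] at *
    · simp [max_eq_right hle]
    · omega
    · omega
    · rw [Function.update_of_ne ht]
    · rw [Function.update_of_ne ht]
    · rw [Function.update_of_ne ht]
  · have hvX := hX.2 h2
    have := hw hvX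
    refine ⟨by omega, by omega, by omega, by omega, by omega, by omega, ⟨fun _ => ?_, fun h => ?_,
      fun h => ?_⟩, fun t ht => ?_, fun t ht => ?_, fun t ht => ?_, fun h => absurd hvX h, ?_⟩ <;>
    simp only [State.table, Function.update_self, ne_eq, Nat.reduceEqDiff, not_false_eq_true,
      Function.update_of_ne, and_self] at *
    · rw [max_eq_left (by omega)]; simp
    · omega
    · omega
    · rw [Function.update_of_ne ht]
    · rw [Function.update_of_ne ht]
    · rw [Function.update_of_ne ht]
  · have hvX : v ∉ X := fun h => h2 (hX.1 h)
    have := hm hvX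
    refine ⟨by omega, by omega, ⟨fun h => absurd h hvX, fun h => ?_,
      fun h => ?_⟩, fun t ht => ?_, fun t ht => ?_, fun t ht => ?_, fun h => ?_, ?_⟩ <;>
    simp only [State.table, Function.update_self, ne_eq, Nat.reduceEqDiff, not_false_eq_true,
      Function.update_of_ne, and_self] at *
    · omega
    · rw [Function.update_of_ne ht]
  · have hvX : v ∉ X := fun h => h2 (hX.1 h)
    have := hm hvX
    refine ⟨by omega, by omega, ⟨fun h => absurd h hvX, fun h => ?_,
      fun h => ?_⟩, fun t ht => ?_, fun t ht => ?_, fun t ht => ?_, fun h => ?_, ?_⟩ <;>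
    simp only [State.table, Function.update_self, ne_eq, Nat.reduceEqDiff, not_false_eq_true,
      Function.update_of_ne, and_self] at *
    · omega
    · rw [max_eq_left hle]
    · rw [Function.update_of_ne ht]
  · have hvX : v ∉ X := fun h => h2 (hX.1 h)
    have := hm hvX
    refine ⟨by omega, by omega, ⟨fun h => absurd h hvX, fun h => ?_,
      fun h => ?_⟩, fun t ht => ?_, fun t ht => ?_, fun t ht => ?_, fun h => ?_, ?_⟩ <;>
    simp only [State.table, Function.update_self, ne_eq, Nat.reduceEqDiff, not_false_eq_true,
      Function.update_of_ne, and_self] at *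
    · omega
    · rw [Function.update_of_ne ht]

theorem count_runs (h6 : σ.reg 6 = v) (h7 : σ.reg 7 = p) (hX : v ∈ X ↔ σ.mem 7 v = 2) (hvp : v ≠ p)
    (hp : 0 ≤ p ∧ p ≤ B) (htw : |σ.mem 16 p + σ.mem 16 v| ≤ B)
    (hnb : 0 ≤ σ.mem 19 p ∧ σ.mem 19 p + 1 ≤ B) (hnc : 0 ≤ σ.mem 20 p ∧ σ.mem 20 p + 1 ≤ B) :
    Runs B countP σ 60 (fun σ' => (σ'.mem 16 = update (σ.mem 16) p (σ.mem 16 p + σ.mem 16 v) ∧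
      σ'.mem 19 = update (σ.mem 19) p (if v ∈ X then σ.mem 19 p else σ.mem 19 p + 1) ∧
      σ'.mem 20 = update (σ.mem 20) p
        (if σ.mem 7 v = 1 ∧ σ.mem 19 v ≠ 0 then σ.mem 20 p + 1 else σ.mem 20 p)) ∧
      Agree countP σ σ') := by
  refine Runs.agree (Runs.of_wp_le ?_ (by decide))
  rw [abs_le] at htw
  simp only [wp, Exp.eval, Guard.Holds, State.setReg, State.setMem, update_self, update_of_ne, ne_eq,
      Nat.reduceEqDiff, not_false_eq_true, abs_le, countP, h6, h7, hvp]
  refine ⟨by omega, by omega, fun h => ?_, fun h => ⟨by omega, by omega, fun h' =>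
    ⟨by omega, by omega, ?_⟩, fun h' => ?_⟩⟩
  · have h1 := hX.2 h
    simp only [h1, if_true, Function.update_eq_self, true_and]
    rw [if_neg (by omega), Function.update_eq_self]
  · have h1 : v ∉ X := fun h1 => h (hX.1 h1)
    simp only [h1, if_false, true_and]
    rw [if_pos h']
  · have h1 : v ∉ X := fun h1 => h (hX.1 h1)
    simp only [h1, if_false, true_and]
    rw [if_neg h', Function.update_eq_self]

theorem report_runs (h6 : σ.reg 6 = v) (h7 : σ.reg 7 = p) (hvp : v ≠ p) (hv : 0 ≤ v ∧ v ≤ B)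
    (hp : 0 ≤ p ∧ p ≤ B) (h01 : σ.mem 7 p = 0 ∨ σ.mem 7 p = 1)
    (hmc : 0 ≤ σ.mem 12 v ∧ σ.mem 12 v ≤ B) (hr : 0 ≤ σ.mem 14 v ∧ σ.mem 14 v ≤ B)
    (hu : σ.mem 7 p = 0 → |σ.mem 13 p + σ.mem 14 v| ≤ B)
    (hj : σ.mem 7 p = 1 → |σ.mem 12 p + σ.mem 12 v| ≤ B) :
    Runs B reportP σ 60 (fun σ' => ((∀ t, t ≠ p → σ'.mem 12 t = σ.mem 12 t ∧
      σ'.mem 13 t = σ.mem 13 t ∧ σ'.mem 15 t = σ.mem 15 t) ∧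
      (σ.mem 7 p = 0 → σ'.mem 13 p = σ.mem 13 p + σ.mem 14 v ∧
        if σ.mem 12 p ≤ σ.mem 12 v then σ'.mem 12 p = σ.mem 12 v ∧ σ'.mem 15 p = v else
          σ'.mem 12 p = σ.mem 12 p ∧ σ'.mem 15 p = σ.mem 15 p) ∧
      (σ.mem 7 p = 1 → σ'.mem 12 p = σ.mem 12 p + σ.mem 12 v ∧
        if σ.mem 13 p ≤ σ.mem 14 v then σ'.mem 13 p = σ.mem 14 v ∧ σ'.mem 15 p = v else
          σ'.mem 13 p = σ.mem 13 p ∧ σ'.mem 15 p = σ.mem 15 p)) ∧ Agree reportP σ σ') := by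
  refine Runs.agree (Runs.of_wp_le ?_ (by decide))
  rw [abs_le] at hu hj
  simp only [wp, Exp.eval, Guard.Holds, State.setReg, State.setMem, update_self, update_of_ne, ne_eq,
      Nat.reduceEqDiff, not_false_eq_true, abs_le, reportP, h6, h7, hvp]
  refine ⟨fun h => ⟨by omega, by omega, fun h' => ⟨by omega, by omega, by omega, by omega, ?_⟩,
    fun h' => ?_⟩, fun h => ⟨by omega, by omega, fun h' => ⟨by omega, by omega, by omega, by omega,
    ?_⟩, fun h' => ?_⟩⟩ <;>
  refine ⟨fun t ht => by simp [ht], fun h0 => ?_, fun h0 => ?_⟩ <;>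
  first
  | omega
  | simp [h']

theorem up_runs (T : Stores A X N root σ L (-1) (-1)) (hroot : σ.reg 0 + 2 = root)
    {P : Finset ℤ} (hP : P ⊆ N) (h10 : σ.mem 10 (σ.reg 4) = v) (hv : v ∈ N) (hvP : v ∉ P)
    (I : UpInv X N (σ.mem 4) (σ.mem 7) (σ.mem 2) L σ.table P)
    (hcl : v ∉ X → chs N (σ.mem 4) v ⊆ P)
    (hpP : v ≠ root → σ.mem 4 v ∉ insert v P) (hW : absSum (σ.mem 2) X ≤ W)
    (hM : σ.reg 2 + W + 5 ≤ B) :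
    Runs B upBody σ 300 (fun σ' => UpInv X N (σ.mem 4) (σ.mem 7) (σ.mem 2) L σ'.table (insert v P)) := by
  have hrt := T.bd root T.tree.root_mem
  have hrt0 := T.root_nonneg
  have hvb := T.bd v hv
  have hW0 := absSum_nonneg (w := σ.mem 2) (S := X)
  have hLW : ∀ t ∈ N, absSum (σ.mem 2) (L t) ≤ W := fun t ht =>
    (absSum_mono (T.tree.L_sub ht)).trans hW
  have hpar : -1 ≤ σ.mem 4 v ∧ σ.mem 4 v < σ.reg 2 := (T.par_ge (.inl hv)).2
  have hXt : ∀ t ∈ N, t ∈ X ↔ σ.mem 7 t = 2 := by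
    intro t ht
    rcases T.tree.leaf_of_typ ht with h | h | h <;> simp [h.1, h.2]
  have h012 : σ.mem 7 v = 0 ∨ σ.mem 7 v = 1 ∨ σ.mem 7 v = 2 := by
    rcases T.tree.leaf_of_typ hv with h | h | h <;> simp [h.2]
  refine ((Runs.of_wp (Q := fun σ' => σ' = (σ.setReg 6 v).setReg 7 (σ.mem 4 v)) ?_).seq
    (T₂ := 250) ?_).mono (by decide) (fun _ h => h)
  · simp only [wp, Exp.eval, Guard.Holds, State.setReg, State.setMem, update_self, update_of_ne, ne_eq,
      Nat.reduceEqDiff, not_false_eq_true, abs_le, h10]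
    exact ⟨by omega, by omega, trivial⟩
  rintro σ₁ rfl
  refine ((finish_runs (B := B) (σ := (σ.setReg 6 v).setReg 7 (σ.mem 4 v)) (X := X) (v := v) (by simp [State.setReg]) (hXt v hv) (by omega) h012 ?_ ?_).seq
    (T₂ := 190) ?_).mono (by omega) (fun _ h => h)
  · intro hvX
    have := hLW v hv
    rw [absSum, (T.tree.leaf v hvX).1, Finset.sum_singleton] at this
    simp only [State.setReg]
    omega
  · intro hvX
    obtain ⟨_, b, c⟩ := (I.acc v hv hvX).bound (w := σ.mem 2) T.tree hv hvX
      (Finset.filter_subset_filter _ hP) fun c hc => I.bdd c (mem_chs.1 hc).1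
    have := hLW v hv
    simp only [State.table, State.setReg] at b c ⊢
    omega
  rintro σ₂ ⟨F, hag⟩
  obtain ⟨I1, I2, I3⟩ := I.finish T.tree hP hv hvP F hcl
  have a0 : σ₂.reg 0 = σ.reg 0 := (hag.1 0 rfl).trans (by simp [State.setReg])
  have a6 : σ₂.reg 6 = v := (hag.1 6 rfl).trans (by simp [State.setReg])
  have a7 : σ₂.reg 7 = σ.mem 4 v := (hag.1 7 rfl).trans (by simp [State.setReg])
  have b7 : σ₂.mem 7 = σ.mem 7 := hag.2 7 rfl
  refine (Runs.ite (T := 180) (fun hg => ?_) (fun hg => ?_)).mono (by decide) (fun _ h => h)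
  · have hvr : v = root := by
      simp only [Guard.Holds, Exp.eval, a6, a0] at hg
      omega
    refine Runs.of_wp_le ?_ (by decide)
    refine ⟨I1, fun t ht htX => ?_, I3⟩
    have : chs (insert v P) (σ.mem 4) t = chs P (σ.mem 4) t := by
      ext c
      simp only [mem_chs, Finset.mem_insert]
      constructor
      · rintro ⟨rfl | h, h'⟩
        · rw [hvr, T.tree.par_root] at h'
          exact absurd (h' ▸ ht) T.tree.neg
        · exact ⟨h, h'⟩
      · exact fun h => ⟨.inr h.1, h.2⟩
    rw [this]
    exact I2 t ht htX
  · have hvr : v ≠ root := by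
      rintro rfl
      simp only [Guard.Holds, Exp.eval, a6, a0] at hg
      omega
    have hp := T.tree.par_mem v hv hvr
    have hpb := T.bd _ hp.1
    have hpP := hpP hvr
    have hvp : v ≠ σ.mem 4 v := fun h => hpP (h ▸ Finset.mem_insert_self _ _)
    have hb := I3 v (by simp)
    have hacc := I2 _ hp.1 hp.2
    have hsub : chs P (σ.mem 4) (σ.mem 4 v) ⊆ chs N (σ.mem 4) (σ.mem 4 v) :=
      Finset.filter_subset_filter _ hP
    have hbp := hacc.bound (w := σ.mem 2) T.tree hp.1 hp.2 hsub
      fun c hc => I3 c (by simp [(mem_chs.1 hc).1])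
    have hLv := hLW v hv
    have hLp := hLW _ hp.1
    -- the new entries at the parent are bounded, too
    have hnew : absSum (σ.mem 2) (L v) + ∑ c ∈ chs P (σ.mem 4) (σ.mem 4 v),
        absSum (σ.mem 2) (L c) ≤ W := by
      rw [← Finset.sum_insert (f := fun c => absSum (σ.mem 2) (L c)) (a := v)
        (s := chs P (σ.mem 4) (σ.mem 4 v)) (by simp [hvP])]
      refine (absSum_chs T.tree hp.1 hp.2 ?_).trans hLp
      intro c hc
      rcases Finset.mem_insert.1 hc with rfl | hc
      · simp [hv]
      · exact hsub hc
    have hcard : ∀ q : ℤ → Prop, [DecidablePred q] →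
        (((chs P (σ.mem 4) (σ.mem 4 v)).filter q).card : ℤ) ≤ σ.reg 2 := by
      intro q _
      refine card_le_of_bound (by omega) fun t ht => T.bd t (hP ?_)
      exact (mem_chs.1 (Finset.mem_filter.1 ht).1).1
    have hs : ∀ f : ℤ → ℤ, (∀ c ∈ chs P (σ.mem 4) (σ.mem 4 v),
        |f c| ≤ absSum (σ.mem 2) (L c)) →
        |∑ c ∈ chs P (σ.mem 4) (σ.mem 4 v), f c| ≤ ∑ c ∈ chs P (σ.mem 4) (σ.mem 4 v),
          absSum (σ.mem 2) (L c) := fun f hf =>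
      (Finset.abs_sum_le_sum_abs _ _).trans (Finset.sum_le_sum hf)
    have hbc : ∀ c ∈ chs P (σ.mem 4) (σ.mem 4 v), Bounded (σ.mem 2) L σ₂.table c := fun c hc =>
      I3 c (by simp [(mem_chs.1 hc).1])
    have htw := hs _ fun c hc => (hbc c hc).tw
    have hmc := hs _ fun c hc => (abs_of_nonneg (hbc c hc).mc.1).trans_le (hbc c hc).mc.2
    have hr := hs _ fun c hc => (abs_of_nonneg (hbc c hc).r.1).trans_le (hbc c hc).r.2
    rw [← hacc.tw] at htw
    have hadd : ∀ {a b s : ℤ}, |a| ≤ s → |b| ≤ absSum (σ.mem 2) (L v) →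
        absSum (σ.mem 2) (L v) + s ≤ W → |a + b| ≤ B := fun h1 h2 h3 =>
      (abs_add_le _ _).trans (by omega)
    have e4 : σ₂.mem 4 = σ.mem 4 := hag.2 4 rfl
    refine ((count_runs (X := X) a6 a7 (by rw [b7]; exact hXt v hv) hvp (by omega)
      (hadd htw hb.tw hnew) ?_ ?_).seq (T₂ := 60) ?_).mono (by omega) (fun _ h => h)
    · have h1 : σ₂.mem 19 (σ.mem 4 v) = _ := hacc.nb
      have := hcard (· ∉ X)
      rw [h1]
      omega
    · have h1 : σ₂.mem 20 (σ.mem 4 v) = _ := hacc.nc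
      have := hcard (fun c => σ.mem 7 c = 1 ∧ σ₂.table.nb c ≠ 0)
      rw [h1]
      omega
    rintro σ₃ ⟨⟨c16, c19, c20⟩, hag3⟩
    have d12 : σ₃.mem 12 = σ₂.mem 12 := hag3.2 12 rfl
    have d13 : σ₃.mem 13 = σ₂.mem 13 := hag3.2 13 rfl
    have d14 : σ₃.mem 14 = σ₂.mem 14 := hag3.2 14 rfl
    have d15 : σ₃.mem 15 = σ₂.mem 15 := hag3.2 15 rfl
    have d7 : σ₃.mem 7 = σ.mem 7 := (hag3.2 7 rfl).trans b7
    refine (report_runs (v := v) (p := σ.mem 4 v) ((hag3.1 6 rfl).trans a6) ((hag3.1 7 rfl).trans a7)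
      hvp (by omega) (by omega) ?_ ?_ ?_ ?_ ?_).mono le_rfl ?_
    · rw [d7]; exact T.tree.typ_int _ hp.1 hp.2
    · rw [d12]; have := hb.mc; simp only [State.table] at this; omega
    · rw [d14]; have := hb.r; simp only [State.table] at this; omega
    · rw [d7, d13, d14]
      intro h
      have := (hacc.union h).1
      rw [← this] at hr
      exact hadd hr ((abs_of_nonneg hb.r.1).trans_le hb.r.2) hnew
    · rw [d7, d12]
      intro h
      have := (hacc.join h).1
      rw [← this] at hmc
      exact hadd hmc ((abs_of_nonneg hb.mc.1).trans_le hb.mc.2) hnew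
    rintro σ₄ ⟨⟨e1, e2, e3⟩, hag4⟩
    rw [d12, d13, d15] at e1
    rw [d7, d12, d13, d14, d15] at e2 e3
    have f16 : σ₄.mem 16 = σ₃.mem 16 := hag4.2 16 rfl
    have f14 : σ₄.mem 14 = σ₂.mem 14 := (hag4.2 14 rfl).trans d14
    have f19 : σ₄.mem 19 = σ₃.mem 19 := hag4.2 19 rfl
    have f20 : σ₄.mem 20 = σ₃.mem 20 := hag4.2 20 rfl
    refine UpInv.add (D := σ₂.table) T.tree I1 I2 I3 hvP rfl hpP ⟨f14, fun t ht => ?_, ?_, ?_, ?_, e2, e3⟩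
    · obtain ⟨g1, g2, g3⟩ := e1 t ht
      simp only [State.table, f16, f19, f20, c16, c19, c20, Function.update_of_ne ht]
      exact ⟨g1, g2, g3, trivial, trivial, trivial⟩
    · simp only [State.table, f16, c16, Function.update_self]
    · simp only [State.table, f19, c19, Function.update_self]
    · simp only [State.table, f20, c20, Function.update_self, b7]
      rfl

end

open Function (update update_self update_of_ne)

/-- The queue lists all nodes, children before their parents. -/
structure Ordered (X N : Finset ℤ) (par q : ℤ → ℤ) (k : ℤ) : Prop where
  enum : IsEnum q k N
  order : ∀ i, 0 ≤ i → i < k → q i ∉ X → ∀ c ∈ chs N par (q i), ∃ j, 0 ≤ j ∧ j < i ∧ q j = c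

namespace Ordered

variable {X N P : Finset ℤ} {par q : ℤ → ℤ} {k i : ℤ}

theorem children (O : Ordered X N par q k) (hP : IsEnum q i P) (hi : i < k) (h : q i ∉ X) :
    chs N par (q i) ⊆ P := by
  intro c hc
  obtain ⟨j, h0, h1, rfl⟩ := O.order i hP.nonneg hi h c hc
  exact hP.mem j h0 h1

theorem parent (O : Ordered X N par q k) (hP : IsEnum q i P) (hi : i ≤ k) {v : ℤ} (hv : v ∈ N)
    (hvP : v ∉ P) (hp : par v ∉ X) : par v ∉ P := by
  intro h
  obtain ⟨j, h0, h1, hj⟩ := hP.surj _ h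
  obtain ⟨j', h0', h1', rfl⟩ := O.order j h0 (by omega) (hj ▸ hp) v (mem_chs.2 ⟨hv, hj.symm⟩)
  exact hvP (hP.mem j' h0' (by omega))

end Ordered

/-- List all nodes, children before parents. -/
def orderP : Prog :=
  (5 ≔ 𝒞 0 ;; .loop (ℛ 5 ≤ₑ (ℛ 0 +ₑ 𝒞 1)) (.write 10 (ℛ 5) (ℛ 5) ;; 5 ≔ ℛ 5 +ₑ 𝒞 1)) ;; sweep

/-- The inherited mode of the node in register 6. -/
def inheritP : Prog :=
  .ite (7⟪ℛ 7⟫ =ₑ 𝒞 0)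
    (.ite (.and (18⟪ℛ 7⟫ =ₑ 𝒞 2) (.not (15⟪ℛ 7⟫ =ₑ ℛ 6))) (.write 18 (ℛ 6) (𝒞 4))
      (.write 18 (ℛ 6) (18⟪ℛ 7⟫)))
    (.ite (18⟪ℛ 7⟫ =ₑ 𝒞 1)
      (.ite (13⟪ℛ 7⟫ ≤ₑ 12⟪ℛ 7⟫) (.write 18 (ℛ 6) (𝒞 2))
        (.ite (15⟪ℛ 7⟫ =ₑ ℛ 6) (.write 18 (ℛ 6) (𝒞 1)) (.write 18 (ℛ 6) (𝒞 4))))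
      (.write 18 (ℛ 6) (18⟪ℛ 7⟫)))

/-- Compute all modes. -/
def downP : Prog :=
  4 ≔ ℛ 5 ;; .loop (𝒞 1 ≤ₑ ℛ 4)
    ((4 ≔ ℛ 4 -ₑ 𝒞 1 ;; 6 ≔ 10⟪ℛ 4⟫) ;;
      .ite (17⟪ℛ 6⟫ =ₑ 𝒞 0) (7 ≔ 4⟪ℛ 6⟫ ;; inheritP) (.write 18 (ℛ 6) (17⟪ℛ 6⟫)))

/-- Write the output. -/
def outP : Prog :=
  (1 ≔ 𝒞 0 ;; 6 ≔ 𝒞 0) ;; .loop ((ℛ 6 +ₑ 𝒞 1) ≤ₑ ℛ 0)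
    (.ite (18⟪ℛ 6⟫ =ₑ 𝒞 3) (.write 3 (ℛ 6) (𝒞 0))
      (.ite (.and (.not (18⟪ℛ 6⟫ =ₑ 𝒞 4)) (𝒞 1 ≤ₑ 2⟪ℛ 6⟫)) (.write 3 (ℛ 6) (𝒞 0))
        (.write 3 (ℛ 6) (𝒞 1) ;; 1 ≔ ℛ 1 +ₑ 2⟪ℛ 6⟫)) ;;
      6 ≔ ℛ 6 +ₑ 𝒞 1)

section

variable {A : ℤ → ℤ → Prop} {X N : Finset ℤ} {root : ℤ} {L : ℤ → Finset ℤ} {B : ℕ} {σ : State}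
  {n W M : ℤ}

open Cotree

theorem order_runs (T : Stores A X N root σ L (-1) (-1)) (h0 : σ.reg 0 = n) (hn : 0 ≤ n)
    (hroot : n + 2 = root) (hX : ∀ y, y ∈ X ↔ 0 ≤ y ∧ y < n + 2)
    (hfc : ∀ t, σ.mem 8 t = 0 ∧ σ.mem 9 t = 0) (hM : σ.reg 2 ≤ M) (hB : M * M + M + 5 ≤ B) :
    Runs B orderP σ (n.toNat * 150 + 400) (fun σ' =>
      Ordered X N (σ.mem 4) (σ'.mem 10) (σ'.reg 5) ∧ Agree orderP σ σ') := by
  refine Runs.agree ?_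
  have hrt := T.bd root T.tree.root_mem
  have hM0 : 0 ≤ M := by omega
  have hMM : 0 ≤ M * M := mul_nonneg hM0 hM0
  refine Runs.seq (T₁ := n.toNat * 20 + 80) (T₂ := n.toNat * 100 + 300) (R := fun σ₁ =>
    (IsEnum (σ₁.mem 10) (σ₁.reg 5) X) ∧ σ₁.mem 4 = σ.mem 4 ∧ σ₁.mem 5 = σ.mem 5 ∧
      σ₁.mem 8 = σ.mem 8 ∧ σ₁.mem 9 = σ.mem 9 ∧ σ₁.reg 0 = n) ?_ ?_ |>.mono (by omega) (fun _ h => h)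
  · refine ((Runs.of_wp (Q := fun σ' => σ' = σ.setReg 5 0) ?_).seq
      (T₂ := n.toNat * 20 + 70) ?_).mono (by simp only [Prog.maxcost, Exp.cost]; omega)
      (fun _ h => h)
    · simp [wp, Exp.eval]
    rintro σ₁ rfl
    refine (Runs.loop 13 (fun σ' => IsEnum (σ'.mem 10) (σ'.reg 5) (Finset.Ico 0 (σ'.reg 5)) ∧
        σ'.reg 5 ≤ n + 2) (fun σ' => (n + 2 - σ'.reg 5).toNat) ?_ ?_).mono ?_ ?_
    · simp only [wp, Exp.eval, Guard.Holds, State.setReg, State.setMem, update_self, update_of_ne, ne_eq,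
      Nat.reduceEqDiff, not_false_eq_true, abs_le]
      exact ⟨by simpa using IsEnum.zero _, by omega⟩
    · rintro σ₂ hag ⟨i1, i2⟩ hg
      have e0 : σ₂.reg 0 = n := (hag.1 0 rfl).trans (by simpa [State.setReg] using h0)
      simp only [Guard.Holds, Exp.eval, e0] at hg
      have hk := i1.nonneg
      refine Runs.of_wp_le ?_ (by decide)
      simp only [wp, Exp.eval, Guard.Holds, State.setReg, State.setMem, update_self, update_of_ne, ne_eq,
      Nat.reduceEqDiff, not_false_eq_true, abs_le]
      refine ⟨by omega, by omega, by omega, ⟨?_, by omega⟩, by omega⟩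
      have : Finset.Ico 0 (σ₂.reg 5 + 1) = insert (σ₂.reg 5) (Finset.Ico 0 (σ₂.reg 5)) := by
        ext y; simp only [Finset.mem_insert, Finset.mem_Ico]; omega
      rw [this]
      exact i1.push (by simp)
    · simp only [State.setReg, Function.update_self, Guard.cost, Exp.cost]
      omega
    · rintro σ' ⟨⟨i1, i2⟩, hg, hag⟩
      have e0 : σ'.reg 0 = n := (hag.1 0 rfl).trans (by simpa [State.setReg] using h0)
      simp only [Guard.Holds, Exp.eval, e0] at hg
      have h5 : σ'.reg 5 = n + 2 := by omega
      have hXe : X = Finset.Ico 0 (n + 2) := by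
        ext y; rw [hX, Finset.mem_Ico]
      refine ⟨?_, hag.2 4 rfl, hag.2 5 rfl, hag.2 8 rfl, hag.2 9 rfl, e0⟩
      rw [hXe]
      rwa [h5] at i1 ⊢
  rintro σ₁ ⟨hE, e4, e5, e8, e9, e0⟩
  have hXc : X.card = n.toNat + 2 := by
    have hXe : X = Finset.Ico 0 (n + 2) := by
      ext y; rw [hX, Finset.mem_Ico]
    rw [hXe, Int.card_Ico]; omega
  refine (sweep_runs (M := M) (σ := σ₁) (by rw [e4]; exact T.tree) (by rw [e4, e5]; exact T.counts)
    (by omega) (fun t ht => by have := T.bd t ht; omega) hB hE subset_rfl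
    (fun t => by rw [e8]; exact (hfc t).1) (fun t => by rw [e9]; exact (hfc t).2)).mono
    (by omega) ?_
  intro σ₂ I
  rw [e4, e5] at I
  have hF : fullNodes N L X = N := by
    ext t
    rw [mem_fullNodes]
    exact ⟨fun h => h.1, fun h => ⟨h, T.tree.L_sub h⟩⟩
  rw [hF] at I
  exact ⟨I.enumS, I.order⟩

theorem upPass_runs (T : Stores A X N root σ L (-1) (-1)) (hroot : σ.reg 0 + 2 = root)
    (O : Ordered X N (σ.mem 4) (σ.mem 10) (σ.reg 5))
    (hz : ∀ a, 12 ≤ a → a ≤ 20 → ∀ t, σ.mem a t = 0) (hW : absSum (σ.mem 2) X ≤ W)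
    (hM : σ.reg 2 + W + 5 ≤ B) :
    Runs B (qloop upBody) σ (N.card * 320 + 20) (fun σ' =>
      UpInv X N (σ.mem 4) (σ.mem 7) (σ.mem 2) L σ'.table N ∧ Agree (qloop upBody) σ σ') := by
  have hrt := T.bd root T.tree.root_mem
  have hW0 := absSum_nonneg (w := σ.mem 2) (S := X)
  have hNc := card_le_of_bound (by omega) T.bd
  refine (qloop_runs (p := upBody) 300 (fun P σ' => UpInv X N (σ.mem 4) (σ.mem 7) (σ.mem 2) L σ'.table P)
    O.enum rfl rfl rfl (fun P σ' z h => h) ?_ (by omega) ?_).mono (by omega) (fun _ h => h)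
  · refine ⟨by simp, fun t ht htX => ?_, by simp⟩
    have h : chs ∅ (σ.mem 4) t = ∅ := by simp [chs]
    rw [h]
    refine ⟨?_, ?_, ?_, fun _ => ⟨?_, by simp, fun _ => ?_, by simp⟩,
      fun _ => ⟨?_, by simp, fun _ => ?_, by simp⟩⟩ <;> simp [State.table, hz]
  · rintro P σ₁ v hag hP hPN hv hvP hqv I
    have T1 : Stores A X N root σ₁ L (-1) (-1) := T.of_eq (hag.2 4 rfl) (hag.2 5 rfl) (hag.2 6 rfl)
      (hag.2 7 rfl) (hag.1 2 rfl)
    have e4 : σ₁.mem 4 = σ.mem 4 := hag.2 4 rfl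
    have e7 : σ₁.mem 7 = σ.mem 7 := hag.2 7 rfl
    have e2 : σ₁.mem 2 = σ.mem 2 := hag.2 2 rfl
    have e10 : σ₁.mem 10 = σ.mem 10 := hag.2 10 rfl
    have hi : σ₁.reg 4 < σ.reg 5 := by
      by_contra h
      obtain ⟨j, h1, h2, h3⟩ := O.enum.surj v hv
      exact hvP (h3 ▸ hP.mem j h1 (by omega))
    have hP' : IsEnum (σ.mem 10) (σ₁.reg 4 + 1) (insert v P) := by
      have := hP.succ (by rw [← e10, hqv]; exact hvP)
      rwa [← e10, hqv, e10] at this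
    have := up_runs (W := W) (B := B) T1 (by rw [hag.1 0 rfl, hroot]) hPN hqv hv hvP
      (by rw [e4, e7, e2]; exact I)
      (fun hvX => by
        have := O.children hP hi (by rw [← e10, hqv]; exact hvX)
        rwa [← e10, hqv, ← e4] at this)
      (fun hvr h => by
        obtain ⟨h1, h2⟩ := T1.tree.par_mem v hv hvr
        have hvv : σ₁.mem 4 v ≠ v := fun h' => T1.tree.not_anc_of_par hv h' .refl
        rw [e4] at h h2 hvv
        exact O.parent hP hi.le hv hvP h2 (by simpa [hvv] using h))
      (by rw [e2]; exact hW) (by rw [hag.1 2 rfl]; exact hM)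
    rwa [e4, e7, e2] at this

theorem inherit_runs {v p : ℤ} (h6 : σ.reg 6 = v) (h7 : σ.reg 7 = p) (hv : 0 ≤ v ∧ v ≤ B)
    (hm : 0 ≤ σ.mem 18 p ∧ σ.mem 18 p ≤ 5) (hB : 5 ≤ (B : ℤ)) :
    Runs B inheritP σ 60 (fun σ' => (σ'.mem 18 = update (σ.mem 18) v
      (inherit (σ.mem 7) (σ.mem 12) (σ.mem 13) (σ.mem 15) (σ.mem 18) p v)) ∧
      Agree inheritP σ σ') := by
  refine Runs.agree (Runs.of_wp_le ?_ (by decide))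
  simp only [wp, Exp.eval, Guard.Holds, State.setReg, State.setMem, update_self, update_of_ne, ne_eq,
      Nat.reduceEqDiff, not_false_eq_true, abs_le, inheritP, inherit, h6, h7]
  refine ⟨fun h1 => ⟨fun h2 => ⟨by omega, by omega, ?_⟩, fun h2 => ⟨by omega, by omega, ?_⟩⟩,
    fun h1 => ⟨fun h2 => ⟨fun h3 => ⟨by omega, by omega, ?_⟩,
      fun h3 => ⟨fun h4 => ⟨by omega, by omega, ?_⟩, fun h4 => ⟨by omega, by omega, ?_⟩⟩⟩,
      fun h2 => ⟨by omega, by omega, ?_⟩⟩⟩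
  · rw [if_pos h1, if_pos h2]
  · rw [if_pos h1, if_neg h2]
  · rw [if_neg h1, if_pos h2, if_pos h3]
  · rw [if_neg h1, if_pos h2, if_neg h3, if_pos h4]
  · rw [if_neg h1, if_pos h2, if_neg h3, if_neg h4]
  · rw [if_neg h1, if_neg h2]

theorem inherit_bound {typ mc mr best mode : ℤ → ℤ} {p v : ℤ} (hm : 0 ≤ mode p ∧ mode p ≤ 5) :
    0 ≤ inherit typ mc mr best mode p v ∧ inherit typ mc mr best mode p v ≤ 5 := by
  unfold inherit
  split_ifs <;> omega

theorem inherit_congr {typ mc mr best mode mode' : ℤ → ℤ} {p v : ℤ} (hm : mode' p = mode p) :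
    inherit typ mc mr best mode' p v = inherit typ mc mr best mode p v := by
  rw [inherit, inherit, hm]

theorem down_runs (T : Cotree A X N root (σ.mem 4) (σ.mem 7) L (-1) (-1))
    (O : Ordered X N (σ.mem 4) (σ.mem 10) (σ.reg 5)) (hov : ∀ t, 0 ≤ σ.mem 17 t ∧ σ.mem 17 t ≤ 5)
    (hmo : ∀ t, 0 ≤ σ.mem 18 t ∧ σ.mem 18 t ≤ 5) (hM : ∀ t ∈ N, 0 ≤ t ∧ t < M) (hB : M + 5 ≤ B) :
    Runs B downP σ (N.card * 120 + 20) (fun σ' =>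
      Modes N root (σ.mem 4) (σ.mem 7) (σ.mem 12) (σ.mem 13) (σ.mem 15) (σ.mem 17) (σ'.mem 18) ∧
      Agree downP σ σ') := by
  refine Runs.agree ?_
  have hNc := O.enum.card
  have hrt := hM root T.root_mem
  have hNM := card_le_of_bound (by omega) hM
  refine ((Runs.of_wp (Q := fun σ' => σ' = σ.setReg 4 (σ.reg 5)) ?_).seq
    (T₂ := N.card * 120 + 10) ?_).mono (by simp only [Prog.maxcost, Exp.cost]; omega) (fun _ h => h)
  · simp only [wp, Exp.eval, Guard.Holds, State.setReg, State.setMem, update_self, update_of_ne, ne_eq,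
      Nat.reduceEqDiff, not_false_eq_true, abs_le]
    exact ⟨by omega, trivial⟩
  rintro σ₁ rfl
  refine (Runs.loop 100 (fun σ' => (0 ≤ σ'.reg 4 ∧ σ'.reg 4 ≤ σ.reg 5) ∧
      (∀ t, 0 ≤ σ'.mem 18 t ∧ σ'.mem 18 t ≤ 5) ∧
      ∀ P, IsEnum (σ.mem 10) (σ'.reg 4) P → ∀ v ∈ N, v ∉ P → (σ.mem 17 v ≠ 0 → σ'.mem 18 v = σ.mem 17 v) ∧
        (v ≠ root → σ.mem 17 v = 0 → σ'.mem 18 v = inherit (σ.mem 7) (σ.mem 12) (σ.mem 13)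
          (σ.mem 15) (σ'.mem 18) (σ.mem 4 v) v))
    (fun σ' => (σ'.reg 4).toNat) ?_ ?_).mono ?_ ?_
  · simp only [State.setReg, Function.update_self]
    refine ⟨by omega, hmo, fun P hP v hv hvP => ?_⟩
    rw [O.enum.eq_of_eq hP] at hvP
    exact absurd hv hvP
  · rintro σ₂ hag ⟨⟨i1, i1'⟩, i2, i3⟩ hg
    have e4 : σ₂.mem 4 = σ.mem 4 := hag.2 4 rfl
    have e7 : σ₂.mem 7 = σ.mem 7 := hag.2 7 rfl
    have e10 : σ₂.mem 10 = σ.mem 10 := hag.2 10 rfl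
    have e12 : σ₂.mem 12 = σ.mem 12 := hag.2 12 rfl
    have e13 : σ₂.mem 13 = σ.mem 13 := hag.2 13 rfl
    have e15 : σ₂.mem 15 = σ.mem 15 := hag.2 15 rfl
    have e17 : σ₂.mem 17 = σ.mem 17 := hag.2 17 rfl
    simp only [Guard.Holds, Exp.eval] at hg
    set i := σ₂.reg 4 - 1 with hi
    have hvN := O.enum.mem i (by omega) (by omega)
    have hvb := hM _ hvN
    set v := σ.mem 10 i with hv
    refine ((Runs.of_wp (Q := fun σ' => σ' = (σ₂.setReg 4 i).setReg 6 v) ?_).seq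
      (T₂ := 85) ?_).mono (by decide) (fun _ h => h)
    · simp only [wp, Exp.eval, Guard.Holds, State.setReg, State.setMem, update_self, update_of_ne, ne_eq,
      Nat.reduceEqDiff, not_false_eq_true, abs_le, e10, ← hi, ← hv]
      exact ⟨by omega, by omega, trivial⟩
    rintro σ₃ rfl
    -- the entries of the nodes that come later do not change
    have hfin : ∀ σ' : State, ∀ m, σ'.reg 4 = i → σ'.mem 18 = update (σ₂.mem 18) v m →
        (0 ≤ m ∧ m ≤ 5) → (σ.mem 17 v ≠ 0 → m = σ.mem 17 v) →
        (v ≠ root → σ.mem 17 v = 0 → m = inherit (σ.mem 7) (σ.mem 12) (σ.mem 13)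
          (σ.mem 15) (σ₂.mem 18) (σ.mem 4 v) v) →
        ((0 ≤ σ'.reg 4 ∧ σ'.reg 4 ≤ σ.reg 5) ∧
        (∀ t, 0 ≤ σ'.mem 18 t ∧ σ'.mem 18 t ≤ 5) ∧
        ∀ P, IsEnum (σ.mem 10) (σ'.reg 4) P → ∀ v ∈ N, v ∉ P →
        (σ.mem 17 v ≠ 0 → σ'.mem 18 v = σ.mem 17 v) ∧
        (v ≠ root → σ.mem 17 v = 0 → σ'.mem 18 v = inherit (σ.mem 7) (σ.mem 12) (σ.mem 13)
          (σ.mem 15) (σ'.mem 18) (σ.mem 4 v) v)) ∧ (σ'.reg 4).toNat < (σ₂.reg 4).toNat := by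
      intro σ' m h4 h18 hm h1 h2
      rw [h4, h18]
      refine ⟨⟨by omega, fun t => ?_, fun P hP u hu huP => ?_⟩, by omega⟩
      · rw [Function.update_apply]
        split_ifs
        · exact hm
        · exact i2 t
      have hvP : v ∉ P := O.enum.notMem_of_prefix hP (by omega)
      have hP' : IsEnum (σ.mem 10) (σ₂.reg 4) (insert v P) := by
        have := hP.succ hvP
        rwa [hi, sub_add_cancel] at this
      by_cases huv : u = v
      · rw [huv, Function.update_self]
        refine ⟨h1, fun hvr h0 => ?_⟩
        rw [h2 hvr h0]
        have hne : σ.mem 4 v ≠ v := fun h' => T.not_anc_of_par hvN h' .refl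
        exact (inherit_congr (Function.update_of_ne hne _ _)).symm
      · obtain ⟨j1, j2⟩ := i3 _ hP' u hu (by simp [huv, huP])
        rw [Function.update_of_ne huv]
        refine ⟨j1, fun hur h0 => ?_⟩
        rw [j2 hur h0]
        refine (inherit_congr (Function.update_of_ne ?_ _ _)).symm
        intro h
        have := O.parent hP' i1' hu (by simp [huv, huP]) (T.par_mem u hu hur).2
        exact this (h ▸ Finset.mem_insert_self _ _)
    refine (Runs.ite (T := 75) (fun hg => ?_) (fun hg => ?_)).mono (by decide) (fun _ h => h)
    · have h17 : σ.mem 17 v = 0 := by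
        simpa [Guard.Holds, Exp.eval, State.setReg, e17] using hg
      have hpb : |σ.mem 4 v| ≤ B := by
        rw [abs_le]
        by_cases hvr : v = root
        · rw [hvr, T.par_root]; omega
        · have := hM _ (T.par_mem v hvN hvr).1; omega
      refine ((Runs.of_wp (Q := fun σ' => σ' = ((σ₂.setReg 4 i).setReg 6 v).setReg 7 (σ.mem 4 v))
        ?_).seq (T₂ := 60) ?_).mono (by decide) (fun _ h => h)
      · simp only [wp, Exp.eval, Guard.Holds, State.setReg, State.setMem, update_self, update_of_ne, ne_eq,
      Nat.reduceEqDiff, not_false_eq_true, abs_le, e4]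
        rw [abs_le] at hpb
        exact ⟨by omega, trivial⟩
      rintro σ₄ rfl
      refine (inherit_runs (σ := ((σ₂.setReg 4 i).setReg 6 v).setReg 7 (σ.mem 4 v)) (B := B) (v := v)
        (p := σ.mem 4 v) (by simp [State.setReg]) (by simp [State.setReg]) (by omega) (i2 _)
        (by omega)).mono le_rfl ?_
      rintro σ₅ ⟨h18, hag5⟩
      simp only [State.setReg, e7, e12, e13, e15] at h18
      refine hfin σ₅ _ ((hag5.1 4 rfl).trans (by simp [State.setReg])) h18 (inherit_bound (i2 _))
        (fun h => absurd h17 h) (fun _ _ => rfl)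
    · have h17 : σ.mem 17 v ≠ 0 := by
        simpa [Guard.Holds, Exp.eval, State.setReg, e17] using hg
      have := hov v
      refine (Runs.of_wp_le (T := 70) (Q := fun σ' => σ' = ((σ₂.setReg 4 i).setReg 6 v).setMem 18 v
        (σ.mem 17 v)) ?_ (by decide)).mono (by omega) ?_
      · simp only [wp, Exp.eval, Guard.Holds, State.setReg, State.setMem, update_self, update_of_ne, ne_eq,
      Nat.reduceEqDiff, not_false_eq_true, abs_le, e17]
        exact ⟨by omega, by omega, trivial⟩
      · rintro σ' rfl
        exact hfin _ (σ.mem 17 v) (by simp [State.setReg, State.setMem])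
          (by simp [State.setReg, State.setMem]) this (fun _ => rfl) (fun _ h => absurd h h17)
  · simp only [State.setReg, Function.update_self, Guard.cost, Exp.cost]
    omega
  · rintro σ' ⟨⟨⟨i1, i1'⟩, i2, i3⟩, hg, hag⟩
    simp only [Guard.Holds, Exp.eval] at hg
    have h4 : σ'.reg 4 = 0 := by omega
    rw [h4] at i3
    have := i3 ∅ (IsEnum.zero _)
    exact ⟨fun v hv => (this v hv (by simp)).1, fun v hv => (this v hv (by simp)).2⟩

theorem out_runs (h0 : σ.reg 0 = n) (hn : 0 ≤ n) (hW : absSum (σ.mem 2) (Finset.Ico 0 n) ≤ W)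
    (hB : n + W + 5 ≤ B) :
    Runs B outP σ (n.toNat * 60 + 20) (fun σ' =>
      ((∀ v, 0 ≤ v → v < n → σ'.mem 3 v =
        if v ∈ kept (σ.mem 2) (σ.mem 18) (Finset.Ico 0 n) then 0 else 1) ∧
      σ'.reg 1 = ∑ v ∈ Finset.Ico 0 n \ kept (σ.mem 2) (σ.mem 18) (Finset.Ico 0 n), σ.mem 2 v) ∧
      Agree outP σ σ') := by
  refine Runs.agree ?_
  have hW0 := absSum_nonneg (w := σ.mem 2) (S := Finset.Ico 0 n)
  refine ((Runs.of_wp (Q := fun σ' => σ' = (σ.setReg 1 0).setReg 6 0) ?_).seq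
    (T₂ := n.toNat * 60 + 16) ?_).mono (by simp only [Prog.maxcost, Exp.cost]; omega) (fun _ h => h)
  · simp [wp, Exp.eval]
  rintro σ₁ rfl
  set K := kept (σ.mem 2) (σ.mem 18) (Finset.Ico 0 n) with hK
  have hKm : ∀ v, v ∈ K ↔ (0 ≤ v ∧ v < n) ∧ (σ.mem 18 v = 3 ∨ (σ.mem 18 v ≠ 4 ∧ 0 < σ.mem 2 v)) := by
    intro v
    rw [hK, kept, Finset.mem_filter, Finset.mem_Ico]
  refine (Runs.loop 50 (fun σ' => (0 ≤ σ'.reg 6 ∧ σ'.reg 6 ≤ n) ∧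
      (∀ v, 0 ≤ v → v < σ'.reg 6 → σ'.mem 3 v = if v ∈ K then 0 else 1) ∧
      σ'.reg 1 = ∑ v ∈ Finset.Ico 0 (σ'.reg 6) \ K, σ.mem 2 v)
    (fun σ' => (n - σ'.reg 6).toNat) ?_ ?_).mono ?_ ?_
  · simp only [wp, Exp.eval, Guard.Holds, State.setReg, State.setMem, update_self, update_of_ne, ne_eq,
      Nat.reduceEqDiff, not_false_eq_true, abs_le]
    refine ⟨by omega, fun v _ _ => by omega, by simp⟩
  · rintro σ₂ hag ⟨⟨i1, i1'⟩, i2, i3⟩ hg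
    have e0 : σ₂.reg 0 = n := (hag.1 0 rfl).trans (by simpa [State.setReg] using h0)
    have e2 : σ₂.mem 2 = σ.mem 2 := hag.2 2 rfl
    have e18 : σ₂.mem 18 = σ.mem 18 := hag.2 18 rfl
    simp only [Guard.Holds, Exp.eval, e0] at hg
    have hs : Finset.Ico 0 (σ₂.reg 6 + 1) = insert (σ₂.reg 6) (Finset.Ico 0 (σ₂.reg 6)) := by
      ext y; simp only [Finset.mem_insert, Finset.mem_Ico]; omega
    refine Runs.of_wp_le ?_ (by decide)
    simp only [wp, Exp.eval, Guard.Holds, State.setReg, State.setMem, update_self, update_of_ne, ne_eq,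
      Nat.reduceEqDiff, not_false_eq_true, abs_le, e2, e18]
    have hyes : σ₂.reg 6 ∈ K → ((0 ≤ σ₂.reg 6 + 1 ∧ σ₂.reg 6 + 1 ≤ n) ∧
        (∀ v, 0 ≤ v → v < σ₂.reg 6 + 1 → update (σ₂.mem 3) (σ₂.reg 6) 0 v = if v ∈ K then 0 else 1) ∧
        σ₂.reg 1 = ∑ v ∈ Finset.Ico 0 (σ₂.reg 6 + 1) \ K, σ.mem 2 v) := by
      intro h
      refine ⟨by omega, fun v h1 h2 => ?_, ?_⟩
      · rw [Function.update_apply]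
        split_ifs with h3 h4 h4
        · rfl
        · exact absurd (h3 ▸ h) h4
        · rw [i2 v h1 (by omega), if_pos h4]
        · rw [i2 v h1 (by omega), if_neg h4]
      · rw [hs, Finset.insert_sdiff_of_mem _ h, i3]
    have hsum : |∑ v ∈ Finset.Ico 0 (σ₂.reg 6 + 1) \ K, σ.mem 2 v| ≤ W := by
      refine (Finset.abs_sum_le_sum_abs _ _).trans ((absSum_mono (w := σ.mem 2) ?_).trans hW)
      intro y hy
      simp only [Finset.mem_sdiff, Finset.mem_Ico] at hy ⊢
      omega
    have hno : σ₂.reg 6 ∉ K → ∑ v ∈ Finset.Ico 0 (σ₂.reg 6 + 1) \ K, σ.mem 2 v =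
        σ₂.reg 1 + σ.mem 2 (σ₂.reg 6) := by
      intro h
      rw [hs, Finset.insert_sdiff_of_notMem _ h, Finset.sum_insert (by simp), i3, add_comm]
    rw [abs_le] at hsum
    refine ⟨fun h3 => ⟨by omega, by omega, by omega, hyes ?_, by omega⟩, fun h3 => ⟨fun h4 =>
      ⟨by omega, by omega, by omega, hyes ?_, by omega⟩, fun h4 => ?_⟩⟩
    · exact (hKm _).2 ⟨by omega, .inl h3⟩
    · exact (hKm _).2 ⟨by omega, .inr ⟨h4.1, by omega⟩⟩
    · have hn' : σ₂.reg 6 ∉ K := by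
        rw [hKm]
        rintro ⟨_, h | h⟩
        · exact h3 h
        · exact h4 ⟨h.1, by omega⟩
      have := hno hn'
      refine ⟨by omega, by omega, by omega, by omega, ⟨by omega, fun v h1 h2 => ?_, this.symm⟩,
        by omega⟩
      rw [Function.update_apply]
      split_ifs with h5 h6 h6
      · exact absurd (h5 ▸ h6) hn'
      · rfl
      · rw [i2 v h1 (by omega), if_pos h6]
      · rw [i2 v h1 (by omega), if_neg h6]
  · simp only [State.setReg, Function.update_self, Guard.cost, Exp.cost]
    omega
  · rintro σ' ⟨⟨⟨i1, i1'⟩, i2, i3⟩, hg, hag⟩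
    have e0 : σ'.reg 0 = n := (hag.1 0 rfl).trans (by simpa [State.setReg] using h0)
    simp only [Guard.Holds, Exp.eval, e0] at hg
    have : σ'.reg 6 = n := by omega
    rw [this] at i2 i3
    exact ⟨i2, i3⟩

end

open Function (update)

/-! ## Connected deletion sets -/

/-- `S` induces a connected graph (or is empty). -/
def ConnSet (A : ℤ → ℤ → Prop) (S : Finset ℤ) : Prop :=
  ∀ a ∈ S, ∀ b ∈ S, Relation.ReflTransGen (fun x y => x ∈ S ∧ y ∈ S ∧ A x y) a b

theorem Clique.connSet {A : ℤ → ℤ → Prop} {S : Finset ℤ} (h : Clique A S) : ConnSet A S := by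
  intro a ha b hb
  by_cases hab : a = b
  · rw [hab]
  · exact .single ⟨ha, hb, h a ha b hb hab⟩

/-- Kept sets below the node `t` for which the rest below `t` is connected. -/
structure LocalFeas (A : ℤ → ℤ → Prop) (L : ℤ → Finset ℤ) (t : ℤ) (K : Finset ℤ) : Prop where
  sub : K ⊆ L t
  cluster : Cluster A K
  conn : ConnSet A (L t \ K)

section

variable {A : ℤ → ℤ → Prop} {X N : Finset ℤ} {root : ℤ} {par typ : ℤ → ℤ} {L : ℤ → Finset ℤ}
  {w mc mr r best tw nb nc cnt : ℤ → ℤ} {t v : ℤ} {K S : Finset ℤ}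

namespace Cotree

/-- The children of an inner node are leaves or of the other type. -/
theorem typ_child (T : Cotree A X N root par typ L (-1) (-1)) {c : ℤ} (hc : c ∈ chs N par t)
    (ht : t ∈ N) (hcX : c ∉ X) : typ c ≠ typ t := by
  rw [mem_chs] at hc
  rw [← hc.2]
  exact T.alt c hc.1 hcX (T.ne_root_of_par ht hc.2) (fun h => T.neg (h ▸ hc.1))

theorem exists_child_ne (T : Cotree A X N root par typ L (-1) (-1)) (ht : t ∈ N) (htX : t ∉ X)
    (c : ℤ) : ∃ d ∈ chs N par t, d ≠ c :=
  Finset.exists_mem_ne (two_le_chs T ht htX) c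

theorem adj_join (T : Cotree A X N root par typ L (-1) (-1)) (htyp : typ t = 1) {c d a b : ℤ}
    (hc : c ∈ chs N par t) (hd : d ∈ chs N par t) (hcd : c ≠ d) (ha : a ∈ L c) (hb : b ∈ L d) :
    A a b := by
  rw [mem_chs] at hc hd
  rw [T.adj c hc.1 d hd.1 hcd (hc.2.trans hd.2.symm) a ha b hb, hc.2, htyp]

theorem not_adj_union (T : Cotree A X N root par typ L (-1) (-1)) (htyp : typ t = 0) {c d a b : ℤ}
    (hc : c ∈ chs N par t) (hd : d ∈ chs N par t) (hcd : c ≠ d) (ha : a ∈ L c) (hb : b ∈ L d) :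
    ¬ A a b := by
  rw [mem_chs] at hc hd
  rw [T.adj c hc.1 d hd.1 hcd (hc.2.trans hd.2.symm) a ha b hb, hc.2, htyp]
  omega

theorem disj_chs (T : Cotree A X N root par typ L (-1) (-1)) {c d a : ℤ}
    (hc : c ∈ chs N par t) (hd : d ∈ chs N par t) (ha : a ∈ L c) (hb : a ∈ L d) : c = d := by
  by_contra hcd
  rw [mem_chs] at hc hd
  exact T.disj c hc.1 d hd.1 hcd (hc.2.trans hd.2.symm) a ha hb

theorem child_of_mem (T : Cotree A X N root par typ L (-1) (-1)) (ht : t ∈ N) (htX : t ∉ X) {a : ℤ}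
    (ha : a ∈ L t) : ∃ c ∈ chs N par t, a ∈ L c := by
  obtain ⟨c, h1, h2, h3⟩ := (T.mem_L t ht htX a).1 ha
  exact ⟨c, mem_chs.2 ⟨h1, h2⟩, h3⟩

theorem L_chs (T : Cotree A X N root par typ L (-1) (-1)) (ht : t ∈ N) {c : ℤ}
    (hc : c ∈ chs N par t) : L c ⊆ L t :=
  T.sub_of_par (mem_chs.1 hc).1 ht (mem_chs.1 hc).2

/-- A set below a join that meets two children of it is connected. -/
theorem conn_of_two (T : Cotree A X N root par typ L (-1) (-1)) (ht : t ∈ N) (htX : t ∉ X)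
    (htyp : typ t = 1) (hS : S ⊆ L t) {c d a b : ℤ} (hc : c ∈ chs N par t) (hd : d ∈ chs N par t)
    (hcd : c ≠ d) (ha : a ∈ L c) (hb : b ∈ L d) (haS : a ∈ S) (hbS : b ∈ S) : ConnSet A S := by
  have key : ∀ x ∈ S, ∀ y ∈ S, ∀ e ∈ chs N par t, ∀ f ∈ chs N par t, x ∈ L e → y ∈ L f → e ≠ f →
      Relation.ReflTransGen (fun x y => x ∈ S ∧ y ∈ S ∧ A x y) x y :=
    fun x hx y hy e he f hf hxe hyf hef => .single ⟨hx, hy, T.adj_join htyp he hf hef hxe hyf⟩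
  intro x hx y hy
  obtain ⟨e, he, hxe⟩ := T.child_of_mem ht htX (hS hx)
  obtain ⟨f, hf, hyf⟩ := T.child_of_mem ht htX (hS hy)
  by_cases hef : e = f
  · subst hef
    by_cases hec : e = c
    · subst hec
      exact (key x hx b hbS e he d hd hxe hb hcd).trans (key b hbS y hy d hd e he hb hyf hcd.symm)
    · exact (key x hx a haS e he c hc hxe ha hec).trans
        (key a haS y hy c hc e he ha hyf (Ne.symm hec))
  · exact key x hx y hy e he f hf hxe hyf hef

/-- A connected set below a union lies below a child of it. -/
theorem conn_union (T : Cotree A X N root par typ L (-1) (-1)) (ht : t ∈ N) (htX : t ∉ X)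
    (htyp : typ t = 0) (hS : S ⊆ L t) (hc : ConnSet A S) {a c : ℤ} (ha : a ∈ S)
    (hct : c ∈ chs N par t) (hac : a ∈ L c) : S ⊆ L c := by
  intro b hb
  have := hc a ha b hb
  induction this with
  | refl => exact hac
  | tail _ h ih =>
    have ih := ih h.1
    obtain ⟨e, he, hye⟩ := T.child_of_mem ht htX (hS h.2.1)
    by_cases hce : c = e
    · rwa [hce]
    · exact absurd h.2.2 (T.not_adj_union htyp hct he hce ih hye)

theorem not_conn_union (T : Cotree A X N root par typ L (-1) (-1)) (ht : t ∈ N) (htX : t ∉ X)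
    (htyp : typ t = 0) : ¬ ConnSet A (L t) := by
  intro h
  obtain ⟨c, hc, -⟩ := T.exists_child_ne ht htX (-1)
  obtain ⟨d, hd, hdc⟩ := T.exists_child_ne ht htX c
  obtain ⟨a, ha⟩ := T.ne c (mem_chs.1 hc).1
  obtain ⟨b, hb⟩ := T.ne d (mem_chs.1 hd).1
  have := T.conn_union ht htX htyp subset_rfl h (T.L_chs ht hc ha) hc ha (T.L_chs ht hd hb)
  exact hdc (T.disj_chs hd hc hb this)

/-- Leaves and joins are connected. -/
theorem conn_L (T : Cotree A X N root par typ L (-1) (-1)) (ht : t ∈ N) (htyp : typ t ≠ 0) :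
    ConnSet A (L t) := by
  rcases T.leaf_of_typ ht with ⟨_, _, hL⟩ | ⟨_, h⟩ | ⟨htX, h⟩
  · rw [hL]
    intro a ha b hb
    rw [Finset.mem_singleton] at ha hb
    rw [ha, hb]
  · exact absurd h htyp
  · obtain ⟨c, hc, -⟩ := T.exists_child_ne ht htX (-1)
    obtain ⟨d, hd, hdc⟩ := T.exists_child_ne ht htX c
    obtain ⟨a, ha⟩ := T.ne c (mem_chs.1 hc).1
    obtain ⟨b, hb⟩ := T.ne d (mem_chs.1 hd).1
    exact T.conn_of_two ht htX h subset_rfl hc hd hdc.symm ha hb (T.L_chs ht hc ha) (T.L_chs ht hd hb)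

theorem not_clique_union (T : Cotree A X N root par typ L (-1) (-1)) (ht : t ∈ N) (htX : t ∉ X)
    (htyp : typ t = 0) : ¬ Clique A (L t) := fun h => T.not_conn_union ht htX htyp h.connSet

/-- A clique misses some leaf below each union. -/
theorem exists_not_mem (T : Cotree A X N root par typ L (-1) (-1)) (ht : t ∈ N) (htX : t ∉ X)
    (htyp : typ t = 0) (hK : Clique A K) : ∃ a ∈ L t, a ∉ K := by
  by_contra! h
  exact T.not_clique_union ht htX htyp (hK.mono h)

theorem union_of_child (T : Cotree A X N root par typ L (-1) (-1)) {c : ℤ} (hc : c ∈ chs N par t)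
    (ht : t ∈ N) (htyp : typ t = 1) (hcX : c ∉ X) : typ c = 0 := by
  have h1 := T.typ_child hc ht hcX
  rcases T.typ_int c (mem_chs.1 hc).1 hcX with h | h <;> omega

theorem clique_of_leaf (T : Cotree A X N root par typ L (-1) (-1)) (ht : t ∈ X) :
    Clique A (L t) := by
  intro a ha b hb hab
  rw [(T.leaf t ht).1, Finset.mem_singleton] at ha hb
  exact absurd (ha.trans hb.symm) hab

end Cotree

namespace Tables

open Cotree

theorem clique_of_nb (D : Tables X N par typ w mc mr r best tw nb nc)
    (T : Cotree A X N root par typ L (-1) (-1)) (ht : t ∈ N) (htyp : typ t ≠ 0)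
    (h : ¬ (typ t = 1 ∧ nb t ≠ 0)) : Clique A (L t) := by
  rcases T.leaf_of_typ ht with ⟨h', _⟩ | ⟨_, h'⟩ | ⟨htX, h'⟩
  · exact T.clique_of_leaf h'
  · exact absurd h' htyp
  · have h0 : nb t = 0 := by tauto
    rw [D.nb_eq t ht htX] at h0
    have h0 : (chs N par t).filter (· ∉ X) = ∅ := Finset.card_eq_zero.1 (by exact_mod_cast h0)
    refine T.clique_join ht h' htX subset_rfl fun c hc => ?_
    have : c ∈ X := by
      by_contra hcX
      have : c ∈ (chs N par t).filter (· ∉ X) := Finset.mem_filter.2 ⟨hc, hcX⟩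
      rw [h0] at this
      simp at this
    exact (T.clique_of_leaf this).mono Finset.inter_subset_right

theorem not_cluster_of_nb (D : Tables X N par typ w mc mr r best tw nb nc)
    (T : Cotree A X N root par typ L (-1) (-1)) (ht : t ∈ N) (htyp : typ t = 1)
    (h : nb t ≠ 0) : ¬ Cluster A (L t) := by
  have htX := T.typ_not_leaf (t := t) (by omega)
  have h0 : ((chs N par t).filter (· ∉ X)).Nonempty := by
    rw [Finset.nonempty_iff_ne_empty]
    intro h'
    rw [D.nb_eq t ht htX, h'] at h
    exact h rfl
  obtain ⟨c, hc⟩ := h0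
  obtain ⟨hc, hcX⟩ := Finset.mem_filter.1 hc
  have hcN := (mem_chs.1 hc).1
  have hct := T.union_of_child hc ht htyp hcX
  obtain ⟨z, hz, hzc⟩ := T.exists_child_ne ht htX c
  obtain ⟨y, hy⟩ := T.ne z (mem_chs.1 hz).1
  obtain ⟨d, hd, -⟩ := T.exists_child_ne hcN hcX (-1)
  obtain ⟨e, he, hed⟩ := T.exists_child_ne hcN hcX d
  obtain ⟨a, ha⟩ := T.ne d (mem_chs.1 hd).1
  obtain ⟨b, hb⟩ := T.ne e (mem_chs.1 he).1
  have hac := T.L_chs hcN hd ha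
  have hbc := T.L_chs hcN he hb
  intro hcl
  have hab := hcl a (T.L_chs ht hc hac) y (T.L_chs ht hz hy) b (T.L_chs ht hc hbc)
    (T.adj_join htyp hc hz hzc.symm hac hy) (T.adj_join htyp hz hc hzc hy hbc)
    (by rintro rfl; exact hed (T.disj_chs he hd hb ha))
  exact T.not_adj_union hct hd he hed.symm ha hb hab

theorem cluster_iff_nc (D : Tables X N par typ w mc mr r best tw nb nc)
    (T : Cotree A X N root par typ L (-1) (-1)) (ht : t ∈ N) (htyp : typ t = 0) :
    Cluster A (L t) ↔ nc t = 0 := by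
  have htX := T.typ_not_leaf (t := t) (by omega)
  rw [D.nc_eq t ht htX]
  constructor
  · intro h
    rw [Nat.cast_eq_zero, Finset.card_eq_zero, Finset.filter_eq_empty_iff]
    rintro c hc ⟨h1, h2⟩
    exact D.not_cluster_of_nb T (mem_chs.1 hc).1 h1 h2 (h.mono (T.L_chs ht hc))
  · intro h
    rw [Nat.cast_eq_zero, Finset.card_eq_zero, Finset.filter_eq_empty_iff] at h
    refine T.cluster_union ht htyp htX subset_rfl fun c hc => ?_
    rw [Finset.inter_eq_right.2 (T.L_chs ht hc)]
    by_cases hcX : c ∈ X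
    · exact (T.clique_of_leaf hcX).cluster
    · have := T.typ_child hc ht hcX
      exact (D.clique_of_nb T (mem_chs.1 hc).1 (by omega) (h hc)).cluster

theorem le_pos (D : Tables X N par typ w mc mr r best tw nb nc)
    (T : Cotree A X N root par typ L (-1) (-1)) : ∀ t ∈ N,
      mc t ≤ ∑ y ∈ L t, max (w y) 0 ∧ r t ≤ ∑ y ∈ L t, max (w y) 0 := by
  refine T.induct _ fun t ht ih => ?_
  have hmono : ∀ c ∈ chs N par t, ∑ y ∈ L c, max (w y) 0 ≤ ∑ y ∈ L t, max (w y) 0 := fun c hc =>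
    Finset.sum_le_sum_of_subset_of_nonneg (T.L_chs ht hc) fun _ _ _ => le_max_right _ _
  have ih' : ∀ c ∈ chs N par t, mc c ≤ ∑ y ∈ L c, max (w y) 0 ∧ r c ≤ ∑ y ∈ L c, max (w y) 0 :=
    fun c hc => ih c (mem_chs.1 hc).1 (mem_chs.1 hc).2
  rcases T.leaf_of_typ ht with ⟨h, _, hL⟩ | ⟨h, htyp⟩ | ⟨h, htyp⟩
  · obtain ⟨h1, h2, _⟩ := D.leaf t h
    rw [h1, h2, hL, Finset.sum_singleton]
    exact ⟨le_rfl, le_rfl⟩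
  · obtain ⟨_, h2, h3⟩ := D.union_mc t ht htyp
    rw [← h3]
    refine ⟨(ih' _ h2).1.trans (hmono _ h2), ?_⟩
    rw [D.union t ht htyp, T.sum_L ht h]
    exact Finset.sum_le_sum fun c hc => (ih' c hc).2
  · have h1 : mc t ≤ ∑ y ∈ L t, max (w y) 0 := by
      rw [D.join t ht htyp, T.sum_L ht h]
      exact Finset.sum_le_sum fun c hc => (ih' c hc).1
    obtain ⟨_, h2, h3, h4⟩ := D.join_r t ht htyp
    rw [h4, ← h3]
    exact ⟨h1, max_le h1 ((ih' _ h2).2.trans (hmono _ h2))⟩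

theorem sum_pos_filter {S : Finset ℤ} {w : ℤ → ℤ} :
    ∑ y ∈ S.filter (fun y => 0 < w y), w y = ∑ y ∈ S, max (w y) 0 := by
  rw [Finset.sum_filter]
  refine Finset.sum_congr rfl fun y _ => ?_
  split_ifs with h
  · rw [max_eq_left h.le]
  · rw [max_eq_right (by omega)]

theorem r_eq_pos (D : Tables X N par typ w mc mr r best tw nb nc)
    (T : Cotree A X N root par typ L (-1) (-1)) (hA : IsCograph A) (ht : t ∈ N)
    (h : Cluster A (L t)) : r t = ∑ y ∈ L t, max (w y) 0 := by
  refine le_antisymm (D.le_pos T t ht).2 ?_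
  rw [← sum_pos_filter]
  exact D.cluster_le T hA t ht _ (Finset.filter_subset _ _) (h.mono (Finset.filter_subset _ _))

end Tables

/-- The candidates for the vertices kept below a join `t` that is not a clique: the modes of `t` and
`v` become `m` and `m'`, the mode of `z` becomes `4`, and the weight is `val`. -/
inductive Cand (X N : Finset ℤ) (par typ : ℤ → ℤ) (mc r tw nb nc cnt : ℤ → ℤ) (t : ℤ) :
    ℤ → ℤ → ℤ → ℤ → ℤ → Prop
  | whole (h1 : 2 ≤ nb t) (h2 : 3 ≤ cnt t) : Cand X N par typ mc r tw nb nc cnt t (r t) 1 (-1) 0 (-1)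
  | clique (h1 : nb t = 2) (h2 : cnt t = 2) : Cand X N par typ mc r tw nb nc cnt t (mc t) 2 (-1) 0 (-1)
  | leaf {v : ℤ} (h1 : nb t = 1) (hv : v ∈ chs N par t) (hvX : v ∈ X) :
      Cand X N par typ mc r tw nb nc cnt t (mc t - mc v) 2 v 4 (-1)
  | sub {v : ℤ} (h1 : nb t = 1 ∨ (nb t = 2 ∧ nc v ≠ 0)) (hv : v ∈ chs N par t) (hvX : v ∉ X) :
      Cand X N par typ mc r tw nb nc cnt t (r v) 4 v 1 (-1)
  | sub_ne {v z : ℤ} (h1 : nb t = 2) (hv : v ∈ chs N par t) (hvX : v ∉ X) (hnc : nc v = 0)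
      (hz : z ∈ X) (hzv : Anc N par z v) :
      Cand X N par typ mc r tw nb nc cnt t (r v - mc z) 4 v 5 z
  | comp {p v s : ℤ} (h1 : nb t = 1) (hp : p ∈ chs N par t) (hpX : p ∉ X) (hv : v ∈ chs N par p)
      (hcnt : cnt p = 2) (hs : s ∈ chs N par p) (hsv : s ≠ v) (hcl : ¬ (typ s = 1 ∧ nb s ≠ 0)) :
      Cand X N par typ mc r tw nb nc cnt t (tw t - tw v) 3 v 4 (-1)

end

open Function (update)

section

variable {A : ℤ → ℤ → Prop} {X N : Finset ℤ} {root : ℤ} {par typ : ℤ → ℤ} {L : ℤ → Finset ℤ}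
  {w mc mr r best tw nb nc cnt : ℤ → ℤ} {t v : ℤ} {K S : Finset ℤ}

namespace Cotree

theorem mem_L_iff_anc (T : Cotree A X N root par typ L (-1) (-1)) {y : ℤ} (hy : y ∈ X) :
    ∀ t ∈ N, (y ∈ L t ↔ Anc N par y t) := by
  refine T.induct _ fun t ht ih => ?_
  constructor
  · intro h
    by_cases htX : t ∈ X
    · rw [(T.leaf t htX).1, Finset.mem_singleton] at h
      rw [h]
      exact .refl
    · obtain ⟨c, hc, hyc⟩ := T.child_of_mem ht htX h
      rw [mem_chs] at hc
      have := ((ih c hc.1 hc.2).1 hyc).step hc.1 (by rw [hc.2]; exact ht)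
      rwa [hc.2] at this
  · intro h
    have := T.anc_sub h
    rw [(T.leaf y hy).1] at this
    exact this (by simp)

end Cotree

namespace Tables

open Cotree

theorem sum_le_of_clique_join (D : Tables X N par typ w mc mr r best tw nb nc)
    (T : Cotree A X N root par typ L (-1) (-1)) (ht : t ∈ N) (htyp : typ t = 1) (hK : K ⊆ L t)
    (hc : Clique A K) (hv : v ∈ chs N par t) (hvK : ∀ y ∈ L v, y ∉ K) :
    ∑ y ∈ K, w y ≤ mc t - mc v := by
  have htX := T.typ_not_leaf (t := t) (by omega)
  rw [D.join t ht htyp, T.sum_chs ht htX hK, ← Finset.add_sum_erase _ _ hv,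
    ← Finset.add_sum_erase _ (fun c => mc c) hv]
  have h0 : K ∩ L v = ∅ := by
    ext y
    simp only [Finset.mem_inter, Finset.notMem_empty, iff_false, not_and]
    exact fun h1 h2 => hvK y h2 h1
  rw [h0, Finset.sum_empty]
  have : ∑ c ∈ (chs N par t).erase v, ∑ y ∈ K ∩ L c, w y ≤ ∑ c ∈ (chs N par t).erase v, mc c := by
    refine Finset.sum_le_sum fun c hc' => ?_
    have hc' := mem_chs.1 (Finset.mem_of_mem_erase hc')
    exact D.clique_le T c hc'.1 _ Finset.inter_subset_right (hc.mono Finset.inter_subset_left)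
  omega

theorem nb_card (D : Tables X N par typ w mc mr r best tw nb nc) (ht : t ∈ N) (htX : t ∉ X) {k : ℕ}
    (h : nb t = k) : ((chs N par t).filter (· ∉ X)).card = k := by
  rw [D.nb_eq t ht htX] at h
  exact_mod_cast h

/-- The only inner child. -/
theorem nb_one (D : Tables X N par typ w mc mr r best tw nb nc) (ht : t ∈ N) (htX : t ∉ X)
    (h : nb t = 1) : ∃ c ∈ chs N par t, c ∉ X ∧ ∀ d ∈ chs N par t, d ≠ c → d ∈ X := by
  obtain ⟨c, hc⟩ := Finset.card_eq_one.1 (D.nb_card (k := 1) ht htX h)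
  have hc' : c ∈ (chs N par t).filter (· ∉ X) := by simp [hc]
  rw [Finset.mem_filter] at hc'
  refine ⟨c, hc'.1, hc'.2, fun d hd hdc => ?_⟩
  by_contra hdX
  have : d ∈ (chs N par t).filter (· ∉ X) := Finset.mem_filter.2 ⟨hd, hdX⟩
  rw [hc, Finset.mem_singleton] at this
  exact hdc this

theorem nb_two (D : Tables X N par typ w mc mr r best tw nb nc) (ht : t ∈ N) (htX : t ∉ X)
    (h : 2 ≤ nb t) : ∃ c ∈ chs N par t, ∃ d ∈ chs N par t, c ≠ d ∧ c ∉ X ∧ d ∉ X := by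
  rw [D.nb_eq t ht htX] at h
  obtain ⟨c, hc, d, hd, hcd⟩ := Finset.one_lt_card.1
    (by omega : 1 < ((chs N par t).filter (· ∉ X)).card)
  rw [Finset.mem_filter] at hc hd
  exact ⟨c, hc.1, d, hd.1, hcd, hc.2, hd.2⟩

/-- If both children are inner nodes. -/
theorem nb_two_eq (D : Tables X N par typ w mc mr r best tw nb nc) (ht : t ∈ N) (htX : t ∉ X)
    (h : nb t = 2) (hc2 : (chs N par t).card = 2) : ∀ c ∈ chs N par t, c ∉ X := by
  have := Finset.eq_of_subset_of_card_le (Finset.filter_subset (· ∉ X) (chs N par t))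
    (by rw [D.nb_card (k := 2) ht htX h, hc2])
  intro c hc
  rw [← this] at hc
  exact (Finset.mem_filter.1 hc).2

theorem sum_le_pos (D : Tables X N par typ w mc mr r best tw nb nc)
    (T : Cotree A X N root par typ L (-1) (-1)) (hA : IsCograph A) (hv : v ∈ N)
    (hcl : Cluster A (L v)) (hK : K ⊆ L v) {z : ℤ} (hz : z ∈ L v) (hzK : z ∉ K) :
    ∑ y ∈ K, w y ≤ r v - mc z := by
  have hzX := T.L_sub hv hz
  rw [D.r_eq_pos T hA hv hcl, (D.leaf z hzX).1, ← Finset.add_sum_erase _ _ hz]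
  have h1 : ∑ y ∈ K, w y ≤ ∑ y ∈ K, max (w y) 0 := Finset.sum_le_sum fun y _ => le_max_left _ _
  have h2 : ∑ y ∈ K, max (w y) 0 ≤ ∑ y ∈ (L v).erase z, max (w y) 0 := by
    refine Finset.sum_le_sum_of_subset_of_nonneg (fun y hy => ?_) fun _ _ _ => le_max_right _ _
    rw [Finset.mem_erase]
    exact ⟨fun h => hzK (h ▸ hy), hK hy⟩
  omega

/-- Every feasible kept set is dominated by a candidate. -/
theorem exists_cand (D : Tables X N par typ w mc mr r best tw nb nc)
    (T : Cotree A X N root par typ L (-1) (-1)) (hA : IsCograph A)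
    (hcnt : ∀ t ∈ N, t ∉ X → cnt t = (chs N par t).card) (ht : t ∈ N) (htyp : typ t = 1)
    (hnb : nb t ≠ 0) (F : LocalFeas A L t K) :
    ∃ val m v m' z, Cand X N par typ mc r tw nb nc cnt t val m v m' z ∧ ∑ y ∈ K, w y ≤ val := by
  have htX := T.typ_not_leaf (t := t) (by omega)
  have hc2 := two_le_chs T ht htX
  have hct := hcnt t ht htX
  have hnbc : nb t ≤ cnt t := by
    rw [hct, D.nb_eq t ht htX]
    exact_mod_cast Finset.card_filter_le _ _
  have hnb0 : 0 ≤ nb t := by rw [D.nb_eq t ht htX]; positivity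
  by_cases hw : 2 ≤ nb t ∧ 3 ≤ cnt t
  · exact ⟨_, _, _, _, _, .whole hw.1 hw.2, D.cluster_le T hA t ht K F.sub F.cluster⟩
  by_cases hb : nb t = 2
  · have hc : cnt t = 2 := by omega
    have hin := D.nb_two_eq ht htX hb (by omega)
    rcases T.cluster_join hA ht htyp htX F.sub F.cluster with hK | ⟨v, hv, hKv⟩
    · exact ⟨_, _, _, _, _, .clique hb hc, D.clique_le T t ht K F.sub hK⟩
    · have hvN := (mem_chs.1 hv).1
      by_cases hnc : nc v = 0
      · have hvt := T.union_of_child hv ht htyp (hin v hv)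
        have : ∃ z ∈ L v, z ∉ K := by
          by_contra! h
          have hKe : K = L v := Finset.Subset.antisymm hKv h
          obtain ⟨d, hd, hdv⟩ := T.exists_child_ne ht htX v
          have : L t \ K = L d := by
            ext y
            rw [Finset.mem_sdiff, hKe]
            constructor
            · rintro ⟨h1, h2⟩
              obtain ⟨e, he, hye⟩ := T.child_of_mem ht htX h1
              have hev : e ≠ v := by rintro rfl; exact h2 hye
              have h2c : (chs N par t).card ≤ 2 := by omega
              have : e = d := by
                by_contra hed
                have hsub : ({e, d, v} : Finset ℤ) ⊆ chs N par t := by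
                  intro x
                  simp only [Finset.mem_insert, Finset.mem_singleton]
                  rintro (rfl | rfl | rfl) <;> assumption
                have := Finset.card_le_card hsub
                rw [Finset.card_eq_three.2 ⟨e, d, v, hed, hev, hdv, rfl⟩] at this
                omega
              rwa [← this]
            · intro h
              exact ⟨T.L_chs ht hd h, fun h' => hdv (T.disj_chs hd hv h h')⟩
          have hconn := F.conn
          rw [this] at hconn
          exact T.not_conn_union (mem_chs.1 hd).1 (hin d hd)
            (T.union_of_child hd ht htyp (hin d hd)) hconn
        obtain ⟨z, hz, hzK⟩ := this
        have hzX := T.L_sub hvN hz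
        exact ⟨_, _, _, _, _, .sub_ne hb hv (hin v hv) hnc hzX ((T.mem_L_iff_anc hzX v hvN).1 hz),
          D.sum_le_pos T hA hvN ((D.cluster_iff_nc T hvN hvt).2 hnc) hKv hz hzK⟩
      · exact ⟨_, _, _, _, _, .sub (.inr ⟨hb, hnc⟩) hv (hin v hv), D.cluster_le T hA v hvN K hKv F.cluster⟩
  have hb1 : nb t = 1 := by omega
  obtain ⟨c, hc, hcX, hleaf⟩ := D.nb_one ht htX hb1
  have hcN := (mem_chs.1 hc).1
  have hctyp := T.union_of_child hc ht htyp hcX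
  by_cases hK : Clique A K
  · by_cases hv : ∃ v ∈ chs N par t, v ∈ X ∧ v ∉ K
    · obtain ⟨v, hv, hvX, hvK⟩ := hv
      refine ⟨_, _, _, _, _, .leaf hb1 hv hvX, D.sum_le_of_clique_join T ht htyp F.sub hK hv ?_⟩
      rw [(T.leaf v hvX).1]
      simpa using hvK
    push Not at hv
    -- everything outside `K` lies below one child of `c`
    obtain ⟨a, hac, haK⟩ := T.exists_not_mem hcN hcX hctyp hK
    have hSc : L t \ K ⊆ L c := by
      intro y hy
      rw [Finset.mem_sdiff] at hy
      obtain ⟨e, he, hye⟩ := T.child_of_mem ht htX hy.1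
      by_cases hec : e = c
      · rwa [← hec]
      · have heX := hleaf e he hec
        rw [(T.leaf e heX).1, Finset.mem_singleton] at hye
        rw [hye] at hy
        exact absurd (hv e he heX) hy.2
    obtain ⟨v, hvc, hav⟩ := T.child_of_mem hcN hcX hac
    have hSv := T.conn_union hcN hcX hctyp hSc F.conn (by simp [haK, T.L_chs ht hc hac]) hvc hav
    have hother : ∀ y ∈ L t, y ∉ L v → y ∈ K := by
      intro y hy hyv
      by_contra hyK
      exact hyv (hSv (by simp [hy, hyK]))
    obtain ⟨s, hs, hsv⟩ := T.exists_child_ne hcN hcX v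
    have hsN := (mem_chs.1 hs).1
    have hsK : L s ⊆ K := fun y hy => hother y (T.L_chs ht hc (T.L_chs hcN hs hy))
      fun h => hsv (T.disj_chs hs hvc hy h)
    obtain ⟨b, hb⟩ := T.ne s hsN
    have hKs : ∀ d ∈ chs N par c, ∀ y ∈ L d, y ∈ K → d = s := by
      intro d hd y hy hyK
      by_contra hds
      refine T.not_adj_union hctyp hd hs hds hy hb (hK y hyK b (hsK hb) ?_)
      rintro rfl
      exact hds (T.disj_chs hd hs hy hb)
    have hcnt2 : cnt c = 2 := by
      rw [hcnt c hcN hcX]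
      have : chs N par c = {s, v} := by
        ext d
        rw [Finset.mem_insert, Finset.mem_singleton]
        constructor
        · intro hd
          by_cases hdv : d = v
          · exact .inr hdv
          · obtain ⟨y, hy⟩ := T.ne d (mem_chs.1 hd).1
            exact .inl (hKs d hd y hy (hother y (T.L_chs ht hc (T.L_chs hcN hd hy))
              fun h => hdv (T.disj_chs hd hvc hy h)))
        · rintro (rfl | rfl) <;> assumption
      rw [this, Finset.card_pair hsv]
      rfl
    refine ⟨_, _, _, _, _, .comp hb1 hc hcX hvc hcnt2 hs hsv ?_, ?_⟩
    · rintro ⟨h1, h2⟩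
      exact D.not_cluster_of_nb T hsN h1 h2 (hK.mono hsK).cluster
    · have hKe : K = L t \ L v := by
        ext y
        rw [Finset.mem_sdiff]
        constructor
        · exact fun hy => ⟨F.sub hy, fun hyv => hsv (hKs v hvc y hyv hy).symm⟩
        · exact fun hy => hother y hy.1 hy.2
      have hvt : L v ⊆ L t := (T.L_chs hcN hvc).trans (T.L_chs ht hc)
      have := Finset.sum_sdiff (f := w) hvt
      rw [hKe, D.tw_sum T t ht, D.tw_sum T v (mem_chs.1 hvc).1]
      omega
  · rcases T.cluster_join hA ht htyp htX F.sub F.cluster with h | ⟨v, hv, hKv⟩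
    · exact absurd h hK
    · have hvc : v = c := by
        by_contra hvc
        exact hK ((T.clique_of_leaf (hleaf v hv hvc)).mono hKv)
      subst hvc
      exact ⟨_, _, _, _, _, .sub (.inl hb1) hv hcX, D.cluster_le T hA v hcN K hKv F.cluster⟩

end Tables

theorem mem_chs_anc {c : ℤ} (ht : t ∈ N) (hc : c ∈ chs N par t) : Anc N par c t :=
  .single ⟨(mem_chs.1 hc).1, ht, (mem_chs.1 hc).2⟩

/-- Constant modes are inherited by all nodes that are not below `b`. -/
theorem Modes.const {ov mode : ℤ → ℤ} (Mo : Modes N root par typ mc mr best ov mode)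
    (T : Cotree A X N root par typ L (-1) (-1)) {a b m : ℤ} (hm : m = 3 ∨ m = 4 ∨ m = 5)
    (hma : mode a = m) (hov : ∀ c ∈ N, Anc N par c a → c ≠ a → ¬ Anc N par c b → ov c = 0)
    {c : ℤ} (hc : Anc N par c a) (hcb : ¬ Anc N par c b) : mode c = m := by
  induction hc using Relation.ReflTransGen.head_induction_on with
  | refl => exact hma
  | head h h' ih =>
    rename_i x y
    have hxy : Anc N par x y := .single h
    have hx : x ≠ a := by
      rintro rfl
      exact T.not_anc_of_par h.2.1 h.2.2 h'
    have := ih (fun h'' => hcb (hxy.trans h''))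
    rw [Mo.inh x h.1 (T.ne_root_of_par h.2.1 h.2.2) (hov x h.1 (hxy.trans h') hx hcb), h.2.2, inherit]
    split_ifs <;> omega

theorem Modes.kept_except {ov mode : ℤ → ℤ} (Mo : Modes N root par typ mc mr best ov mode)
    (D : Tables X N par typ w mc mr r best tw nb nc)
    (T : Cotree A X N root par typ L (-1) (-1)) {a b m : ℤ} (hm : m = 3 ∨ m = 5)
    (ha : a ∈ N) (hb : b ∈ N) (hma : mode a = m) (hmb : mode b = 4) (hfb : Free N par ov b)
    (hov : ∀ c ∈ N, Anc N par c a → c ≠ a → ¬ Anc N par c b → ov c = 0) :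
    kept w mode (L a) = (L a \ L b).filter (fun y => m = 3 ∨ 0 < w y) := by
  ext y
  simp only [kept, Finset.mem_filter, Finset.mem_sdiff, and_assoc]
  refine and_congr_right fun hya => ?_
  have hyX := T.L_sub ha hya
  have hya' := (T.mem_L_iff_anc hyX a ha).1 hya
  by_cases hyb : y ∈ L b
  · have := (Mo.selects D T b hb hfb).four hmb
    have h2 : y ∉ kept w mode (L b) := by simp [this]
    simp only [kept, Finset.mem_filter, not_and] at h2
    have := h2 hyb
    tauto
  · have hyb' := (not_congr (T.mem_L_iff_anc hyX b hb)).1 hyb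
    have := Mo.const T (by tauto) hma hov hya' hyb'
    rw [this]
    rcases hm with rfl | rfl <;> simp [hyb]

end

open Function (update)

section

variable {A : ℤ → ℤ → Prop} {X N : Finset ℤ} {root : ℤ} {par typ : ℤ → ℤ} {L : ℤ → Finset ℤ}
  {w mc mr r best tw nb nc cnt : ℤ → ℤ} {t v : ℤ} {K S : Finset ℤ}

namespace Cotree

theorem chs_eq_of_anc (T : Cotree A X N root par typ L (-1) (-1)) {c e d : ℤ}
    (hc : c ∈ chs N par t) (he : e ∈ chs N par t) (hd : d ∈ N) (h1 : Anc N par d c)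
    (h2 : Anc N par d e) : c = e := by
  obtain ⟨y, hy⟩ := T.ne d hd
  exact T.disj_chs hc he (T.anc_sub h1 hy) (T.anc_sub h2 hy)

theorem not_anc_child (T : Cotree A X N root par typ L (-1) (-1)) (ht : t ∈ N) {c : ℤ}
    (hc : c ∈ chs N par t) : ¬ Anc N par t c := fun h =>
  T.not_anc_of_par ht (mem_chs.1 hc).2 h

theorem eq_of_anc_leaf (T : Cotree A X N root par typ L (-1) (-1)) {c z : ℤ} (hz : z ∈ X)
    (h : Anc N par c z) : z = c := by
  rcases h.eq_or with h | ⟨d, hd, hdz, hzN, _⟩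
  · exact h
  · exact absurd hz (T.not_leaf_of_par hd hzN hdz)

end Cotree

namespace Tables

open Cotree

theorem conn_clique (D : Tables X N par typ w mc mr r best tw nb nc)
    (T : Cotree A X N root par typ L (-1) (-1)) (ht : t ∈ N) (htyp : typ t = 1) (h : 2 ≤ nb t)
    (hK : Clique A K) : ConnSet A (L t \ K) := by
  have htX := T.typ_not_leaf (t := t) (by omega)
  obtain ⟨c, hc, d, hd, hcd, hcX, hdX⟩ := D.nb_two ht htX h
  obtain ⟨a, ha, haK⟩ := T.exists_not_mem (mem_chs.1 hc).1 hcX (T.union_of_child hc ht htyp hcX) hK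
  obtain ⟨b, hb, hbK⟩ := T.exists_not_mem (mem_chs.1 hd).1 hdX (T.union_of_child hd ht htyp hdX) hK
  exact T.conn_of_two ht htX htyp Finset.sdiff_subset hc hd hcd ha hb
    (Finset.mem_sdiff.2 ⟨T.L_chs ht hc ha, haK⟩) (Finset.mem_sdiff.2 ⟨T.L_chs ht hd hb, hbK⟩)

theorem conn_whole (D : Tables X N par typ w mc mr r best tw nb nc)
    (T : Cotree A X N root par typ L (-1) (-1)) (hA : IsCograph A) (ht : t ∈ N) (htyp : typ t = 1)
    (h : 2 ≤ nb t) (hc3 : 3 ≤ (chs N par t).card) (hKt : K ⊆ L t) (hK : Cluster A K) :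
    ConnSet A (L t \ K) := by
  have htX := T.typ_not_leaf (t := t) (by omega)
  rcases T.cluster_join hA ht htyp htX hKt hK with hK | ⟨v, hv, hKv⟩
  · exact D.conn_clique T ht htyp h hK
  · obtain ⟨c, hc, d, hd, hcd⟩ := Finset.one_lt_card.1
      (by rw [Finset.card_erase_of_mem hv]; omega : 1 < ((chs N par t).erase v).card)
    rw [Finset.mem_erase] at hc hd
    obtain ⟨a, ha⟩ := T.ne c (mem_chs.1 hc.2).1
    obtain ⟨b, hb⟩ := T.ne d (mem_chs.1 hd.2).1
    exact T.conn_of_two ht htX htyp Finset.sdiff_subset hc.2 hd.2 hcd ha hb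
      (Finset.mem_sdiff.2 ⟨T.L_chs ht hc.2 ha, fun h => hc.1 (T.disj_chs hc.2 hv ha (hKv h))⟩)
      (Finset.mem_sdiff.2 ⟨T.L_chs ht hd.2 hb, fun h => hd.1 (T.disj_chs hd.2 hv hb (hKv h))⟩)

theorem conn_sub (D : Tables X N par typ w mc mr r best tw nb nc)
    (T : Cotree A X N root par typ L (-1) (-1)) (ht : t ∈ N) (htyp : typ t = 1)
    (hv : v ∈ chs N par t) (hvX : v ∉ X) (h : nb t = 1 ∨ (nb t = 2 ∧ nc v ≠ 0)) (hKv : K ⊆ L v)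
    (hK : Cluster A K) : ConnSet A (L t \ K) := by
  have htX := T.typ_not_leaf (t := t) (by omega)
  have hvt := T.union_of_child hv ht htyp hvX
  by_cases h' : L v ⊆ K
  · have hKe : K = L v := Finset.Subset.antisymm hKv h'
    have hnc := (D.cluster_iff_nc T (mem_chs.1 hv).1 hvt).1 (hKe ▸ hK)
    obtain ⟨c, hc, hcX, hleaf⟩ := D.nb_one ht htX (by tauto)
    have hvc : v = c := by
      by_contra hvc
      exact hvX (hleaf v hv hvc)
    subst hvc
    refine Clique.connSet fun a ha b hb hab => ?_
    rw [Finset.mem_sdiff] at ha hb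
    obtain ⟨e, he, hae⟩ := T.child_of_mem ht htX ha.1
    obtain ⟨f, hf, hbf⟩ := T.child_of_mem ht htX hb.1
    by_cases hef : e = f
    · subst hef
      have hev : e ≠ v := by rintro rfl; exact ha.2 (h' hae)
      rw [(T.leaf e (hleaf e he hev)).1, Finset.mem_singleton] at hae hbf
      exact absurd (hae.trans hbf.symm) hab
    · exact T.adj_join htyp he hf hef hae hbf
  · obtain ⟨a, ha, haK⟩ := Finset.not_subset.1 h'
    obtain ⟨d, hd, hdv⟩ := T.exists_child_ne ht htX v
    obtain ⟨b, hb⟩ := T.ne d (mem_chs.1 hd).1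
    exact T.conn_of_two ht htX htyp Finset.sdiff_subset hv hd hdv.symm ha hb
      (Finset.mem_sdiff.2 ⟨T.L_chs ht hv ha, haK⟩)
      (Finset.mem_sdiff.2 ⟨T.L_chs ht hd hb, fun h => hdv (T.disj_chs hd hv hb (hKv h))⟩)

end Tables

/-- If the children other than `v` are not kept, then only vertices below `v` are kept. -/
theorem kept_one (T : Cotree A X N root par typ L (-1) (-1)) {mode : ℤ → ℤ} (ht : t ∈ N) (htX : t ∉ X)
    (hv : v ∈ chs N par t) (h : ∀ c ∈ chs N par t, c ≠ v → kept w mode (L c) = ∅) :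
    kept w mode (L t) = kept w mode (L v) := by
  ext y
  rw [T.mem_kept ht htX]
  constructor
  · rintro ⟨c, hc, hy⟩
    by_cases hcv : c = v
    · rwa [← hcv]
    · rw [h c hc hcv] at hy
      simp at hy
  · exact fun hy => ⟨v, hv, hy⟩

/-- The candidates are feasible and have the stated weight. -/
theorem Cand.kept {ov mode : ℤ → ℤ} {val m m' z : ℤ} (Mo : Modes N root par typ mc mr best ov mode)
    (D : Tables X N par typ w mc mr r best tw nb nc)
    (T : Cotree A X N root par typ L (-1) (-1)) (hA : IsCograph A)
    (hcnt : ∀ t ∈ N, t ∉ X → cnt t = (chs N par t).card) (ht : t ∈ N) (htyp : typ t = 1)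
    (h : Cand X N par typ mc r tw nb nc cnt t val m v m' z) (hm : mode t = m)
    (hv : v ∈ N → mode v = m') (hz : z ∈ N → mode z = 4)
    (hov : ∀ c ∈ N, Anc N par c t → c ≠ t → c ≠ v → c ≠ z → ov c = 0) :
    LocalFeas A L t (kept w mode (L t)) ∧ ∑ y ∈ kept w mode (L t), w y = val := by
  have htX := T.typ_not_leaf (t := t) (by omega)
  have htyp0 : typ t ≠ 0 := by omega
  have hneg : ∀ c ∈ N, c ≠ -1 := fun c hc h => T.neg (h ▸ hc)
  have hfree : v = -1 → z = -1 → Free N par ov t := fun h1 h2 c hc hct hne =>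
    hov c hc hct hne (h1 ▸ hneg c hc) (h2 ▸ hneg c hc)
  -- children to which no mode has been assigned
  have hch : ∀ u ∈ chs N par t, (∀ c ∈ N, c = v ∨ c = z → Anc N par c u) →
      ∀ c ∈ chs N par t, c ≠ u → Selects A L w mc r mode c ∧
        mode c = inherit typ mc mr best mode t c := by
    intro u hu hvz c hc hcu
    have hcN := (mem_chs.1 hc).1
    have hne : ∀ d ∈ N, Anc N par d c → ov d = 0 := by
      intro d hd hdc
      refine hov d hd (hdc.trans (mem_chs_anc ht hc)) ?_ ?_ ?_
      · rintro rfl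
        exact T.not_anc_child ht hc hdc
      · rintro rfl
        exact hcu (T.chs_eq_of_anc hc hu hd hdc (hvz d hd (.inl rfl)))
      · rintro rfl
        exact hcu (T.chs_eq_of_anc hc hu hd hdc (hvz d hd (.inr rfl)))
    refine ⟨Mo.selects D T c hcN fun d hd hdc _ => hne d hd hdc, ?_⟩
    have := Mo.inh c hcN (T.ne_root_of_par ht (mem_chs.1 hc).2) (hne c hcN .refl)
    rwa [(mem_chs.1 hc).2] at this
  cases h with
  | whole h1 h2 =>
    obtain ⟨a, b⟩ := (Mo.selects D T t ht (hfree rfl rfl)).one hm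
    rw [hcnt t ht htX] at h2
    exact ⟨⟨kept_sub, a, D.conn_whole T hA ht htyp h1 (by exact_mod_cast h2) kept_sub a⟩, b⟩
  | clique h1 h2 =>
    obtain ⟨a, b⟩ := (Mo.selects D T t ht (hfree rfl rfl)).two hm
    exact ⟨⟨kept_sub, a.cluster, D.conn_clique T ht htyp h1.ge a⟩, b⟩
  | leaf h1 hvt hvX =>
    have hvN := (mem_chs.1 hvt).1
    have hsel := hch v hvt (fun c hc h => by
      rcases h with rfl | rfl
      · exact .refl
      · exact absurd rfl (hneg _ hc))
    have hkv : ClusterVD.kept w mode (L v) = ∅ := by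
      ext y
      simp only [ClusterVD.kept, (T.leaf v hvX).1, Finset.mem_filter, Finset.mem_singleton,
        Finset.notMem_empty, iff_false]
      rintro ⟨rfl, h⟩
      rw [hv hvN] at h
      omega
    have hmode : ∀ c ∈ chs N par t, c ≠ v → mode c = 2 := by
      intro c hc hcv
      rw [(hsel c hc hcv).2, inherit, if_neg htyp0, if_neg (by omega), hm]
    have hcl : Clique A (ClusterVD.kept w mode (L t)) := by
      refine T.clique_join ht htyp htX kept_sub fun c hc => ?_
      rw [kept_inter (T.L_chs ht hc)]
      by_cases hcv : c = v
      · rw [hcv, hkv]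
        exact clique_empty A
      · exact ((hsel c hc hcv).1.two (hmode c hc hcv)).1
    refine ⟨⟨kept_sub, hcl.cluster, ?_⟩, ?_⟩
    · obtain ⟨c, hc, hcX, _⟩ := D.nb_one ht htX h1
      obtain ⟨a, ha, haK⟩ := T.exists_not_mem (mem_chs.1 hc).1 hcX
        (T.union_of_child hc ht htyp hcX) hcl
      have hcv : c ≠ v := by rintro rfl; exact hcX hvX
      have hvv : v ∈ L v := by rw [(T.leaf v hvX).1]; simp
      refine T.conn_of_two ht htX htyp Finset.sdiff_subset hc hvt hcv ha hvv
        (Finset.mem_sdiff.2 ⟨T.L_chs ht hc ha, haK⟩)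
        (Finset.mem_sdiff.2 ⟨T.L_chs ht hvt hvv, fun h => ?_⟩)
      have : v ∈ ClusterVD.kept w mode (L v) := by
        rw [← kept_inter (T.L_chs ht hvt)]
        exact Finset.mem_inter.2 ⟨h, hvv⟩
      rw [hkv] at this
      simp at this
    · rw [T.kept_sum ht htX, D.join t ht htyp, ← Finset.add_sum_erase _ _ hvt,
        ← Finset.add_sum_erase _ (fun c => mc c) hvt, hkv, Finset.sum_empty]
      have : ∑ c ∈ (chs N par t).erase v, ∑ y ∈ ClusterVD.kept w mode (L c), w y =
          ∑ c ∈ (chs N par t).erase v, mc c := by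
        refine Finset.sum_congr rfl fun c hc => ?_
        rw [Finset.mem_erase] at hc
        exact ((hsel c hc.2 hc.1).1.two (hmode c hc.2 hc.1)).2
      omega
  | sub h1 hvt hvX =>
    have hvN := (mem_chs.1 hvt).1
    have hsel := hch v hvt (fun c hc h => by
      rcases h with rfl | rfl
      · exact .refl
      · exact absurd rfl (hneg _ hc))
    have hk : ClusterVD.kept w mode (L t) = ClusterVD.kept w mode (L v) := by
      refine kept_one T ht htX hvt fun c hc hcv => (hsel c hc hcv).1.four ?_
      rw [(hsel c hc hcv).2, inherit, if_neg htyp0, if_neg (by omega), hm]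
    have hfv : Free N par ov v := by
      intro c hc hcv hne
      refine hov c hc (hcv.trans (mem_chs_anc ht hvt)) ?_ hne (hneg c hc)
      rintro rfl
      exact T.not_anc_child ht hvt hcv
    obtain ⟨a, b⟩ := (Mo.selects D T v hvN hfv).one (hv hvN)
    rw [hk]
    exact ⟨⟨kept_sub.trans (T.L_chs ht hvt), a, D.conn_sub T ht htyp hvt hvX h1 kept_sub a⟩, b⟩
  | sub_ne h1 hvt hvX hnc hzX hzv =>
    have hvN := (mem_chs.1 hvt).1
    have hzN := T.X_sub hzX
    have hsel := hch v hvt (fun c hc h => by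
      rcases h with rfl | rfl
      · exact .refl
      · exact hzv)
    have hk : ClusterVD.kept w mode (L t) = ClusterVD.kept w mode (L v) := by
      refine kept_one T ht htX hvt fun c hc hcv => (hsel c hc hcv).1.four ?_
      rw [(hsel c hc hcv).2, inherit, if_neg htyp0, if_neg (by omega), hm]
    have hk2 := Mo.kept_except D T (a := v) (b := z) (m := 5) (.inr rfl) hvN hzN (hv hvN) (hz hzN)
      (fun c hc hcz hne => absurd (T.eq_of_anc_leaf hzX hcz).symm hne) (fun c hc hcv hne hcz =>
        hov c hc (hcv.trans (mem_chs_anc ht hvt)) (by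
          rintro rfl
          exact T.not_anc_child ht hvt hcv) hne (by
          rintro rfl
          exact hcz .refl))
    have hvt0 := T.union_of_child hvt ht htyp hvX
    have hcl := (D.cluster_iff_nc T hvN hvt0).2 hnc
    have hzL := (T.mem_L_iff_anc hzX v hvN).2 hzv
    have hzK : z ∉ ClusterVD.kept w mode (L v) := by
      rw [hk2, (T.leaf z hzX).1]
      simp
    rw [hk]
    refine ⟨⟨kept_sub.trans (T.L_chs ht hvt), hcl.mono kept_sub, ?_⟩, ?_⟩
    · obtain ⟨d, hd, hdv⟩ := T.exists_child_ne ht htX v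
      obtain ⟨b, hb⟩ := T.ne d (mem_chs.1 hd).1
      exact T.conn_of_two ht htX htyp Finset.sdiff_subset hvt hd hdv.symm hzL hb
        (Finset.mem_sdiff.2 ⟨T.L_chs ht hvt hzL, hzK⟩)
        (Finset.mem_sdiff.2 ⟨T.L_chs ht hd hb, fun h => hdv (T.disj_chs hd hvt hb (kept_sub h))⟩)
    · have h5 : ∀ y, ((5 : ℤ) = 3 ∨ 0 < w y) ↔ 0 < w y := fun y => by omega
      rw [hk2]
      simp only [h5]
      rw [Tables.sum_pos_filter, (T.leaf z hzX).1, D.r_eq_pos T hA hvN hcl, (D.leaf z hzX).1,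
        ← Finset.sum_sdiff (Finset.singleton_subset_iff.2 hzL), Finset.sum_singleton]
      omega
  | @comp p _ s h1 hp hpX hvp hcp hs hsv hcl =>
    have hvN := (mem_chs.1 hvp).1
    have hpN := (mem_chs.1 hp).1
    have hpt := T.union_of_child hp ht htyp hpX
    have hvt : Anc N par v t := (mem_chs_anc hpN hvp).trans (mem_chs_anc ht hp)
    have hntv : ¬ Anc N par t v := fun h =>
      T.not_anc_child ht hp (h.trans (mem_chs_anc hpN hvp))
    have hk := Mo.kept_except D T (a := t) (b := v) (m := 3) (.inl rfl) ht hvN hm (hv hvN)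
      (fun c hc hcv hne => hov c hc (hcv.trans hvt) (by rintro rfl; exact hntv hcv) hne (hneg c hc))
      (fun c hc hct hne hcv => hov c hc hct hne (by rintro rfl; exact hcv .refl) (hneg c hc))
    have hLv : L v ⊆ L t := T.anc_sub hvt
    have hk' : ClusterVD.kept w mode (L t) = L t \ L v := by
      rw [hk]
      simp
    rw [hk']
    have hv0 : typ v ≠ 0 := by
      by_cases hvX : v ∈ X
      · rw [(T.leaf v hvX).2]; omega
      · have := T.typ_child hvp hpN hvX
        omega
    have hs0 : typ s ≠ 0 := by
      by_cases hsX : s ∈ X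
      · rw [(T.leaf s hsX).2]; omega
      · have := T.typ_child hs hpN hsX
        omega
    have hscl := D.clique_of_nb T (mem_chs.1 hs).1 hs0 hcl
    have hpch : chs N par p = {s, v} := by
      refine (Finset.eq_of_subset_of_card_le ?_ ?_).symm
      · intro d
        rw [Finset.mem_insert, Finset.mem_singleton]
        rintro (rfl | rfl) <;> assumption
      · rw [hcnt p hpN hpX] at hcp
        rw [Finset.card_pair hsv]
        omega
    obtain ⟨c, hc, hcX, hleaf⟩ := D.nb_one ht htX h1
    have hpc : p = c := by
      by_contra hpc
      exact hpX (hleaf p hp hpc)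
    subst hpc
    refine ⟨⟨Finset.sdiff_subset, Clique.cluster fun a ha b hb hab => ?_, ?_⟩, ?_⟩
    · rw [Finset.mem_sdiff] at ha hb
      obtain ⟨e, he, hae⟩ := T.child_of_mem ht htX ha.1
      obtain ⟨f, hf, hbf⟩ := T.child_of_mem ht htX hb.1
      by_cases hef : e = f
      · subst hef
        by_cases hep : e = p
        · subst hep
          have hin : ∀ y ∈ L e, y ∉ L v → y ∈ L s := by
            intro y hy hyv
            obtain ⟨g, hg, hyg⟩ := T.child_of_mem hpN hpX hy
            rw [hpch, Finset.mem_insert, Finset.mem_singleton] at hg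
            rcases hg with rfl | rfl
            · exact hyg
            · exact absurd hyg hyv
          exact hscl a (hin a hae ha.2) b (hin b hbf hb.2) hab
        · rw [(T.leaf e (hleaf e he hep)).1, Finset.mem_singleton] at hae hbf
          exact absurd (hae.trans hbf.symm) hab
      · exact T.adj_join htyp he hf hef hae hbf
    · rw [Finset.sdiff_sdiff_eq_self hLv]
      exact T.conn_L hvN hv0
    · have := Finset.sum_sdiff (f := w) hLv
      rw [D.tw_sum T t ht, D.tw_sum T v hvN]
      omega

end

open Function (update)

theorem ConnSet.diff_isolated {A : ℤ → ℤ → Prop} {S H : Finset ℤ} (h : ConnSet A S)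
    (hH : ∀ y ∈ H, ∀ z, ¬ A y z ∧ ¬ A z y) : ConnSet A (S \ H) := by
  intro a ha b hb
  rw [Finset.mem_sdiff] at ha hb
  refine (h a ha.1 b hb.1).lift id ?_
  rintro x y ⟨hx, hy, hxy⟩
  exact ⟨Finset.mem_sdiff.2 ⟨hx, fun h => (hH x h y).1 hxy⟩,
    Finset.mem_sdiff.2 ⟨hy, fun h => (hH y h x).2 hxy⟩, hxy⟩

theorem Cluster.union_isolated {A : ℤ → ℤ → Prop} {S H : Finset ℤ} (h : Cluster A S)
    (hH : ∀ y ∈ H, ∀ z, ¬ A y z ∧ ¬ A z y) : Cluster A (S ∪ H) := by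
  have key : ∀ {x y}, x ∈ S ∪ H → A x y ∨ A y x → x ∈ S := fun hx hxy => by
    rcases Finset.mem_union.1 hx with hx | hx
    · exact hx
    · have := hH _ hx
      have := this (‹_›)
      tauto
  intro a ha b hb c hc hab hbc hac
  exact h a (key ha (.inl hab)) b (key hb (.inl hbc)) c (key hc (.inr hbc)) hab hbc hac

section

variable {A : ℤ → ℤ → Prop} {X N : Finset ℤ} {root : ℤ} {par typ : ℤ → ℤ} {L : ℤ → Finset ℤ}
  {w mc mr r best tw nb nc cnt : ℤ → ℤ} {t v : ℤ} {K S : Finset ℤ}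

open Cotree

namespace Tables

theorem typ_child_root (T : Cotree A X N root par typ L (-1) (-1)) {c : ℤ}
    (hc : c ∈ chs N par root) : typ c ≠ 0 := by
  by_cases hcX : c ∈ X
  · rw [(T.leaf c hcX).2]; omega
  · have := T.typ_child hc T.root_mem hcX
    rwa [T.typ_root] at this

/-- A connected deletion set lies below a child of the root. -/
theorem root_split (D : Tables X N par typ w mc mr r best tw nb nc)
    (T : Cotree A X N root par typ L (-1) (-1)) (F : LocalFeas A L root K) :
    ∃ c ∈ chs N par root, LocalFeas A L c (K ∩ L c) ∧
      (∀ d ∈ chs N par root, d ≠ c → ¬ (typ d = 1 ∧ nb d ≠ 0)) ∧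
      ∑ y ∈ K, w y = tw root - tw c + ∑ y ∈ K ∩ L c, w y := by
  have hr := T.root_mem
  obtain ⟨c, hc, hSc⟩ : ∃ c ∈ chs N par root, L root \ K ⊆ L c := by
    rcases (L root \ K).eq_empty_or_nonempty with h | ⟨a, ha⟩
    · obtain ⟨c, hc, -⟩ := T.exists_child_ne hr T.root_not (-1)
      exact ⟨c, hc, by rw [h]; simp⟩
    · obtain ⟨c, hc, hac⟩ := T.child_of_mem hr T.root_not (Finset.sdiff_subset ha)
      exact ⟨c, hc, T.conn_union hr T.root_not T.typ_root Finset.sdiff_subset F.conn ha hc hac⟩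
  have hd : ∀ d ∈ chs N par root, d ≠ c → L d ⊆ K := by
    intro d hd hdc y hy
    by_contra hyK
    exact hdc (T.disj_chs hd hc hy (hSc (Finset.mem_sdiff.2 ⟨T.L_chs hr hd hy, hyK⟩)))
  refine ⟨c, hc, ⟨Finset.inter_subset_right, F.cluster.mono Finset.inter_subset_left, ?_⟩, ?_, ?_⟩
  · have : L c \ (K ∩ L c) = L root \ K := by
      ext y
      simp only [Finset.mem_sdiff, Finset.mem_inter]
      have := @hSc y
      rw [Finset.mem_sdiff] at this
      have := @T.L_chs _ _ _ _ _ _ _ _ hr c hc y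
      tauto
    rw [this]
    exact F.conn
  · rintro d hdr hdc ⟨h1, h2⟩
    exact D.not_cluster_of_nb T (mem_chs.1 hdr).1 h1 h2 (F.cluster.mono (hd d hdr hdc))
  · rw [T.sum_chs hr T.root_not F.sub, D.tw_eq root hr T.root_not, ← Finset.add_sum_erase _ _ hc,
      ← Finset.add_sum_erase _ tw hc]
    have : ∑ d ∈ (chs N par root).erase c, ∑ y ∈ K ∩ L d, w y =
        ∑ d ∈ (chs N par root).erase c, tw d := by
      refine Finset.sum_congr rfl fun d hd' => ?_
      rw [Finset.mem_erase] at hd'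
      rw [Finset.inter_eq_right.2 (hd d hd'.2 hd'.1), D.tw_sum T d (mem_chs.1 hd'.2).1]
    omega

end Tables

/-- If everything outside `c` is kept, then the vertices kept below `c` decide. -/
theorem Modes.root_join {ov mode : ℤ → ℤ} (Mo : Modes N root par typ mc mr best ov mode)
    (D : Tables X N par typ w mc mr r best tw nb nc)
    (T : Cotree A X N root par typ L (-1) (-1)) {c : ℤ} (hc : c ∈ chs N par root)
    (hcl : ∀ d ∈ chs N par root, d ≠ c → ¬ (typ d = 1 ∧ nb d ≠ 0)) (hroot : ov root = 3)
    (hov : ∀ d ∈ N, d ≠ root → ¬ Anc N par d c → ov d = 0)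
    (F : LocalFeas A L c (kept w mode (L c))) :
    LocalFeas A L root (kept w mode (L root)) ∧
      ∑ y ∈ kept w mode (L root), w y = tw root - tw c + ∑ y ∈ kept w mode (L c), w y := by
  have hr := T.root_mem
  have hmr : mode root = 3 := by rw [Mo.ov_of root hr (by omega), hroot]
  have hd : ∀ d ∈ chs N par root, d ≠ c → kept w mode (L d) = L d := by
    intro d hd hdc
    have hdN := (mem_chs.1 hd).1
    have hne := T.ne_root_of_par hr (mem_chs.1 hd).2
    have h0 : ∀ e ∈ N, Anc N par e d → ov e = 0 := by
      intro e he hed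
      refine hov e he ?_ fun hec => hdc (T.chs_eq_of_anc hd hc he hed hec)
      rintro rfl
      exact T.not_anc_child hr hd hed
    refine (Mo.selects D T d hdN fun e he hed _ => h0 e he hed).three ?_
    rw [Mo.inh d hdN hne (h0 d hdN .refl), (mem_chs.1 hd).2, inherit, if_pos T.typ_root,
      if_neg (by omega), hmr]
  refine ⟨⟨kept_sub, T.cluster_union hr T.typ_root T.root_not kept_sub fun d hd' => ?_, ?_⟩, ?_⟩
  · rw [kept_inter (T.L_chs hr hd')]
    by_cases hdc : d = c
    · rw [hdc]
      exact F.cluster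
    · exact ((D.clique_of_nb T (mem_chs.1 hd').1 (Tables.typ_child_root T hd')
        (hcl d hd' hdc)).mono kept_sub).cluster
  · have : L root \ kept w mode (L root) = L c \ kept w mode (L c) := by
      ext y
      rw [Finset.mem_sdiff, Finset.mem_sdiff, T.mem_kept hr T.root_not]
      constructor
      · rintro ⟨h1, h2⟩
        obtain ⟨d, hd', hyd⟩ := T.child_of_mem hr T.root_not h1
        by_cases hdc : d = c
        · subst hdc
          exact ⟨hyd, fun h => h2 ⟨_, hd', h⟩⟩
        · exact absurd ⟨d, hd', by rwa [hd d hd' hdc]⟩ h2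
      · rintro ⟨h1, h2⟩
        refine ⟨T.L_chs hr hc h1, ?_⟩
        rintro ⟨d, hd', hyd⟩
        exact h2 (T.disj_chs hd' hc (kept_sub hyd) h1 ▸ hyd)
    rw [this]
    exact F.conn
  · rw [T.kept_sum hr T.root_not, D.tw_eq root hr T.root_not, ← Finset.add_sum_erase _ _ hc,
      ← Finset.add_sum_erase _ tw hc]
    have : ∑ d ∈ (chs N par root).erase c, ∑ y ∈ kept w mode (L d), w y =
        ∑ d ∈ (chs N par root).erase c, tw d := by
      refine Finset.sum_congr rfl fun d hd' => ?_
      rw [Finset.mem_erase] at hd'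
      rw [hd d hd'.2 hd'.1, D.tw_sum T d (mem_chs.1 hd'.2).1]
    omega

/-- `K` is a feasible kept set of maximum weight. -/
def Optimal (A : ℤ → ℤ → Prop) (L : ℤ → Finset ℤ) (w : ℤ → ℤ) (root : ℤ) (K : Finset ℤ) : Prop :=
  LocalFeas A L root K ∧ ∀ K', LocalFeas A L root K' → ∑ y ∈ K', w y ≤ ∑ y ∈ K, w y

theorem Tables.infeasible (D : Tables X N par typ w mc mr r best tw nb nc)
    (T : Cotree A X N root par typ L (-1) (-1)) (h : 2 ≤ nc root) : ¬ LocalFeas A L root K := by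
  intro F
  obtain ⟨c, hc, _, hd, _⟩ := D.root_split T F
  rw [D.nc_eq root T.root_mem T.root_not] at h
  obtain ⟨a, ha, b, hb, hab⟩ := Finset.one_lt_card.1 (by exact_mod_cast h :
    1 < ((chs N par root).filter (fun c => typ c = 1 ∧ nb c ≠ 0)).card)
  rw [Finset.mem_filter] at ha hb
  by_cases hac : a = c
  · exact hd b hb.1 (by rintro rfl; exact hab hac) hb.2
  · exact hd a ha.1 hac ha.2

/-- All components are cliques: delete from one of them. -/
theorem Modes.optimal_zero {ov mode : ℤ → ℤ} (Mo : Modes N root par typ mc mr best ov mode)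
    (D : Tables X N par typ w mc mr r best tw nb nc)
    (T : Cotree A X N root par typ L (-1) (-1)) (h0 : nc root = 0) {c : ℤ}
    (hc : c ∈ chs N par root) (hmax : ∀ d ∈ chs N par root, mc d - tw d ≤ mc c - tw c)
    (hroot : ov root = 3) (hovc : ov c = 2) (hov : ∀ d ∈ N, d ≠ root → d ≠ c → ov d = 0) :
    Optimal A L w root (kept w mode (L root)) := by
  have hcl : ∀ d ∈ chs N par root, ¬ (typ d = 1 ∧ nb d ≠ 0) := by
    rw [D.nc_eq root T.root_mem T.root_not, Nat.cast_eq_zero, Finset.card_eq_zero,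
      Finset.filter_eq_empty_iff] at h0
    exact fun d hd => h0 hd
  have hclq : ∀ d ∈ chs N par root, Clique A (L d) := fun d hd =>
    D.clique_of_nb T (mem_chs.1 hd).1 (Tables.typ_child_root T hd) (hcl d hd)
  have hcN := (mem_chs.1 hc).1
  have hsel := (Mo.selects D T c hcN fun d hd hdc hne => hov d hd (by
    rintro rfl
    exact T.not_anc_child T.root_mem hc hdc) hne).two (by rw [Mo.ov_of c hcN (by omega), hovc])
  obtain ⟨h1, h2⟩ := Mo.root_join D T hc (fun d hd _ => hcl d hd) hroot
    (fun d hd hdr hdc => hov d hd hdr (by rintro rfl; exact hdc .refl))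
    ⟨kept_sub, hsel.1.cluster, ((hclq c hc).mono Finset.sdiff_subset).connSet⟩
  refine ⟨h1, fun K' F => ?_⟩
  obtain ⟨d, hd, F', _, h3⟩ := D.root_split T F
  have := D.clique_le T d (mem_chs.1 hd).1 (K' ∩ L d) Finset.inter_subset_right
    ((hclq d hd).mono Finset.inter_subset_right)
  have := hmax d hd
  rw [h2, h3, hsel.2]
  omega

/-- One component is not a clique: the best candidate is optimal. -/
theorem Modes.optimal_one {ov mode : ℤ → ℤ} (Mo : Modes N root par typ mc mr best ov mode)
    (D : Tables X N par typ w mc mr r best tw nb nc)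
    (T : Cotree A X N root par typ L (-1) (-1)) (hA : IsCograph A)
    (hcnt : ∀ t ∈ N, t ∉ X → cnt t = (chs N par t).card) (h1 : nc root = 1)
    (ht : t ∈ chs N par root) (htyp : typ t = 1) (hnb : nb t ≠ 0) {val m m' z : ℤ}
    (h : Cand X N par typ mc r tw nb nc cnt t val m v m' z)
    (hmax : ∀ val' m₁ v₁ m₂ z₁, Cand X N par typ mc r tw nb nc cnt t val' m₁ v₁ m₂ z₁ → val' ≤ val)
    (hroot : ov root = 3) (hovt : ov t = m) (hovv : v ∈ N → ov v = m') (hovz : z ∈ N → ov z = 4)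
    (hov : ∀ d ∈ N, d ≠ root → d ≠ t → d ≠ v → d ≠ z → ov d = 0) :
    Optimal A L w root (kept w mode (L root)) := by
  have htN := (mem_chs.1 ht).1
  have hm0 : m ≠ 0 ∧ (v ∈ N → m' ≠ 0) ∧ (v ∈ N → Anc N par v t) ∧ (z ∈ N → Anc N par z t) := by
    have hneg := T.neg
    cases h with
    | whole | clique => exact ⟨by omega, by tauto, by tauto, by tauto⟩
    | leaf _ h | sub _ h =>
      exact ⟨by omega, fun _ => by omega, fun _ => mem_chs_anc htN h, by tauto⟩
    | sub_ne _ h _ _ _ h' =>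
      exact ⟨by omega, fun _ => by omega, fun _ => mem_chs_anc htN h,
        fun _ => h'.trans (mem_chs_anc htN h)⟩
    | comp _ h _ h' =>
      exact ⟨by omega, fun _ => by omega,
        fun _ => (mem_chs_anc (mem_chs.1 h).1 h').trans (mem_chs_anc htN h), by tauto⟩
  have huniq : ∀ d ∈ chs N par root, d ≠ t → ¬ (typ d = 1 ∧ nb d ≠ 0) := by
    intro d hd hdt hd'
    rw [D.nc_eq root T.root_mem T.root_not] at h1
    have h1 : ((chs N par root).filter (fun c => typ c = 1 ∧ nb c ≠ 0)).card = 1 := by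
      exact_mod_cast h1
    exact hdt (Finset.card_le_one.1 h1.le d (Finset.mem_filter.2 ⟨hd, hd'⟩) t
      (Finset.mem_filter.2 ⟨ht, htyp, hnb⟩))
  obtain ⟨F, hval⟩ := h.kept Mo D T hA hcnt htN htyp (by rw [Mo.ov_of t htN (by omega), hovt])
    (fun hv => by rw [Mo.ov_of v hv (by rw [hovv hv]; exact hm0.2.1 hv), hovv hv])
    (fun hz => by rw [Mo.ov_of z hz (by rw [hovz hz]; omega), hovz hz])
    (fun c hc hct hne => hov c hc (by
      rintro rfl
      exact T.not_anc_child T.root_mem ht hct) hne)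
  obtain ⟨h2, h3⟩ := Mo.root_join D T ht huniq hroot (fun d hd hdr hdt => hov d hd hdr
    (by rintro rfl; exact hdt .refl) (by rintro rfl; exact hdt (hm0.2.2.1 hd))
    (by rintro rfl; exact hdt (hm0.2.2.2 hd))) F
  refine ⟨h2, fun K' F' => ?_⟩
  obtain ⟨d, hd, F'', hd', h4⟩ := D.root_split T F'
  have hdt : d = t := by
    by_contra hdt
    exact hd' t ht (Ne.symm hdt) ⟨htyp, hnb⟩
  subst hdt
  obtain ⟨val', m₁, v₁, m₂, z₁, hc, hle⟩ := D.exists_cand T hA hcnt htN htyp hnb F''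
  have := hmax _ _ _ _ _ hc
  omega

end

open Function (update update_self update_of_ne)

/-! ## Choosing the best of several offers -/

/-- Only registers below 20 occur. -/
def Exp.low : Exp → Bool
  | .const _ => true
  | .reg i => decide (i < 20)
  | .read _ e => e.low
  | .add e₁ e₂ => e₁.low && e₂.low
  | .sub e₁ e₂ => e₁.low && e₂.low

/-- Only registers below 20 occur. -/
def Guard.low : Guard → Bool
  | .le e₁ e₂ => e₁.low && e₂.low
  | .eq e₁ e₂ => e₁.low && e₂.low
  | .not g => g.low
  | .and g₁ g₂ => g₁.low && g₂.low

/-- The states differ at most in registers from 20 on. -/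
def Low (σ σ' : State) : Prop := (∀ i < 20, σ'.reg i = σ.reg i) ∧ σ'.mem = σ.mem

theorem Low.trans {σ₁ σ₂ σ₃ : State} (h : Low σ₁ σ₂) (h' : Low σ₂ σ₃) : Low σ₁ σ₃ :=
  ⟨fun i hi => (h'.1 i hi).trans (h.1 i hi), h'.2.trans h.2⟩

theorem Low.eval {σ σ' : State} (h : Low σ σ') : ∀ {e : Exp}, e.low = true →
    e.eval σ' = e.eval σ
  | .const _, _ => rfl
  | .reg i, he => h.1 i (by simpa [Exp.low] using he)
  | .read a e, he => by rw [Exp.eval, Exp.eval, h.2, h.eval (e := e) he]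
  | .add e₁ e₂, he => by
    simp only [Exp.low, Bool.and_eq_true] at he
    rw [Exp.eval, Exp.eval, h.eval he.1, h.eval he.2]
  | .sub e₁ e₂, he => by
    simp only [Exp.low, Bool.and_eq_true] at he
    rw [Exp.eval, Exp.eval, h.eval he.1, h.eval he.2]

theorem Low.holds {σ σ' : State} (h : Low σ σ') : ∀ {g : Guard}, g.low = true →
    (g.Holds σ' ↔ g.Holds σ)
  | .le e₁ e₂, hg => by
    simp only [Guard.low, Bool.and_eq_true] at hg
    rw [Guard.Holds, Guard.Holds, h.eval hg.1, h.eval hg.2]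
  | .eq e₁ e₂, hg => by
    simp only [Guard.low, Bool.and_eq_true] at hg
    rw [Guard.Holds, Guard.Holds, h.eval hg.1, h.eval hg.2]
  | .not g, hg => by rw [Guard.Holds, Guard.Holds, h.holds (g := g) hg]
  | .and g₁ g₂, hg => by
    simp only [Guard.low, Bool.and_eq_true] at hg
    rw [Guard.Holds, Guard.Holds, h.holds hg.1, h.holds hg.2]

/-- If `g` holds, then the value `val` can be reached with the parameters `m`, `m'` and those in the
registers `i` and `j`. -/
structure Offer where
  (g : Guard) (val : Exp) (m : ℤ) (i : ℕ) (m' : ℤ) (j : ℕ)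

def Offer.ok (o : Offer) : Bool :=
  o.g.low && o.val.low && decide (o.i < 20 ∧ o.j < 20 ∧ 0 ≤ o.m ∧ o.m ≤ 5 ∧ 0 ≤ o.m' ∧ o.m' ≤ 5)

/-- Record the offer in the registers 20 to 24 if it is better than the one recorded there. -/
def Offer.prog (o : Offer) : Prog :=
  .ite o.g (25 ≔ o.val ;; .ite (ℛ 25 ≤ₑ ℛ 20) .skip
    (20 ≔ ℛ 25 ;; 21 ≔ 𝒞 o.m ;; 22 ≔ ℛ o.i ;; 23 ≔ 𝒞 o.m' ;; 24 ≔ ℛ o.j)) .skip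

def offersP : List Offer → Prog
  | [] => .skip
  | o :: os => o.prog ;; offersP os

/-- The recorded offer satisfies `C`, if there is any. -/
def Recorded (C : ℤ → ℤ → ℤ → ℤ → ℤ → Prop) (σ : State) : Prop :=
  σ.reg 20 = -1 ∨ C (σ.reg 20) (σ.reg 21) (σ.reg 22) (σ.reg 23) (σ.reg 24)

/-- The offer is justified by `C`. -/
def Offer.Good (B : ℕ) (C : ℤ → ℤ → ℤ → ℤ → ℤ → Prop) (σ : State) (o : Offer) : Prop :=
  o.g.Holds σ → |o.val.eval σ| ≤ B ∧ |σ.reg o.i| ≤ B ∧ |σ.reg o.j| ≤ B ∧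
    C (o.val.eval σ) o.m (σ.reg o.i) o.m' (σ.reg o.j)

/-- Visit all nodes and record the best offer. Meanwhile, registers 6 and 7 contain the node and its
parent; register 8 contains the parent or, if that is not a child of the node in register 19, the
grandparent. -/
def pickP (os : List Offer) : Prog :=
  (9 ≔ 𝒞 (-1) ;; 20 ≔ 𝒞 (-1)) ;;
  qloop ((6 ≔ 10⟪ℛ 4⟫ ;; 7 ≔ 4⟪ℛ 6⟫ ;;
    .ite (4⟪ℛ 7⟫ =ₑ ℛ 19) (8 ≔ ℛ 7) (8 ≔ 4⟪ℛ 7⟫)) ;; offersP os)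

/-- The state `σ₁` in which the node `y` is visited. -/
structure Visits (σ : State) (y : ℤ) (σ₁ : State) : Prop where
  mem : σ₁.mem = σ.mem
  r19 : σ₁.reg 19 = σ.reg 19
  r6 : σ₁.reg 6 = y
  r7 : σ₁.reg 7 = σ.mem 4 y
  r8 : σ₁.reg 8 = if σ.mem 4 (σ.mem 4 y) = σ.reg 19 then σ.mem 4 y else σ.mem 4 (σ.mem 4 y)
  r9 : σ₁.reg 9 = -1

theorem offersP_wm (os : List Offer) (a : ℕ) : (offersP os).wm a = false := by
  induction os with
  | nil => rfl
  | cons o os ih => simp [offersP, Offer.prog, Prog.wm, ih]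

theorem offersP_wr (os : List Offer) {i : ℕ} (hi : i < 20) : (offersP os).wr i = false := by
  induction os with
  | nil => rfl
  | cons o os ih =>
    simp [offersP, Offer.prog, Prog.wr, ih]
    omega

theorem pickP_wm (os : List Offer) (a : ℕ) : (pickP os).wm a = false := by
  simp [pickP, qloop, Prog.wm, offersP_wm]

theorem pickP_wr (os : List Offer) {i : ℕ} (hi : i < 20) (h : i ≠ 4 ∧ i ≠ 6 ∧ i ≠ 7 ∧ i ≠ 8 ∧ i ≠ 9) :
    (pickP os).wr i = false := by
  simp [pickP, qloop, Prog.wr, offersP_wr os hi]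
  omega

section

variable {A : ℤ → ℤ → Prop} {X N : Finset ℤ} {root : ℤ} {L : ℤ → Finset ℤ} {B : ℕ} {σ : State}
  {n W M : ℤ} {C : ℤ → ℤ → ℤ → ℤ → ℤ → Prop}

open Cotree

theorem Offer.runs {o : Offer} (hok : o.ok = true) (hg : o.Good B C σ) (hC : Recorded C σ)
    (hB : 5 ≤ (B : ℤ)) :
    Runs B o.prog σ o.prog.maxcost (fun σ' => Low σ σ' ∧ Recorded C σ' ∧ σ.reg 20 ≤ σ'.reg 20 ∧
      (o.g.Holds σ → o.val.eval σ ≤ σ'.reg 20)) := by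
  simp only [Offer.ok, Bool.and_eq_true, decide_eq_true_eq] at hok
  have hi : ∀ k, 20 ≤ k → o.i ≠ k ∧ o.j ≠ k := fun k hk => by omega
  refine Runs.of_wp ?_
  simp only [Offer.prog, wp, Exp.eval, Guard.Holds, State.setReg, State.setMem, update_self, update_of_ne, ne_eq,
      Nat.reduceEqDiff, not_false_eq_true, abs_le]
  refine ⟨fun h => ?_, fun h => ⟨⟨fun _ _ => rfl, rfl⟩, hC, le_rfl, fun h' => absurd h' h⟩⟩
  obtain ⟨h1, h2, h3, h4⟩ := hg h
  rw [abs_le] at h1 h2 h3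
  have hlow : ∀ k, k < 20 → ∀ l, 20 ≤ l → k ≠ l := fun _ _ _ _ => by omega
  refine ⟨h1, fun h5 => ⟨⟨fun k hk => Function.update_of_ne (by omega) _ _, rfl⟩, ?_, le_rfl,
    fun _ => h5⟩, fun h5 => ?_⟩
  · simpa [Recorded] using hC
  · rw [Function.update_of_ne (hi 21 (by omega)).1, Function.update_of_ne (hi 20 (by omega)).1,
      Function.update_of_ne (hi 25 (by omega)).1, Function.update_of_ne (hi 23 (by omega)).2,
      Function.update_of_ne (hi 22 (by omega)).2, Function.update_of_ne (hi 21 (by omega)).2,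
      Function.update_of_ne (hi 20 (by omega)).2, Function.update_of_ne (hi 25 (by omega)).2]
    refine ⟨h1, by omega, h2, by omega, h3, ⟨fun k hk => ?_, rfl⟩, ?_, by omega, fun _ => le_rfl⟩
    · simp [hlow k hk]
    · right
      simpa using h4

theorem Low.good {σ' : State} {o : Offer} (h : Low σ σ') (hok : o.ok = true) (hg : o.Good B C σ) :
    o.Good B C σ' := by
  simp only [Offer.ok, Bool.and_eq_true, decide_eq_true_eq] at hok
  intro hh
  rw [h.eval hok.1.2, h.1 o.i hok.2.1, h.1 o.j hok.2.2.1]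
  exact hg ((h.holds hok.1.1).1 hh)

theorem offers_runs {os : List Offer} (hB : 5 ≤ (B : ℤ)) : ∀ {σ : State}, (∀ o ∈ os, o.ok = true) →
    (∀ o ∈ os, o.Good B C σ) → Recorded C σ →
    Runs B (offersP os) σ (offersP os).maxcost (fun σ' => Low σ σ' ∧ Recorded C σ' ∧
      σ.reg 20 ≤ σ'.reg 20 ∧ ∀ o ∈ os, o.g.Holds σ → o.val.eval σ ≤ σ'.reg 20) := by
  induction os with
  | nil =>
    intro σ _ _ hC
    exact ⟨σ, _, .skip _, le_rfl, ⟨fun _ _ => rfl, rfl⟩, hC, le_rfl, by simp⟩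
  | cons o os ih =>
    intro σ hok hg hC
    refine Runs.seq (Offer.runs (hok o (by simp)) (hg o (by simp)) hC hB) ?_
    rintro σ₁ ⟨h1, h2, h3, h4⟩
    refine (ih (fun o ho => hok o (by simp [ho])) (fun o ho => h1.good (hok o (by simp [ho]))
      (hg o (by simp [ho]))) h2).mono le_rfl ?_
    rintro σ₂ ⟨j1, j2, j3, j4⟩
    refine ⟨h1.trans j1, j2, h3.trans j3, fun o' ho' hh => ?_⟩
    rcases List.mem_cons.1 ho' with rfl | ho
    · exact (h4 hh).trans j3
    · have hok' := hok o' ho'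
      simp only [Offer.ok, Bool.and_eq_true] at hok'
      rw [← h1.eval hok'.1.2]
      exact j4 o' ho ((h1.holds hok'.1.1).2 hh)

theorem pick_runs (T : Stores A X N root σ L (-1) (-1)) (O : IsEnum (σ.mem 10) (σ.reg 5) N)
    {os : List Offer} (hok : ∀ o ∈ os, o.ok = true) {τ : ℕ} (hτ : (offersP os).maxcost ≤ τ)
    (hg : ∀ y ∈ N, ∀ σ₁, Visits σ y σ₁ → ∀ o ∈ os, o.Good B C σ₁) (hM : σ.reg 2 + 5 ≤ B) :
    Runs B (pickP os) σ (N.card * (τ + 50) + 30) (fun σ' => (Recorded C σ' ∧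
      ∀ y ∈ N, ∃ σ₁, Visits σ y σ₁ ∧ ∀ o ∈ os, o.g.Holds σ₁ → o.val.eval σ₁ ≤ σ'.reg 20) ∧
      Agree (pickP os) σ σ') := by
  refine Runs.agree ?_
  have hrt := T.bd root T.tree.root_mem
  have hNc := card_le_of_bound (by omega) T.bd
  have hpar : ∀ v, v ∈ N ∨ v = -1 → σ.mem 4 v ∈ N ∨ σ.mem 4 v = -1 := by
    rintro v (hv | rfl)
    · by_cases h : v = root
      · rw [h, T.tree.par_root]; exact .inr rfl
      · exact .inl (T.tree.par_mem v hv h).1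
    · exact .inr T.tree.par_neg
  have hbd : ∀ v, v ∈ N ∨ v = -1 → |v| ≤ B := by
    rintro v (hv | rfl)
    · have := T.bd v hv
      rw [abs_le]; omega
    · simp; omega
  refine ((Runs.of_wp (Q := fun σ' => σ' = (σ.setReg 9 (-1)).setReg 20 (-1)) ?_).seq
    (T₂ := N.card * (τ + 50) + 20) ?_).mono (by simp only [Prog.maxcost, Exp.cost]; omega)
    (fun _ h => h)
  · simp only [wp, Exp.eval, Guard.Holds, State.setReg, State.setMem, update_self, update_of_ne, ne_eq,
      Nat.reduceEqDiff, not_false_eq_true, abs_le]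
    refine ⟨by omega, by omega, trivial⟩
  rintro σ₀ rfl
  refine (qloop_runs (S := N) (τ + 30) (fun P σ' => Recorded C σ' ∧ σ'.reg 9 = -1 ∧
    ∀ y ∈ P, ∃ σ₁, Visits σ y σ₁ ∧ ∀ o ∈ os, o.g.Holds σ₁ → o.val.eval σ₁ ≤ σ'.reg 20) ?_ ?_ ?_ ?_
    ?_ ?_ (by omega) ?_).mono (by rw [add_assoc τ 30 20]) (fun σ' h => ⟨h.1.1, h.1.2.2⟩)
  · simpa [State.setReg] using O
  · simp [Prog.wm, offersP_wm]
  · simp [Prog.wr, offersP_wr]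
  · simp [Prog.wr, offersP_wr]
  · intro P σ' z h
    simpa [Recorded, State.setReg] using h
  · exact ⟨.inl (by simp [State.setReg]), by simp [State.setReg], by simp⟩
  rintro P σ₂ y hag hP hPN hy hyP hqy ⟨i1, i2, i3⟩
  have em : σ₂.mem = σ.mem := by
    funext a
    exact (hag.2 a (by simp [qloop, Prog.wm, offersP_wm])).trans rfl
  have e19 : σ₂.reg 19 = σ.reg 19 :=
    (hag.1 19 (by simp [qloop, Prog.wr, offersP_wr])).trans (by simp [State.setReg])
  have b1 := hbd y (.inl hy)
  have b2 := hbd _ (hpar y (.inl hy))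
  have b3 := hbd _ (hpar _ (hpar y (.inl hy)))
  refine (Runs.seq (T₁ := 25) (T₂ := τ) (R := fun σ₃ => Visits σ y σ₃ ∧ Recorded C σ₃ ∧
    σ₃.reg 20 = σ₂.reg 20) (Runs.of_wp_le ?_ (by decide)) ?_).mono (by omega) (fun _ h => h)
  · rw [em] at hqy
    rw [abs_le] at b1 b2 b3
    simp only [wp, Exp.eval, Guard.Holds, State.setReg, State.setMem, update_self, update_of_ne, ne_eq,
      Nat.reduceEqDiff, not_false_eq_true, abs_le, em, hqy, e19, Recorded]
    exact ⟨by omega, by omega,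
      fun h => ⟨by omega, ⟨by simp [em], by simp [e19], by simp, by simp, by simp [h], by simp [i2]⟩,
        i1, trivial⟩,
      fun h => ⟨by omega, ⟨by simp [em], by simp [e19], by simp, by simp, by simp [h], by simp [i2]⟩,
        i1, trivial⟩⟩
  · rintro σ₃ ⟨hV, hR, h20⟩
    refine (offers_runs (by omega) hok (hg y hy σ₃ hV) hR).mono hτ ?_
    rintro σ₄ ⟨j1, j2, j3, j4⟩
    refine ⟨j2, by rw [j1.1 9 (by omega), hV.r9], fun u hu => ?_⟩
    rcases Finset.mem_insert.1 hu with rfl | hu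
    · exact ⟨σ₃, hV, j4⟩
    · obtain ⟨σ₅, k1, k2⟩ := i3 u hu
      exact ⟨σ₅, k1, fun o ho hh => (k2 o ho hh).trans (h20 ▸ j3)⟩

end

open Function (update)

/-- Find the component that is not a clique. -/
def componentOffers : List Offer :=
  [⟨.and (ℛ 7 =ₑ ℛ 19) (.and (7⟪ℛ 6⟫ =ₑ 𝒞 1) (.not (19⟪ℛ 6⟫ =ₑ 𝒞 0))), 𝒞 0, 0, 6, 0, 9⟩]

/-- Delete from a component that is a clique. -/
def cliqueOffers : List Offer := [⟨ℛ 7 =ₑ ℛ 19, 12⟪ℛ 6⟫ -ₑ 16⟪ℛ 6⟫, 3, 6, 2, 9⟩]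

/-- The candidates for the node in register 19. -/
def candOffers : List Offer :=
  [⟨.and (𝒞 2 ≤ₑ 19⟪ℛ 19⟫) (𝒞 3 ≤ₑ 5⟪ℛ 19⟫), 14⟪ℛ 19⟫, 1, 9, 0, 9⟩,
   ⟨.and (19⟪ℛ 19⟫ =ₑ 𝒞 2) (5⟪ℛ 19⟫ =ₑ 𝒞 2), 12⟪ℛ 19⟫, 2, 9, 0, 9⟩,
   ⟨.and (ℛ 7 =ₑ ℛ 19) (.and (7⟪ℛ 6⟫ =ₑ 𝒞 2) (19⟪ℛ 19⟫ =ₑ 𝒞 1)), 12⟪ℛ 19⟫ -ₑ 12⟪ℛ 6⟫, 2, 6, 4, 9⟩,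
   ⟨.and (ℛ 7 =ₑ ℛ 19) (.and (.not (7⟪ℛ 6⟫ =ₑ 𝒞 2)) (19⟪ℛ 19⟫ =ₑ 𝒞 1)), 14⟪ℛ 6⟫, 4, 6, 1, 9⟩,
   ⟨.and (ℛ 7 =ₑ ℛ 19) (.and (.not (7⟪ℛ 6⟫ =ₑ 𝒞 2)) (.and (19⟪ℛ 19⟫ =ₑ 𝒞 2)
     (.not (20⟪ℛ 6⟫ =ₑ 𝒞 0)))), 14⟪ℛ 6⟫, 4, 6, 1, 9⟩,
   ⟨.and (4⟪ℛ 8⟫ =ₑ ℛ 19) (.and (7⟪ℛ 6⟫ =ₑ 𝒞 2) (.and (19⟪ℛ 19⟫ =ₑ 𝒞 2) (20⟪ℛ 8⟫ =ₑ 𝒞 0))),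
     14⟪ℛ 8⟫ -ₑ 12⟪ℛ 6⟫, 4, 8, 5, 6⟩,
   ⟨.and (4⟪ℛ 7⟫ =ₑ ℛ 19) (.and (19⟪ℛ 19⟫ =ₑ 𝒞 1) (.and (5⟪ℛ 7⟫ =ₑ 𝒞 2)
     (.not (.and (7⟪6⟪ℛ 7⟫ -ₑ ℛ 6⟫ =ₑ 𝒞 1) (.not (19⟪6⟪ℛ 7⟫ -ₑ ℛ 6⟫ =ₑ 𝒞 0)))))),
     16⟪ℛ 19⟫ -ₑ 16⟪ℛ 6⟫, 3, 6, 4, 9⟩]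

/-- The memory contains the cotree, an ordering of its nodes, and the tables. -/
structure Ready (A : ℤ → ℤ → Prop) (X N : Finset ℤ) (root : ℤ) (L : ℤ → Finset ℤ) (W : ℤ) (B : ℕ)
    (σ : State) : Prop where
  stores : Stores A X N root σ L (-1) (-1)
  ordered : Ordered X N (σ.mem 4) (σ.mem 10) (σ.reg 5)
  up : UpInv X N (σ.mem 4) (σ.mem 7) (σ.mem 2) L σ.table N
  weight : absSum (σ.mem 2) X ≤ W
  bound : σ.reg 2 + 2 * W + 5 ≤ B

/-- The candidates for `t`, according to the memory. -/
abbrev State.Cand (σ : State) (X N : Finset ℤ) (t : ℤ) : ℤ → ℤ → ℤ → ℤ → ℤ → Prop :=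
  ClusterVD.Cand X N (σ.mem 4) (σ.mem 7) (σ.mem 12) (σ.mem 14) (σ.mem 16) (σ.mem 19) (σ.mem 20)
    (σ.mem 5) t

namespace Ready

variable {A : ℤ → ℤ → Prop} {X N : Finset ℤ} {root : ℤ} {L : ℤ → Finset ℤ} {B : ℕ} {σ : State}
  {n W M t : ℤ}

open Cotree

theorem of_eq {σ' : State} (R : Ready A X N root L W B σ) (h2 : σ'.reg 2 = σ.reg 2)
    (h5 : σ'.reg 5 = σ.reg 5) (hm : ∀ a, a ≠ 17 → σ'.mem a = σ.mem a) : Ready A X N root L W B σ' := by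
  obtain ⟨T, O, I, hW, hB⟩ := R
  refine ⟨T.of_eq (hm 4 (by omega)) (hm 5 (by omega)) (hm 6 (by omega)) (hm 7 (by omega)) h2,
    by rwa [hm 4 (by omega), hm 10 (by omega), h5], ?_, by rwa [hm 2 (by omega)], by rwa [h2]⟩
  have : σ'.table = σ.table := by
    simp only [State.table, hm 12 (by omega), hm 13 (by omega), hm 14 (by omega), hm 15 (by omega),
      hm 16 (by omega), hm 19 (by omega), hm 20 (by omega)]
  rwa [hm 4 (by omega), hm 7 (by omega), hm 2 (by omega), this]

theorem tables (R : Ready A X N root L W B σ) :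
    Tables X N (σ.mem 4) (σ.mem 7) (σ.mem 2) (σ.mem 12) (σ.mem 13) (σ.mem 14) (σ.mem 15)
      (σ.mem 16) (σ.mem 19) (σ.mem 20) := R.up.tables R.stores.tree

theorem bounds (R : Ready A X N root L W B σ) {v : ℤ} (hv : v ∈ N) :
    (-W ≤ σ.mem 16 v ∧ σ.mem 16 v ≤ W) ∧ (0 ≤ σ.mem 12 v ∧ σ.mem 12 v ≤ W) ∧
      (0 ≤ σ.mem 14 v ∧ σ.mem 14 v ≤ W) := by
  obtain ⟨h1, h2, h3⟩ := R.up.bdd v hv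
  have := (absSum_mono (w := σ.mem 2) (R.stores.tree.L_sub hv)).trans R.weight
  simp only [State.table, abs_le] at h1 h2 h3
  omega

theorem mem_of_par (R : Ready A X N root L W B σ) {v : ℤ} (hv : v ∈ N ∨ v = -1) (ht : t ∈ N)
    (h : σ.mem 4 v = t) : v ∈ chs N (σ.mem 4) t := by
  have T := R.stores.tree
  rcases hv with hv | rfl
  · exact mem_chs.2 ⟨hv, h⟩
  · rw [T.par_neg] at h
    exact absurd (h ▸ ht) T.neg

theorem par_mem (R : Ready A X N root L W B σ) {v : ℤ} (hv : v ∈ N ∨ v = -1) :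
    (σ.mem 4 v ∈ N ∧ σ.mem 4 v ∉ X) ∨ σ.mem 4 v = -1 := by
  have T := R.stores.tree
  rcases hv with hv | rfl
  · by_cases h : v = root
    · exact .inr (h ▸ T.par_root)
    · exact .inl (T.par_mem v hv h)
  · exact .inr T.par_neg

theorem mem_X (R : Ready A X N root L W B σ) {v : ℤ} (hv : v ∈ N) : v ∈ X ↔ σ.mem 7 v = 2 := by
  rcases R.stores.tree.leaf_of_typ hv with h | h | h
  · exact ⟨fun _ => h.2.1, fun _ => h.1⟩
  · exact ⟨fun h' => absurd h' h.1, fun h' => by omega⟩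
  · exact ⟨fun h' => absurd h' h.1, fun h' => by omega⟩

/-- The other child of a node with two children. -/
theorem sibling (R : Ready A X N root L W B σ) {p v : ℤ} (hp : p ∈ N) (hpX : p ∉ X)
    (hv : v ∈ chs N (σ.mem 4) p) (h : σ.mem 5 p = 2) :
    σ.mem 6 p - v ∈ chs N (σ.mem 4) p ∧ σ.mem 6 p - v ≠ v ∧
      ∀ s ∈ chs N (σ.mem 4) p, s ≠ v → σ.mem 6 p - v = s := by
  obtain ⟨h1, h2⟩ := R.stores.counts p hp hpX
  obtain ⟨a, b, hab, hch⟩ := Finset.card_eq_two.1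
    (by exact_mod_cast h1.symm.trans h : (chs N (σ.mem 4) p).card = 2)
  rw [hch, Finset.sum_pair hab] at h2
  rw [hch] at hv ⊢
  simp only [Finset.mem_insert, Finset.mem_singleton] at hv ⊢
  rw [h2]
  refine ⟨by omega, by omega, fun s hs hsv => by omega⟩

theorem cand_good (R : Ready A X N root L W B σ) (ht : σ.reg 19 = t) (htN : t ∈ N) :
    ∀ y ∈ N, ∀ σ₁, Visits σ y σ₁ → ∀ o ∈ candOffers, o.Good B (σ.Cand X N t) σ₁ := by
  intro y hy σ₁ V o ho
  have hW := R.bound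
  have hbt := R.bounds htN
  have hby := R.bounds hy
  have hyX := R.mem_X hy
  have hyb := R.stores.bd y hy
  have hp := R.par_mem (.inl hy)
  have hpb : -1 ≤ σ.mem 4 y ∧ σ.mem 4 y < σ.reg 2 := by
    rcases hp with h | h
    · have := R.stores.bd _ h.1; omega
    · omega
  have e9 := V.r9
  have e8 := V.r8
  have e7 := V.r7
  have e6 := V.r6
  have e19 := V.r19.trans ht
  have em := V.mem
  simp only [candOffers, List.mem_cons, List.not_mem_nil, or_false] at ho
  rcases ho with rfl | rfl | rfl | rfl | rfl | rfl | rfl <;> intro hh <;>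
    simp only [Guard.Holds, Exp.eval, e19, e6, e7, em] at hh <;>
    simp only [Exp.eval, e19, e6, e7, e9, em, abs_le]
  · exact ⟨by omega, by omega, by omega, .whole hh.1 hh.2⟩
  · exact ⟨by omega, by omega, by omega, .clique hh.1 hh.2⟩
  · exact ⟨by omega, by omega, by omega, .leaf hh.2.2 (mem_chs.2 ⟨hy, hh.1⟩) (hyX.2 hh.2.1)⟩
  · exact ⟨by omega, by omega, by omega,
      .sub (.inl hh.2.2) (mem_chs.2 ⟨hy, hh.1⟩) fun h => hh.2.1 (hyX.1 h)⟩
  · exact ⟨by omega, by omega, by omega,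
      .sub (.inr hh.2.2) (mem_chs.2 ⟨hy, hh.1⟩) fun h => hh.2.1 (hyX.1 h)⟩
  · have hv : ((σ₁.reg 8 ∈ N ∧ σ₁.reg 8 ∉ X) ∨ σ₁.reg 8 = -1) ∧
        (σ₁.reg 8 ∈ N → Anc N (σ.mem 4) y (σ₁.reg 8)) := by
      have hp' : σ.mem 4 y ∈ N ∨ σ.mem 4 y = -1 := by tauto
      have h1 : σ.mem 4 y ∈ N → Anc N (σ.mem 4) y (σ.mem 4 y) := fun h => .single ⟨hy, h, rfl⟩
      rw [e8]
      split_ifs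
      · exact ⟨hp, h1⟩
      · refine ⟨R.par_mem hp', fun h => ?_⟩
        rcases hp with hp | hp
        · exact (h1 hp.1).tail ⟨hp.1, h, rfl⟩
        · rw [hp, R.stores.tree.par_neg] at h
          exact absurd h R.stores.tree.neg
    have hvt := R.mem_of_par (by tauto) htN hh.1
    have hvN := (mem_chs.1 hvt).1
    have hvX : σ₁.reg 8 ∉ X := by
      rcases hv.1 with h | h
      · exact h.2
      · exact absurd (h ▸ hvN) R.stores.tree.neg
    have := R.bounds hvN
    have := R.stores.bd _ hvN
    exact ⟨by omega, by omega, by omega,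
      .sub_ne hh.2.2.1 hvt hvX hh.2.2.2 (hyX.2 hh.2.1) (hv.2 hvN)⟩
  · have hpt := R.mem_of_par (by tauto) htN hh.1
    have hpN := (mem_chs.1 hpt).1
    have hpX : σ.mem 4 y ∉ X := by
      rcases hp with h | h
      · exact h.2
      · exact absurd (h ▸ hpN) R.stores.tree.neg
    obtain ⟨h1, h2, -⟩ := R.sibling hpN hpX (mem_chs.2 ⟨hy, rfl⟩) hh.2.2.1
    exact ⟨by omega, by omega, by omega,
      .comp hh.2.1 hpt hpX (mem_chs.2 ⟨hy, rfl⟩) hh.2.2.1 h1 h2 hh.2.2.2⟩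

/-- A leaf below a union of cliques is a child or a grandchild. -/
theorem leaf_below (R : Ready A X N root L W B σ) {v z : ℤ} (hv : v ∈ N) (hvX : v ∉ X)
    (htyp : σ.mem 7 v = 0) (hnc : σ.mem 20 v = 0) (hz : z ∈ X) (hzv : Anc N (σ.mem 4) z v) :
    σ.mem 4 z = v ∨ σ.mem 4 (σ.mem 4 z) = v := by
  have T := R.stores.tree
  have D := R.tables
  rcases hzv.eq_or with rfl | ⟨c, hc, hcv, -, hzc⟩
  · exact absurd hz hvX
  rcases hzc.eq_or with rfl | ⟨d, hd, hdc, -, hzd⟩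
  · exact .inl hcv
  have hcX := T.not_leaf_of_par hd hc hdc
  have hct := T.typ_child (mem_chs.2 ⟨hc, hcv⟩) hv hcX
  have hnb : σ.mem 19 c = 0 := by
    rw [D.nc_eq v hv hvX, Nat.cast_eq_zero, Finset.card_eq_zero, Finset.filter_eq_empty_iff] at hnc
    have := hnc (mem_chs.2 ⟨hc, hcv⟩)
    have := T.typ_int c hc hcX
    by_contra
    apply ‹¬ (_ ∧ _)›
    constructor <;> omega
  rw [D.nb_eq c hc hcX, Nat.cast_eq_zero, Finset.card_eq_zero, Finset.filter_eq_empty_iff] at hnb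
  have hdX : d ∈ X := by simpa using hnb (mem_chs.2 ⟨hd, hdc⟩)
  have : z = d := by
    rcases hzd.eq_or with h | ⟨e, he, hed, hdN, -⟩
    · exact h.symm
    · exact absurd hdX (T.not_leaf_of_par he hdN hed)
  subst this
  exact .inr (by rw [hdc, hcv])

theorem cand_complete (R : Ready A X N root L W B σ) (ht : σ.reg 19 = t) (htN : t ∈ N)
    (htyp : σ.mem 7 t = 1) {val m v m' z : ℤ} (h : σ.Cand X N t val m v m' z) :
    ∃ y ∈ N, ∀ σ₁, Visits σ y σ₁ → ∃ o ∈ candOffers, o.g.Holds σ₁ ∧ o.val.eval σ₁ = val := by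
  have T := R.stores.tree
  have key : ∀ y : ℤ, y ∈ N → ∀ o ∈ candOffers, (∀ σ₁, Visits σ y σ₁ → o.g.Holds σ₁ ∧
      o.val.eval σ₁ = val) → ∃ y ∈ N, ∀ σ₁, Visits σ y σ₁ → ∃ o ∈ candOffers, o.g.Holds σ₁ ∧
      o.val.eval σ₁ = val :=
    fun y hy o ho h => ⟨y, hy, fun σ₁ V => ⟨o, ho, h σ₁ V⟩⟩
  have hmem : ∀ i (hi : i < 7), candOffers[i]'hi ∈ candOffers := fun i hi => List.getElem_mem _
  cases h with
  | whole h1 h2 =>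
    refine key t htN _ (hmem 0 (by decide)) fun σ₁ V => ?_
    simp only [candOffers, List.getElem_cons_zero, List.getElem_cons_succ, Guard.Holds, Exp.eval,
      V.mem, V.r19, ht]
    exact ⟨⟨h1, h2⟩, trivial⟩
  | clique h1 h2 =>
    refine key t htN _ (hmem 1 (by decide)) fun σ₁ V => ?_
    simp only [candOffers, List.getElem_cons_zero, List.getElem_cons_succ, Guard.Holds, Exp.eval,
      V.mem, V.r19, ht]
    exact ⟨⟨h1, h2⟩, trivial⟩
  | leaf h1 hv hvX =>
    obtain ⟨hvN, hvt⟩ := mem_chs.1 hv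
    refine key v hvN _ (hmem 2 (by decide)) fun σ₁ V => ?_
    simp only [candOffers, List.getElem_cons_zero, List.getElem_cons_succ, Guard.Holds, Exp.eval,
      V.mem, V.r19, V.r6, V.r7, ht]
    exact ⟨⟨hvt, (R.mem_X hvN).1 hvX, h1⟩, trivial⟩
  | sub h1 hv hvX =>
    obtain ⟨hvN, hvt⟩ := mem_chs.1 hv
    have h2 := (not_congr (R.mem_X hvN)).1 hvX
    rcases h1 with h1 | h1
    · refine key v hvN _ (hmem 3 (by decide)) fun σ₁ V => ?_
      simp only [candOffers, List.getElem_cons_zero, List.getElem_cons_succ, Guard.Holds, Exp.eval,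
        V.mem, V.r19, V.r6, V.r7, ht]
      exact ⟨⟨hvt, h2, h1⟩, trivial⟩
    · refine key v hvN _ (hmem 4 (by decide)) fun σ₁ V => ?_
      simp only [candOffers, List.getElem_cons_zero, List.getElem_cons_succ, Guard.Holds, Exp.eval,
        V.mem, V.r19, V.r6, V.r7, ht]
      exact ⟨⟨hvt, h2, h1⟩, trivial⟩
  | sub_ne h1 hv hvX hnc hz hzv =>
    obtain ⟨hvN, hvt⟩ := mem_chs.1 hv
    have hv0 := T.union_of_child hv htN htyp hvX
    have hzN := T.X_sub hz
    refine key z hzN _ (hmem 5 (by decide)) fun σ₁ V => ?_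
    have h8 : σ₁.reg 8 = v := by
      rw [V.r8, ht]
      rcases R.leaf_below hvN hvX hv0 hnc hz hzv with h | h
      · rw [h, if_pos hvt]
      · rw [h, if_neg]
        rintro rfl
        exact T.not_anc_of_par hvN hvt .refl
    simp only [candOffers, List.getElem_cons_zero, List.getElem_cons_succ, Guard.Holds, Exp.eval,
      V.mem, V.r19, V.r6, h8, ht]
    exact ⟨⟨hvt, (R.mem_X hzN).1 hz, h1, hnc⟩, trivial⟩
  | comp h1 hp hpX hv hcnt hs hsv hcl =>
    obtain ⟨hpN, hpt⟩ := mem_chs.1 hp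
    obtain ⟨hvN, hvp⟩ := mem_chs.1 hv
    refine key v hvN _ (hmem 6 (by decide)) fun σ₁ V => ?_
    simp only [candOffers, List.getElem_cons_zero, List.getElem_cons_succ, Guard.Holds, Exp.eval,
      V.mem, V.r19, V.r6, V.r7, hvp, ht, (R.sibling hpN hpX hv hcnt).2.2 _ hs hsv]
    exact ⟨⟨hpt, h1, hcnt, hcl⟩, trivial⟩

end Ready

open Function (update update_self update_of_ne)

/-! ## The algorithms -/

/-- Compute the cotree and the tables. -/
def tablesP : Prog := buildP ;; orderP ;; qloop upBody

/-- Compute a solution from the prescribed modes. -/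
def solutionP : Prog := downP ;; outP ;; 0 ≔ 𝒞 1

/-- Minimum weight cluster vertex deletion. -/
def minP : Prog := tablesP ;; .write 17 (ℛ 0 +ₑ 𝒞 2) (𝒞 1) ;; solutionP

/-- Prescribe the chosen modes. -/
def prescribeP : Prog :=
  .write 17 (ℛ 0 +ₑ 𝒞 2) (𝒞 3) ;; .write 17 (ℛ 19) (ℛ 21) ;; .write 17 (ℛ 22) (ℛ 23) ;;
  .write 17 (ℛ 24) (𝒞 4)

/-- Choose where to delete. -/
def choiceP : Prog :=
  .ite (20⟪ℛ 19⟫ =ₑ 𝒞 0) (pickP cliqueOffers)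
    (pickP componentOffers ;; 19 ≔ ℛ 22 ;; pickP candOffers)

/-- Minimum weight connected cluster vertex deletion. -/
def connP : Prog :=
  tablesP ;; 19 ≔ ℛ 0 +ₑ 𝒞 2 ;;
  .ite (𝒞 2 ≤ₑ 20⟪ℛ 19⟫) (0 ≔ 𝒞 0) (choiceP ;; prescribeP ;; solutionP)

/-- The input: a cograph on the vertices `0, …, n - 1` with weights. -/
structure Input (A : ℤ → ℤ → Prop) (n W : ℤ) (B : ℕ) (σ : State) : Prop where
  cograph : IsCograph A
  nonneg : 0 ≤ n
  size : σ.reg 0 = n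
  lists : Lists A n (σ.mem 0) (σ.mem 1)
  zero : ∀ a, 3 ≤ a → ∀ t, σ.mem a t = 0
  phantom : σ.mem 2 n = 0 ∧ σ.mem 2 (n + 1) = 0
  weight : absSum (σ.mem 2) (Finset.Ico 0 n) ≤ W
  offset : ∀ x, 0 ≤ x → x < n → σ.mem 0 (x + 1) ≤ σ.mem 0 n
  bound : (3 * n + 5) * (3 * n + 5) + (3 * n + 5) + 2 * W + 10 ≤ B
  length : σ.mem 0 n ≤ B

/-- The result describes the complement of a kept set `K` of maximum weight with `F K`. -/
def Solved (F : Finset ℤ → Prop) (n : ℤ) (w : ℤ → ℤ) (σ : State) : Prop :=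
  ((∀ K ⊆ Finset.Ico 0 n, ¬ F K) ∧ σ.reg 0 = 0) ∨
    (σ.reg 0 = 1 ∧ ∃ K ⊆ Finset.Ico 0 n, F K ∧
      (∀ K' ⊆ Finset.Ico 0 n, F K' → ∑ v ∈ K', w v ≤ ∑ v ∈ K, w v) ∧
      (∀ v, 0 ≤ v → v < n → σ.mem 3 v = if v ∈ K then 0 else 1) ∧
      σ.reg 1 = ∑ v ∈ Finset.Ico 0 n \ K, w v)

section

variable {A : ℤ → ℤ → Prop} {X N : Finset ℤ} {root : ℤ} {L : ℤ → Finset ℤ} {B : ℕ} {σ : State}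
  {n W M t : ℤ}

open Cotree

/-- The cotree of the input graph and the tables are in memory. -/
structure Prepared (A : ℤ → ℤ → Prop) (X N : Finset ℤ) (L : ℤ → Finset ℤ) (n W : ℤ) (B : ℕ)
    (w : ℤ → ℤ) (σ : State) : Prop where
  ready : Ready A X N (n + 2) L W B σ
  leaves : ∀ y, y ∈ X ↔ 0 ≤ y ∧ y < n + 2
  size : σ.reg 0 = n
  nodes : N.card ≤ 3 * n.toNat + 5
  weights : σ.mem 2 = w
  modes : ∀ t, σ.mem 18 t = 0

theorem tables_runs (I : Input A n W B σ) :
    Runs B tablesP σ ((σ.mem 0 n - σ.mem 0 0).toNat * 1000 + n.toNat * 2500 + 3000) (fun σ' =>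
      (∃ X N L, Prepared A X N L n W B (σ.mem 2) σ') ∧ ∀ t, σ'.mem 17 t = 0) := by
  have hn := I.nonneg
  have hb := I.bound
  have hW := absSum_nonneg.trans I.weight
  have hz := I.zero
  have hMM : 0 ≤ (3 * n + 5) * (3 * n + 5) := mul_self_nonneg _
  refine (Runs.seq (T₂ := n.toNat * 1200 + 2500) (build_runs hn I.size I.cograph I.lists
    (fun t => ⟨hz 8 (by omega) t, hz 9 (by omega) t⟩) (fun t => (hz 11 (by omega) t).le) le_rfl
    (by omega) I.offset I.length) ?_).mono (by omega) (fun _ h => h)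
  rintro σ₁ ⟨⟨⟨X, N, L, T, hX⟩, hfc, h2⟩, ag1⟩
  have hrt := T.bd _ T.tree.root_mem
  have hNc := card_le_of_bound (by omega) T.bd
  have e0 : σ₁.reg 0 = n := (ag1.1 0 rfl).trans I.size
  refine (Runs.seq (T₂ := n.toNat * 1000 + 2000) (order_runs (M := 3 * n + 5) T e0 hn rfl hX hfc h2
    (by omega)) ?_).mono (by omega) (fun _ h => h)
  rintro σ₂ ⟨O, ag2⟩
  have T2 : Stores A X N (n + 2) σ₂ L (-1) (-1) := T.of_eq (ag2.2 4 rfl) (ag2.2 5 rfl) (ag2.2 6 rfl)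
    (ag2.2 7 rfl) (ag2.1 2 rfl)
  rw [← ag2.2 4 rfl] at O
  have e0' : σ₂.reg 0 = n := (ag2.1 0 rfl).trans e0
  have ew : σ₂.mem 2 = σ.mem 2 := (ag2.2 2 rfl).trans (ag1.2 2 rfl)
  have hXW : absSum (σ₂.mem 2) X ≤ W := by
    refine le_trans (le_of_eq ?_) I.weight
    rw [ew]
    refine (Finset.sum_subset (fun y hy => ?_) fun y hy hy' => ?_).symm
    · rw [Finset.mem_Ico] at hy; rw [hX]; omega
    · rw [hX] at hy
      rw [Finset.mem_Ico] at hy'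
      have : y = n ∨ y = n + 1 := by omega
      rcases this with rfl | rfl
      · rw [I.phantom.1]; rfl
      · rw [I.phantom.2]; rfl
  have e2 : σ₂.reg 2 ≤ 3 * n + 5 := by rw [ag2.1 2 rfl]; exact h2
  have hz2 : ∀ a, 12 ≤ a → a ≤ 20 → σ₂.mem a = σ.mem a := by
    intro a h1 h2
    interval_cases a <;> exact (ag2.2 _ rfl).trans (ag1.2 _ rfl)
  refine (upPass_runs (W := W) T2 (by rw [e0']) O
    (fun a h1 h2 t => by rw [hz2 a h1 h2]; exact hz a (by omega) t) hXW (by omega)).mono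
    (by omega) ?_
  rintro σ₃ ⟨U, ag3⟩
  have ea : ∀ a, a = 2 ∨ a = 4 ∨ a = 7 ∨ a = 10 → σ₃.mem a = σ₂.mem a := by
    rintro a (rfl | rfl | rfl | rfl) <;> exact ag3.2 _ rfl
  refine ⟨⟨X, N, L, ⟨⟨T2.of_eq (ag3.2 4 rfl) (ag3.2 5 rfl) (ag3.2 6 rfl) (ag3.2 7 rfl) (ag3.1 2 rfl),
    by rwa [ea 4 (by omega), ea 10 (by omega), ag3.1 5 rfl],
    by rwa [ea 4 (by omega), ea 7 (by omega), ea 2 (by omega)],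
    by rwa [ea 2 (by omega)], by rw [ag3.1 2 rfl]; omega⟩, hX, (ag3.1 0 rfl).trans e0', by omega,
    (ea 2 (by omega)).trans ew, fun t => ?_⟩⟩, fun t => ?_⟩
  · rw [ag3.2 18 rfl, hz2 18 (by omega) (by omega)]
    exact hz 18 (by omega) t
  · rw [ag3.2 17 rfl, hz2 17 (by omega) (by omega)]
    exact hz 17 (by omega) t

theorem solution_runs {w : ℤ → ℤ} (P : Prepared A X N L n W B w σ) (hn : 0 ≤ n)
    (hov : ∀ t, 0 ≤ σ.mem 17 t ∧ σ.mem 17 t ≤ 5) :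
    Runs B solutionP σ (n.toNat * 500 + 1000) (fun σ' => σ'.reg 0 = 1 ∧ ∃ mode,
      Modes N (n + 2) (σ.mem 4) (σ.mem 7) (σ.mem 12) (σ.mem 13) (σ.mem 15) (σ.mem 17) mode ∧
      (∀ v, 0 ≤ v → v < n → σ'.mem 3 v = if v ∈ kept w mode (Finset.Ico 0 n) then 0 else 1) ∧
      σ'.reg 1 = ∑ v ∈ Finset.Ico 0 n \ kept w mode (Finset.Ico 0 n), w v) := by
  have R := P.ready
  have hB := R.bound
  have hW := absSum_nonneg.trans R.weight
  have hNc := P.nodes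
  have hrt := R.stores.bd _ R.stores.tree.root_mem
  refine (Runs.seq (T₂ := n.toNat * 100 + 50) (down_runs (M := σ.reg 2) R.stores.tree R.ordered hov
    (fun t => by rw [P.modes t]; omega) R.stores.bd (by omega)) ?_).mono (by omega) (fun _ h => h)
  rintro σ₁ ⟨Mo, ag⟩
  have e2 : σ₁.mem 2 = w := (ag.2 2 rfl).trans P.weights
  refine (Runs.seq (T₂ := 4) (out_runs (W := W) ((ag.1 0 rfl).trans P.size) hn ?_ (by omega))
    ?_).mono (by omega) (fun _ h => h)
  · rw [e2, ← P.weights]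
    refine (absSum_mono fun y hy => ?_).trans R.weight
    rw [Finset.mem_Ico] at hy
    rw [P.leaves]
    omega
  rintro σ₂ ⟨⟨h1, h2⟩, -⟩
  rw [e2] at h1 h2
  refine Runs.of_wp_le ?_ (by decide)
  simp only [wp, Exp.eval, Guard.Holds, State.setReg, State.setMem, update_self, update_of_ne, ne_eq,
      Nat.reduceEqDiff, not_false_eq_true, abs_le]
  exact ⟨by omega, trivial, _, Mo, h1, h2⟩

theorem min_runs (I : Input A n W B σ) :
    Runs B minP σ ((σ.mem 0 n - σ.mem 0 0).toNat * 1000 + n.toNat * 3000 + 5000)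
      (Solved (Cluster A) n (σ.mem 2)) := by
  have hn := I.nonneg
  refine (Runs.seq (T₂ := n.toNat * 500 + 1500) (tables_runs I) ?_).mono (by omega) (fun _ h => h)
  rintro σ₁ ⟨⟨X, N, L, P⟩, h17⟩
  have R := P.ready
  have T := R.stores.tree
  have hrt := R.stores.bd _ T.root_mem
  have hB := R.bound
  have hW := absSum_nonneg.trans R.weight
  refine (Runs.seq (T₁ := 10) (Q := Solved (Cluster A) n (σ.mem 2)) (R := fun σ' =>
    σ' = σ₁.setMem 17 (n + 2) 1) (T₂ := n.toNat * 500 + 1000) (Runs.of_wp_le ?_ (by decide))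
    ?_).mono (by omega) (fun _ h => h)
  · simp only [wp, Exp.eval, Guard.Holds, State.setReg, State.setMem, update_self, update_of_ne, ne_eq,
      Nat.reduceEqDiff, not_false_eq_true, abs_le, P.size]
    exact ⟨by omega, by omega, trivial⟩
  rintro _ rfl
  have P2 : Prepared A X N L n W B (σ.mem 2) (σ₁.setMem 17 (n + 2) 1) :=
    ⟨R.of_eq rfl rfl fun a ha => by simp [State.setMem, ha], P.leaves, P.size, P.nodes, P.weights,
      P.modes⟩
  have e17 : ∀ t, (σ₁.setMem 17 (n + 2) 1).mem 17 t = if t = n + 2 then 1 else 0 := by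
    intro t
    simp only [State.setMem, Function.update_self, Function.update_apply, h17]
  refine (solution_runs P2 hn fun t => by rw [e17]; split_ifs <;> omega).mono le_rfl ?_
  rintro σ₂ ⟨h0, mode, Mo, h3, h1⟩
  have D := P2.ready.tables
  have hV : Finset.Ico 0 n ⊆ L (n + 2) := fun y hy => by
    rw [T.L_root, P.leaves]; rw [Finset.mem_Ico] at hy; omega
  have hS := (Mo.selects D T _ T.root_mem fun c hc _ hne => by rw [e17, if_neg hne]).one
    (by rw [Mo.ov_of _ T.root_mem (by rw [e17]; simp), e17, if_pos rfl])
  rw [P2.weights] at hS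
  refine .inr ⟨h0, _, kept_sub, hS.1.mono (by rw [← kept_inter hV]; exact Finset.inter_subset_left),
    fun K' hK' hc => ?_, h3, h1⟩
  have hle := D.cluster_le T I.cograph _ T.root_mem K' (hK'.trans hV) hc
  rw [P2.weights, ← hS.2] at hle
  refine hle.trans (le_of_eq ?_)
  rw [← kept_inter hV]
  refine (Finset.sum_subset Finset.inter_subset_left fun y hy hy' => ?_).symm
  have hyX := (P.leaves y).1 (T.L_root ▸ kept_sub hy)
  rw [Finset.mem_inter, Finset.mem_Ico] at hy'
  have : y = n ∨ y = n + 1 := by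
    by_contra
    exact hy' ⟨hy, by omega, by omega⟩
  rcases this with rfl | rfl
  · exact I.phantom.1
  · exact I.phantom.2

end

open Function (update update_self update_of_ne)

section

variable {A : ℤ → ℤ → Prop} {X N : Finset ℤ} {root : ℤ} {L : ℤ → Finset ℤ} {B : ℕ} {σ : State}
  {n W M t : ℤ}

open Cotree

theorem Cand.nodes {par typ mc r tw nb nc cnt : ℤ → ℤ} {val m v m' z : ℤ}
    (T : Cotree A X N root par typ L (-1) (-1)) (ht : t ∈ N) (htX : t ∉ X)
    (h : Cand X N par typ mc r tw nb nc cnt t val m v m' z) :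
    (v = -1 ∨ (v ∈ N ∧ v ≠ root ∧ v ≠ t)) ∧
      (z = -1 ∨ (z ∈ N ∧ z ≠ root ∧ z ≠ t ∧ z ≠ v)) ∧ (1 ≤ m ∧ m ≤ 5) ∧ (0 ≤ m' ∧ m' ≤ 5) := by
  have hch : ∀ c ∈ chs N par t, c ∈ N ∧ c ≠ root ∧ c ≠ t := by
    intro c hc
    refine ⟨(mem_chs.1 hc).1, T.ne_root_of_par ht (mem_chs.1 hc).2, ?_⟩
    rintro rfl
    exact T.not_anc_child ht hc .refl
  cases h with
  | whole | clique => omega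
  | leaf _ h | sub _ h => exact ⟨.inr (hch _ h), by omega, by omega, by omega⟩
  | sub_ne _ h hvX _ hz =>
    refine ⟨.inr (hch _ h), .inr ⟨T.X_sub hz, ?_, ?_, ?_⟩, by omega, by omega⟩ <;> rintro rfl
    · exact T.root_not hz
    · exact htX hz
    · exact hvX hz
  | comp _ hp _ hv =>
    have hpN := (mem_chs.1 hp).1
    refine ⟨.inr ⟨(mem_chs.1 hv).1, T.ne_root_of_par hpN (mem_chs.1 hv).2, ?_⟩, by omega, by omega,
      by omega⟩
    rintro rfl
    exact T.not_anc_child hpN hv (mem_chs_anc ht hp)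

theorem clique_child (D : Ready A X N root L W B σ) (h0 : σ.mem 20 root = 0) {c : ℤ}
    (hc : c ∈ chs N (σ.mem 4) root) : Clique A (L c) := by
  have T := D.stores.tree
  rw [D.tables.nc_eq root T.root_mem T.root_not, Nat.cast_eq_zero, Finset.card_eq_zero,
    Finset.filter_eq_empty_iff] at h0
  exact D.tables.clique_of_nb T (mem_chs.1 hc).1 (Tables.typ_child_root T hc) (h0 hc)

/-- What is to be deleted is determined by the registers. -/
def Chosen (X N : Finset ℤ) (root : ℤ) (σ : State) : Prop :=
  (σ.mem 20 root = 0 ∧ σ.reg 19 = root ∧ σ.reg 21 = 3 ∧ σ.reg 22 ∈ chs N (σ.mem 4) root ∧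
    σ.reg 23 = 2 ∧ σ.reg 24 = -1 ∧ ∀ d ∈ chs N (σ.mem 4) root,
      σ.mem 12 d - σ.mem 16 d ≤ σ.mem 12 (σ.reg 22) - σ.mem 16 (σ.reg 22)) ∨
  (σ.mem 20 root = 1 ∧ σ.reg 19 ∈ chs N (σ.mem 4) root ∧ σ.mem 7 (σ.reg 19) = 1 ∧
    σ.mem 19 (σ.reg 19) ≠ 0 ∧
    σ.Cand X N (σ.reg 19) (σ.reg 20) (σ.reg 21) (σ.reg 22) (σ.reg 23) (σ.reg 24) ∧
    ∀ val m v m' z, σ.Cand X N (σ.reg 19) val m v m' z → val ≤ σ.reg 20)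

/-- The states differ only in registers that are not used to store the input and the cotree. -/
def Keeps (σ σ' : State) : Prop :=
  (∀ i, i = 0 ∨ i = 2 ∨ i = 5 → σ'.reg i = σ.reg i) ∧ σ'.mem = σ.mem

theorem keeps_of_pick {os : List Offer} {σ' : State} (h : Agree (pickP os) σ σ') :
    Keeps σ σ' ∧ σ'.reg 19 = σ.reg 19 :=
  ⟨⟨fun i hi => h.1 i (pickP_wr os (by omega) (by omega)), funext fun a => h.2 a (pickP_wm os a)⟩,
    h.1 19 (pickP_wr os (by omega) (by omega))⟩

theorem choice_zero_runs (R : Ready A X N root L W B σ) (h19 : σ.reg 19 = root)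
    (h0 : σ.mem 20 root = 0) :
    Runs B (pickP cliqueOffers) σ (N.card * 150 + 30) (fun σ' => Chosen X N root σ' ∧ Keeps σ σ') := by
  have T := R.stores.tree
  have hB := R.bound
  have hW := absSum_nonneg.trans R.weight
  refine (pick_runs (τ := 100) (C := fun val m v m' z => v ∈ chs N (σ.mem 4) root ∧
    val = σ.mem 12 v - σ.mem 16 v ∧ m = 3 ∧ m' = 2 ∧ z = -1) R.stores R.ordered.enum (by decide)
    (by decide) ?_ (by omega)).mono le_rfl ?_
  · intro y hy σ₁ V o ho
    have := R.bounds hy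
    have := R.stores.bd y hy
    rw [cliqueOffers, List.mem_singleton] at ho
    subst ho
    intro hh
    simp only [Guard.Holds, Exp.eval, V.r7, V.r19, h19] at hh
    simp only [Exp.eval, V.r6, V.r9, V.mem, abs_le]
    exact ⟨by omega, by omega, by omega, mem_chs.2 ⟨hy, hh⟩, by simp⟩
  · rintro σ' ⟨⟨hR, hmax⟩, hag⟩
    obtain ⟨hk, k19⟩ := keeps_of_pick hag
    have hm : ∀ d ∈ chs N (σ.mem 4) root, σ.mem 12 d - σ.mem 16 d ≤ σ'.reg 20 := by
      intro d hd
      obtain ⟨hdN, hdr⟩ := mem_chs.1 hd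
      obtain ⟨σ₁, V, h⟩ := hmax d hdN
      have := h _ (List.mem_singleton_self _)
      simp only [Guard.Holds, Exp.eval, V.r6, V.r7, V.r19, h19, V.mem] at this
      exact this hdr
    obtain ⟨c, hc, -⟩ := T.exists_child_ne T.root_mem T.root_not (-1)
    have hc0 : 0 ≤ σ.mem 12 c - σ.mem 16 c := by
      have := R.tables.clique_le T c (mem_chs.1 hc).1 (L c) subset_rfl (clique_child R h0 hc)
      rw [← R.tables.tw_sum T c (mem_chs.1 hc).1] at this
      omega
    rcases hR with hR | ⟨h1, h2, h3, h4, h5⟩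
    · have := hm c hc; omega
    · refine ⟨.inl ?_, hk⟩
      rw [hk.2]
      exact ⟨h0, k19.trans h19, h3, h1, h4, h5, fun d hd => h2 ▸ hm d hd⟩

theorem component_runs (R : Ready A X N root L W B σ) (h19 : σ.reg 19 = root)
    (h1 : σ.mem 20 root = 1) :
    Runs B (pickP componentOffers) σ (N.card * 150 + 30) (fun σ' =>
      (σ'.reg 22 ∈ chs N (σ.mem 4) root ∧ σ.mem 7 (σ'.reg 22) = 1 ∧ σ.mem 19 (σ'.reg 22) ≠ 0) ∧
      Keeps σ σ') := by
  have T := R.stores.tree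
  have hB := R.bound
  have hW := absSum_nonneg.trans R.weight
  refine (pick_runs (τ := 100) (C := fun _ _ v _ _ => v ∈ chs N (σ.mem 4) root ∧
    σ.mem 7 v = 1 ∧ σ.mem 19 v ≠ 0) R.stores R.ordered.enum (by decide)
    (by decide) ?_ (by omega)).mono le_rfl ?_
  · intro y hy σ₁ V o ho
    have := R.stores.bd y hy
    rw [componentOffers, List.mem_singleton] at ho
    subst ho
    intro hh
    simp only [Guard.Holds, Exp.eval, V.r6, V.r7, V.r19, V.mem, h19] at hh
    simp only [Exp.eval, V.r6, V.r9, abs_le]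
    exact ⟨by omega, by omega, by omega, mem_chs.2 ⟨hy, hh.1⟩, hh.2⟩
  · rintro σ' ⟨⟨hR, hmax⟩, hag⟩
    refine ⟨?_, (keeps_of_pick hag).1⟩
    rcases hR with hR | h
    · rw [R.tables.nc_eq root T.root_mem T.root_not] at h1
      obtain ⟨c, hc⟩ := Finset.card_pos.1 (by omega :
        0 < ((chs N (σ.mem 4) root).filter (fun c => σ.mem 7 c = 1 ∧ σ.mem 19 c ≠ 0)).card)
      obtain ⟨hc, hc'⟩ := Finset.mem_filter.1 hc
      obtain ⟨hcN, hcr⟩ := mem_chs.1 hc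
      obtain ⟨σ₁, V, h⟩ := hmax c hcN
      have := h _ (List.mem_singleton_self _)
      simp only [Guard.Holds, Exp.eval, V.r6, V.r7, V.r19, h19, V.mem] at this
      have := this ⟨hcr, hc'⟩
      omega
    · exact h

theorem choice_one_runs (R : Ready A X N root L W B σ) (hA : IsCograph A) (h1 : σ.mem 20 root = 1)
    (ht : σ.reg 19 ∈ chs N (σ.mem 4) root) (htyp : σ.mem 7 (σ.reg 19) = 1)
    (hnb : σ.mem 19 (σ.reg 19) ≠ 0) :
    Runs B (pickP candOffers) σ (N.card * 350 + 30) (fun σ' => Chosen X N root σ' ∧ Keeps σ σ') := by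
  have T := R.stores.tree
  have hB := R.bound
  have hW := absSum_nonneg.trans R.weight
  have htN := (mem_chs.1 ht).1
  refine (pick_runs (τ := 300) R.stores R.ordered.enum (by decide) (by decide)
    (R.cand_good rfl htN) (by omega)).mono le_rfl ?_
  rintro σ' ⟨⟨hR, hmax⟩, hag⟩
  obtain ⟨hk, k19⟩ := keeps_of_pick hag
  have hm : ∀ val m v m' z, σ.Cand X N (σ.reg 19) val m v m' z → val ≤ σ'.reg 20 := by
    intro val m v m' z h
    obtain ⟨y, hy, hc⟩ := R.cand_complete rfl htN htyp h
    obtain ⟨σ₁, V, hle⟩ := hmax y hy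
    obtain ⟨o, ho, hh, rfl⟩ := hc σ₁ V
    exact hle o ho hh
  rcases hR with hR | hR
  · obtain ⟨val, m, v, m', z, hc, hle⟩ := R.tables.exists_cand T hA
      (fun t ht htX => (R.stores.counts t ht htX).1) htN htyp hnb (K := ∅)
      ⟨by simp, (clique_empty A).cluster, by
        rw [Finset.sdiff_empty]; exact T.conn_L htN (by omega)⟩
    have := hm _ _ _ _ _ hc
    rw [Finset.sum_empty] at hle
    omega
  · refine ⟨.inr ?_, hk⟩
    rw [k19, hk.2]
    simp only [State.Cand, hk.2]
    exact ⟨h1, ht, htyp, hnb, hR, hm⟩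

theorem Ready.keeps {σ' : State} (R : Ready A X N root L W B σ) (h : Keeps σ σ') :
    Ready A X N root L W B σ' :=
  R.of_eq (h.1 2 (by omega)) (h.1 5 (by omega)) fun a _ => by rw [h.2]

theorem Keeps.trans {σ₁ σ₂ σ₃ : State} (h : Keeps σ₁ σ₂) (h' : Keeps σ₂ σ₃) : Keeps σ₁ σ₃ :=
  ⟨fun i hi => (h'.1 i hi).trans (h.1 i hi), h'.2.trans h.2⟩

theorem choice_runs (R : Ready A X N root L W B σ) (hA : IsCograph A) (h19 : σ.reg 19 = root)
    (h2 : σ.mem 20 root < 2) :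
    Runs B choiceP σ (N.card * 500 + 100) (fun σ' => Chosen X N root σ' ∧ Keeps σ σ') := by
  have T := R.stores.tree
  have hB := R.bound
  have hW := absSum_nonneg.trans R.weight
  refine (Runs.ite (T := N.card * 500 + 80) (fun hg => ?_) (fun hg => ?_)).mono
    (by simp only [Guard.cost, Exp.cost]; omega) (fun _ h => h)
  · simp only [Guard.Holds, Exp.eval, h19] at hg
    exact (choice_zero_runs R h19 hg).mono (by omega) fun _ h => h
  · simp only [Guard.Holds, Exp.eval, h19] at hg
    have h1 : σ.mem 20 root = 1 := by
      have := R.tables.nc_eq root T.root_mem T.root_not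
      omega
    refine (Runs.seq (T₂ := N.card * 350 + 50) (component_runs R h19 h1) ?_).mono (by omega)
      (fun _ h => h)
    rintro σ₁ ⟨⟨j1, j2, j3⟩, hk⟩
    have hb := R.stores.bd _ (mem_chs.1 j1).1
    have hk' : Keeps σ (σ₁.setReg 19 (σ₁.reg 22)) :=
      ⟨fun i hi => by rw [← hk.1 i hi]; exact Function.update_of_ne (by omega) _ _, hk.2⟩
    refine ((Runs.of_wp (Q := fun σ' => σ' = σ₁.setReg 19 (σ₁.reg 22)) ?_).seq
      (T₂ := N.card * 350 + 30) ?_).mono (by simp only [Prog.maxcost, Exp.cost]; omega)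
      (fun _ h => h)
    · simp only [wp, Exp.eval, Guard.Holds, State.setReg, State.setMem, update_self, update_of_ne, ne_eq,
      Nat.reduceEqDiff, not_false_eq_true, abs_le]
      exact ⟨by omega, trivial⟩
    · rintro _ rfl
      refine (choice_one_runs (R.keeps hk') hA ?_ ?_ ?_ ?_).mono le_rfl
        fun σ' h => ⟨h.1, hk'.trans h.2⟩
      all_goals
        rw [hk'.2]
        simpa only [State.setReg, Function.update_self]

/-- The modes that are prescribed by the registers. -/
def State.prescribed (σ : State) (root : ℤ) : ℤ → ℤ :=
  update (update (update (update (fun _ => 0) root 3) (σ.reg 19) (σ.reg 21)) (σ.reg 22) (σ.reg 23))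
    (σ.reg 24) 4

theorem Chosen.bounds (C : Chosen X N root σ) (T : Cotree A X N root (σ.mem 4) (σ.mem 7) L (-1) (-1)) :
    σ.reg 19 ∈ N ∧ (σ.reg 22 = -1 ∨ σ.reg 22 ∈ N) ∧ (σ.reg 24 = -1 ∨ σ.reg 24 ∈ N) ∧
      (0 ≤ σ.reg 21 ∧ σ.reg 21 ≤ 5) ∧ (0 ≤ σ.reg 23 ∧ σ.reg 23 ≤ 5) := by
  rcases C with ⟨_, h1, h2, h3, h4, h5, _⟩ | ⟨_, h1, h2, _, h3, _⟩
  · exact ⟨h1 ▸ T.root_mem, .inr (mem_chs.1 h3).1, .inl h5, by omega, by omega⟩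
  · have htN := (mem_chs.1 h1).1
    obtain ⟨a, b, c, d⟩ := h3.nodes T htN (T.typ_not_leaf (by omega))
    exact ⟨htN, by tauto, by tauto, by omega, d⟩

theorem Chosen.optimal (C : Chosen X N root σ) (R : Ready A X N root L W B σ) (hA : IsCograph A)
    {mode : ℤ → ℤ} (Mo : Modes N root (σ.mem 4) (σ.mem 7) (σ.mem 12) (σ.mem 13) (σ.mem 15)
      (σ.prescribed root) mode) : Optimal A L (σ.mem 2) root (kept (σ.mem 2) mode (L root)) := by
  have T := R.stores.tree
  have hr := T.root_mem
  have hneg : ∀ c ∈ N, c ≠ -1 := fun c hc h => T.neg (h ▸ hc)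
  have hroot1 := hneg root hr
  rcases C with ⟨h0, h1, h2, h3, h4, h5, h6⟩ | ⟨h0, h1, h2, h3, h4, h5⟩
  · have hc := mem_chs.1 h3
    have hcr := T.ne_root_of_par hr hc.2
    have hc1 := hneg _ hc.1
    rw [State.prescribed, h1, h2, h4, h5] at Mo
    refine Mo.optimal_zero R.tables T h0 h3 h6 ?_ ?_ fun d hd hdr hdc => ?_
    · simp [hroot1, hcr.symm]
    · simp [hc1]
    · simp [hneg d hd, hdr, hdc]
  · have htN := (mem_chs.1 h1).1
    have htr := T.ne_root_of_par hr (mem_chs.1 h1).2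
    obtain ⟨a, b, -, -⟩ := h4.nodes T htN (T.typ_not_leaf (by omega))
    have ht1 := hneg _ htN
    rw [State.prescribed] at Mo
    set t := σ.reg 19
    set v := σ.reg 22
    set z := σ.reg 24
    have hz : z ≠ root ∧ z ≠ t ∧ (v ∈ N → z ≠ v) := by
      rcases b with h | h
      · rw [h]; exact ⟨hroot1.symm, ht1.symm, fun hv => (hneg v hv).symm⟩
      · tauto
    have hv : v ≠ root ∧ v ≠ t := by
      rcases a with h | h
      · rw [h]; exact ⟨hroot1.symm, ht1.symm⟩
      · tauto
    refine Mo.optimal_one R.tables T hA (fun t ht htX => (R.stores.counts t ht htX).1) h0 h1 h2 h3 h4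
      h5 ?_ ?_ (fun h => ?_) (fun h => ?_) fun d hd hdr hdt hdv hdz => ?_
    · simp [hz.1.symm, hv.1.symm, htr.symm]
    · simp [hz.2.1.symm, hv.2.symm]
    · simp [(hz.2.2 h).symm]
    · simp
    · simp [hdr, hdt, hdv, hdz]

/-- The phantoms can be kept. -/
theorem LocalFeas.extend (hn : 0 ≤ n) (hL : L root = Finset.Ico 0 (n + 2))
    (hA : ∀ x y, A x y → (0 ≤ x ∧ x < n) ∧ 0 ≤ y ∧ y < n) {K : Finset ℤ} (hK : K ⊆ Finset.Ico 0 n)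
    (hF : Cluster A K ∧ ConnSet A (Finset.Ico 0 n \ K)) :
    LocalFeas A L root (K ∪ Finset.Ico n (n + 2)) := by
  refine ⟨?_, hF.1.union_isolated fun y hy z => ?_, ?_⟩
  · rw [hL]
    exact Finset.union_subset (hK.trans (Finset.Ico_subset_Ico_right (by omega)))
      (Finset.Ico_subset_Ico_left hn)
  · rw [Finset.mem_Ico] at hy
    exact ⟨fun h => by have := hA _ _ h; omega, fun h => by have := hA _ _ h; omega⟩
  · have : L root \ (K ∪ Finset.Ico n (n + 2)) = Finset.Ico 0 n \ K := by
      ext y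
      rw [hL]
      simp only [Finset.mem_sdiff, Finset.mem_union, Finset.mem_Ico]
      constructor
      · rintro ⟨h1, h2⟩
        exact ⟨⟨h1.1, by by_contra; exact h2 (.inr (by omega))⟩, fun h => h2 (.inl h)⟩
      · rintro ⟨h1, h2⟩
        refine ⟨by omega, ?_⟩
        rintro (h | h)
        · exact h2 h
        · omega
    rw [this]
    exact hF.2

theorem Optimal.restrict {w : ℤ → ℤ} {K : Finset ℤ} (h : Optimal A L w root K)
    (hn : 0 ≤ n) (hL : L root = Finset.Ico 0 (n + 2))
    (hA : ∀ x y, A x y → (0 ≤ x ∧ x < n) ∧ 0 ≤ y ∧ y < n) (hw : w n = 0 ∧ w (n + 1) = 0) :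
    (Cluster A (K ∩ Finset.Ico 0 n) ∧ ConnSet A (Finset.Ico 0 n \ (K ∩ Finset.Ico 0 n))) ∧
      ∀ K' ⊆ Finset.Ico 0 n, Cluster A K' ∧ ConnSet A (Finset.Ico 0 n \ K') →
        ∑ v ∈ K', w v ≤ ∑ v ∈ K ∩ Finset.Ico 0 n, w v := by
  obtain ⟨F, hopt⟩ := h
  set H : Finset ℤ := Finset.Ico n (n + 2) with hH
  have hiso : ∀ y ∈ H, ∀ z, ¬ A y z ∧ ¬ A z y := by
    intro y hy z
    rw [hH, Finset.mem_Ico] at hy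
    exact ⟨fun h => by have := hA _ _ h; omega, fun h => by have := hA _ _ h; omega⟩
  have hw0 : ∀ y, n ≤ y → y < n + 2 → w y = 0 := by
    intro y h1 h2
    have : y = n ∨ y = n + 1 := by omega
    rcases this with rfl | rfl
    · exact hw.1
    · exact hw.2
  refine ⟨⟨F.cluster.mono Finset.inter_subset_left, ?_⟩, fun K' hK' hF => ?_⟩
  · have : Finset.Ico 0 n \ (K ∩ Finset.Ico 0 n) = (L root \ K) \ H := by
      ext y
      rw [hL, hH]
      simp only [Finset.mem_sdiff, Finset.mem_inter, Finset.mem_Ico]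
      constructor
      · rintro ⟨h1, h2⟩
        exact ⟨⟨by omega, fun h => h2 ⟨h, h1⟩⟩, by omega⟩
      · rintro ⟨⟨h1, h2⟩, h3⟩
        exact ⟨by omega, fun h => h2 h.1⟩
    rw [this]
    exact F.conn.diff_isolated hiso
  · have hle := hopt (K' ∪ H) (LocalFeas.extend hn hL hA hK' hF)
    have e1 : ∑ v ∈ K', w v = ∑ v ∈ K' ∪ H, w v := by
      refine Finset.sum_subset Finset.subset_union_left fun y hy hy' => ?_
      have := Finset.mem_Ico.1 ((Finset.mem_union.1 hy).resolve_left hy')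
      exact hw0 y this.1 this.2
    have e2 : ∑ v ∈ K ∩ Finset.Ico 0 n, w v = ∑ v ∈ K, w v := by
      refine Finset.sum_subset Finset.inter_subset_left fun y hy hy' => ?_
      have h1 := F.sub hy
      rw [hL, Finset.mem_Ico] at h1
      rw [Finset.mem_inter, Finset.mem_Ico] at hy'
      refine hw0 y ?_ h1.2
      by_contra
      exact hy' ⟨hy, by omega⟩
    rw [e1, e2]
    exact hle

theorem conn_runs (I : Input A n W B σ) :
    Runs B connP σ ((σ.mem 0 n - σ.mem 0 0).toNat * 1000 + n.toNat * 5000 + 8000)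
      (Solved (fun K => Cluster A K ∧ ConnSet A (Finset.Ico 0 n \ K)) n (σ.mem 2)) := by
  have hn := I.nonneg
  refine (Runs.seq (T₂ := n.toNat * 2100 + 4000) (tables_runs I) ?_).mono (by omega) (fun _ h => h)
  rintro σ₁ ⟨⟨X, N, L, P⟩, h17⟩
  have R := P.ready
  have T := R.stores.tree
  have hrt := R.stores.bd _ T.root_mem
  have hB := R.bound
  have hW := absSum_nonneg.trans R.weight
  have hNc := P.nodes
  have hLr : L (n + 2) = Finset.Ico 0 (n + 2) := by
    ext y
    rw [T.L_root, P.leaves, Finset.mem_Ico]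
  have hV : Finset.Ico 0 n ⊆ L (n + 2) := by
    rw [hLr]
    exact Finset.Ico_subset_Ico_right (by omega)
  have e2 := P.weights
  refine (Runs.seq (T₁ := 10) (R := fun σ' => σ' = σ₁.setReg 19 (n + 2)) (T₂ := n.toNat * 2100 + 3900)
    (Runs.of_wp_le ?_ (by decide)) ?_).mono (by omega) (fun _ h => h)
  · simp only [wp, Exp.eval, Guard.Holds, State.setReg, State.setMem, update_self, update_of_ne, ne_eq,
      Nat.reduceEqDiff, not_false_eq_true, abs_le, P.size]
    exact ⟨by omega, trivial⟩
  rintro _ rfl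
  have K2 : Keeps σ₁ (σ₁.setReg 19 (n + 2)) :=
    ⟨fun i hi => Function.update_of_ne (by omega) _ _, rfl⟩
  refine (Runs.ite (T := n.toNat * 2100 + 3800) (fun hg => ?_) (fun hg => ?_)).mono
    (by simp only [Guard.cost, Exp.cost]; omega) (fun _ h => h)
  · simp only [Guard.Holds, Exp.eval, State.setReg, Function.update_self] at hg
    refine Runs.of_wp_le ?_ (by simp only [Prog.maxcost, Exp.cost]; omega)
    simp only [wp, Exp.eval, abs_zero]
    refine ⟨by omega, .inl ⟨fun K hK hF => ?_, by simp [State.setReg]⟩⟩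
    exact R.tables.infeasible T hg (LocalFeas.extend hn hLr I.lists.range hK hF)
  · simp only [Guard.Holds, Exp.eval, State.setReg, Function.update_self, not_le] at hg
    refine (Runs.seq (T₂ := n.toNat * 600 + 1200) (choice_runs (R.keeps K2) I.cograph
      (by simp [State.setReg]) hg) ?_).mono (by omega) (fun _ h => h)
    rintro σ₃ ⟨C, K3⟩
    have K3 := K2.trans K3
    have R3 := R.keeps K3
    have T3 := R3.stores.tree
    obtain ⟨b1, b2, b3, b4, b5⟩ := C.bounds T3
    have hbd : ∀ v, v = -1 ∨ v ∈ N → -(B : ℤ) ≤ v ∧ v ≤ B := by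
      rintro v (rfl | hv)
      · omega
      · have := R.stores.bd v hv; omega
    have b1 := hbd _ (.inr b1)
    have b2 := hbd _ b2
    have b3 := hbd _ b3
    have e0 : σ₃.reg 0 = n := (K3.1 0 (by omega)).trans P.size
    set σ₄ := (((σ₃.setMem 17 (n + 2) 3).setMem 17 (σ₃.reg 19) (σ₃.reg 21)).setMem 17 (σ₃.reg 22)
      (σ₃.reg 23)).setMem 17 (σ₃.reg 24) 4 with hσ₄
    have e17 : σ₄.mem 17 = σ₃.prescribed (n + 2) := by
      have : σ₃.mem 17 = fun _ => 0 := by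
        rw [K3.2]
        exact funext h17
      simp only [hσ₄, State.setMem, Function.update_self, this, State.prescribed]
    have em : ∀ a, a ≠ 17 → σ₄.mem a = σ₃.mem a := fun a ha => by simp [hσ₄, State.setMem, ha]
    have P4 : Prepared A X N L n W B (σ.mem 2) σ₄ :=
      ⟨R3.of_eq rfl rfl em, P.leaves, e0, P.nodes, by rw [em 2 (by omega), K3.2]; exact e2,
        fun t => by rw [em 18 (by omega), K3.2]; exact P.modes t⟩
    refine (Runs.seq (T₁ := 30) (R := fun σ' => σ' = σ₄) (T₂ := n.toNat * 500 + 1000)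
      (Runs.of_wp_le ?_ (by decide)) ?_).mono (by omega) (fun _ h => h)
    · simp only [prescribeP, wp, Exp.eval, Guard.Holds, State.setReg, State.setMem, update_self, update_of_ne, ne_eq,
      Nat.reduceEqDiff, not_false_eq_true, abs_le, e0]
      refine ⟨by omega, by omega, by omega, by omega, by omega, by omega, by omega, by omega, ?_⟩
      simp only [hσ₄, State.setMem, Function.update_self]
    rintro _ rfl
    refine (solution_runs P4 hn fun t => ?_).mono le_rfl ?_
    · rw [e17]
      simp only [State.prescribed, Function.update_apply]
      split_ifs <;> omega
    rintro σ₅ ⟨h0, mode, Mo, h3, h1⟩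
    rw [e17, em 4 (by omega), em 7 (by omega), em 12 (by omega), em 13 (by omega),
      em 15 (by omega)] at Mo
    have hopt := C.optimal R3 I.cograph Mo
    have ew : σ₃.mem 2 = σ.mem 2 := by rw [K3.2]; exact e2
    rw [ew] at hopt
    obtain ⟨f1, f2⟩ := hopt.restrict hn hLr I.lists.range I.phantom
    rw [kept_inter hV] at f1 f2
    exact .inr ⟨h0, _, kept_sub, f1, f2, h3, h1⟩

end

open Function (update update_self update_of_ne)

/-! ## Graphs on `Fin n` as relations on integers -/

/-- The vertices as integers. -/
def toZ (n : ℕ) : Fin n ↪ ℤ := ⟨fun v => ((v : ℕ) : ℤ), fun u v h => Fin.ext (Int.ofNat.inj h)⟩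

/-- Adjacency as a relation on integers. -/
def adjZ {n : ℕ} (G : SimpleGraph (Fin n)) (a b : ℤ) : Prop :=
  ∃ u v, toZ n u = a ∧ toZ n v = b ∧ G.Adj u v

section

variable {n : ℕ} {G : SimpleGraph (Fin n)}

theorem adjZ_iff {u v : Fin n} : adjZ G (toZ n u) (toZ n v) ↔ G.Adj u v := by
  constructor
  · rintro ⟨u', v', h1, h2, h⟩
    rwa [← (toZ n).injective h1, ← (toZ n).injective h2]
  · exact fun h => ⟨u, v, rfl, rfl, h⟩

theorem toZ_apply (u : Fin n) : toZ n u = ((u : ℕ) : ℤ) := rfl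

theorem toZ_range (u : Fin n) : 0 ≤ toZ n u ∧ toZ n u < n := by
  simp [toZ_apply]

theorem exists_toZ {x : ℤ} (h0 : 0 ≤ x) (h1 : x < n) : ∃ u : Fin n, toZ n u = x :=
  ⟨⟨x.toNat, by omega⟩, by simp [toZ_apply, h0]⟩

theorem isCograph_adjZ (h : IsFreeOf (SimpleGraph.pathGraph 4) G) : IsCograph (adjZ G) where
  symm := by
    rintro a b ⟨u, v, h1, h2, h3⟩
    exact ⟨v, u, h2, h1, h3.symm⟩
  irrefl := by
    rintro a ⟨u, v, h1, h2, h3⟩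
    exact h3.ne ((toZ n).injective (h1.trans h2.symm))
  p4 := by
    rintro _ _ _ d ⟨a, b, rfl, rfl, hab⟩ ⟨b', c, hb, rfl, hbc⟩ ⟨c', d', hc, rfl, hcd⟩ hac had hbd
    rw [(toZ n).injective hb] at hbc
    rw [(toZ n).injective hc] at hcd
    rw [adjZ_iff] at hac had hbd
    have key : ∀ i j : Fin 4, G.Adj (![a, b, c, d'] i) (![a, b, c, d'] j) ↔
        (SimpleGraph.pathGraph 4).Adj i j := by
      have := hab.symm; have := hbc.symm; have := hcd.symm
      have : ¬ G.Adj c a := fun h => hac h.symm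
      have : ¬ G.Adj d' a := fun h => had h.symm
      have : ¬ G.Adj d' b := fun h => hbd h.symm
      intro i j
      fin_cases i <;> fin_cases j <;> simp [SimpleGraph.pathGraph_adj, *]
    refine h ⟨⟨⟨![a, b, c, d'], fun i j hij => ?_⟩, key _ _⟩⟩
    have hne : a ≠ c ∧ a ≠ d' ∧ b ≠ d' := by
      refine ⟨?_, ?_, ?_⟩ <;> rintro rfl
      · exact had hcd
      · exact hac hcd.symm
      · exact had hab
    have := hab.ne; have := hbc.ne; have := hcd.ne
    fin_cases i <;> fin_cases j <;> simp_all

theorem isClusterGraph_iff {V : Type*} {H : SimpleGraph V} :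
    IsClusterGraph H ↔ ∀ a b c, H.Adj a b → H.Adj b c → a ≠ c → H.Adj a c := by
  constructor
  · intro h a b c hab hbc hac
    refine h (H.connectedComponentMk a) rfl ?_ hac
    exact SimpleGraph.ConnectedComponent.sound (hab.reachable.trans hbc.reachable).symm
  · intro h C a ha b hb hab
    have hr : H.Reachable a b := SimpleGraph.ConnectedComponent.exact (ha.trans hb.symm)
    rw [SimpleGraph.reachable_iff_reflTransGen] at hr
    have key : ∀ d, Relation.ReflTransGen H.Adj a d → a ≠ d → H.Adj a d := by
      intro d hd
      induction hd with
      | refl => exact fun h => absurd rfl h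
      | @tail c d _ hcd ih =>
        intro had
        by_cases hac : a = c
        · exact hac ▸ hcd
        · exact h a c d (ih hac) hcd had
    exact key b hr hab

theorem cluster_iff (S : Finset (Fin n)) :
    IsClusterVDSet G (S : Set (Fin n)) ↔ Cluster (adjZ G) (Sᶜ.map (toZ n)) := by
  rw [IsClusterVDSet, isClusterGraph_iff]
  simp only [Cluster, Finset.forall_mem_map, adjZ_iff, (toZ n).injective.ne_iff,
    SimpleGraph.comap_adj, Subtype.forall, Function.Embedding.subtype_apply, ne_eq,
    Subtype.mk.injEq, Finset.mem_compl, Set.mem_compl_iff, Finset.mem_coe]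

theorem preconnected_iff (S : Finset (Fin n)) :
    (G.induce (S : Set (Fin n))).Preconnected ↔ ConnSet (adjZ G) (S.map (toZ n)) := by
  constructor
  · intro h a ha b hb
    obtain ⟨u, hu, rfl⟩ := Finset.mem_map.1 ha
    obtain ⟨v, hv, rfl⟩ := Finset.mem_map.1 hb
    have := h ⟨u, hu⟩ ⟨v, hv⟩
    rw [SimpleGraph.reachable_iff_reflTransGen] at this
    exact this.lift (p := fun x y => x ∈ S.map (toZ n) ∧ y ∈ S.map (toZ n) ∧ adjZ G x y)
      (fun x : (S : Set (Fin n)) => toZ n x.1) fun x y hxy => ⟨Finset.mem_map_of_mem _ x.2,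
      Finset.mem_map_of_mem _ y.2, adjZ_iff.2 hxy⟩
  · rintro h ⟨u, hu⟩ ⟨v, hv⟩
    have key : ∀ b, Relation.ReflTransGen (fun x y => x ∈ S.map (toZ n) ∧ y ∈ S.map (toZ n) ∧
        adjZ G x y) (toZ n u) b → ∀ v (hv : v ∈ (S : Set (Fin n))), toZ n v = b →
        (G.induce (S : Set (Fin n))).Reachable ⟨u, hu⟩ ⟨v, hv⟩ := by
      intro b hb
      induction hb with
      | refl =>
        intro v hv hvu
        obtain rfl := (toZ n).injective hvu
        rfl
      | tail _ h ih =>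
        rintro v hv rfl
        obtain ⟨w, hw, rfl⟩ := Finset.mem_map.1 h.1
        exact (ih w hw rfl).trans (SimpleGraph.Adj.reachable (adjZ_iff.1 h.2.2))
    exact key _ (h _ (Finset.mem_map_of_mem _ hu) _ (Finset.mem_map_of_mem _ hv)) v hv rfl

theorem map_univ_toZ : Finset.univ.map (toZ n) = Finset.Ico 0 (n : ℤ) := by
  ext x
  simp only [Finset.mem_map, Finset.mem_univ, true_and, Finset.mem_Ico]
  exact ⟨fun ⟨u, hu⟩ => hu ▸ toZ_range u, fun h => exists_toZ h.1 h.2⟩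

theorem Ico_sdiff_compl (S : Finset (Fin n)) :
    Finset.Ico 0 (n : ℤ) \ Sᶜ.map (toZ n) = S.map (toZ n) := by
  rw [← map_univ_toZ]
  ext x
  simp only [Finset.mem_sdiff, Finset.mem_map, Finset.mem_univ, true_and, Finset.mem_compl]
  constructor
  · rintro ⟨⟨u, rfl⟩, h⟩
    refine ⟨u, ?_, rfl⟩
    by_contra hu
    exact h ⟨u, hu, rfl⟩
  · rintro ⟨u, hu, rfl⟩
    exact ⟨⟨u, rfl⟩, fun ⟨v, hv, h⟩ => hv ((toZ n).injective h ▸ hu)⟩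

theorem connected_iff (S : Finset (Fin n)) :
    IsConnectedClusterVDSet G (S : Set (Fin n)) ↔ Cluster (adjZ G) (Sᶜ.map (toZ n)) ∧
      ConnSet (adjZ G) (Finset.Ico 0 (n : ℤ) \ Sᶜ.map (toZ n)) := by
  rw [IsConnectedClusterVDSet, cluster_iff, preconnected_iff, Ico_sdiff_compl]

/-! ## Adjacency lists in memory -/

variable {adj : Fin n → List (Fin n)}

theorem graphInput_off {x : ℤ} (h0 : 0 ≤ x) (h1 : x ≤ n) : (graphInput adj).mem 0 x =
    ((((List.ofFn adj).map List.length).take x.toNat).sum : ℕ) := by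
  have : (List.ofFn adj).map List.length = List.ofFn (fun v => (adj v).length) := by
    simp [List.map_ofFn, Function.comp_def]
  rw [this, List.sum_take_ofFn]
  simp only [graphInput, if_true, if_pos h1, Finset.sum_filter]
  push_cast
  refine Finset.sum_congr rfl fun v _ => ?_
  congr 1
  simp only [eq_iff_iff]
  omega

theorem length_eq (h : IsAdjLists G adj) :
    (((List.ofFn adj).map List.length).take n).sum = 2 * G.edgeSet.ncard := by
  classical
  have : (List.ofFn adj).map List.length = List.ofFn (fun v => (adj v).length) := by
    simp [List.map_ofFn, Function.comp_def]
  rw [this, List.take_of_length_le (by simp), List.sum_ofFn, Set.ncard_eq_toFinset_card',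
    ← SimpleGraph.edgeFinset, ← G.sum_degrees_eq_twice_card_edges]
  refine Finset.sum_congr rfl fun v _ => ?_
  rw [← List.toFinset_card_of_nodup (h v).1, ← SimpleGraph.card_neighborFinset_eq_degree]
  congr 1
  ext u
  rw [List.mem_toFinset, (h v).2, SimpleGraph.mem_neighborFinset]

theorem graphInput_nb {v : Fin n} {j : ℕ} (hj : j < (adj v).length) :
    (graphInput adj).mem 1 ((graphInput adj).mem 0 (toZ n v) + j) = toZ n (adj v)[j] := by
  have hv := toZ_range v
  have hd := List.drop_take_succ_flatten_eq_getElem (List.ofFn adj) v (by simp)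
  rw [graphInput_off hv.1 hv.2.le]
  simp only [graphInput, one_ne_zero, if_true, if_false]
  have e : (toZ n v).toNat = v := by simp [toZ_apply]
  rw [if_pos (by omega), e]
  set s := (((List.ofFn adj).map List.length).take v).sum
  have h1 : (List.ofFn adj)[(v : ℕ)]'(by simp) = adj v := by simp
  have h2 : (adj v)[j]? = some (adj v)[j] := List.getElem?_eq_getElem hj
  have h3 : (List.ofFn adj).flatten[s + j]? = some (adj v)[j] := by
    rw [← h2, ← h1, ← hd, List.getElem?_drop, List.getElem?_take_of_lt]
    rw [List.sum_take_succ _ _ (by simp), List.getElem_map, h1]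
    exact Nat.add_lt_add_left hj _
  have e' : ((s : ℤ) + j).toNat = s + j := by omega
  simp only [List.bind_eq_flatMap, List.pure_def, ← List.map_eq_flatMap,
    List.getD_eq_getElem?_getD, List.getElem?_map, e', h3]
  rfl

theorem lists_adjZ (h : IsAdjLists G adj) :
    Lists (adjZ G) n ((graphInput adj).mem 0) ((graphInput adj).mem 1) := by
  have hs : ∀ v : Fin n, (graphInput adj).mem 0 (toZ n v + 1) =
      (graphInput adj).mem 0 (toZ n v) + (adj v).length := by
    intro v
    have hv := toZ_range v
    rw [graphInput_off hv.1 hv.2.le, graphInput_off (by omega) (by omega)]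
    have e : (toZ n v + 1).toNat = v + 1 := by simp [toZ_apply]
    have e' : (toZ n v).toNat = v := by simp [toZ_apply]
    rw [e, e', List.sum_take_succ _ _ (by simp)]
    simp
  refine ⟨fun x h0 h1 => ?_, fun x h0 h1 => ?_, ?_, fun x h0 h1 y => ?_, ?_⟩
  · rw [graphInput_off h0 h1.le]
    positivity
  · obtain ⟨v, rfl⟩ := exists_toZ h0 h1
    rw [hs]
    omega
  · rintro _ _ ⟨u, v, rfl, rfl, -⟩
    exact ⟨toZ_range u, toZ_range v⟩
  · obtain ⟨v, rfl⟩ := exists_toZ h0 h1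
    rw [hs]
    constructor
    · rintro ⟨v', u, hv, rfl, hvu⟩
      rw [(toZ n).injective hv, ← (h v).2] at hvu
      obtain ⟨j, hj, rfl⟩ := List.getElem_of_mem hvu
      exact ⟨_, by omega, by omega, graphInput_nb hj⟩
    · rintro ⟨i, h1, h2, rfl⟩
      obtain ⟨j, rfl⟩ := Int.le.dest h1
      rw [graphInput_nb (by omega), adjZ_iff, ← (h v).2]
      exact List.getElem_mem _
  · rintro x h0 h1 i i' a b c d hii
    obtain ⟨v, rfl⟩ := exists_toZ h0 h1
    rw [hs] at b d
    obtain ⟨j, rfl⟩ := Int.le.dest a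
    obtain ⟨j', rfl⟩ := Int.le.dest c
    rw [graphInput_nb (by omega), graphInput_nb (by omega)] at hii
    have := (h v).1.getElem_inj_iff.1 ((toZ n).injective hii)
    omega

theorem input_of {W : ℤ} {B : ℕ} {σ : State} (hG : IsFreeOf (SimpleGraph.pathGraph 4) G)
    (h : IsAdjLists G adj) (h0 : σ.reg 0 = n) (m0 : σ.mem 0 = (graphInput adj).mem 0)
    (m1 : σ.mem 1 = (graphInput adj).mem 1) (hz : ∀ a, 3 ≤ a → ∀ t, σ.mem a t = 0)
    (hp : ∀ t, (n : ℤ) ≤ t → σ.mem 2 t = 0) (hw : absSum (σ.mem 2) (Finset.Ico 0 n) ≤ W)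
    (hB : (3 * (n : ℤ) + 5) * (3 * n + 5) + (3 * n + 5) + 2 * W + 10 ≤ B)
    (hm : 2 * (G.edgeSet.ncard : ℤ) ≤ B) :
    Input (adjZ G) n W B σ ∧ σ.mem 0 n - σ.mem 0 0 = 2 * G.edgeSet.ncard := by
  have e1 : σ.mem 0 n = 2 * G.edgeSet.ncard := by
    rw [m0, graphInput_off (by omega) le_rfl, Int.toNat_natCast, length_eq h]
    push_cast
    rfl
  have e0 : σ.mem 0 0 = 0 := by
    rw [m0, graphInput_off le_rfl (by omega)]
    simp
  refine ⟨⟨isCograph_adjZ hG, by omega, h0, by rw [m0, m1]; exact lists_adjZ h, hz,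
    ⟨hp _ le_rfl, hp _ (by omega)⟩, hw, fun x hx hxn => ?_, hB, by omega⟩, by omega⟩
  rw [m0, graphInput_off (by omega) (by omega), graphInput_off (by omega) le_rfl]
  exact_mod_cast ((List.take_sublist_take_left (by omega)).sum_le_sum (fun _ _ => Nat.zero_le _))

end

open Function (update update_self update_of_ne)

/-! ## Linear time -/

/-- Give weight 1 to all vertices. -/
def unitP : Prog :=
  (50 ≔ ℛ 1 ;; 6 ≔ 𝒞 0) ;;
  .loop ((ℛ 6 +ₑ 𝒞 1) ≤ₑ ℛ 0) (.write 2 (ℛ 6) (𝒞 1) ;; 6 ≔ ℛ 6 +ₑ 𝒞 1)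

/-- Compare the minimum with the bound. -/
def compareP : Prog := .ite (.and (ℛ 0 =ₑ 𝒞 1) (ℛ 1 ≤ₑ ℛ 50)) (0 ≔ 𝒞 1) (0 ≔ 𝒞 0)

theorem bound_le {n m : ℕ} {W : ℤ} {N : ℕ} (hn : n + 2 ≤ N) (hm : m + 2 ≤ N) (hW : W + 2 ≤ N) :
    (3 * (n : ℤ) + 5) * (3 * n + 5) + (3 * n + 5) + 2 * W + 10 ≤ (N ^ 6 : ℕ) ∧
      2 * (m : ℤ) ≤ (N ^ 6 : ℕ) ∧ (N : ℤ) ≤ (N ^ 6 : ℕ) := by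
  have h2 : (2 : ℤ) ≤ N := by omega
  have h4 : (16 : ℤ) * (N * N) ≤ (N ^ 6 : ℕ) := by
    push_cast
    have : (2 : ℤ) ^ 4 ≤ (N : ℤ) ^ 4 := pow_le_pow_left₀ (by norm_num) h2 4
    nlinarith [mul_self_nonneg (N : ℤ)]
  have hn' : (n : ℤ) + 2 ≤ N := by omega
  refine ⟨?_, ?_, ?_⟩ <;> nlinarith

/-- What it means for sets of vertices that the problem on integers is solved. -/
theorem Solved.sets {n : ℕ} {F : Finset ℤ → Prop} {Feas : Set (Fin n) → Prop} {w : Fin n → ℤ}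
    {wz : ℤ → ℤ} {σ : State} (h : Solved F n wz σ) (hw : ∀ v, wz (toZ n v) = w v)
    (hF : ∀ S : Finset (Fin n), Feas S ↔ F (Sᶜ.map (toZ n))) :
    ((¬ ∃ T : Finset (Fin n), Feas T) ∧ σ.reg 0 = 0) ∨
      (σ.reg 0 = 1 ∧ ∃ S : Finset (Fin n), Feas S ∧
        (∀ T : Finset (Fin n), Feas T → ∑ v ∈ S, w v ≤ ∑ v ∈ T, w v) ∧
        (∀ v : Fin n, σ.mem 3 ((v : ℕ) : ℤ) = if v ∈ S then 1 else 0) ∧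
        σ.reg 1 = ∑ v ∈ S, w v) := by
  have hsub : ∀ S : Finset (Fin n), S.map (toZ n) ⊆ Finset.Ico 0 (n : ℤ) := fun S => by
    rw [← map_univ_toZ]
    exact Finset.map_subset_map.2 (Finset.subset_univ _)
  rcases h with ⟨h1, h2⟩ | ⟨h1, K, hK, hFK, hopt, h3, h4⟩
  · exact .inl ⟨fun ⟨T, hT⟩ => h1 _ (hsub _) ((hF T).1 hT), h2⟩
  · obtain ⟨S, rfl⟩ : ∃ S : Finset (Fin n), K = Sᶜ.map (toZ n) := by
      refine ⟨Finset.univ.filter (fun v => toZ n v ∉ K), ?_⟩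
      ext x
      simp only [Finset.mem_map, Finset.mem_compl, Finset.mem_filter, Finset.mem_univ, true_and,
        not_not]
      constructor
      · intro hx
        obtain ⟨h0, h1⟩ := Finset.mem_Ico.1 (hK hx)
        obtain ⟨u, rfl⟩ := exists_toZ h0 h1
        exact ⟨u, hx, rfl⟩
      · rintro ⟨u, hu, rfl⟩
        exact hu
    have hsum : ∀ T : Finset (Fin n), ∑ x ∈ T.map (toZ n), wz x = ∑ v ∈ T, w v := fun T => by
      rw [Finset.sum_map]
      exact Finset.sum_congr rfl fun v _ => hw v
    refine .inr ⟨h1, S, (hF S).2 hFK, fun T hT => ?_, fun v => ?_, ?_⟩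
    · have := hopt _ (hsub _) ((hF T).1 hT)
      rw [hsum, hsum] at this
      have h5 := Finset.sum_add_sum_compl S w
      have h6 := Finset.sum_add_sum_compl T w
      omega
    · have hv := toZ_range v
      rw [← toZ_apply, h3 _ hv.1 hv.2]
      simp only [Finset.mem_map', Finset.mem_compl]
      split_ifs <;> tauto
    · rw [h4, Ico_sdiff_compl, hsum]

section

variable {p : Prog} {F : ℤ → (ℤ → ℤ → Prop) → Finset ℤ → Prop}
  {Feas : ∀ n : ℕ, SimpleGraph (Fin n) → Set (Fin n) → Prop}

theorem minimizable (hF : ∀ n (G : SimpleGraph (Fin n)) (S : Finset (Fin n)),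
      Feas n G S ↔ F n (adjZ G) (Sᶜ.map (toZ n)))
    (hp : ∀ {A n W B σ}, Input A n W B σ → Runs B p σ
      ((σ.mem 0 n - σ.mem 0 0).toNat * 1000 + n.toNat * 5000 + 8000) (Solved (F n A) n (σ.mem 2))) :
    MinimizableInLinearTime (fun _ G => IsFreeOf (SimpleGraph.pathGraph 4) G) Feas := by
  refine ⟨p, 8000, 6, fun n G adj w hG hadj => ?_⟩
  set W := ∑ v, (w v).natAbs with hWdef
  have hw : ∀ v, (weightedInput adj w).mem 2 (toZ n v) = w v := by
    intro v
    have hv := toZ_range v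
    simp only [weightedInput, if_true, dif_pos hv]
    congr 1
  obtain ⟨b1, b2, -⟩ := bound_le (n := n) (m := G.edgeSet.ncard) (W := W)
    (N := n + G.edgeSet.ncard + W + 2) (by omega) (by omega) (by omega)
  obtain ⟨I, hlen⟩ := input_of (σ := weightedInput adj w) (W := W) hG hadj
    (by simp [weightedInput, graphInput]) rfl rfl
    (fun a ha t => by
      simp only [weightedInput, graphInput]
      rw [if_neg (by omega), if_neg (by omega), if_neg (by omega)])
    (fun t ht => by
      simp only [weightedInput, if_true]
      rw [dif_neg (by omega)])
    (by
      rw [absSum, ← map_univ_toZ, Finset.sum_map, hWdef]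
      push_cast
      exact (Finset.sum_congr rfl fun v _ => by rw [hw]).le) b1 b2
  obtain ⟨σ', t, h1, h2, h3⟩ := hp I
  exact ⟨σ', t, h1, by omega, h3.sets hw (hF n G)⟩

theorem unit_runs {n : ℤ} {B : ℕ} {σ : State} (hn : 0 ≤ n) (h0 : σ.reg 0 = n)
    (hB : n ≤ B ∧ |σ.reg 1| ≤ B) :
    Runs B unitP σ (n.toNat * 20 + 20) (fun σ' => ((∀ v, 0 ≤ v → v < n → σ'.mem 2 v = 1) ∧
      (∀ v, n ≤ v → σ'.mem 2 v = σ.mem 2 v) ∧ σ'.reg 50 = σ.reg 1) ∧ Agree unitP σ σ') := by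
  refine Runs.agree ?_
  refine ((Runs.of_wp (Q := fun σ' => σ' = (σ.setReg 50 (σ.reg 1)).setReg 6 0) ?_).seq
    (T₂ := n.toNat * 20 + 12) ?_).mono (by simp only [Prog.maxcost, Exp.cost]; omega) (fun _ h => h)
  · simp [wp, Exp.eval, hB.2]
  rintro σ₁ rfl
  refine (Runs.loop 12 (fun σ' => (0 ≤ σ'.reg 6 ∧ σ'.reg 6 ≤ n) ∧
    (∀ v, 0 ≤ v → v < σ'.reg 6 → σ'.mem 2 v = 1) ∧ (∀ v, n ≤ v → σ'.mem 2 v = σ.mem 2 v))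
    (fun σ' => (n - σ'.reg 6).toNat) ?_ ?_).mono ?_ ?_
  · simp only [State.setReg, update_self]
    exact ⟨by omega, fun v _ _ => by omega, fun _ _ => trivial⟩
  · rintro σ₂ hag ⟨i1, i2, i3⟩ hg
    have e0 : σ₂.reg 0 = n := (hag.1 0 rfl).trans (by simpa [State.setReg] using h0)
    simp only [Guard.Holds, Exp.eval, e0] at hg
    refine Runs.of_wp_le ?_ (by decide)
    simp only [wp, Exp.eval, Guard.Holds, State.setReg, State.setMem, update_self, update_of_ne, ne_eq,
      Nat.reduceEqDiff, not_false_eq_true, abs_le]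
    refine ⟨by omega, by omega, by omega, ⟨by omega, fun v h1 h2 => ?_, fun v h1 => ?_⟩, by omega⟩
    · rw [Function.update_apply]
      split_ifs
      · rfl
      · exact i2 v h1 (by omega)
    · rw [update_of_ne (by omega), i3 v h1]
  · simp only [State.setReg, update_self, Guard.cost, Exp.cost]
    omega
  · rintro σ' ⟨⟨i1, i2, i3⟩, hg, hag⟩
    have e0 : σ'.reg 0 = n := (hag.1 0 rfl).trans (by simpa [State.setReg] using h0)
    simp only [Guard.Holds, Exp.eval, e0] at hg
    exact ⟨fun v h1 h2 => i2 v h1 (by omega), i3,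
      (hag.1 50 rfl).trans (by simp [State.setReg])⟩

theorem decidable (hF : ∀ n (G : SimpleGraph (Fin n)) (S : Finset (Fin n)),
      Feas n G S ↔ F n (adjZ G) (Sᶜ.map (toZ n))) (h50 : p.wr 50 = false)
    (hp : ∀ {A n W B σ}, Input A n W B σ → Runs B p σ
      ((σ.mem 0 n - σ.mem 0 0).toNat * 1000 + n.toNat * 5000 + 8000) (Solved (F n A) n (σ.mem 2))) :
    DecidableInLinearTime (fun _ G => IsFreeOf (SimpleGraph.pathGraph 4) G) Feas := by
  refine ⟨unitP ;; p ;; compareP, 9000, 6, fun n G adj k hG hadj => ?_⟩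
  obtain ⟨b1, b2, b3⟩ := bound_le (n := n) (m := G.edgeSet.ncard) (W := n)
    (N := n + G.edgeSet.ncard + k.natAbs + 2) (by omega) (by omega) (by omega)
  set B := (n + G.edgeSet.ncard + k.natAbs + 2) ^ 6
  have e0 : (decisionInput adj k).reg 0 = n := by
    simp [decisionInput, graphInput, State.setReg]
  have e1 : (decisionInput adj k).reg 1 = k := by simp [decisionInput, State.setReg]
  have main : Runs B (unitP ;; p ;; compareP) (decisionInput adj k)
      (9000 * (n + G.edgeSet.ncard + 1)) (fun σ => (σ.reg 0 = 0 ∨ σ.reg 0 = 1) ∧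
        (σ.reg 0 = 1 ↔ ∃ S : Finset (Fin n), Feas n G S ∧ (S.card : ℤ) ≤ k)) := by
    refine (Runs.seq (T₂ := 2000 * G.edgeSet.ncard + n * 5000 + 8100) (unit_runs (by omega) e0
      ⟨by omega, by rw [e1, Int.abs_eq_natAbs]; omega⟩) ?_).mono (by omega) (fun _ h => h)
    rintro σ₁ ⟨⟨h1, h2, h3⟩, ag⟩
    have hm : ∀ a, a ≠ 2 → σ₁.mem a = (graphInput adj).mem a := fun a ha =>
      ag.2 a (by simpa [unitP, Prog.wm] using ha)
    have hw : ∀ v, σ₁.mem 2 (toZ n v) = 1 := fun v => h1 _ (toZ_range v).1 (toZ_range v).2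
    obtain ⟨I, hlen⟩ := input_of (σ := σ₁) (W := n) hG hadj ((ag.1 0 rfl).trans e0)
      (hm 0 (by omega)) (hm 1 (by omega))
      (fun a ha t => by
        rw [hm a (by omega)]
        simp only [graphInput]
        rw [if_neg (by omega), if_neg (by omega)])
      (fun t ht => by
        rw [h2 t ht]
        simp [decisionInput, State.setReg, graphInput])
      (by
        rw [absSum, ← map_univ_toZ, Finset.sum_map]
        simp [hw]) b1 b2
    refine (Runs.seq (T₂ := 15) (hp I).agree ?_).mono (by omega) (fun _ h => h)
    rintro σ₂ ⟨hS, ag2⟩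
    have h50 : σ₂.reg 50 = k := (ag2.1 50 h50).trans (h3.trans e1)
    have hS := hS.sets hw (hF n G)
    refine Runs.of_wp_le ?_ (by decide)
    simp only [compareP, wp, Exp.eval, Guard.Holds, State.setReg, State.setMem, update_self, update_of_ne, ne_eq,
      Nat.reduceEqDiff, not_false_eq_true, abs_le, h50]
    refine ⟨fun h => ⟨by omega, .inr trivial, ?_⟩, fun h => ⟨by omega, .inl trivial, ?_⟩⟩
    · rcases hS with ⟨_, h'⟩ | ⟨_, S, hS, _, _, h'⟩
      · omega
      · simp only [Finset.sum_const, nsmul_eq_mul, mul_one] at h'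
        exact iff_of_true trivial ⟨S, hS, by omega⟩
    · refine iff_of_false (by omega) ?_
      rintro ⟨T, hT, hk⟩
      rcases hS with ⟨h', _⟩ | ⟨h0, S, _, hopt, _, h'⟩
      · exact h' ⟨T, hT⟩
      · have := hopt T hT
        simp only [Finset.sum_const, nsmul_eq_mul, mul_one] at h' this
        exact h ⟨h0, by omega⟩
  obtain ⟨σ, t, r1, r2, r3, r4⟩ := main
  exact ⟨σ, t, r1, r2, r3, r4⟩

end

end ClusterVD

theorem mainTheorem9 :
    ClusterVD.DecidableInLinearTime
      (fun _ G => ClusterVD.IsFreeOf (SimpleGraph.pathGraph 4) G)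
      (fun _ G S => ClusterVD.IsClusterVDSet G S) ∧
    ClusterVD.DecidableInLinearTime
      (fun _ G => ClusterVD.IsFreeOf (SimpleGraph.pathGraph 4) G)
      (fun _ G S => ClusterVD.IsConnectedClusterVDSet G S) ∧
    ClusterVD.MinimizableInLinearTime
      (fun _ G => ClusterVD.IsFreeOf (SimpleGraph.pathGraph 4) G)
      (fun _ G S => ClusterVD.IsClusterVDSet G S) ∧
    ClusterVD.MinimizableInLinearTime
      (fun _ G => ClusterVD.IsFreeOf (SimpleGraph.pathGraph 4) G)
      (fun _ G S => ClusterVD.IsConnectedClusterVDSet G S) := by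
  open ClusterVD in
  have hmin : ∀ {A n W B σ}, Input A n W B σ → Runs B minP σ
      ((σ.mem 0 n - σ.mem 0 0).toNat * 1000 + n.toNat * 5000 + 8000)
      (Solved (Cluster A) n (σ.mem 2)) :=
    fun I => (min_runs I).mono (by omega) fun _ h => h
  exact ⟨decidable (F := fun _ A K => Cluster A K) (fun _ _ S => cluster_iff S) rfl hmin,
    decidable (F := fun n A K => Cluster A K ∧ ConnSet A (Finset.Ico 0 n \ K))
      (fun _ _ S => connected_iff S) rfl conn_runs,
    minimizable (F := fun _ A K => Cluster A K) (fun _ _ S => cluster_iff S) hmin,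
    minimizable (F := fun n A K => Cluster A K ∧ ConnSet A (Finset.Ico 0 n \ K))
      (fun _ _ S => connected_iff S) conn_runs⟩
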